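/- Let $G=\cos$ or $G\equiv 1$, and consider the delayed, switched pendulum $$\dot\theta=\phi,\qquad \dot\phi=\sin\theta+F\,G(\theta),\qquad F(t)=\begin{cases}-\big(a\,\theta(t-\tau)+b\,\phi(t-\tau)\big), & \theta(t-\tau)\big(\phi(t-\tau)-s\,\theta(t-\tau)\big)>0,\\ 0,&\text{otherwise,}\end{cases}$$ with $a>1$, $b\in\mathbb R$, small $s\le 0$ and small $\tau>0$; solutions are continuous and satisfy the integrated equations for $t\ge 0$. The ON region is $\{\theta(\phi-s\theta)>0\}$, the OFF region is its complement, $\Sigma_1=\{\phi=s\theta\}$, and $H(\theta,\phi)=\tfrac12\phi^2+\cos\theta$. A forward orbit of $(\theta_0,s\theta_0)\in\Sigma_1$ is a solution on $[-\tau,\infty)$ that is at this point at $t=0$ and lies in the OFF region for $t\in[-\tau,0]$. It performs a zigzag oscillation on $[0,P]$, with intersection time $T$, if it lies in the ON region for $0<t<T$, on $\Sigma_1$ at $t=T$, in the interior of the OFF region for $T<t<P$, and on $\Sigma_1$ at $t=P$, where $P\ge T+\tau$. Put $\theta_1=\theta(\tau)$ and $\Delta H=H(\theta,\phi)(T+\tau)-H(\theta,\phi)(\tau)$.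 A zigzag periodic orbit is a $P$-periodic solution of this kind (one zigzag per period). Such an orbit is stable if for every $\varepsilon>0$ the forward orbits of all points of $\Sigma_1$ sufficiently near its starting point stay within $\varepsilon$ of its closed curve in the $(\theta,\phi)$-plane for all $t\ge0$, asymptotically stable if moreover their distance to the curve tends to $0$ when they start sufficiently near, and unstable if it is not stable. Put $$Q=-\frac{a^2}{a-1}s\tau+\frac{a^2(a-2)}{2(a-1)}\tau^2-\frac{ab(a-2)}{(a-1)^2}s^2\tau+\frac{ab(a^2-3a+4)}{2(a-1)^2}s\tau^2+\frac{ab(3a^3-9a^2+7a+1)}{6(a-1)^2}\tau^3 .$$ All bounds below are uniform for $(a,b)$ near a given $(a_0,b_0)$ with $a_0>1$. There are functions $c(a,b,s,\tau)$, the same for both $G$, and $d_G(a,b,s,\tau)$ such that the following holds. 1. For $a_0>1$, $s\le 0$, $\tau>0$ and $\theta_0\neq0$ small, the point $(\theta_0,s\theta_0)$ has a forward orbit, and every such orbit performs a zigzag oscillation with $P=O(\tau)$. If $T\ge 2\tau$, then $\Delta H=\big(Q+O((|s|+\tau)^4)\big)\theta_1^2+O(\theta_1^4)$. If $a_0<2$,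 then $T\ge2\tau$ holds automatically, $\Delta H=c\,\theta_1^2+d_G\,\theta_1^4+O(\theta_1^6)$, and $c=Q+O((|s|+\tau)^4)$. 2. For $1<a_0<2$ and small $s<0$, $c$ vanishes at exactly one small $\tau>0$, namely $$\tau=\frac{2}{a-2}s-\frac{2(2+8a-15a^2+6a^3)}{3a(a-1)(a-2)^3}bs^2+O(s^3).$$ 3. For small $s<0$, $d_G$ vanishes at exactly one small $\tau>0$: for $G=\cos$ and $1<a_0<\tfrac53$, $$\tau=\frac{3a-5}{3a^2-8a+6}s+\frac{b(-243a^6+1674a^5-4491a^4+5862a^3-3611a^2+642a+175)}{6a(a-1)(3a^2-8a+6)^3}s^2+O(s^3),$$ and for $G\equiv1$ and $1<a_0<2$, $$\tau=-\frac2a s-\frac{2b(a^2-2)(3a-1)}{3a^4(a-1)}s^2+O(s^3).$$ 4. Let $1<a_0<2$ and let $p_0=(a_0,b_0,s_0,\tau_0)$ satisfy $c(p_0)=0$, with $s_0<0<\tau_0$ small (depending on $a_0,b_0$). Put $d_0=d_G(p_0)$. Then $d_0<0$ if $G=\cos$ and $d_0>0$ if $G\equiv1$; $c$ is differentiable at $p_0$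 with $\partial_a c\neq0$ and $\partial_\tau c\ne0$. There are $\rho>0$, a neighbourhood $U$ of $p_0$ and a function $X$ on $U$ such that for $p\in U$ and $0<|x|<\rho$ there is a zigzag periodic orbit starting at $(x,sx)$ if and only if $c(p)d_0<0$ and $x=\pm X(p)$. If $p\in U$ and $c(p)d_0<0$, then $0<X(p)<\rho$, the two orbits are images of each other under $(\theta,\phi)\mapsto(-\theta,-\phi)$, have period $O(\tau)$ (uniformly in $s_0,\tau_0$), keep the sign of $\theta$, satisfy $\tfrac12X\le|\theta(t)|\le2X$ and $|\phi(t)|\le X$ for all $t$, and are asymptotically stable if $d_0>0$ and unstable if $d_0<0$. So both stable and unstable orbits arise. Their amplitude grows like the square root of the parameter change: if $\gamma$ is a curve of parameters with $\gamma(0)=p_0$, differentiable at $0$, and $\lambda=Dc(p_0)\gamma'(0)\ne0$, then $X(\gamma(\mu))/\sqrt{|\mu|}$ has a positive limit as $\mu\to0$ with $\mu\lambda d_0<0$. -/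

import Mathlib

open Set Filter Topology MeasureTheory

noncomputable section

/-- The parameters `(a, b, s, τ)`: control gains `a`, `b`, slope `s` of the switching line, and
delay `τ`. -/
abbrev Params : Type := ℝ × ℝ × ℝ × ℝ

namespace Params

/-- position gain -/
def a (p : Params) : ℝ := p.1

/-- velocity gain -/
def b (p : Params) : ℝ := p.2.1

/-- slope of the switching line `φ = s θ` -/
def s (p : Params) : ℝ := p.2.2.1

/-- delay -/
def τ (p : Params) : ℝ := p.2.2.2

end Params

namespace Pendulum

/-- The two actuation functions of the model, `G = cos` and `G = 1`. -/
def actuations : Set (ℝ → ℝ) := {Real.cos, fun _ => 1}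

/-- The sign of this quantity decides the region: ON where it is positive, OFF otherwise. -/
def region (p : Params) (x y : ℝ) : ℝ := x * (y - p.s * x)

/-- The delayed PD control with the position-velocity switching rule. -/
def control (p : Params) (θ φ : ℝ → ℝ) (t : ℝ) : ℝ :=
  if 0 < region p (θ (t - p.τ)) (φ (t - p.τ)) then
    -(p.a * θ (t - p.τ) + p.b * φ (t - p.τ))
  else 0

/-- `(θ, φ)` is a continuous function on `[-τ, ∞)` that solves, for `t ≥ 0`, the delay equation
`θ' = φ`, `φ' = sin θ + F G(θ)`. As the control `F` is discontinuous, the equation is read in its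
integrated (Carathéodory) form. -/
structure IsSolution (G : ℝ → ℝ) (p : Params) (θ φ : ℝ → ℝ) : Prop where
  continuousOn_pos : ContinuousOn θ (Ici (-p.τ))
  continuousOn_vel : ContinuousOn φ (Ici (-p.τ))
  pos_eq : ∀ t, 0 ≤ t → θ t = θ 0 + ∫ r in (0 : ℝ)..t, φ r
  vel_eq : ∀ t, 0 ≤ t →
    φ t = φ 0 + ∫ r in (0 : ℝ)..t, (Real.sin (θ r) + control p θ φ r * G (θ r))

/-- `(θ, φ)` is a forward orbit of the point `(x, s x)` of the switching line: it is there at time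
`0`, having been in the OFF region for at least the delay time. -/
structure IsForwardOrbit (G : ℝ → ℝ) (p : Params) (x : ℝ) (θ φ : ℝ → ℝ) : Prop where
  isSolution : IsSolution G p θ φ
  pos_zero : θ 0 = x
  vel_zero : φ 0 = p.s * x
  off_before : ∀ t ∈ Icc (-p.τ) 0, region p (θ t) (φ t) ≤ 0

/-- The part of `(θ, φ)` on `[0, P]` is a zigzag oscillation, with intermediate intersection time
`T`: the curve starts on the line `φ = s θ`, is in the ON region until it meets this line again, for
the first time, at `T`, and is then in the interior of the OFF region until it leaves it at time
`P`, not before `T + τ`, through the line `φ = s θ` again. -/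
structure IsZigzag (p : Params) (θ φ : ℝ → ℝ) (T P : ℝ) : Prop where
  pos : 0 < T
  delay_le : T + p.τ ≤ P
  start : φ 0 = p.s * θ 0
  on_first : ∀ t ∈ Ioo 0 T, 0 < region p (θ t) (φ t)
  cross : φ T = p.s * θ T
  off_second : ∀ t ∈ Ioo T P, region p (θ t) (φ t) < 0
  return_line : φ P = p.s * θ P

/-- The Hamiltonian of the pendulum without control. -/
def hamiltonian (x y : ℝ) : ℝ := y ^ 2 / 2 + Real.cos x

/-- The change of energy over one zigzag oscillation: the control acts from time `τ` to time
`T + τ`. -/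
def energyChange (p : Params) (θ φ : ℝ → ℝ) (T : ℝ) : ℝ :=
  hamiltonian (θ (T + p.τ)) (φ (T + p.τ)) - hamiltonian (θ p.τ) (φ p.τ)

/-- `(θ, φ)` is a zigzag periodic orbit of period `P`: it repeats itself after one zigzag
oscillation, which starts at the point `(x, s x)` at time `0`. -/
def IsZigzagPeriodicOrbit (G : ℝ → ℝ) (p : Params) (x : ℝ) (θ φ : ℝ → ℝ) (P : ℝ) : Prop :=
  IsForwardOrbit G p x θ φ ∧ (∃ T, IsZigzag p θ φ T P) ∧
    Function.Periodic θ P ∧ Function.Periodic φ P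

/-- The closed curve traced out in the `(θ, φ)`-plane. -/
def orbitSet (θ φ : ℝ → ℝ) : Set (ℝ × ℝ) := range fun t => (θ t, φ t)

/-- Orbital (Lyapunov) stability of a zigzag periodic orbit, with respect to the forward orbits of
the points of the switching line. -/
def IsStable (G : ℝ → ℝ) (p : Params) (θ φ : ℝ → ℝ) : Prop :=
  ∀ ε > 0, ∃ δ > 0, ∀ (y : ℝ) (θ' φ' : ℝ → ℝ), |y - θ 0| < δ → IsForwardOrbit G p y θ' φ' →
    ∀ t, 0 ≤ t → Metric.infDist (θ' t, φ' t) (orbitSet θ φ) < ε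

/-- Asymptotic orbital stability: stability together with local attractivity. -/
def IsAsymptoticallyStable (G : ℝ → ℝ) (p : Params) (θ φ : ℝ → ℝ) : Prop :=
  IsStable G p θ φ ∧
    ∃ δ > 0, ∀ (y : ℝ) (θ' φ' : ℝ → ℝ), |y - θ 0| < δ → IsForwardOrbit G p y θ' φ' →
      Tendsto (fun t => Metric.infDist (θ' t, φ' t) (orbitSet θ φ)) atTop (𝓝 0)

/-- The expansion, up to third order in `(s, τ)`, of the coefficient of `θ₁²` in the energy
change. -/
def quadCoeff (p : Params) : ℝ :=
  -(p.a ^ 2 / (p.a - 1)) * p.s * p.τ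
    + p.a ^ 2 * (p.a - 2) / (2 * (p.a - 1)) * p.τ ^ 2
    - p.a * p.b * (p.a - 2) / (p.a - 1) ^ 2 * p.s ^ 2 * p.τ
    + p.a * p.b * (p.a ^ 2 - 3 * p.a + 4) / (2 * (p.a - 1) ^ 2) * p.s * p.τ ^ 2
    + p.a * p.b * (3 * p.a ^ 3 - 9 * p.a ^ 2 + 7 * p.a + 1) / (6 * (p.a - 1) ^ 2) * p.τ ^ 3

/-- Second order approximation of the delay at which the `θ₁²` coefficient vanishes. -/
def bifurcationDelay (a b s : ℝ) : ℝ :=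
  2 / (a - 2) * s
    - 2 * (2 + 8 * a - 15 * a ^ 2 + 6 * a ^ 3) / (3 * a * (a - 1) * (a - 2) ^ 3) * b * s ^ 2

/-- Second order approximation of the delay at which the `θ₁⁴` coefficient vanishes, `G = cos`. -/
def criticalDelayCos (a b s : ℝ) : ℝ :=
  (3 * a - 5) / (3 * a ^ 2 - 8 * a + 6) * s
    + b * (-243 * a ^ 6 + 1674 * a ^ 5 - 4491 * a ^ 4 + 5862 * a ^ 3 - 3611 * a ^ 2
        + 642 * a + 175) / (6 * a * (a - 1) * (3 * a ^ 2 - 8 * a + 6) ^ 3) * s ^ 2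

/-- Second order approximation of the delay at which the `θ₁⁴` coefficient vanishes, `G = 1`. -/
def criticalDelayOne (a b s : ℝ) : ℝ :=
  -(2 / a) * s - 2 * b * (a ^ 2 - 2) * (3 * a - 1) / (3 * a ^ 4 * (a - 1)) * s ^ 2

/-- For small `s < 0`, and locally uniformly in `a ∈ I` and `b ∈ ℝ`, the function `f` of the
parameters vanishes at exactly one small delay `τ > 0`, and this delay is
`approx a b s + O(s³)`. -/
def HasZeroCurve (f : Params → ℝ) (I : Set ℝ) (approx : ℝ → ℝ → ℝ → ℝ) : Prop :=
  ∀ a₀ ∈ I, ∀ b₀ : ℝ, ∃ ε > 0, ∃ δ > 0, ∃ C > 0, ∀ a b s : ℝ,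
    |a - a₀| < δ → |b - b₀| < δ → -δ < s → s < 0 →
      ∃ τ' : ℝ, 0 < τ' ∧ τ' < ε ∧ |τ' - approx a b s| ≤ C * |s| ^ 3 ∧
        ∀ τ : ℝ, 0 < τ → τ < ε → (f (a, b, s, τ) = 0 ↔ τ = τ')

end Pendulum

end

noncomputable section

namespace Pendulum

/-! ### Gronwall estimates and solutions with a prescribed forcing -/

/-! The small delay becomes a regular parameter after rescaling. A forward orbit of `(x, s x)` is
written as `θ = x ϑ(t/τ)`, `φ = x (s ϑ + τ w)(t/τ)`, together with `σ = sin θ / x` and `κ = cos θ`.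
With `z = x²`, the functions `ϑ, σ, κ, w` solve an integral system with delay one in which the
control, once on, stays on. This system depends smoothly on `(a, b, s, τ, z)` up to and including `s
= τ = z = 0`, where `ϑ = σ = κ = 1` and `w` is the tent `u - a (u - 1)₊`. The implicit function
theorem in the space of bounded continuous functions of time solves it (`exists_onFamily`). The zero
`U` of `w` near `a / (a - 1)` gives the intersection time `T = τ U` (`exists_isOnPhase`). Up to time
`τ (U + 1)` the true orbit is the rescaled curve; from then on its motion is free, and gravity
pushes it back to the switching line within time `O(τ)` (`exists_free_return`,
`IsOnPhase.exists_isCycle`).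

The energy changes only through the work of the control, so `ΔH = τ f(p, z) θ₁²` with `f =
energyRate` and `θ₁ = x ϑ(1)`. The work consists of one integral with factor `s` and one with factor
`τ`; therefore first order expansions of `w`, `U` and these integrals determine `f` up to third
order terms (`energy_expansion`, `energyRate_expansion`). They are piecewise polynomial in time, and
the formulas are those for `U ≥ 2`. The curves have weak corners at integer times, but on `(2, N)`
they are smooth enough to make `U` and `f` of class C² if `a < 2`, that is `a / (a - 1) > 2`. Taylor
expansion in `z` then gives `c = τ f(p, 0)` and `d = τ ∂_z f(p, 0) / m(p, 0)²`, where `m = ϑ(1)`. At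
`z = 0` both actuations equal 1, which is why `c` does not depend on `G`.

Remainders are kept as homogeneous polynomials in `s` and `τ` with C¹ coefficients, so that they can
be differentiated in `z` and in `a` without losing order (`OrderClass`). The zero curves follow from
`∂_τ ≠ 0` and an explicit approximate root with residual `O(s³)` (`exists_zero_curve`). Where `c =
0` one has `s ≈ (a - 2) τ / 2`, and inserting this into the linear parts of `∂_z f` and `∂_a f`
yields their signs (`exists_leading_sign`).

For the bifurcation, the orbit after one zigzag is again a forward orbit of a point of the line, and
on the line the energy is strictly decreasing in `|x|`. The return map is thus governed by the
energy change as a function of `x²`, and its fixed points are the zeros of `f(p, x²)`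
(`HasCycles.exists_periodic_iff`). Near `p₀` the function `f(p, ·)` is almost affine with a slope
`g₀` of the sign of `d₀`, so it has a small positive zero, and only one, exactly if `c d₀ < 0`
(`exists_bifurcation`). A gain of energy decreases `|x|`; hence `d₀ > 0` makes returns approach the
periodic orbit monotonically and `d₀ < 0` drives them away (`HasCycles.isAsymptoticallyStable`,
`HasCycles.not_isStable`). Between returns, continuous dependence is used, which survives the
discontinuity of the control because a periodic orbit meets the line at countably many times only
(`exists_close`). The square root law is `X² ≈ -f(p, 0) / g₀`. -/

lemma le_mul_exp_of_le_add_integral {D : ℝ → ℝ} {t₀ t₁ ε L : ℝ} (hD : Continuous D) (hL : 0 ≤ L)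
    (h : ∀ t ∈ Icc t₀ t₁, D t ≤ ε + L * ∫ r in t₀..t, D r) {t : ℝ} (ht : t ∈ Icc t₀ t₁) :
    D t ≤ ε * Real.exp (L * (t - t₀)) := by
  -- The upper bound in the hypothesis, multiplied by `exp (-L (t - t₀))`, is antitone and starts at
  -- `ε`.
  have hder : ∀ t, HasDerivAt (fun t => (ε + L * ∫ r in t₀..t, D r) * Real.exp (-(L * (t - t₀))))
      (L * D t * Real.exp (-(L * (t - t₀))) + (ε + L * ∫ r in t₀..t, D r) *
        (Real.exp (-(L * (t - t₀))) * -L)) t := by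
    intro t
    have h1 : HasDerivAt (fun t => ε + L * ∫ r in t₀..t, D r) (L * D t) t :=
      ((intervalIntegral.integral_hasDerivAt_right (hD.intervalIntegrable _ _)
        hD.stronglyMeasurable.stronglyMeasurableAtFilter hD.continuousAt).const_mul L).const_add ε
    have h2 : HasDerivAt (fun t => Real.exp (-(L * (t - t₀)))) (Real.exp (-(L * (t - t₀))) * -L) t := by
      have := ((((hasDerivAt_id t).sub_const t₀).const_mul L).neg).exp
      simpa using this
    exact h1.mul h2
  have hanti : AntitoneOn (fun t => (ε + L * ∫ r in t₀..t, D r) * Real.exp (-(L * (t - t₀))))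
      (Icc t₀ t₁) := by
    apply antitoneOn_of_deriv_nonpos (convex_Icc _ _)
      (fun x _ => (hder x).continuousAt.continuousWithinAt)
      (fun x _ => (hder x).differentiableAt.differentiableWithinAt)
    intro x hx
    rw [interior_Icc] at hx
    rw [(hder x).deriv]
    have := h x (Ioo_subset_Icc_self hx)
    have he := Real.exp_pos (-(L * (x - t₀)))
    nlinarith [mul_le_mul_of_nonneg_left this (mul_nonneg hL he.le)]
  have h0 := hanti (left_mem_Icc.2 (ht.1.trans ht.2)) ht ht.1
  simp only [intervalIntegral.integral_same, mul_zero, add_zero, sub_self, neg_zero, Real.exp_zero,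
    mul_one] at h0
  calc D t ≤ ε + L * ∫ r in t₀..t, D r := h t ht
    _ = ((ε + L * ∫ r in t₀..t, D r) * Real.exp (-(L * (t - t₀)))) * Real.exp (L * (t - t₀)) := by
        rw [mul_assoc, ← Real.exp_add]; simp
    _ ≤ _ := by gcongr

/-- Both actuation functions have the properties used below. -/
structure IsActuation (G : ℝ → ℝ) : Prop where
  lip : ∀ x y, |G x - G y| ≤ |x - y|
  bound : ∀ x, |G x| ≤ 1
  even : ∀ x, G (-x) = G x

lemma abs_sin_sub_sin_le (x y : ℝ) : |Real.sin x - Real.sin y| ≤ |x - y| := by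
  have := Real.lipschitzWith_sin.dist_le_mul x y
  simpa [Real.dist_eq] using this

lemma isActuation_of_mem {G : ℝ → ℝ} (hG : G ∈ actuations) : IsActuation G := by
  rcases hG with rfl | rfl
  · refine ⟨fun x y => ?_, Real.abs_cos_le_one, Real.cos_neg⟩
    have := Real.lipschitzWith_cos.dist_le_mul x y
    simpa [Real.dist_eq] using this
  · exact ⟨fun x y => by simp, fun x => by simp, fun x => rfl⟩

lemma IsActuation.continuous {G : ℝ → ℝ} (hG : IsActuation G) : Continuous G :=
  (LipschitzWith.of_dist_le_mul (K := 1) fun x y => by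
    simpa [Real.dist_eq] using hG.lip x y).continuous

/-- `(θ, φ)` solves the pendulum equation with forcing `F` on `[t₀, t₁]`, in integrated form. -/
structure SolvesOn (G F θ φ : ℝ → ℝ) (t₀ t₁ : ℝ) : Prop where
  pos_eq : ∀ t ∈ Icc t₀ t₁, θ t = θ t₀ + ∫ r in t₀..t, φ r
  vel_eq : ∀ t ∈ Icc t₀ t₁, φ t = φ t₀ + ∫ r in t₀..t, (Real.sin (θ r) + F r * G (θ r))

lemma intervalIntegrable_mul_actuation {G F θ : ℝ → ℝ} (hG : IsActuation G) (hθ : Continuous θ)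
    {t₀ t₁ : ℝ} (hF : IntervalIntegrable F volume t₀ t₁) :
    IntervalIntegrable (fun r => Real.sin (θ r) + F r * G (θ r)) volume t₀ t₁ :=
  ((Real.continuous_sin.comp hθ).intervalIntegrable _ _).add
    (hF.mul_continuousOn (hG.continuous.comp hθ).continuousOn)

/-- The two forcings are compared only through the integral of their difference, so a discontinuous
control may differ on a small set of times. This serves both for uniqueness and for continuous
dependence. The rate `2 + M` dominates the Lipschitz constants `1` and `1 + M` of the two equations.
-/
lemma SolvesOn.abs_sub_le {G F F' θ φ θ' φ' : ℝ → ℝ} {t₀ t₁ M : ℝ} (hG : IsActuation G)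
    (h : SolvesOn G F θ φ t₀ t₁) (h' : SolvesOn G F' θ' φ' t₀ t₁)
    (hθ : Continuous θ) (hφ : Continuous φ) (hθ' : Continuous θ') (hφ' : Continuous φ')
    (hF : IntervalIntegrable F volume t₀ t₁) (hF' : IntervalIntegrable F' volume t₀ t₁)
    (hM : ∀ t ∈ Ioc t₀ t₁, |F' t| ≤ M) (hM0 : 0 ≤ M) {t : ℝ} (ht : t ∈ Icc t₀ t₁) :
    |θ t - θ' t| + |φ t - φ' t| ≤
      (|θ t₀ - θ' t₀| + |φ t₀ - φ' t₀| + ∫ r in t₀..t₁, |F r - F' r|) *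
        Real.exp ((2 + M) * (t - t₀)) := by
  refine le_mul_exp_of_le_add_integral (D := fun t => |θ t - θ' t| + |φ t - φ' t|)
    (by fun_prop) (by positivity) (fun t ht => ?_) ht
  have hsub : ∀ {f : ℝ → ℝ}, IntervalIntegrable f volume t₀ t₁ → IntervalIntegrable f volume t₀ t :=
    fun hf => hf.mono_set (by rw [uIcc_of_le ht.1, uIcc_of_le (ht.1.trans ht.2)]; exact Icc_subset_Icc_right ht.2)
  have hI : IntervalIntegrable (fun r => |F r - F' r|) volume t₀ t₁ := (hF.sub hF').abs
  have e1 : |θ t - θ' t| ≤ |θ t₀ - θ' t₀| + ∫ r in t₀..t, |φ r - φ' r| := by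
    rw [h.pos_eq t ht, h'.pos_eq t ht]
    have : θ t₀ + (∫ r in t₀..t, φ r) - (θ' t₀ + ∫ r in t₀..t, φ' r)
        = (θ t₀ - θ' t₀) + ∫ r in t₀..t, (φ r - φ' r) := by
      rw [intervalIntegral.integral_sub (hφ.intervalIntegrable _ _) (hφ'.intervalIntegrable _ _)]; ring
    rw [this]
    refine (abs_add_le _ _).trans ?_
    gcongr
    exact intervalIntegral.abs_integral_le_integral_abs ht.1
  have e2 : |φ t - φ' t| ≤ |φ t₀ - φ' t₀| + (∫ r in t₀..t, |F r - F' r|) +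
      (1 + M) * ∫ r in t₀..t, |θ r - θ' r| := by
    rw [h.vel_eq t ht, h'.vel_eq t ht]
    have i1 := intervalIntegrable_mul_actuation hG hθ (hsub hF)
    have i2 := intervalIntegrable_mul_actuation hG hθ' (hsub hF')
    rw [show φ t₀ + (∫ r in t₀..t, (Real.sin (θ r) + F r * G (θ r))) - (φ' t₀ +
        ∫ r in t₀..t, (Real.sin (θ' r) + F' r * G (θ' r))) = (φ t₀ - φ' t₀) + ∫ r in t₀..t,
        ((Real.sin (θ r) + F r * G (θ r)) - (Real.sin (θ' r) + F' r * G (θ' r))) by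
      rw [intervalIntegral.integral_sub i1 i2]; ring]
    refine (abs_add_le _ _).trans ?_
    rw [add_assoc, ← intervalIntegral.integral_const_mul, ← intervalIntegral.integral_add (hsub hI)
      ((by fun_prop : Continuous fun r => (1 + M) * |θ r - θ' r|).intervalIntegrable _ _)]
    gcongr
    rw [← Real.norm_eq_abs]
    refine intervalIntegral.norm_integral_le_of_norm_le ht.1 ?_ ((hsub hI).add
      ((by fun_prop : Continuous fun r => (1 + M) * |θ r - θ' r|).intervalIntegrable _ _))
    refine ae_of_all _ fun r hr => ?_
    have hr' : r ∈ Ioc t₀ t₁ := ⟨hr.1, hr.2.trans ht.2⟩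
    -- The products are split so that only `F'` multiplies a difference of values of `G`; hence only
    -- `F'` needs a pointwise bound.
    rw [Real.norm_eq_abs, show Real.sin (θ r) + F r * G (θ r) - (Real.sin (θ' r) + F' r * G (θ' r))
      = (F r - F' r) * G (θ r) + ((Real.sin (θ r) - Real.sin (θ' r))
        + F' r * (G (θ r) - G (θ' r))) by ring]
    have a1 : |(F r - F' r) * G (θ r)| ≤ |F r - F' r| := by
      rw [abs_mul]; exact mul_le_of_le_one_right (abs_nonneg _) (hG.bound _)
    have a2 : |F' r * (G (θ r) - G (θ' r))| ≤ M * |θ r - θ' r| := by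
      rw [abs_mul]; exact mul_le_mul (hM r hr') (hG.lip _ _) (abs_nonneg _) hM0
    have a3 := abs_sin_sub_sin_le (θ r) (θ' r)
    have := abs_add_le ((F r - F' r) * G (θ r)) ((Real.sin (θ r) - Real.sin (θ' r))
        + F' r * (G (θ r) - G (θ' r)))
    have := abs_add_le (Real.sin (θ r) - Real.sin (θ' r)) (F' r * (G (θ r) - G (θ' r)))
    linarith
  have e3 : ∫ r in t₀..t, |F r - F' r| ≤ ∫ r in t₀..t₁, |F r - F' r| :=
    intervalIntegral.integral_mono_interval le_rfl ht.1 ht.2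
      (ae_of_all _ fun r => abs_nonneg _) hI
  have e4 : ∫ r in t₀..t, (|θ r - θ' r| + |φ r - φ' r|) =
      (∫ r in t₀..t, |θ r - θ' r|) + ∫ r in t₀..t, |φ r - φ' r| :=
    intervalIntegral.integral_add ((by fun_prop : Continuous fun r => |θ r - θ' r|).intervalIntegrable _ _)
      ((by fun_prop : Continuous fun r => |φ r - φ' r|).intervalIntegrable _ _)
  have p1 : 0 ≤ ∫ r in t₀..t, |θ r - θ' r| :=
    intervalIntegral.integral_nonneg ht.1 fun r _ => abs_nonneg _
  have p2 : 0 ≤ ∫ r in t₀..t, |φ r - φ' r| :=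
    intervalIntegral.integral_nonneg ht.1 fun r _ => abs_nonneg _
  simp only [e4]
  nlinarith [mul_nonneg hM0 p2]

/-- The weighted Picard operator on curves `[0, ℓ] → ℝ²`. -/
lemma exists_solvesOn {G F : ℝ → ℝ} (hG : IsActuation G) {t₀ ℓ M : ℝ} (hℓ : 0 < ℓ)
    (hF : Measurable F) (hM : ∀ t ∈ Icc t₀ (t₀ + ℓ), |F t| ≤ M) (θ₀ φ₀ : ℝ) :
    ∃ θ φ : ℝ → ℝ, Continuous θ ∧ Continuous φ ∧ θ t₀ = θ₀ ∧ φ t₀ = φ₀ ∧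
      SolvesOn G F θ φ t₀ (t₀ + ℓ) := by
  have hM0 : 0 ≤ M := (abs_nonneg _).trans (hM t₀ ⟨le_rfl, by linarith⟩)
  -- Curves are stored divided by `exp (lam r)`. With `lam` twice the Lipschitz constant `1 + M`,
  -- the Picard operator contracts by `1/2` on the whole interval at once.
  set lam : ℝ := 2 * (1 + M) with hlam
  have hlam0 : 0 < lam := by positivity
  have hle : (0:ℝ) ≤ ℓ := hℓ.le
  let X := C(Icc (0:ℝ) ℓ, ℝ)
  let ext : X → ℝ → ℝ := fun α r => Real.exp (lam * r) * IccExtend hle α r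
  have hext : ∀ α, Continuous (ext α) := fun α => by
    have : Continuous (IccExtend hle α) := α.continuous.Icc_extend'
    fun_prop
  have hext_sub : ∀ α α' : X, ∀ r, |ext α r - ext α' r| ≤ Real.exp (lam * r) * dist α α' := by
    intro α α' r
    rw [← mul_sub, abs_mul, abs_of_pos (Real.exp_pos _)]
    gcongr
    simpa [IccExtend, Real.dist_eq] using ContinuousMap.dist_apply_le_dist (f := α) (g := α') (projIcc 0 ℓ hle r)
  have hFi : ∀ r ∈ Icc 0 ℓ, IntervalIntegrable (fun r => F (t₀ + r)) volume 0 r := by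
    intro r hr
    rw [intervalIntegrable_iff_integrableOn_Ioc_of_le hr.1]
    refine Measure.integrableOn_of_bounded (M := M) (by simp)
      (hF.comp (measurable_const.add measurable_id)).aestronglyMeasurable ?_
    filter_upwards [ae_restrict_mem measurableSet_Ioc] with x hx
    exact hM _ ⟨by linarith [hx.1], by linarith [hx.2, hr.2]⟩
  let f : X → ℝ → ℝ := fun α r => Real.sin (ext α r) + F (t₀ + r) * G (ext α r)
  have hfi : ∀ α, ∀ r ∈ Icc 0 ℓ, IntervalIntegrable (f α) volume 0 r := fun α r hr =>
    intervalIntegrable_mul_actuation hG (hext α) (hFi r hr)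
  have hf_sub : ∀ α α' : X, ∀ r ∈ Icc 0 ℓ, |f α r - f α' r| ≤
      (1 + M) * (Real.exp (lam * r) * dist α α') := by
    intro α α' r hr
    have h1 := abs_sin_sub_sin_le (ext α r) (ext α' r)
    have h2 : |F (t₀ + r) * (G (ext α r) - G (ext α' r))| ≤ M * |ext α r - ext α' r| := by
      rw [abs_mul]
      exact mul_le_mul (hM _ ⟨by linarith [hr.1], by linarith [hr.2]⟩) (hG.lip _ _) (abs_nonneg _) hM0
    calc |f α r - f α' r| = |(Real.sin (ext α r) - Real.sin (ext α' r)) +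
          F (t₀ + r) * (G (ext α r) - G (ext α' r))| := by simp only [f]; ring_nf
      _ ≤ (1 + M) * |ext α r - ext α' r| := by
          refine (abs_add_le _ _).trans ?_; linarith
      _ ≤ _ := by gcongr; exact hext_sub α α' r
  have hexp : ∀ r, 0 ≤ r → Real.exp (-(lam * r)) * ∫ ρ in (0:ℝ)..r, Real.exp (lam * ρ) ≤ 1 / lam := by
    intro r hr
    have : ∫ ρ in (0:ℝ)..r, Real.exp (lam * ρ) = (Real.exp (lam * r) - 1) / lam := by
      rw [intervalIntegral.integral_comp_mul_left (fun x => Real.exp x) hlam0.ne']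
      simp [div_eq_inv_mul]
    rw [this, ← mul_div_assoc, mul_sub, ← Real.exp_add]
    gcongr
    simp [Real.exp_nonneg]
  have mk : ∀ (c : ℝ) (g : ℝ → ℝ), (∀ r ∈ Icc 0 ℓ, IntervalIntegrable g volume 0 r) →
      ContinuousOn (fun r => Real.exp (-(lam * r)) * (c + ∫ ρ in (0:ℝ)..r, g ρ)) (Icc 0 ℓ) := by
    intro c g hg
    have h1 : ContinuousOn (fun r => ∫ ρ in (0:ℝ)..r, g ρ) (Icc 0 ℓ) := by
      have := intervalIntegral.continuousOn_primitive_interval' (hg ℓ ⟨hle, le_rfl⟩) left_mem_uIcc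
      rwa [uIcc_of_le hle] at this
    exact (by fun_prop : Continuous fun r => Real.exp (-(lam * r))).continuousOn.mul
      (continuousOn_const.add h1)
  let T : X × X → X × X := fun y =>
    (⟨_, (mk θ₀ (ext y.2) (fun r _ => (hext _).intervalIntegrable _ _)).domRestrict⟩,
      ⟨_, (mk φ₀ (f y.1) (hfi y.1)).domRestrict⟩)
  have contr : ∀ (c : ℝ) (g g' : ℝ → ℝ) (d : ℝ) (_ : 0 ≤ d),
      (∀ r ∈ Icc 0 ℓ, IntervalIntegrable g volume 0 r) →
      (∀ r ∈ Icc 0 ℓ, IntervalIntegrable g' volume 0 r) →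
      (∀ r ∈ Icc 0 ℓ, |g r - g' r| ≤ (1 + M) * (Real.exp (lam * r) * d)) → ∀ r ∈ Icc 0 ℓ,
      dist (Real.exp (-(lam * r)) * (c + ∫ ρ in (0:ℝ)..r, g ρ))
        (Real.exp (-(lam * r)) * (c + ∫ ρ in (0:ℝ)..r, g' ρ)) ≤ 1 / 2 * d := by
    intro c g g' d hd hg hg' hgg r hr
    rw [Real.dist_eq, ← mul_sub, abs_mul, abs_of_pos (Real.exp_pos _), add_sub_add_left_eq_sub,
      ← intervalIntegral.integral_sub (hg r hr) (hg' r hr)]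
    have h1 : |∫ ρ in (0:ℝ)..r, (g ρ - g' ρ)| ≤
        ∫ ρ in (0:ℝ)..r, (1 + M) * (Real.exp (lam * ρ) * d) := by
      rw [← Real.norm_eq_abs]
      refine intervalIntegral.norm_integral_le_of_norm_le hr.1 (ae_of_all _ fun ρ hρ =>
        hgg ρ ⟨hρ.1.le, hρ.2.trans hr.2⟩) ((by fun_prop : Continuous _).intervalIntegrable _ _)
    rw [intervalIntegral.integral_const_mul, intervalIntegral.integral_mul_const] at h1
    calc _ ≤ Real.exp (-(lam * r)) * ((1 + M) * ((∫ ρ in (0:ℝ)..r, Real.exp (lam * ρ)) * d)) := by gcongr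
      _ = (1 + M) * d * (Real.exp (-(lam * r)) * ∫ ρ in (0:ℝ)..r, Real.exp (lam * ρ)) := by ring
      _ ≤ (1 + M) * d * (1 / lam) := by gcongr; exact hexp r hr.1
      _ = 1 / 2 * d := by rw [hlam]; field_simp
  have hT : ContractingWith (1 / 2) T := by
    refine ⟨by norm_num, LipschitzWith.of_dist_le_mul fun y y' => ?_⟩
    rw [Prod.dist_eq, max_le_iff]
    have hc : ((1 / 2 : NNReal) : ℝ) = 1 / 2 := by norm_num
    rw [hc]
    constructor
    · rw [ContinuousMap.dist_le (by positivity)]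
      intro r
      refine (contr θ₀ _ _ (dist y.2 y'.2) dist_nonneg (fun r _ => (hext _).intervalIntegrable _ _)
        (fun r _ => (hext _).intervalIntegrable _ _) (fun r _ => ?_) r r.2).trans ?_
      · refine (hext_sub _ _ _).trans (le_mul_of_one_le_left (by positivity) (by linarith))
      · rw [Prod.dist_eq]; gcongr; exact le_max_right _ _
    · rw [ContinuousMap.dist_le (by positivity)]
      intro r
      refine (contr φ₀ _ _ (dist y.1 y'.1) dist_nonneg (hfi _) (hfi _)
        (hf_sub _ _) r r.2).trans ?_
      rw [Prod.dist_eq]; gcongr; exact le_max_left _ _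
  set y := ContractingWith.fixedPoint T hT
  have hy : T y = y := hT.fixedPoint_isFixedPt
  have h1 : ∀ r ∈ Icc 0 ℓ, ext y.1 r = θ₀ + ∫ ρ in (0:ℝ)..r, ext y.2 ρ := by
    intro r hr
    have : Real.exp (-(lam * r)) * (θ₀ + ∫ ρ in (0:ℝ)..r, ext y.2 ρ) = y.1 ⟨r, hr⟩ :=
      congrArg (fun y : X × X => y.1 ⟨r, hr⟩) hy
    simp only [ext, IccExtend_of_mem hle _ hr]
    rw [← this, ← mul_assoc, ← Real.exp_add]; simp [ext]
  have h2 : ∀ r ∈ Icc 0 ℓ, ext y.2 r = φ₀ + ∫ ρ in (0:ℝ)..r, f y.1 ρ := by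
    intro r hr
    have : Real.exp (-(lam * r)) * (φ₀ + ∫ ρ in (0:ℝ)..r, f y.1 ρ) = y.2 ⟨r, hr⟩ :=
      congrArg (fun y : X × X => y.2 ⟨r, hr⟩) hy
    simp only [ext, IccExtend_of_mem hle _ hr]
    rw [← this, ← mul_assoc, ← Real.exp_add]; simp
  have z : (0:ℝ) ∈ Icc 0 ℓ := ⟨le_rfl, hle⟩
  refine ⟨fun t => ext y.1 (t - t₀), fun t => ext y.2 (t - t₀), (hext _).comp (by fun_prop),
    (hext _).comp (by fun_prop), ?_, ?_, ?_, ?_⟩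
  · simp [h1 0 z]
  · simp [h2 0 z]
  · intro t ht
    rw [intervalIntegral.integral_comp_sub_right (fun r => ext y.2 r), sub_self,
      h1 _ ⟨by linarith [ht.1], by linarith [ht.2]⟩, h1 0 z]
    simp
  · intro t ht
    have : ∀ r, Real.sin (ext y.1 (r - t₀)) + F r * G (ext y.1 (r - t₀)) = f y.1 (r - t₀) := by
      intro r; simp [f]
    simp only [this]
    rw [intervalIntegral.integral_comp_sub_right (fun r => f y.1 r), sub_self,
      h2 _ ⟨by linarith [ht.1], by linarith [ht.2]⟩, h2 0 z]
    simp

end Pendulum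

/-! ### Solutions of the delay equation: gluing, method of steps, comparison with a known forcing -/

namespace Pendulum

lemma SolvesOn.congr {G F F' θ φ θ' φ' : ℝ → ℝ} {t₀ t₁ : ℝ} (h : SolvesOn G F θ φ t₀ t₁)
    (hθ : EqOn θ θ' (Icc t₀ t₁)) (hφ : EqOn φ φ' (Icc t₀ t₁)) (hF : EqOn F F' (Ioc t₀ t₁)) :
    SolvesOn G F' θ' φ' t₀ t₁ := by
  have sub : ∀ {t r}, t ∈ Icc t₀ t₁ → r ∈ uIcc t₀ t → r ∈ Icc t₀ t₁ := fun ht hr => by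
    rw [uIcc_of_le ht.1] at hr; exact ⟨hr.1, hr.2.trans ht.2⟩
  refine ⟨fun t ht => ?_, fun t ht => ?_⟩
  · rw [← hθ ht, ← hθ ⟨le_rfl, ht.1.trans ht.2⟩, h.pos_eq t ht]
    congr 1
    exact intervalIntegral.integral_congr fun r hr => hφ (sub ht hr)
  · rw [← hφ ht, ← hφ ⟨le_rfl, ht.1.trans ht.2⟩, h.vel_eq t ht]
    congr 1
    refine intervalIntegral.integral_congr_ae (ae_of_all _ fun r hr => ?_)
    rw [uIoc_of_le ht.1] at hr
    have hr' : r ∈ Ioc t₀ t₁ := ⟨hr.1, hr.2.trans ht.2⟩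
    rw [hθ (Ioc_subset_Icc_self hr'), hF hr']

lemma SolvesOn.trans {G F θ φ : ℝ → ℝ} {t₀ t₁ t₂ : ℝ} (hG : IsActuation G) (h : SolvesOn G F θ φ t₀ t₁)
    (h' : SolvesOn G F θ φ t₁ t₂) (hθ : Continuous θ) (hφ : Continuous φ) (h01 : t₀ ≤ t₁)
    (hF : ∀ t, IntervalIntegrable F volume t₀ t) : SolvesOn G F θ φ t₀ t₂ := by
  have key : ∀ {x f : ℝ → ℝ}, (∀ t, IntervalIntegrable f volume t₀ t) →
      (∀ t ∈ Icc t₀ t₁, x t = x t₀ + ∫ r in t₀..t, f r) →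
      (∀ t ∈ Icc t₁ t₂, x t = x t₁ + ∫ r in t₁..t, f r) →
      ∀ t ∈ Icc t₀ t₂, x t = x t₀ + ∫ r in t₀..t, f r := by
    intro x f hf h1 h2 t ht
    rcases le_total t t₁ with h | h
    · exact h1 t ⟨ht.1, h⟩
    · rw [h2 t ⟨h, ht.2⟩, h1 t₁ ⟨h01, le_rfl⟩, add_assoc,
        intervalIntegral.integral_add_adjacent_intervals (hf _) ((hf _).symm.trans (hf _))]
  exact ⟨key (fun t => hφ.intervalIntegrable _ _) h.pos_eq h'.pos_eq,
    key (fun t => intervalIntegrable_mul_actuation hG hθ (hF t)) h.vel_eq h'.vel_eq⟩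

lemma SolvesOn.mono {G F θ φ : ℝ → ℝ} {t₀ t₁ t₂ : ℝ} (h : SolvesOn G F θ φ t₀ t₂) (h12 : t₁ ≤ t₂) :
    SolvesOn G F θ φ t₀ t₁ :=
  ⟨fun t ht => h.pos_eq t ⟨ht.1, ht.2.trans h12⟩, fun t ht => h.vel_eq t ⟨ht.1, ht.2.trans h12⟩⟩

/-- The countable set `S` is there for the instants at which the forcing jumps and the velocity has
a corner. -/
lemma solvesOn_of_hasDerivAt {G F θ φ : ℝ → ℝ} {t₀ t₁ : ℝ} {S : Set ℝ} (hS : S.Countable)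
    (hG : IsActuation G) (hθ : Continuous θ) (hφ : Continuous φ)
    (hF : ∀ t, IntervalIntegrable F volume t₀ t)
    (h1 : ∀ t ∈ Ioo t₀ t₁ \ S, HasDerivAt θ (φ t) t)
    (h2 : ∀ t ∈ Ioo t₀ t₁ \ S, HasDerivAt φ (Real.sin (θ t) + F t * G (θ t)) t) :
    SolvesOn G F θ φ t₀ t₁ := by
  refine ⟨fun t ht => ?_, fun t ht => ?_⟩
  · rw [integral_eq_of_hasDerivAt_off_countable_of_le θ φ ht.1 hS hθ.continuousOn
      (fun r hr => h1 r ⟨⟨hr.1.1, hr.1.2.trans_le ht.2⟩, hr.2⟩) (hφ.intervalIntegrable _ _)]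
    ring
  · rw [integral_eq_of_hasDerivAt_off_countable_of_le φ _ ht.1 hS hφ.continuousOn
      (fun r hr => h2 r ⟨⟨hr.1.1, hr.1.2.trans_le ht.2⟩, hr.2⟩)
      (intervalIntegrable_mul_actuation hG hθ (hF t))]
    ring

lemma measurable_control (p : Params) {θ φ : ℝ → ℝ} (hθ : Continuous θ) (hφ : Continuous φ) :
    Measurable (control p θ φ) := by
  unfold control region
  exact Measurable.ite (measurableSet_lt measurable_const (by fun_prop)) (by fun_prop) (by fun_prop)

lemma abs_control_le (p : Params) (θ φ : ℝ → ℝ) (t : ℝ) :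
    |control p θ φ t| ≤ |p.a| * |θ (t - p.τ)| + |p.b| * |φ (t - p.τ)| := by
  unfold control
  split_ifs
  · rw [abs_neg, ← abs_mul, ← abs_mul]; exact abs_add_le _ _
  · rw [abs_zero]; positivity

lemma exists_abs_control_le (p : Params) {θ φ : ℝ → ℝ} (hθ : Continuous θ) (hφ : Continuous φ)
    (t₀ t₁ : ℝ) : ∃ M, 0 ≤ M ∧ ∀ t ∈ Icc t₀ t₁, |control p θ φ t| ≤ M := by
  obtain ⟨M, hM⟩ := (isCompact_Icc (a := t₀) (b := t₁)).exists_bound_of_continuousOn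
    (f := fun t => |p.a| * |θ (t - p.τ)| + |p.b| * |φ (t - p.τ)|)
    (by fun_prop : Continuous _).continuousOn
  refine ⟨max M 0, le_max_right _ _, fun t ht => (abs_control_le p θ φ t).trans ?_⟩
  exact (le_abs_self _).trans ((hM t ht).trans (le_max_left _ _))

lemma intervalIntegrable_control (p : Params) {θ φ : ℝ → ℝ} (hθ : Continuous θ) (hφ : Continuous φ)
    (t₀ t₁ : ℝ) : IntervalIntegrable (control p θ φ) volume t₀ t₁ := by
  obtain ⟨M, -, hM⟩ := exists_abs_control_le p hθ hφ (min t₀ t₁) (max t₀ t₁)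
  rw [intervalIntegrable_iff]
  refine Measure.integrableOn_of_bounded (M := M) (by simp)
    (measurable_control p hθ hφ).aestronglyMeasurable ?_
  filter_upwards [ae_restrict_mem measurableSet_uIoc] with x hx
  exact hM x (Ioc_subset_Icc_self hx)

lemma control_congr {p : Params} {θ φ θ' φ' : ℝ → ℝ} {t : ℝ} (hθ : θ (t - p.τ) = θ' (t - p.τ))
    (hφ : φ (t - p.τ) = φ' (t - p.τ)) : control p θ φ t = control p θ' φ' t := by
  simp only [control, hθ, hφ]

lemma IsSolution.solvesOn {G : ℝ → ℝ} {p : Params} {θ φ : ℝ → ℝ} (h : IsSolution G p θ φ) (t : ℝ) :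
    SolvesOn G (control p θ φ) θ φ 0 t :=
  ⟨fun t ht => h.pos_eq t ht.1, fun t ht => h.vel_eq t ht.1⟩

/-- Method of steps: on an interval of length `τ` the control reads only the part of the curve that
is already known, so it is a given measurable bounded forcing. -/
lemma exists_step {G : ℝ → ℝ} (hG : IsActuation G) {p : Params} (hτ : 0 < p.τ) (t₀ : ℝ)
    (y : (ℝ → ℝ) × (ℝ → ℝ)) (hθ : Continuous y.1) (hφ : Continuous y.2) :
    ∃ y' : (ℝ → ℝ) × (ℝ → ℝ), (Continuous y'.1 ∧ Continuous y'.2) ∧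
      EqOn y'.1 y.1 (Iic t₀) ∧ EqOn y'.2 y.2 (Iic t₀) ∧
      SolvesOn G (control p y'.1 y'.2) y'.1 y'.2 t₀ (t₀ + p.τ) := by
  obtain ⟨M, -, hM⟩ := exists_abs_control_le p hθ hφ t₀ (t₀ + p.τ)
  obtain ⟨θ, φ, cθ, cφ, e1, e2, hs⟩ := exists_solvesOn hG hτ (measurable_control p hθ hφ) hM
    (y.1 t₀) (y.2 t₀)
  refine ⟨(fun t => if t ≤ t₀ then y.1 t else θ t, fun t => if t ≤ t₀ then y.2 t else φ t),
    ⟨Continuous.if_le hθ cθ continuous_id continuous_const (fun t ht => by rw [ht, e1]),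
     Continuous.if_le hφ cφ continuous_id continuous_const (fun t ht => by rw [ht, e2])⟩,
    fun t ht => if_pos ht, fun t ht => if_pos ht, ?_⟩
  have glue : ∀ {x x' : ℝ → ℝ}, x t₀ = x' t₀ →
      EqOn x (fun t => if t ≤ t₀ then x' t else x t) (Icc t₀ (t₀ + p.τ)) := by
    intro x x' h t ht
    by_cases h' : t ≤ t₀
    · have : t = t₀ := le_antisymm h' ht.1
      subst this
      simp [h]
    · simp [h']
  refine hs.congr (glue e1) (glue e2) fun t ht => control_congr ?_ ?_
  · have : t - p.τ ≤ t₀ := by linarith [ht.2]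
    simp [this]
  · have : t - p.τ ≤ t₀ := by linarith [ht.2]
    simp [this]

/-- Every continuous past has a global solution. -/
lemma exists_isSolution {G : ℝ → ℝ} (hG : IsActuation G) {p : Params} (hτ : 0 < p.τ)
    {θ₀ φ₀ : ℝ → ℝ} (hθ : Continuous θ₀) (hφ : Continuous φ₀) :
    ∃ θ φ : ℝ → ℝ, IsSolution G p θ φ ∧ EqOn θ θ₀ (Iic 0) ∧ EqOn φ φ₀ (Iic 0) := by
  choose! step hstep using fun (t₀ : ℝ) (y : (ℝ → ℝ) × (ℝ → ℝ)) (h : Continuous y.1 ∧ Continuous y.2) =>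
    exists_step hG hτ t₀ y h.1 h.2
  -- The curve number `n` solves the equation on `[0, n τ]`, and all later curves agree with it up
  -- to time `n τ`.
  let y : ℕ → (ℝ → ℝ) × (ℝ → ℝ) := fun n =>
    Nat.rec (θ₀, φ₀) (fun n y => step (n * p.τ) y) n
  have ysucc : ∀ n : ℕ, y (n + 1) = step (n * p.τ) (y n) := fun n => rfl
  have hc : ∀ n, Continuous (y n).1 ∧ Continuous (y n).2 := by
    intro n
    induction n with
    | zero => exact ⟨hθ, hφ⟩
    | succ n ih => rw [ysucc]; exact (hstep _ _ ih).1
  have hmono : ∀ m n : ℕ, n ≤ m → EqOn (y m).1 (y n).1 (Iic (n * p.τ)) ∧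
      EqOn (y m).2 (y n).2 (Iic (n * p.τ)) := by
    intro m n hnm
    induction m, hnm using Nat.le_induction with
    | base => exact ⟨eqOn_refl _ _, eqOn_refl _ _⟩
    | succ m hm ih =>
      have hsub : Iic ((n:ℝ) * p.τ) ⊆ Iic (m * p.τ) := Iic_subset_Iic.2 (by gcongr)
      rw [ysucc]
      exact ⟨((hstep _ _ (hc m)).2.1.mono hsub).trans ih.1, ((hstep _ _ (hc m)).2.2.1.mono hsub).trans ih.2⟩
  have hsol : ∀ n : ℕ, SolvesOn G (control p (y n).1 (y n).2) (y n).1 (y n).2 0 (n * p.τ) := by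
    intro n
    induction n with
    | zero =>
      refine ⟨fun t ht => ?_, fun t ht => ?_⟩ <;>
      · have : t = 0 := le_antisymm (by simpa using ht.2) ht.1
        simp [this]
    | succ n ih =>
      have h0 : (0:ℝ) ≤ n * p.τ := by positivity
      obtain ⟨e1, e2⟩ := hmono (n + 1) n (Nat.le_succ n)
      have h1 : SolvesOn G (control p (y (n+1)).1 (y (n+1)).2) (y (n+1)).1 (y (n+1)).2 0 (n * p.τ) := by
        refine ih.congr (fun t ht => (e1 ht.2).symm) (fun t ht => (e2 ht.2).symm) fun t ht => ?_
        have : t - p.τ ∈ Iic ((n:ℝ) * p.τ) := by simp only [mem_Iic]; linarith [ht.2]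
        exact control_congr (e1 this).symm (e2 this).symm
      have h2 := (hstep (n * p.τ) (y n) (hc n)).2.2.2
      rw [← ysucc] at h2
      have := h1.trans hG h2 (hc (n + 1)).1 (hc (n + 1)).2 h0
        (intervalIntegrable_control p (hc (n + 1)).1 (hc (n + 1)).2 0)
      push_cast
      rwa [add_mul, one_mul]
  have hfloor : ∀ t, t ≤ (⌈t / p.τ⌉₊ : ℝ) * p.τ := fun t => by
    rw [← div_le_iff₀ hτ]; exact Nat.le_ceil _
  have heq : ∀ (n : ℕ) (t : ℝ), t ≤ n * p.τ → (y ⌈t / p.τ⌉₊).1 t = (y n).1 t ∧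
      (y ⌈t / p.τ⌉₊).2 t = (y n).2 t := by
    intro n t ht
    have : ⌈t / p.τ⌉₊ ≤ n := Nat.ceil_le.2 (by rwa [div_le_iff₀ hτ])
    exact ⟨((hmono _ _ this).1 (hfloor t)).symm, ((hmono _ _ this).2 (hfloor t)).symm⟩
  have hnhds : ∀ t, ∃ n : ℕ, t < n * p.τ := fun t => by
    obtain ⟨n, hn⟩ := exists_nat_gt (t / p.τ)
    exact ⟨n, by rwa [div_lt_iff₀ hτ] at hn⟩
  -- At each time the first curve that is valid there is read off; for `t ≤ 0` the natural ceiling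
  -- is `0`, which returns the prescribed past.
  set θ : ℝ → ℝ := fun t => (y ⌈t / p.τ⌉₊).1 t with hθd
  set φ : ℝ → ℝ := fun t => (y ⌈t / p.τ⌉₊).2 t with hφd
  have cθ : Continuous θ := by
    refine continuous_iff_continuousAt.2 fun t => ?_
    obtain ⟨n, hn⟩ := hnhds t
    exact ((hc n).1.continuousAt).congr ((eventually_lt_nhds hn).mono fun r hr => ((heq n r hr.le).1).symm)
  have cφ : Continuous φ := by
    refine continuous_iff_continuousAt.2 fun t => ?_
    obtain ⟨n, hn⟩ := hnhds t
    exact ((hc n).2.continuousAt).congr ((eventually_lt_nhds hn).mono fun r hr => ((heq n r hr.le).2).symm)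
  have hS : ∀ n : ℕ, SolvesOn G (control p θ φ) θ φ 0 (n * p.τ) := fun n =>
    (hsol n).congr (fun t ht => (heq n t ht.2).1.symm) (fun t ht => (heq n t ht.2).2.symm)
      fun t ht => control_congr (heq n _ (by linarith [ht.2])).1.symm (heq n _ (by linarith [ht.2])).2.symm
  refine ⟨θ, φ, ⟨cθ.continuousOn, cφ.continuousOn, fun t ht => ?_, fun t ht => ?_⟩, fun t ht => ?_, fun t ht => ?_⟩
  · obtain ⟨n, hn⟩ := hnhds t
    exact (hS n).pos_eq t ⟨ht, hn.le⟩
  · obtain ⟨n, hn⟩ := hnhds t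
    exact (hS n).vel_eq t ⟨ht, hn.le⟩
  · exact (heq 0 t (by simpa using ht)).1
  · exact (heq 0 t (by simpa using ht)).2

/-- A past at rest at the point of the switching line is admissible, since the line itself belongs
to the OFF region. -/
lemma exists_isForwardOrbit {G : ℝ → ℝ} (hG : IsActuation G) {p : Params} (hτ : 0 < p.τ) (x : ℝ) :
    ∃ θ φ : ℝ → ℝ, IsForwardOrbit G p x θ φ := by
  obtain ⟨θ, φ, h, e1, e2⟩ := exists_isSolution hG hτ (θ₀ := fun _ => x) (φ₀ := fun _ => p.s * x)
    continuous_const continuous_const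
  refine ⟨θ, φ, h, e1 (mem_Iic.2 le_rfl), e2 (mem_Iic.2 le_rfl), fun t ht => ?_⟩
  rw [e1 ht.2, e2 ht.2]
  simp [region]

lemma IsSolution.congr {G : ℝ → ℝ} {p : Params} (hτ : 0 < p.τ) {θ φ θ' φ' : ℝ → ℝ}
    (h : IsSolution G p θ φ) (hθ : EqOn θ θ' (Ici (-p.τ))) (hφ : EqOn φ φ' (Ici (-p.τ))) :
    IsSolution G p θ' φ' := by
  have key : ∀ t, SolvesOn G (control p θ' φ') θ' φ' 0 t := fun t =>
    (h.solvesOn t).congr (fun r hr => hθ (by simp only [mem_Ici]; linarith [hr.1]))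
      (fun r hr => hφ (by simp only [mem_Ici]; linarith [hr.1]))
      fun r hr => control_congr (hθ (by simp only [mem_Ici]; linarith [hr.1]))
        (hφ (by simp only [mem_Ici]; linarith [hr.1]))
  exact ⟨h.continuousOn_pos.congr hθ.symm, h.continuousOn_vel.congr hφ.symm,
    fun t ht => (key t).pos_eq t ⟨ht, le_rfl⟩, fun t ht => (key t).vel_eq t ⟨ht, le_rfl⟩⟩

lemma IsForwardOrbit.congr {G : ℝ → ℝ} {p : Params} (hτ : 0 < p.τ) {x : ℝ} {θ φ θ' φ' : ℝ → ℝ}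
    (h : IsForwardOrbit G p x θ φ) (hθ : EqOn θ θ' (Ici (-p.τ))) (hφ : EqOn φ φ' (Ici (-p.τ))) :
    IsForwardOrbit G p x θ' φ' := by
  have h0 : (0:ℝ) ∈ Ici (-p.τ) := by simp only [mem_Ici]; linarith
  refine ⟨h.isSolution.congr hτ hθ hφ, ?_, ?_, fun t ht => ?_⟩
  · rw [← hθ h0, h.pos_zero]
  · rw [← hφ h0, h.vel_zero]
  · rw [← hθ ht.1, ← hφ ht.1]; exact h.off_before t ht

/-- A forward orbit agrees on `[-τ, ∞)` with one that is continuous on `ℝ`. -/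
lemma IsForwardOrbit.exists_continuous {G : ℝ → ℝ} {p : Params} (hτ : 0 < p.τ) {x : ℝ}
    {θ φ : ℝ → ℝ} (h : IsForwardOrbit G p x θ φ) :
    ∃ θ' φ' : ℝ → ℝ, Continuous θ' ∧ Continuous φ' ∧ EqOn θ θ' (Ici (-p.τ)) ∧
      EqOn φ φ' (Ici (-p.τ)) ∧ IsForwardOrbit G p x θ' φ' := by
  have e : ∀ f : ℝ → ℝ, EqOn f (fun t => f (max (-p.τ) t)) (Ici (-p.τ)) := fun f t ht => by
    simp [max_eq_right (mem_Ici.1 ht)]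
  refine ⟨_, _, ?_, ?_, e θ, e φ, h.congr hτ (e θ) (e φ)⟩
  · exact h.isSolution.continuousOn_pos.comp_continuous (by fun_prop) fun t =>
      mem_Ici.2 (le_max_left _ _)
  · exact h.isSolution.continuousOn_vel.comp_continuous (by fun_prop) fun t =>
      mem_Ici.2 (le_max_left _ _)

/-- A solution of the delay equation agrees with a model solution whose forcing is the control that
the model produces. -/
lemma IsSolution.eq_model {G : ℝ → ℝ} (hG : IsActuation G) {p : Params} (hτ : 0 < p.τ)
    {θ φ θ' φ' F : ℝ → ℝ} (h : IsSolution G p θ φ) (hθ : Continuous θ) (hφ : Continuous φ)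
    (hθ' : Continuous θ') (hφ' : Continuous φ') {L : ℝ} (h' : SolvesOn G F θ' φ' 0 L)
    (hθ0 : θ 0 = θ' 0) (hφ0 : φ 0 = φ' 0) {S : Set ℝ} (hS : S.Countable)
    (hF : ∀ t ∈ Ioo 0 L \ S, (0 ≤ t - p.τ → θ (t - p.τ) = θ' (t - p.τ) ∧ φ (t - p.τ) = φ' (t - p.τ)) →
      control p θ φ t = F t) :
    ∀ t ∈ Icc 0 L, θ t = θ' t ∧ φ t = φ' t := by
  -- The hypothesis `hF` identifies the control at `t` once the curves agree at `t - τ`; induction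
  -- over intervals of length `τ` provides that agreement.
  have key : ∀ n : ℕ, ∀ t ∈ Icc 0 L, t ≤ n * p.τ → θ t = θ' t ∧ φ t = φ' t := by
    intro n
    induction n with
    | zero =>
      intro t ht htn
      have : t = 0 := le_antisymm (by simpa using htn) ht.1
      subst this
      exact ⟨hθ0, hφ0⟩
    | succ n ih =>
      intro t ht htn
      push_cast at htn
      have hFe : ∀ r ∈ Ioo 0 t \ S, control p θ φ r = F r := fun r hr =>
        hF r ⟨⟨hr.1.1, hr.1.2.trans_le ht.2⟩, hr.2⟩ fun h0 =>
          ih _ ⟨h0, by linarith [hr.1.2, ht.2]⟩ (by linarith [hr.1.2])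
      have hae : ∀ᵐ r, r ∈ Ioc 0 t → control p θ φ r = F r := by
        have h1 : ∀ᵐ r : ℝ, r ∉ S ∪ {t} :=
          compl_mem_ae_iff.2 ((hS.union (countable_singleton t)).measure_zero volume)
        filter_upwards [h1] with r hr hrt
        refine hFe r ⟨⟨hrt.1, lt_of_le_of_ne hrt.2 fun h => hr (Or.inr h)⟩, fun h => hr (Or.inl h)⟩
      obtain ⟨M, hM0, hM⟩ := exists_abs_control_le p hθ hφ 0 t
      have hi := intervalIntegrable_control p hθ hφ 0 t
      have h'' : SolvesOn G (control p θ φ) θ' φ' 0 t := by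
        refine ⟨fun r hr => h'.pos_eq r ⟨hr.1, hr.2.trans ht.2⟩, fun r hr => ?_⟩
        rw [h'.vel_eq r ⟨hr.1, hr.2.trans ht.2⟩]
        congr 1
        refine intervalIntegral.integral_congr_ae ?_
        filter_upwards [hae] with ρ hρ hρt
        rw [uIoc_of_le hr.1] at hρt
        rw [hρ ⟨hρt.1, hρt.2.trans hr.2⟩]
      -- Equal forcing and equal initial data make the Gronwall bound zero.
      have := (h.solvesOn t).abs_sub_le hG h'' hθ hφ hθ' hφ' hi hi
        (fun r hr => hM r (Ioc_subset_Icc_self hr)) hM0 ⟨ht.1, le_rfl⟩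
      simp only [hθ0, hφ0, sub_self, abs_zero, add_zero, intervalIntegral.integral_zero, zero_mul] at this
      have a1 := abs_nonneg (θ t - θ' t)
      have a2 := abs_nonneg (φ t - φ' t)
      exact ⟨sub_eq_zero.1 (abs_eq_zero.1 (by linarith)), sub_eq_zero.1 (abs_eq_zero.1 (by linarith))⟩
  intro t ht
  obtain ⟨n, hn⟩ := exists_nat_gt (t / p.τ)
  exact key n t ht (by rw [div_lt_iff₀ hτ] at hn; exact hn.le)

end Pendulum

/-! ### Bounded continuous functions of time that depend smoothly on parameters -/

/-- Bounded continuous functions of time. -/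
abbrev TimeFun : Type := BoundedContinuousFunction ℝ ℝ

namespace TimeFun

lemma norm_primitive_le (c N : ℝ) (k : TimeFun) (u : ℝ) :
    ‖∫ r in c..max c (min u N), k r‖ ≤ ‖k‖ * |N - c| := by
  refine (intervalIntegral.norm_integral_le_of_norm_le_const
    fun r _ => k.norm_coe_le_norm r).trans (mul_le_mul_of_nonneg_left ?_ (norm_nonneg _))
  rw [abs_of_nonneg (sub_nonneg.2 (le_max_left _ _))]
  rcases le_total c N with h | h
  · rw [abs_of_nonneg (sub_nonneg.2 h)]
    exact sub_le_sub_right (max_le h (min_le_right _ _)) _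
  · rw [max_eq_left ((min_le_right _ _).trans h)]; simp

/-- The primitive `u ↦ ∫_c^u k`, frozen outside `[c, N]`, as a bounded operator. -/
def integ (c N : ℝ) : TimeFun →L[ℝ] TimeFun :=
  LinearMap.mkContinuous
    { toFun := fun k => BoundedContinuousFunction.ofNormedAddCommGroup
        (fun u => ∫ r in c..max c (min u N), k r)
        ((intervalIntegral.continuous_primitive
          (fun a b => k.continuous.intervalIntegrable a b) c).comp (by fun_prop))
        (‖k‖ * |N - c|) (norm_primitive_le c N k)
      map_add' := fun k l => by
        ext u
        exact intervalIntegral.integral_add (k.continuous.intervalIntegrable _ _)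
          (l.continuous.intervalIntegrable _ _)
      map_smul' := fun a k => by
        ext u
        exact intervalIntegral.integral_const_mul a k }
    |N - c| (fun k => (BoundedContinuousFunction.norm_ofNormedAddCommGroup_le _
      (by positivity) (norm_primitive_le c N k)).trans_eq (mul_comm _ _))

lemma integ_apply (c N : ℝ) (k : TimeFun) (u : ℝ) :
    integ c N k u = ∫ r in c..max c (min u N), k r := rfl

lemma integ_of_mem {c N u : ℝ} (hu : u ∈ Icc c N) (k : TimeFun) : integ c N k u = ∫ r in c..u, k r := by
  rw [integ_apply, min_eq_left hu.2, max_eq_right hu.1]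

lemma integ_of_le {c N u : ℝ} (hu : u ≤ c) (k : TimeFun) : integ c N k u = 0 := by
  rw [integ_apply, max_eq_left ((min_le_left _ _).trans hu), intervalIntegral.integral_same]

lemma hasDerivAt_integ {c N u : ℝ} (hu : u ∈ Ioo c N) (k : TimeFun) :
    HasDerivAt (integ c N k) (k u) u := by
  refine (intervalIntegral.integral_hasDerivAt_right (k.continuous.intervalIntegrable c u)
    k.continuous.stronglyMeasurable.stronglyMeasurableAtFilter k.continuous.continuousAt).congr_of_eventuallyEq ?_
  filter_upwards [Ioo_mem_nhds hu.1 hu.2] with r hr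
  exact integ_of_mem (Ioo_subset_Icc_self hr) k

/-- Delay by one unit of time. -/
def delay : TimeFun →L[ℝ] TimeFun :=
  BoundedContinuousFunction.compContinuousCLM ℝ ℝ ⟨fun u => u - 1, by fun_prop⟩

lemma delay_apply (k : TimeFun) (u : ℝ) : delay k u = k (u - 1) := rfl

end TimeFun

open TimeFun

/-- On a finite dimensional `E`, a continuous linear map is the finite tuple of its values on a
basis, so smoothness may be checked vector by vector. -/
lemma contDiffAt_clm_apply {D E F : Type*} [NormedAddCommGroup D] [NormedSpace ℝ D]
    [NormedAddCommGroup E] [NormedSpace ℝ E] [FiniteDimensional ℝ E]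
    [NormedAddCommGroup F] [NormedSpace ℝ F] {n : WithTop ℕ∞} {f : D → E →L[ℝ] F} {x : D} 
    (h : ∀ y, ContDiffAt ℝ n (fun x => f x y) x) : ContDiffAt ℝ n f x := by
  let d := Module.finrank ℝ E
  have hd : d = Module.finrank ℝ (Fin d → ℝ) := (Module.finrank_fin_fun ℝ).symm
  let e₁ := ContinuousLinearEquiv.ofFinrankEq hd
  let e₂ := (e₁.arrowCongr (1 : F ≃L[ℝ] F)).trans (ContinuousLinearEquiv.piRing (Fin d))
  rw [← Function.id_comp f, ← e₂.symm_comp_self]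
  exact e₂.symm.contDiff.contDiffAt.comp x (contDiffAt_pi.mpr fun i => h _)

section TimeSmooth

variable {E : Type*} [NormedAddCommGroup E] [NormedSpace ℝ E]

/-- `k q` is the time derivative of `h q` on `(i, N)`, for parameters `q` near `q₀`. -/
def IsTimeDeriv (q₀ : E) (N i : ℝ) (h k : E → TimeFun) : Prop :=
  ∀ᶠ q in 𝓝 q₀, ∀ u ∈ Ioo i N, HasDerivAt (h q) (k q u) u

/-- A smooth family of time functions with `n` successive time derivatives on `(i, N)` that are
smooth families themselves. -/
def TimeSmooth (q₀ : E) (N i : ℝ) : ℕ → (E → TimeFun) → Prop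
  | 0, h => ContDiffAt ℝ (↑(⊤ : ℕ∞)) h q₀
  | n + 1, h => ContDiffAt ℝ (↑(⊤ : ℕ∞)) h q₀ ∧ ∃ k, TimeSmooth q₀ N i n k ∧ IsTimeDeriv q₀ N i h k

variable {q₀ : E} {N i : ℝ} {n : ℕ} {h k : E → TimeFun}

lemma TimeSmooth.contDiffAt (hh : TimeSmooth q₀ N i n h) : ContDiffAt ℝ (↑(⊤ : ℕ∞)) h q₀ := by
  cases n with
  | zero => exact hh
  | succ n => exact hh.1

lemma TimeSmooth.of_succ (hh : TimeSmooth q₀ N i (n + 1) h) : TimeSmooth q₀ N i n h := by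
  induction n generalizing h with
  | zero => exact hh.1
  | succ n ih =>
    obtain ⟨h1, k, hk, hd⟩ := hh
    exact ⟨h1, k, ih hk, hd⟩

lemma TimeSmooth.mono {j : ℝ} (hij : i ≤ j) (hh : TimeSmooth q₀ N i n h) : TimeSmooth q₀ N j n h := by
  induction n generalizing h with
  | zero => exact hh
  | succ n ih =>
    obtain ⟨h1, k, hk, hd⟩ := hh
    exact ⟨h1, k, ih hk, hd.mono fun q hq u hu => hq u ⟨hij.trans_lt hu.1, hu.2⟩⟩

lemma TimeSmooth.const (c : ℝ) : TimeSmooth q₀ N i n fun _ => algebraMap ℝ TimeFun c := by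
  induction n generalizing c with
  | zero => exact contDiffAt_const
  | succ n ih =>
    refine ⟨contDiffAt_const, _, ih 0, Eventually.of_forall fun q u hu => ?_⟩
    exact (hasDerivAt_const u c).congr_deriv (by simp)

lemma TimeSmooth.add (hh : TimeSmooth q₀ N i n h) (hk : TimeSmooth q₀ N i n k) :
    TimeSmooth q₀ N i n fun q => h q + k q := by
  induction n generalizing h k with
  | zero => exact ContDiffAt.add hh hk
  | succ n ih =>
    obtain ⟨h1, h', h2, h3⟩ := hh
    obtain ⟨k1, k', k2, k3⟩ := hk
    refine ⟨h1.add k1, _, ih h2 k2, ?_⟩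
    filter_upwards [h3, k3] with q a b u hu
    exact (a u hu).add (b u hu)

lemma TimeSmooth.mul (hh : TimeSmooth q₀ N i n h) (hk : TimeSmooth q₀ N i n k) :
    TimeSmooth q₀ N i n fun q => h q * k q := by
  induction n generalizing h k with
  | zero => exact ContDiffAt.mul hh hk
  | succ n ih =>
    have hh' := hh.of_succ
    have hk' := hk.of_succ
    obtain ⟨h1, h', h2, h3⟩ := hh
    obtain ⟨k1, k', k2, k3⟩ := hk
    refine ⟨h1.mul k1, _, (ih h2 hk').add (ih hh' k2), ?_⟩
    filter_upwards [h3, k3] with q a b u hu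
    exact (a u hu).mul (b u hu)

lemma TimeSmooth.smul {c : E → ℝ} (hc : ContDiffAt ℝ (↑(⊤ : ℕ∞)) c q₀) (hh : TimeSmooth q₀ N i n h) :
    TimeSmooth q₀ N i n fun q => c q • h q := by
  induction n generalizing h with
  | zero => exact ContDiffAt.smul hc hh
  | succ n ih =>
    obtain ⟨h1, h', h2, h3⟩ := hh
    refine ⟨hc.smul h1, _, ih h2, ?_⟩
    filter_upwards [h3] with q a u hu
    exact (a u hu).const_smul (c q)

lemma TimeSmooth.congr (hh : TimeSmooth q₀ N i n h) (hk : ∀ᶠ q in 𝓝 q₀, k q = h q) :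
    TimeSmooth q₀ N i n k := by
  cases n with
  | zero => exact ContDiffAt.congr_of_eventuallyEq hh hk
  | succ n =>
    obtain ⟨h1, h', h2, h3⟩ := hh
    refine ⟨h1.congr_of_eventuallyEq hk, h', h2, ?_⟩
    filter_upwards [h3, hk] with q a b
    rwa [b]

lemma TimeSmooth.neg (hh : TimeSmooth q₀ N i n h) : TimeSmooth q₀ N i n fun q => - h q :=
  (hh.smul (c := fun _ => (-1 : ℝ)) contDiffAt_const).congr
    (Eventually.of_forall fun q => (neg_one_smul ℝ (h q)).symm)

lemma TimeSmooth.sub (hh : TimeSmooth q₀ N i n h) (hk : TimeSmooth q₀ N i n k) :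
    TimeSmooth q₀ N i n fun q => h q - k q := by
  simpa [sub_eq_add_neg] using hh.add hk.neg

/-- Integration gains one time derivative, whereas `delay` only moves the left end of the interval
by one. Iterating both in the integral equations shows that solutions become smoother with each
elapsed delay. -/
lemma TimeSmooth.integ_succ {c : ℝ} (hc : c ≤ i) (hh : TimeSmooth q₀ N i n h) :
    TimeSmooth q₀ N i (n + 1) fun q => integ c N (h q) := by
  refine ⟨(integ c N).contDiff.contDiffAt.comp q₀ hh.contDiffAt, h, hh,
    Eventually.of_forall fun q u hu => hasDerivAt_integ ⟨hc.trans_lt hu.1, hu.2⟩ _⟩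

lemma TimeSmooth.delay (hh : TimeSmooth q₀ N i n h) :
    TimeSmooth q₀ N (i + 1) n fun q => delay (h q) := by
  induction n generalizing h with
  | zero => exact (TimeFun.delay).contDiff.contDiffAt.comp q₀ hh
  | succ n ih =>
    obtain ⟨h1, h', h2, h3⟩ := hh
    refine ⟨(TimeFun.delay).contDiff.contDiffAt.comp q₀ h1, _, ih h2, ?_⟩
    filter_upwards [h3] with q a u hu
    exact (a (u - 1) ⟨by linarith [hu.1], by linarith [hu.2]⟩).comp_sub_const u 1

set_option linter.unusedSectionVars false in
lemma IsTimeDeriv.eventually_eq (hd : IsTimeDeriv q₀ N i h k) :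
    ∀ᶠ q in 𝓝 q₀, ∀ u ∈ Ioo i N, ∀ u' ∈ Ioo i N, u' ≤ u → h q u = h q u' + integ u' N (k q) u := by
  filter_upwards [hd] with q hq u hu u' hu' hle
  rw [integ_of_mem ⟨hle, hu.2.le⟩, intervalIntegral.integral_eq_sub_of_hasDerivAt (f := h q)]
  · ring
  · intro r hr
    rw [uIcc_of_le hle] at hr
    exact hq r ⟨hu'.1.trans_le hr.1, hr.2.trans_lt hu.2⟩
  · exact (k q).continuous.intervalIntegrable _ _

/-- Parameter and time derivatives commute: the integrated relation between `h` and `k` is expressed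
by bounded linear operators, so it may be differentiated in the parameter and then in time. -/
lemma IsTimeDeriv.fderiv_apply (hd : IsTimeDeriv q₀ N i h k) (hh : ContDiffAt ℝ (↑(⊤ : ℕ∞)) h q₀)
    (hk : ContDiffAt ℝ (↑(⊤ : ℕ∞)) k q₀) (e : E) :
    IsTimeDeriv q₀ N i (fun q => fderiv ℝ h q e) (fun q => fderiv ℝ k q e) := by
  have one : (1 : WithTop ℕ∞) ≤ (↑(⊤ : ℕ∞)) := by exact_mod_cast le_top
  have e1 : ∀ᶠ q in 𝓝 q₀, DifferentiableAt ℝ h q :=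
    ((hh.of_le one).eventually (by simp)).mono fun q hq => hq.differentiableAt (by simp)
  have e2 : ∀ᶠ q in 𝓝 q₀, DifferentiableAt ℝ k q :=
    ((hk.of_le one).eventually (by simp)).mono fun q hq => hq.differentiableAt (by simp)
  filter_upwards [hd.eventually_eq.eventually_nhds, e1, e2] with q hq h1 h2 u hu
  obtain ⟨u', hu'⟩ := exists_between hu.1
  have key : ∀ r ∈ Ioo i N, u' ≤ r →
      fderiv ℝ h q e r = fderiv ℝ h q e u' + TimeFun.integ u' N (fderiv ℝ k q e) r := by
    intro r hr hur
    let ev := fun r => BoundedContinuousFunction.evalCLM ℝ (α := ℝ) (β := ℝ) r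
    have d1 : HasFDerivAt (fun q => h q r) ((ev r).comp (fderiv ℝ h q)) q :=
      (ev r).hasFDerivAt.comp q h1.hasFDerivAt
    have d2 : HasFDerivAt (fun q => h q u' + TimeFun.integ u' N (k q) r)
        ((ev u').comp (fderiv ℝ h q) +
          ((ev r).comp (TimeFun.integ u' N)).comp (fderiv ℝ k q)) q :=
      ((ev u').hasFDerivAt.comp q h1.hasFDerivAt).add
        (((ev r).comp (TimeFun.integ u' N)).hasFDerivAt.comp q h2.hasFDerivAt)
    have := d1.unique (d2.congr_of_eventuallyEq (hq.mono fun q' hq' =>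
      hq' r hr u' ⟨hu'.1, hu'.2.trans hu.2⟩ hur))
    exact congrArg (fun L : E →L[ℝ] ℝ => L e) this
  have hder := (hasDerivAt_integ (c := u') (N := N) ⟨hu'.2, hu.2⟩ (fderiv ℝ k q e)).const_add
    (fderiv ℝ h q e u')
  refine hder.congr_of_eventuallyEq ?_
  filter_upwards [Ioo_mem_nhds hu'.2 hu.2] with r hr
  exact key r ⟨hu'.1.trans hr.1, hr.2⟩ hr.1.le

lemma contDiffAt_fderiv_apply {F : Type*} [NormedAddCommGroup F] [NormedSpace ℝ F] {h : E → F}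
    (hh : ContDiffAt ℝ (↑(⊤ : ℕ∞)) h q₀) (e : E) :
    ContDiffAt ℝ (↑(⊤ : ℕ∞)) (fun q => fderiv ℝ h q e) q₀ :=
  ContDiffAt.clm_apply (hh.fderiv_right (m := (↑(⊤ : ℕ∞))) (by exact_mod_cast le_top)) contDiffAt_const

lemma TimeSmooth.fderiv_apply (hh : TimeSmooth q₀ N i n h) (e : E) :
    TimeSmooth q₀ N i n fun q => fderiv ℝ h q e := by
  induction n generalizing h with
  | zero => exact contDiffAt_fderiv_apply hh e
  | succ n ih =>
    obtain ⟨h1, h', h2, h3⟩ := hh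
    exact ⟨contDiffAt_fderiv_apply h1 e, _, ih h2, h3.fderiv_apply h1 h2.contDiffAt e⟩

/-- Joint smoothness of the evaluation `(q, u) ↦ h q u`. -/
theorem TimeSmooth.contDiffAt_eval [FiniteDimensional ℝ E] (hh : TimeSmooth q₀ N i n h) {u₀ : ℝ}
    (hu₀ : u₀ ∈ Ioo i N) : ContDiffAt ℝ n (fun x : E × ℝ => h x.1 x.2) (q₀, u₀) := by
  have cont : ∀ {h : E → TimeFun} {x : E × ℝ}, ContinuousAt h x.1 →
      ContinuousAt (fun x : E × ℝ => h x.1 x.2) x := by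
    intro h x hx
    have : ContinuousAt (fun x : E × ℝ => (h x.1, x.2)) x :=
      (ContinuousAt.comp (f := Prod.fst) hx continuousAt_fst).prodMk continuousAt_snd
    exact (continuous_eval (F := TimeFun) (X := ℝ) (Y := ℝ)).continuousAt.comp this
  have ev2 : ∀ {h : E → TimeFun}, ContDiffAt ℝ (↑(⊤ : ℕ∞)) h q₀ →
      ∀ᶠ q in 𝓝 q₀, ContDiffAt ℝ 2 h q := fun hh =>
    (hh.of_le (m := 2) (WithTop.coe_le_coe.2 (le_top : (2 : ℕ∞) ≤ ⊤))).eventually (by simp)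
  induction n generalizing h with
  | zero =>
    rw [Nat.cast_zero, contDiffAt_zero]
    have h' := (ev2 hh.contDiffAt)
    refine ⟨{x | ContDiffAt ℝ 2 h x.1}, continuous_fst.continuousAt.eventually h', fun x hx => ?_⟩
    exact (cont (ContDiffAt.continuousAt (𝕜 := ℝ) (n := 2) hx)).continuousWithinAt
  | succ n ih =>
    obtain ⟨h1, k, h2, h3⟩ := hh
    -- Both partial derivatives of the evaluation are evaluations of families one order lower, the
    -- parameter derivative of `h` and the time derivative `k`; this drives the induction.
    have hfd : ∀ e, TimeSmooth q₀ N i n fun q => fderiv ℝ h q e := fun e =>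
      TimeSmooth.fderiv_apply (of_succ ⟨h1, k, h2, h3⟩) e
    let f₁ : E → ℝ → E →L[ℝ] ℝ := fun q u =>
      (BoundedContinuousFunction.evalCLM ℝ (α := ℝ) (β := ℝ) u).comp (fderiv ℝ h q)
    let f₂ : E → ℝ → ℝ →L[ℝ] ℝ := fun q u => ContinuousLinearMap.toSpanSingleton ℝ (k q u)
    rw [Nat.cast_add, Nat.cast_one, contDiffAt_succ_iff_hasFDerivAt]
    refine ⟨fun x => (f₁ x.1 x.2).coprod (f₂ x.1 x.2), ?_, ?_⟩
    · rw [← eventually_iff_exists_mem]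
      have hq : ∀ᶠ x : E × ℝ in 𝓝 (q₀, u₀), (ContDiffAt ℝ 2 h x.1 ∧ ContDiffAt ℝ 2 k x.1 ∧
          ∀ u ∈ Ioo i N, HasDerivAt (h x.1) (k x.1 u) u) :=
        (continuousAt_fst : Tendsto Prod.fst (𝓝 (q₀, u₀)) (𝓝 q₀)).eventually
          ((ev2 h1).and ((ev2 h2.contDiffAt).and h3))
      have hu : ∀ᶠ x : E × ℝ in 𝓝 (q₀, u₀), x.2 ∈ Ioo i N :=
        continuous_snd.continuousAt.eventually (Ioo_mem_nhds hu₀.1 hu₀.2)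
      filter_upwards [hq, hq.eventually_nhds, hu.eventually_nhds] with x hx hx' hxu'
      refine (hasStrictFDerivAt_uncurry_coprod (f := fun q u => h q u) (f₁ := f₁) (f₂ := f₂)
        (hx'.mono fun y hy => ?_) ?_ ?_ ?_).hasFDerivAt
      · exact (BoundedContinuousFunction.evalCLM ℝ (α := ℝ) (β := ℝ) y.2).hasFDerivAt.comp y.1
          (hy.1.differentiableAt (by simp)).hasFDerivAt
      · filter_upwards [hx', hxu'] with y hy hyu
        exact (hy.2.2 y.2 hyu).hasFDerivAt
      · rw [continuousAt_clm_apply]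
        intro e
        have := ((hx.1.fderiv_right (m := 1) (by norm_num)).continuousAt).clm_apply
          (continuousAt_const (y := e))
        exact cont this
      · rw [continuousAt_clm_apply]
        intro e
        have h5 := (cont hx.2.1.continuousAt).const_mul e
        simpa [f₂, Function.HasUncurry.uncurry] using h5
    · refine contDiffAt_clm_apply fun e => ?_
      have a1 := ih (hfd e.1)
      have a2 := ih h2
      have : (fun x : E × ℝ => ((f₁ x.1 x.2).coprod (f₂ x.1 x.2)) e) =
          fun x : E × ℝ => fderiv ℝ h x.1 e.1 x.2 + e.2 * k x.1 x.2 := by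
        funext x; simp [f₁, f₂]
      rw [this]
      exact a1.add (contDiffAt_const.mul a2)

end TimeSmooth

/-! ### The entire functions `cos √z` and `sin √z / √z` -/

section Entire

/-- Taylor coefficients of `cos √z` (`k = 0`) and `sin √z / √z` (`k = 1`). -/
def trigCoeff (k n : ℕ) : ℝ := (-1) ^ n / (2 * n + k).factorial

/-- `cos √z` for `k = 0` and `sin √z / √z` for `k = 1`. -/
def trigSqrt (k : ℕ) (z : ℝ) : ℝ := FormalMultilinearSeries.ofScalarsSum (trigCoeff k) z

/-- Quotients of consecutive coefficients are at most `1 / (n + 1)`, so the series converges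
everywhere. Smoothness at `z = 0` is what makes the squared amplitude a regular parameter. -/
lemma hasFPowerSeriesOnBall_trigSqrt (k : ℕ) : HasFPowerSeriesOnBall (trigSqrt k)
    (FormalMultilinearSeries.ofScalars ℝ (trigCoeff k)) 0 ⊤ := by
  have hr : (FormalMultilinearSeries.ofScalars ℝ (trigCoeff k)).radius = ⊤ := by
    refine FormalMultilinearSeries.ofScalars_radius_eq_top_of_tendsto _ _
      (Eventually.of_forall fun n => ?_) ?_
    · unfold trigCoeff; positivity
    · have h0 : ∀ n : ℕ, ‖trigCoeff k n.succ‖ / ‖trigCoeff k n‖ ≤ 1 / ((n : ℝ) + 1) := by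
        intro n
        simp only [trigCoeff, norm_div, norm_pow, norm_neg, norm_one, one_pow, Real.norm_natCast]
        rw [div_div_eq_mul_div, div_one, one_div_mul_eq_div,
          show 2 * n.succ + k = (2 * n + k + 1) + 1 by rw [Nat.succ_eq_add_one]; ring,
          Nat.factorial_succ, Nat.factorial_succ]
        push_cast
        rw [div_le_div_iff₀ (by positivity) (by positivity)]
        have : (0:ℝ) < (2 * n + k).factorial := by positivity
        nlinarith [mul_nonneg (Nat.cast_nonneg (α := ℝ) n) (Nat.cast_nonneg (α := ℝ) k),
          Nat.cast_nonneg (α := ℝ) n, Nat.cast_nonneg (α := ℝ) k, mul_pos this this,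
          mul_nonneg this.le (Nat.cast_nonneg (α := ℝ) n),
          mul_nonneg this.le (Nat.cast_nonneg (α := ℝ) k),
          mul_nonneg this.le (sq_nonneg ((2 * n + k : ℝ)))]
      exact squeeze_zero (fun n => by positivity) h0 tendsto_one_div_add_atTop_nhds_zero_nat
  have := (FormalMultilinearSeries.ofScalars ℝ (trigCoeff k)).hasFPowerSeriesOnBall (by rw [hr]; exact ENNReal.zero_lt_top)
  rwa [hr] at this

lemma contDiff_trigSqrt (k : ℕ) {n : WithTop ℕ∞} : ContDiff ℝ n (trigSqrt k) := by
  rw [contDiff_iff_contDiffAt]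
  intro z
  exact ((hasFPowerSeriesOnBall_trigSqrt k).analyticAt_of_mem (by simp)).contDiffAt

lemma hasDerivAt_trigSqrt_zero (k : ℕ) : HasDerivAt (trigSqrt k) (trigCoeff k 1) 0 := by
  have := (hasFPowerSeriesOnBall_trigSqrt k).hasFPowerSeriesAt.hasDerivAt
  simpa [FormalMultilinearSeries.ofScalars] using this

lemma trigSqrt_eq_tsum (k : ℕ) (z : ℝ) : trigSqrt k z = ∑' n, trigCoeff k n * z ^ n := by
  simp [trigSqrt, FormalMultilinearSeries.ofScalarsSum_eq_tsum]

lemma trigSqrt_zero_right (k : ℕ) : trigSqrt k 0 = 1 / k.factorial := by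
  simp [trigSqrt, FormalMultilinearSeries.ofScalarsSum_zero, trigCoeff]

lemma trigSqrt_zero_sq (x : ℝ) : trigSqrt 0 (x ^ 2) = Real.cos x := by
  rw [trigSqrt_eq_tsum, ← (Real.hasSum_cos x).tsum_eq]
  refine tsum_congr fun n => ?_
  rw [trigCoeff, ← pow_mul, add_zero]; ring

lemma mul_trigSqrt_one_sq (x : ℝ) : x * trigSqrt 1 (x ^ 2) = Real.sin x := by
  rw [trigSqrt_eq_tsum, ← (Real.hasSum_sin x).tsum_eq, ← tsum_mul_left]
  refine tsum_congr fun n => ?_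
  rw [trigCoeff, ← pow_mul]; ring

end Entire

/-! ### The rescaled system with the control switched on for good -/

namespace Params

variable {n : WithTop ℕ∞}

@[fun_prop] lemma contDiff_a : ContDiff ℝ n Params.a := contDiff_fst
@[fun_prop] lemma contDiff_b : ContDiff ℝ n Params.b := contDiff_fst.comp contDiff_snd
@[fun_prop] lemma contDiff_s : ContDiff ℝ n Params.s :=
  contDiff_fst.comp (contDiff_snd.comp contDiff_snd)
@[fun_prop] lemma contDiff_τ : ContDiff ℝ n Params.τ :=
  contDiff_snd.comp (contDiff_snd.comp contDiff_snd)

end Params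

namespace Pendulum

open TimeFun

/-- rescaled velocity -/
def vel (q : Params × ℝ) (ϑ w : TimeFun) : TimeFun := q.1.s • ϑ + q.1.τ • w

/-- minus the rescaled feedback -/
def feedback (q : Params × ℝ) (ϑ w : TimeFun) : TimeFun :=
  delay (q.1.a • ϑ + q.1.b • vel q ϑ w)

/-- the actuation, `1` for `e = 0` and `cos` for `e = 1` -/
def act (e : ℝ) (κ : TimeFun) : TimeFun := 1 + e • (κ - 1)

/-- The rescaled system: `ϑ` is the position, `σ` and `κ` are the (rescaled) sine and cosine of the
position, and `w` is the (rescaled) distance from the switching line. The unscaled amplitude is the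
square root of `q.2`. -/
structure IsOnCurve (e N : ℝ) (q : Params × ℝ) (ϑ σ κ w : TimeFun) : Prop where
  pos : ϑ = 1 + q.1.τ • integ 0 N (vel q ϑ w)
  sin : σ = algebraMap ℝ TimeFun (trigSqrt 1 q.2) + q.1.τ • integ 0 N (κ * vel q ϑ w)
  cos : κ = algebraMap ℝ TimeFun (trigSqrt 0 q.2) - (q.2 * q.1.τ) • integ 0 N (σ * vel q ϑ w)
  dev : w = integ 0 N σ - q.1.s • integ 0 N (vel q ϑ w) - integ 1 N (feedback q ϑ w * act e κ)

/-- A smooth family of solutions of the rescaled system. -/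
structure IsOnFamily (e N : ℝ) (q₀ : Params × ℝ) (ϑ σ κ w : Params × ℝ → TimeFun) : Prop where
  pos : ContDiffAt ℝ (↑(⊤ : ℕ∞)) ϑ q₀
  sin : ContDiffAt ℝ (↑(⊤ : ℕ∞)) σ q₀
  cos : ContDiffAt ℝ (↑(⊤ : ℕ∞)) κ q₀
  dev : ContDiffAt ℝ (↑(⊤ : ℕ∞)) w q₀
  eq : ∀ᶠ q in 𝓝 q₀, IsOnCurve e N q (ϑ q) (σ q) (κ q) (w q)

/-- The defect of a tuple `((ϑ, σ, κ), w)` in the rescaled system. -/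
def onDefect (e N : ℝ) (x : (Params × ℝ) × ((TimeFun × TimeFun × TimeFun) × TimeFun)) :
    (TimeFun × TimeFun × TimeFun) × TimeFun :=
  ((x.2.1.1 - (1 + x.1.1.τ • integ 0 N (vel x.1 x.2.1.1 x.2.2)),
    x.2.1.2.1 - (algebraMap ℝ TimeFun (trigSqrt 1 x.1.2) +
      x.1.1.τ • integ 0 N (x.2.1.2.2 * vel x.1 x.2.1.1 x.2.2)),
    x.2.1.2.2 - (algebraMap ℝ TimeFun (trigSqrt 0 x.1.2) -
      (x.1.2 * x.1.1.τ) • integ 0 N (x.2.1.2.1 * vel x.1 x.2.1.1 x.2.2))),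
    x.2.2 - (integ 0 N x.2.1.2.1 - x.1.1.s • integ 0 N (vel x.1 x.2.1.1 x.2.2)
      - integ 1 N (feedback x.1 x.2.1.1 x.2.2 * act e x.2.1.2.2)))

lemma contDiff_onDefect (e N : ℝ) : ContDiff ℝ (↑(⊤ : ℕ∞)) (onDefect e N) := by
  have hC : ∀ k, ContDiff ℝ (↑(⊤ : ℕ∞)) fun x : (Params × ℝ) × ((TimeFun × TimeFun × TimeFun) × TimeFun) =>
      algebraMap ℝ TimeFun (trigSqrt k x.1.2) := fun k => by
    have h1 : ContDiff ℝ (↑(⊤ : ℕ∞)) (algebraMap ℝ TimeFun) :=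
      (Algebra.linearMap ℝ TimeFun).toContinuousLinearMap.contDiff
    exact h1.comp ((contDiff_trigSqrt k).comp (by fun_prop))
  have h0 := hC 0
  have h1 := hC 1
  unfold onDefect feedback act vel
  fun_prop

/-- The base point: no delay, no slope, zero amplitude. -/
def basePoint (a₀ b₀ : ℝ) : Params × ℝ := ((a₀, b₀, 0, 0), 0)

/-- Implicit function theorem at zero delay, slope and amplitude, where the first three equations
are trivial because their integrals carry the factor `τ`. The linearization is then triangular with
identity blocks, hence invertible without any condition on `a₀`. The final clause, local uniqueness,
allows families with different `e` to be compared at amplitude zero. -/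
lemma exists_onFamily (e N a₀ b₀ : ℝ) :
    ∃ ϑ σ κ w, IsOnFamily e N (basePoint a₀ b₀) ϑ σ κ w ∧
      ϑ (basePoint a₀ b₀) = 1 ∧ σ (basePoint a₀ b₀) = 1 ∧ κ (basePoint a₀ b₀) = 1 ∧
      w (basePoint a₀ b₀) = integ 0 N 1 - a₀ • integ 1 N 1 ∧
      ∀ᶠ x in 𝓝 (basePoint a₀ b₀, (((1, 1, 1), integ 0 N 1 - a₀ • integ 1 N 1) :
        (TimeFun × TimeFun × TimeFun) × TimeFun)),
        IsOnCurve e N x.1 x.2.1.1 x.2.1.2.1 x.2.1.2.2 x.2.2 →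
          (((ϑ x.1, σ x.1, κ x.1), w x.1) : (TimeFun × TimeFun × TimeFun) × TimeFun) = x.2 := by
  set q₀ := basePoint a₀ b₀ with hq₀
  have hda : delay (1 : TimeFun) = 1 := rfl
  set w₀ : TimeFun := integ 0 N 1 - a₀ • integ 1 N 1 with hw₀
  set y₀ : (TimeFun × TimeFun × TimeFun) × TimeFun := ((1, 1, 1), w₀) with hy₀
  set u₀ := (q₀, y₀) with hu₀
  have hs : q₀.1.s = 0 := rfl
  have hτ : q₀.1.τ = 0 := rfl
  have ha : q₀.1.a = a₀ := rfl
  have hz : q₀.2 = 0 := rfl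
  have hpart : ∀ y, onDefect e N (q₀, y) = ((y.1.1 - 1, y.1.2.1 - 1, y.1.2.2 - 1),
      y.2 - (integ 0 N y.1.2.1 - integ 1 N (delay (a₀ • y.1.1) * act e y.1.2.2))) := by
    intro y
    simp [onDefect, hs, hτ, hz, ha, vel, feedback, trigSqrt_zero_right]
  have hzero : onDefect e N u₀ = 0 := by
    rw [hu₀, hpart]
    simp [hy₀, act, hw₀, map_smul, hda]
  let P := TimeFun × TimeFun × TimeFun
  -- `Λ` is the derivative of the `w`-equation in the other unknowns; `e` enters through the
  -- derivative of the actuation at `κ = 1`.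
  let Λ : P →L[ℝ] TimeFun := -((integ 0 N).comp ((ContinuousLinearMap.fst ℝ TimeFun TimeFun).comp
      (ContinuousLinearMap.snd ℝ TimeFun (TimeFun × TimeFun)))) +
    (integ 1 N).comp (a₀ • (delay.comp (ContinuousLinearMap.fst ℝ TimeFun (TimeFun × TimeFun))) +
      (a₀ * e) • ((ContinuousLinearMap.snd ℝ TimeFun TimeFun).comp
        (ContinuousLinearMap.snd ℝ TimeFun (TimeFun × TimeFun))))
  let D : (P × TimeFun) ≃L[ℝ] (P × TimeFun) :=
    (ContinuousLinearEquiv.refl ℝ P).skewProd (ContinuousLinearEquiv.refl ℝ TimeFun) Λ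
  have hsm : ContDiffAt ℝ (↑(⊤ : ℕ∞)) (onDefect e N) u₀ := (contDiff_onDefect e N).contDiffAt
  have hn0 : ((↑(⊤ : ℕ∞)) : WithTop ℕ∞) ≠ 0 := by simp
  have hfd : HasFDerivAt (fun y => onDefect e N (q₀, y)) (D : (P × TimeFun) →L[ℝ] (P × TimeFun)) y₀ := by
    simp only [hpart]
    have f1 : HasFDerivAt (fun y : P × TimeFun => delay (a₀ • y.1.1))
        (a₀ • delay.comp ((ContinuousLinearMap.fst ℝ TimeFun (TimeFun × TimeFun)).comp
          (ContinuousLinearMap.fst ℝ P TimeFun))) y₀ := by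
      simp only [map_smul]
      exact (a₀ • delay.comp ((ContinuousLinearMap.fst ℝ TimeFun (TimeFun × TimeFun)).comp
          (ContinuousLinearMap.fst ℝ P TimeFun))).hasFDerivAt
    have f2 : HasFDerivAt (fun y : P × TimeFun => act e y.1.2.2)
        (e • ((ContinuousLinearMap.snd ℝ TimeFun TimeFun).comp
        ((ContinuousLinearMap.snd ℝ TimeFun (TimeFun × TimeFun)).comp
          (ContinuousLinearMap.fst ℝ P TimeFun)))) y₀ :=
      ((((ContinuousLinearMap.snd ℝ TimeFun TimeFun).comp
        ((ContinuousLinearMap.snd ℝ TimeFun (TimeFun × TimeFun)).comp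
          (ContinuousLinearMap.fst ℝ P TimeFun))).hasFDerivAt.sub_const 1).const_smul e).const_add 1
    have f3 := ((integ 1 N).hasFDerivAt).comp y₀ (f1.mul f2)
    have f4 := ((integ 0 N).comp ((ContinuousLinearMap.fst ℝ TimeFun TimeFun).comp
        ((ContinuousLinearMap.snd ℝ TimeFun (TimeFun × TimeFun)).comp
          (ContinuousLinearMap.fst ℝ P TimeFun)))).hasFDerivAt (x := y₀)
    have f5 := (ContinuousLinearMap.snd ℝ P TimeFun).hasFDerivAt (x := y₀)
    have f6 : HasFDerivAt (fun y : P × TimeFun => (y.1.1 - 1, y.1.2.1 - 1, y.1.2.2 - 1))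
        (ContinuousLinearMap.fst ℝ P TimeFun) y₀ := by
      have : (fun y : P × TimeFun => (y.1.1 - 1, y.1.2.1 - 1, y.1.2.2 - 1)) = fun y => y.1 - (1 : P) := rfl
      rw [this]
      exact (ContinuousLinearMap.fst ℝ P TimeFun).hasFDerivAt.sub_const 1
    refine (f6.prodMk (f5.sub (f4.sub f3))).congr_fderiv ?_
    refine ContinuousLinearMap.ext fun y => ?_
    refine Prod.ext rfl ?_
    simp [D, Λ, hy₀, act, hda]
    change y.2 - (integ 0 N y.1.2.1 - (a₀ • e • integ 1 N y.1.2.2 + a₀ • integ 1 N (delay y.1.1))) =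
      y.2 + (-integ 0 N y.1.2.1 + (a₀ • integ 1 N (delay y.1.1) + (a₀ * e) • integ 1 N y.1.2.2))
    rw [mul_smul]
    abel
  have hinv : (fderiv ℝ (onDefect e N) u₀ ∘L .inr ℝ (Params × ℝ) (P × TimeFun)).IsInvertible := by
    refine ⟨D, ?_⟩
    have h1 : HasFDerivAt (fun y : P × TimeFun => (q₀, y)) (ContinuousLinearMap.inr ℝ (Params × ℝ) (P × TimeFun)) y₀ :=
      (hasFDerivAt_const q₀ y₀).prodMk (hasFDerivAt_id y₀)
    have h2 := ((hsm.differentiableAt hn0).hasFDerivAt).comp y₀ h1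
    exact hfd.unique h2
  set Y := hsm.implicitFunction hn0 hinv
  have hYs : ContDiffAt ℝ (↑(⊤ : ℕ∞)) Y q₀ := hsm.contDiffAt_implicitFunction hn0 hinv
  have hY0 : Y q₀ = y₀ := hsm.implicitFunction_apply_self hn0 hinv
  have hYe : ∀ᶠ q in 𝓝 q₀, onDefect e N (q, Y q) = onDefect e N u₀ :=
    hsm.eventually_apply_implicitFunction hn0 hinv
  refine ⟨fun q => (Y q).1.1, fun q => (Y q).1.2.1, fun q => (Y q).1.2.2, fun q => (Y q).2,
    ⟨hYs.fst.fst, hYs.fst.snd.fst, hYs.fst.snd.snd, hYs.snd, ?_⟩, ?_, ?_, ?_, ?_, ?_⟩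
  · filter_upwards [hYe] with q hq
    rw [hzero] at hq
    simp only [onDefect, Prod.mk_eq_zero, sub_eq_zero] at hq
    exact ⟨hq.1.1, hq.1.2.1, hq.1.2.2, hq.2⟩
  · simp only [hY0, hy₀]
  · simp only [hY0, hy₀]
  · simp only [hY0, hy₀]
  · simp only [hY0, hy₀]
  · filter_upwards [hsm.eventually_apply_eq_iff_implicitFunction hn0 hinv] with x hx hc
    refine hx.1 ?_
    rw [hzero]
    simp only [onDefect, Prod.mk_eq_zero, sub_eq_zero]
    exact ⟨⟨hc.pos, hc.sin, hc.cos⟩, hc.dev⟩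

end Pendulum

/-! ### Orders of vanishing in two small quantities -/

section Order

variable {X V W : Type*} [AddCommGroup V] [Module ℝ V] [AddCommGroup W] [Module ℝ W]

/-- Functions that are, along `l`, homogeneous polynomials of degree `k` in `s` and `τ` with
coefficients in the class `C`. -/
def OrderClass (s τ : X → ℝ) (l : Filter X) (C : Set (X → V)) : ℕ → Set (X → V)
  | 0 => C
  | k + 1 => {h | ∃ f ∈ OrderClass s τ l C k, ∃ g ∈ OrderClass s τ l C k,
      ∀ᶠ x in l, h x = s x • f x + τ x • g x}

/-- A class of functions that is closed under sums and under changes off the filter. -/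
structure IsModuleClass (l : Filter X) (C : Set (X → V)) : Prop where
  zero : (fun _ => 0) ∈ C
  add : ∀ {f g}, f ∈ C → g ∈ C → (fun x => f x + g x) ∈ C
  neg : ∀ {f}, f ∈ C → (fun x => - f x) ∈ C
  congr : ∀ {f g}, f ∈ C → (∀ᶠ x in l, g x = f x) → g ∈ C

variable {s τ : X → ℝ} {l : Filter X} {C : Set (X → V)} {D : Set (X → W)}

lemma IsModuleClass.orderClass (hC : IsModuleClass l C) (k : ℕ) :
    IsModuleClass l (OrderClass s τ l C k) := by
  induction k with
  | zero => exact hC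
  | succ k ih =>
    refine ⟨⟨_, ih.zero, _, ih.zero, Eventually.of_forall fun x => by simp⟩, ?_, ?_, ?_⟩
    · rintro f g ⟨f1, h1, f2, h2, h3⟩ ⟨g1, k1, g2, k2, k3⟩
      refine ⟨_, ih.add h1 k1, _, ih.add h2 k2, ?_⟩
      filter_upwards [h3, k3] with x a b
      rw [a, b]; module
    · rintro f ⟨f1, h1, f2, h2, h3⟩
      refine ⟨_, ih.neg h1, _, ih.neg h2, ?_⟩
      filter_upwards [h3] with x a
      rw [a]; module
    · rintro f g ⟨f1, h1, f2, h2, h3⟩ h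
      refine ⟨f1, h1, f2, h2, ?_⟩
      filter_upwards [h3, h] with x a b
      rw [b, a]

set_option linter.unusedSectionVars false in
lemma IsModuleClass.sub (hC : IsModuleClass l C) {f g : X → V} (hf : f ∈ C) (hg : g ∈ C) :
    (fun x => f x - g x) ∈ C := by
  simpa only [sub_eq_add_neg] using hC.add hf (hC.neg hg)

lemma IsModuleClass.smul_left (hC : IsModuleClass l C) {k : ℕ} {f : X → V}
    (hf : f ∈ OrderClass s τ l C k) : (fun x => s x • f x) ∈ OrderClass s τ l C (k + 1) :=
  ⟨f, hf, _, (hC.orderClass k).zero, Eventually.of_forall fun x => by simp⟩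

lemma IsModuleClass.smul_right (hC : IsModuleClass l C) {k : ℕ} {f : X → V}
    (hf : f ∈ OrderClass s τ l C k) : (fun x => τ x • f x) ∈ OrderClass s τ l C (k + 1) :=
  ⟨_, (hC.orderClass k).zero, f, hf, Eventually.of_forall fun x => by simp⟩

/-- A linear operation acts on the coefficients and leaves the powers of `s` and `τ` alone. It may
vary with the point, as does evaluation at the crossing time, and the filter may shrink. -/
lemma OrderClass.map {l' : Filter X} (hl : l' ≤ l) (T : X → V → W)
    (hadd : ∀ x u v, T x (u + v) = T x u + T x v) (hsmul : ∀ x (c : ℝ) u, T x (c • u) = c • T x u)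
    {k : ℕ} (hT : ∀ f ∈ C, (fun x => T x (f x)) ∈ D) {f : X → V} (hf : f ∈ OrderClass s τ l C k) :
    (fun x => T x (f x)) ∈ OrderClass s τ l' D k := by
  induction k generalizing f with
  | zero => exact hT f hf
  | succ k ih =>
    obtain ⟨f1, h1, f2, h2, h3⟩ := hf
    refine ⟨_, ih h1, _, ih h2, ?_⟩
    filter_upwards [hl h3] with x a
    rw [a, hadd, hsmul, hsmul]

lemma IsModuleClass.order_le (hC : IsModuleClass l C) (hs : ∀ f ∈ C, (fun x => s x • f x) ∈ C)
    (hτ : ∀ f ∈ C, (fun x => τ x • f x) ∈ C) {k : ℕ} {f : X → V}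
    (hf : f ∈ OrderClass s τ l C (k + 1)) : f ∈ OrderClass s τ l C k := by
  obtain ⟨f1, h1, f2, h2, h3⟩ := hf
  refine (hC.orderClass k).congr ((hC.orderClass k).add
    (OrderClass.map (D := C) le_rfl (fun x v => s x • v) (fun _ _ _ => smul_add _ _ _)
      (fun _ _ _ => smul_comm _ _ _) hs h1)
    (OrderClass.map (D := C) le_rfl (fun x v => τ x • v) (fun _ _ _ => smul_add _ _ _)
      (fun _ _ _ => smul_comm _ _ _) hτ h2)) h3

lemma OrderClass.map' {j : ℕ} (T : X → V → W)
    (hadd : ∀ x u v, T x (u + v) = T x u + T x v) (hsmul : ∀ x (c : ℝ) u, T x (c • u) = c • T x u)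
    {k : ℕ} (hT : ∀ f ∈ C, (fun x => T x (f x)) ∈ OrderClass s τ l D j) {f : X → V}
    (hf : f ∈ OrderClass s τ l C k) :
    (fun x => T x (f x)) ∈ OrderClass s τ l D (j + k) := by
  induction k generalizing f with
  | zero => exact hT f hf
  | succ k ih =>
    obtain ⟨f1, h1, f2, h2, h3⟩ := hf
    refine ⟨_, ih h1, _, ih h2, ?_⟩
    filter_upwards [h3] with x a
    rw [a, hadd, hsmul, hsmul]

/-- A class of real functions closed under the ring operations. -/
structure IsRingClass (l : Filter X) (A : Set (X → ℝ)) : Prop where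
  const : ∀ c : ℝ, (fun _ => c) ∈ A
  add : ∀ {f g}, f ∈ A → g ∈ A → (fun x => f x + g x) ∈ A
  mul : ∀ {f g}, f ∈ A → g ∈ A → (fun x => f x * g x) ∈ A
  congr : ∀ {f g}, f ∈ A → (∀ᶠ x in l, g x = f x) → g ∈ A

variable {A : Set (X → ℝ)}

lemma IsRingClass.neg (hA : IsRingClass l A) {f : X → ℝ} (hf : f ∈ A) : (fun x => - f x) ∈ A := by
  simpa using hA.mul (hA.const (-1)) hf

lemma IsRingClass.sub (hA : IsRingClass l A) {f g : X → ℝ} (hf : f ∈ A) (hg : g ∈ A) :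
    (fun x => f x - g x) ∈ A := by
  simpa only [sub_eq_add_neg] using hA.add hf (hA.neg hg)

lemma IsRingClass.pow (hA : IsRingClass l A) {f : X → ℝ} (hf : f ∈ A) (n : ℕ) :
    (fun x => f x ^ n) ∈ A := by
  induction n with
  | zero => simpa using hA.const 1
  | succ n ih => simpa only [pow_succ] using hA.mul ih hf

lemma IsRingClass.isModuleClass (hA : IsRingClass l A) : IsModuleClass l A :=
  ⟨hA.const 0, hA.add, hA.neg, hA.congr⟩

lemma IsRingClass.mul_order (hA : IsRingClass l A) {k : ℕ} {f g : X → ℝ} (hf : f ∈ A)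
    (hg : g ∈ OrderClass s τ l A k) : (fun x => f x * g x) ∈ OrderClass s τ l A k :=
  OrderClass.map (C := A) (D := A) le_rfl (fun x v => f x * v) (fun _ _ _ => by ring)
    (fun _ _ _ => by simp only [smul_eq_mul]; ring) (fun _ h => hA.mul hf h) hg

lemma IsRingClass.order_mul_order (hA : IsRingClass l A) {j k : ℕ} {f g : X → ℝ}
    (hf : f ∈ OrderClass s τ l A j) (hg : g ∈ OrderClass s τ l A k) :
    (fun x => f x * g x) ∈ OrderClass s τ l A (j + k) :=
  OrderClass.map' (C := A) (D := A) (fun x v => f x * v) (fun _ _ _ => by ring)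
    (fun _ _ _ => by simp only [smul_eq_mul]; ring)
    (fun h hh => by simpa only [mul_comm] using hA.mul_order hh hf) hg

lemma IsRingClass.order_le (hA : IsRingClass l A) (hs : s ∈ A) (hτ : τ ∈ A) {k : ℕ} {f : X → ℝ}
    (hf : f ∈ OrderClass s τ l A (k + 1)) : f ∈ OrderClass s τ l A k :=
  hA.isModuleClass.order_le (fun _ => hA.mul hs) (fun _ => hA.mul hτ) hf

end Order

/-! ### Algebra of the third order expansion of the energy change -/

namespace Pendulum

/-- The energy change up to third order, divided by `τ θ₁²`, in terms of the gains and of the values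
`S` of `sin θ / θ` and `K` of the actuation at the amplitude. -/
def energyCoeff (a b s τ S K : ℝ) : ℝ :=
  -(a ^ 2 * K ^ 2 / (a * K - S)) * s + a ^ 2 * K ^ 2 * (a * K - 2 * S) / (2 * (a * K - S)) * τ
    - a * b * K ^ 2 * (a * K - 2 * S) / (a * K - S) ^ 2 * s ^ 2
    + a * b * K ^ 2 * (a ^ 2 * K ^ 2 - 3 * a * K * S + 4 * S ^ 2) / (2 * (a * K - S) ^ 2) * (s * τ)
    + a * b * K ^ 2 * (3 * a ^ 3 * K ^ 3 - 9 * a ^ 2 * K ^ 2 * S + 7 * a * K * S ^ 2 + S ^ 3) /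
      (6 * (a * K - S) ^ 2) * τ ^ 2

/-- Deviation from the switching line, to first order, at a time `u ≥ 2`. -/
def devPoly (a b s τ S K u : ℝ) : ℝ :=
  S * u - (a + b * s) * K * (u - 1) - b * τ * K * ((S * (u - 1) ^ 2 - a * K * (u - 2) ^ 2) / 2)

/-- The work integral of the position, to first order, at a time `u ≥ 2`. -/
def posWorkPoly (a b s τ S K u : ℝ) : ℝ :=
  (a + b * s) * K * (u - 1) + b * τ * K * ((S * (u - 1) ^ 2 - a * K * (u - 2) ^ 2) / 2)

/-- The work integral of the deviation, to first order, at a time `u ≥ 2`. -/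
def devWorkPoly (a b s τ S K u : ℝ) : ℝ :=
  (a + b * s) * K * (S * ((u ^ 2 - 1) / 2) - (a + b * s) * K * ((u - 1) ^ 2 / 2)
    - b * τ * K * ((S * (u - 1) ^ 3 - a * K * (u - 2) ^ 3) / 6))
  + b * τ * K * (S ^ 2 / 2 + S * (S - a * K) / 3 + a * K * S * (u - 2)
    - (a * K - S) * (a * K + S) * (((u - 1) ^ 2 - 1) / 2) + (a * K - S) ^ 2 * (((u - 1) ^ 3 - 1) / 3))

/-- The expansion of the energy change follows from the first order expansions of the deviation at
its zero `U` and of the work integrals. -/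
theorem energy_expansion {X : Type*} {l : Filter X} {𝒜 : Set (X → ℝ)} (hA : IsRingClass l 𝒜)
    {a b s τ S K U m A B : X → ℝ} (ha : a ∈ 𝒜) (hb : b ∈ 𝒜) (hs : s ∈ 𝒜) (hτ : τ ∈ 𝒜) (hS : S ∈ 𝒜)
    (hK : K ∈ 𝒜) (hU : U ∈ 𝒜) (hm : m ∈ 𝒜) (hmn : ∀ᶠ x in l, m x * (a x * K x - S x) = 1)
    (hW : (fun x => devPoly (a x) (b x) (s x) (τ x) (S x) (K x) (U x)) ∈ OrderClass s τ l 𝒜 2)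
    (hPA : (fun x => A x - posWorkPoly (a x) (b x) (s x) (τ x) (S x) (K x) (U x + 1)) ∈
      OrderClass s τ l 𝒜 2)
    (hPB : (fun x => B x - devWorkPoly (a x) (b x) (s x) (τ x) (S x) (K x) (U x + 1)) ∈
      OrderClass s τ l 𝒜 2) :
    (fun x => s x * A x + τ x * B x + energyCoeff (a x) (b x) (s x) (τ x) (S x) (K x)) ∈
      OrderClass s τ l 𝒜 3 := by
  have M := hA.isModuleClass
  have M1 := M.orderClass (s := s) (τ := τ) 1
  have M2 := M.orderClass (s := s) (τ := τ) 2
  have M3 := M.orderClass (s := s) (τ := τ) 3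
  have one := hA.const 1
  have two := hA.const 2
  have half := hA.const (1 / 2)
  have sixth := hA.const (1 / 6)
  have third := hA.const (1 / 3)
  have hbK := hA.mul hb hK
  have haK := hA.mul ha hK
  -- the zero to first order
  set U₀ : X → ℝ := fun x => a x * K x * m x with hU₀d
  have hU₀ : U₀ ∈ 𝒜 := hA.mul haK hm
  set δ : X → ℝ := fun x => U x - U₀ x with hδd
  have hδA : δ ∈ 𝒜 := hA.sub hU hU₀
  set h : X → ℝ → ℝ := fun x u => (S x * (u - 1) ^ 2 - a x * K x * (u - 2) ^ 2) / 2 with hhd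
  have hhU : ∀ {V : X → ℝ}, V ∈ 𝒜 → (fun x => h x (V x)) ∈ 𝒜 := fun {V} hV => by
    have := hA.mul (hA.sub (hA.mul hS (hA.pow (hA.sub hV one) 2))
      (hA.mul haK (hA.pow (hA.sub hV two) 2))) half
    simpa only [h, div_eq_mul_one_div (_ - _) (2 : ℝ)] using this
  -- Up to terms that carry `s` or `τ`, the equation for `U` is affine with slope `-(a K - S)`, and
  -- `U₀` is the root of its affine part.
  have hδ1 : δ ∈ OrderClass s τ l 𝒜 1 := by
    have h1 : (fun x => s x • (b x * K x * (U x - 1))) ∈ OrderClass s τ l 𝒜 (0 + 1) :=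
      M.smul_left (hA.mul hbK (hA.sub hU one))
    have h2 : (fun x => τ x • (b x * K x * h x (U x))) ∈ OrderClass s τ l 𝒜 (0 + 1) :=
      M.smul_right (hA.mul hbK (hhU hU))
    refine M1.congr (hA.mul_order hm (M1.neg (M1.add (M1.add (hA.order_le hs hτ hW) h1) h2))) ?_
    filter_upwards [hmn] with x hx
    simp only [hδd, hU₀d, devPoly, hhd, smul_eq_mul]
    linear_combination (-U x) * hx
  -- One Newton-like correction: in the terms with a factor `s` or `τ` the unknown `U` is replaced
  -- by `U₀`, which costs second order only.
  set δ₁ : X → ℝ := fun x => -(m x * (s x • (b x * K x * (U₀ x - 1)) + τ x • (b x * K x * h x (U₀ x))))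
    with hδ₁d
  have hδ2 : (fun x => δ x - δ₁ x) ∈ OrderClass s τ l 𝒜 2 := by
    have h1 : (fun x => s x • (b x * K x * δ x)) ∈ OrderClass s τ l 𝒜 (1 + 1) :=
      M.smul_left (hA.mul_order hbK hδ1)
    have hc : (fun x => b x * K x * (S x * (U x + U₀ x - 2) - a x * K x * (U x + U₀ x - 4)) * (1 / 2)) ∈ 𝒜 := 
      hA.mul (hA.mul hbK (hA.sub (hA.mul hS (hA.sub (hA.add hU hU₀) two))
        (hA.mul haK (hA.sub (hA.add hU hU₀) (hA.const 4))))) half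
    have h2 : (fun x => τ x • (b x * K x * (S x * (U x + U₀ x - 2) - a x * K x * (U x + U₀ x - 4)) * (1 / 2) * δ x)) ∈
        OrderClass s τ l 𝒜 (1 + 1) := M.smul_right (hA.mul_order hc hδ1)
    refine M2.congr (hA.mul_order hm (M2.neg (M2.add (M2.add hW h1) h2))) ?_
    filter_upwards [hmn] with x hx
    simp only [hδd, hδ₁d, hU₀d, devPoly, hhd, smul_eq_mul]
    linear_combination (-U x) * hx
  -- the work integrals to first order
  set A₁ : X → ℝ := fun x => a x * K x * U₀ x + a x * K x * δ₁ x + s x * (b x * K x * U₀ x) +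
    τ x * (b x * K x * h x (U₀ x + 1)) with hA₁d
  have hA1 : (fun x => A x - A₁ x) ∈ OrderClass s τ l 𝒜 2 := by
    have h1 : (fun x => s x • (b x * K x * δ x)) ∈ OrderClass s τ l 𝒜 (1 + 1) :=
      M.smul_left (hA.mul_order hbK hδ1)
    have hc : (fun x => b x * K x * (S x * (U x + U₀ x) - a x * K x * (U x + U₀ x - 2)) * (1 / 2)) ∈ 𝒜 := 
      hA.mul (hA.mul hbK (hA.sub (hA.mul hS (hA.add hU hU₀))
        (hA.mul haK (hA.sub (hA.add hU hU₀) two)))) half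
    have h2 : (fun x => τ x • (b x * K x * (S x * (U x + U₀ x) - a x * K x * (U x + U₀ x - 2)) * (1 / 2) * δ x)) ∈
        OrderClass s τ l 𝒜 (1 + 1) := M.smul_right (hA.mul_order hc hδ1)
    refine M2.congr (M2.add (M2.add (M2.add hPA (hA.mul_order haK hδ2)) h1) h2) (Eventually.of_forall fun x => ?_)
    simp only [hδd, hA₁d, posWorkPoly, hhd, smul_eq_mul]
    ring
  set p : X → ℝ := fun x => b x * K x * (S x * (U₀ x ^ 2 + 2 * U₀ x) * (1 / 2) - a x * K x * U₀ x ^ 2) with hpd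
  set r : X → ℝ → ℝ := fun x U => -(a x * K x * (b x * K x) * (S x * U ^ 3 - a x * K x * (U - 1) ^ 3) * (1 / 6))
    + b x * K x * (S x ^ 2 * (1 / 2) + S x * (S x - a x * K x) * (1 / 3) + a x * K x * S x * (U - 1)
    - (a x * K x - S x) * (a x * K x + S x) * ((U ^ 2 - 1) * (1 / 2)) +
      (a x * K x - S x) ^ 2 * ((U ^ 3 - 1) * (1 / 3))) with hrd
  -- The coefficient of `δ₁` is the derivative of the zeroth order work at `U₀`, simplified by `U₀
  -- (a K - S) = a K`.
  set B₁ : X → ℝ := fun x => a x * K x * (S x * (U₀ x ^ 2 + 2 * U₀ x) / 2 - a x * K x * U₀ x ^ 2 / 2)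
    - a x * K x * (a x * K x - S x) * δ₁ x + s x * p x + τ x * r x (U₀ x) with hB₁d
  have hn := hA.sub haK hS
  have hB1 : (fun x => B x - B₁ x) ∈ OrderClass s τ l 𝒜 2 := by
    have h1 : (fun x => δ x * δ x) ∈ OrderClass s τ l 𝒜 (1 + 1) := hA.order_mul_order hδ1 hδ1
    have h1' := hA.mul_order (hA.mul (hA.mul haK hn) half) h1
    have h2 : (fun x => s x • (b x * K x * (S x * (U x + U₀ x + 2) * (1 / 2) - a x * K x * (U x + U₀ x)) * δ x)) ∈
        OrderClass s τ l 𝒜 (1 + 1) := M.smul_left (hA.mul_order (hA.mul hbK (hA.sub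
          (hA.mul (hA.mul hS (hA.add (hA.add hU hU₀) two)) half) (hA.mul haK (hA.add hU hU₀)))) hδ1)
    have hcub : (fun x => U x ^ 2 + U x * U₀ x + U₀ x ^ 2) ∈ 𝒜 :=
      hA.add (hA.add (hA.pow hU 2) (hA.mul hU hU₀)) (hA.pow hU₀ 2)
    have hcub' : (fun x => (U x - 1) ^ 2 + (U x - 1) * (U₀ x - 1) + (U₀ x - 1) ^ 2) ∈ 𝒜 :=
      hA.add (hA.add (hA.pow (hA.sub hU one) 2) (hA.mul (hA.sub hU one) (hA.sub hU₀ one)))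
        (hA.pow (hA.sub hU₀ one) 2)
    have h3 : (fun x => τ x • ((-(a x * K x * (b x * K x) * (S x * (U x ^ 2 + U x * U₀ x + U₀ x ^ 2) -
          a x * K x * ((U x - 1) ^ 2 + (U x - 1) * (U₀ x - 1) + (U₀ x - 1) ^ 2)) * (1 / 6))
        + b x * K x * (a x * K x * S x - (a x * K x - S x) * (a x * K x + S x) * ((U x + U₀ x) * (1 / 2)) +
          (a x * K x - S x) ^ 2 * ((U x ^ 2 + U x * U₀ x + U₀ x ^ 2) * (1 / 3)))) * δ x)) ∈
        OrderClass s τ l 𝒜 (1 + 1) := by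
      refine M.smul_right (hA.mul_order (hA.add (hA.neg (hA.mul (hA.mul (hA.mul haK hbK)
        (hA.sub (hA.mul hS hcub) (hA.mul haK hcub'))) sixth)) (hA.mul hbK (hA.add (hA.sub (hA.mul haK hS)
        (hA.mul (hA.mul hn (hA.add haK hS)) (hA.mul (hA.add hU hU₀) half)))
        (hA.mul (hA.pow hn 2) (hA.mul hcub third))))) hδ1)
    have h4 : (fun x => s x • s x • (-(b x * K x * (b x * K x)) * (1 / 2) * U x ^ 2)) ∈ OrderClass s τ l 𝒜 (0 + 1 + 1) :=
      M.smul_left (M.smul_left (hA.mul (hA.mul (hA.neg (hA.mul hbK hbK)) half) (hA.pow hU 2)))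
    have h5 : (fun x => s x • τ x • (-(b x * K x * (b x * K x) * (S x * U x ^ 3 - a x * K x * (U x - 1) ^ 3) * (1 / 6)))) ∈
        OrderClass s τ l 𝒜 (0 + 1 + 1) :=
      M.smul_left (M.smul_right (hA.neg (hA.mul (hA.mul (hA.mul hbK hbK) (hA.sub (hA.mul hS (hA.pow hU 3))
        (hA.mul haK (hA.pow (hA.sub hU one) 3)))) sixth)))
    refine M2.congr (M2.add (M2.add (M2.sub (M2.add (M2.add (M2.sub hPB h1')
      (M2.add h4 h5)) h2) (hA.mul_order (hA.mul haK hn) hδ2)) h3)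
      (hA.mul_order (hA.const 0) hPB)) ?_
    filter_upwards [hmn] with x hx
    have hU0n : U₀ x * (a x * K x - S x) = a x * K x := by
      simp only [hU₀d]; linear_combination (a x * K x) * hx
    simp only [hδd, hB₁d, devWorkPoly, hrd, hpd, smul_eq_mul]
    linear_combination (a x * K x * (U₀ x - U x)) * hU0n
  -- The two integrals enter with factors `s` and `τ`, so second order errors in them become third
  -- order errors in the sum.
  refine M3.congr (M3.add (M.smul_left hA1) (M.smul_right hB1)) ?_
  filter_upwards [hmn] with x hx
  have hne : a x * K x - S x ≠ 0 := right_ne_zero_of_mul_eq_one hx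
  have hmx : m x = 1 / (a x * K x - S x) := eq_one_div_of_mul_eq_one_left hx
  simp only [hA₁d, hB₁d, hδ₁d, hU₀d, hrd, hpd, hhd, energyCoeff, smul_eq_mul, hmx]
  field_simp
  ring

end Pendulum

namespace Pendulum
open TimeFun

/-! ### First order expansions of the rescaled system -/

/-- Families of time functions of order `k` in the slope and the delay, with coefficients that have
`n` smooth time derivatives on `(i, N)`. -/
abbrev TimeOrder (q₀ : Params × ℝ) (N i : ℝ) (n k : ℕ) : Set (Params × ℝ → TimeFun) :=
  OrderClass (fun q : Params × ℝ => q.1.s) (fun q => q.1.τ) (𝓝 q₀) {h | TimeSmooth q₀ N i n h} k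

section TimeOrder

variable {q₀ : Params × ℝ} {N i : ℝ} {n k : ℕ} {f g : Params × ℝ → TimeFun}

lemma isModuleClass_timeSmooth (q₀ : Params × ℝ) (N i : ℝ) (n : ℕ) :
    IsModuleClass (𝓝 q₀) {h | TimeSmooth q₀ N i n h} :=
  ⟨by simpa using TimeSmooth.const (q₀ := q₀) (N := N) (i := i) (n := n) 0,
    TimeSmooth.add, TimeSmooth.neg, TimeSmooth.congr⟩

lemma isModuleClass_timeOrder (q₀ : Params × ℝ) (N i : ℝ) (n k : ℕ) :
    IsModuleClass (𝓝 q₀) (TimeOrder q₀ N i n k) :=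
  (isModuleClass_timeSmooth q₀ N i n).orderClass k

lemma TimeOrder.integ {c : ℝ} (hc : c ≤ i) (hf : f ∈ TimeOrder q₀ N i n k) :
    (fun q => integ c N (f q)) ∈ TimeOrder q₀ N i (n + 1) k :=
  OrderClass.map (D := {h | TimeSmooth q₀ N i (n + 1) h}) le_rfl (fun _ => TimeFun.integ c N)
    (fun _ => map_add _) (fun _ => map_smul _) (fun _ h => h.integ_succ hc) hf

lemma TimeOrder.of_succ (hf : f ∈ TimeOrder q₀ N i (n + 1) k) : f ∈ TimeOrder q₀ N i n k :=
  OrderClass.map (D := {h | TimeSmooth q₀ N i n h}) le_rfl (fun _ v => v)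
    (fun _ _ _ => rfl) (fun _ _ _ => rfl) (fun _ h => h.of_succ) hf

lemma TimeOrder.mono {j : ℝ} (hij : i ≤ j) (hf : f ∈ TimeOrder q₀ N i n k) :
    f ∈ TimeOrder q₀ N j n k :=
  OrderClass.map (D := {h | TimeSmooth q₀ N j n h}) le_rfl (fun _ v => v)
    (fun _ _ _ => rfl) (fun _ _ _ => rfl) (fun _ h => h.mono hij) hf

lemma TimeOrder.delay (hf : f ∈ TimeOrder q₀ N i n k) :
    (fun q => delay (f q)) ∈ TimeOrder q₀ N (i + 1) n k :=
  OrderClass.map (D := {h | TimeSmooth q₀ N (i + 1) n h}) le_rfl (fun _ => TimeFun.delay)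
    (fun _ => map_add _) (fun _ => map_smul _) (fun _ h => h.delay) hf

lemma TimeOrder.mul_left (hg : TimeSmooth q₀ N i n g) (hf : f ∈ TimeOrder q₀ N i n k) :
    (fun q => g q * f q) ∈ TimeOrder q₀ N i n k :=
  OrderClass.map (D := {h | TimeSmooth q₀ N i n h}) le_rfl (fun q v => g q * v)
    (fun _ _ _ => mul_add _ _ _) (fun _ _ _ => mul_smul_comm _ _ _) (fun _ h => hg.mul h) hf

lemma TimeOrder.smul {c : Params × ℝ → ℝ} (hc : ContDiffAt ℝ (↑(⊤ : ℕ∞)) c q₀)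
    (hf : f ∈ TimeOrder q₀ N i n k) : (fun q => c q • f q) ∈ TimeOrder q₀ N i n k :=
  OrderClass.map (D := {h | TimeSmooth q₀ N i n h}) le_rfl (fun q v => c q • v)
    (fun _ _ _ => smul_add _ _ _) (fun _ _ _ => smul_comm _ _ _) (fun _ h => h.smul hc) hf

end TimeOrder

/-- the value of the actuation at the amplitude -/
def actCoeff (e z : ℝ) : ℝ := 1 + e * (trigSqrt 0 z - 1)

lemma TimeOrder.order_le {q₀ : Params × ℝ} {N i : ℝ} {n k : ℕ} {f : Params × ℝ → TimeFun}
    (hf : f ∈ TimeOrder q₀ N i n (k + 1)) : f ∈ TimeOrder q₀ N i n k :=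
  (isModuleClass_timeSmooth q₀ N i n).order_le (fun _ h => TimeSmooth.smul (by fun_prop) h)
    (fun _ h => TimeSmooth.smul (by fun_prop) h) hf

section Family

variable {e N : ℝ} {q₀ : Params × ℝ} {ϑ σ κ w : Params × ℝ → TimeFun}

/-- the actuated delayed position and deviation, integrated against the position -/
def posWork (e N : ℝ) (ϑ κ w : Params × ℝ → TimeFun) (q : Params × ℝ) : TimeFun :=
  integ 1 N (feedback q (ϑ q) (w q) * act e (κ q) * ϑ q)

/-- the actuated delayed position and deviation, integrated against the deviation -/
def devWork (e N : ℝ) (ϑ κ w : Params × ℝ → TimeFun) (q : Params × ℝ) : TimeFun :=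
  integ 1 N (feedback q (ϑ q) (w q) * act e (κ q) * w q)

lemma contDiffAt_trigSqrt_snd (k : ℕ) :
    ContDiffAt ℝ (↑(⊤ : ℕ∞)) (fun q : Params × ℝ => trigSqrt k q.2) q₀ :=
  ((contDiff_trigSqrt k).comp (by fun_prop)).contDiffAt

lemma contDiffAt_actCoeff_snd : ContDiffAt ℝ (↑(⊤ : ℕ∞)) (fun q : Params × ℝ => actCoeff e q.2) q₀ := by
  have := contDiffAt_trigSqrt_snd (q₀ := q₀) 0
  unfold actCoeff
  fun_prop

/-- deviation to zeroth order -/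
def dev₀ (e N : ℝ) (q : Params × ℝ) : TimeFun :=
  trigSqrt 1 q.2 • integ 0 N 1 - (q.1.a * actCoeff e q.2) • integ 1 N 1

/-- deviation to first order -/
def dev₁ (e N : ℝ) (q : Params × ℝ) : TimeFun :=
  trigSqrt 1 q.2 • integ 0 N 1 - ((q.1.a + q.1.b * q.1.s) * actCoeff e q.2) • integ 1 N 1 -
    (q.1.b * q.1.τ * actCoeff e q.2) • integ 1 N (delay (dev₀ e N q))

lemma TimeSmooth.one {i : ℝ} {n : ℕ} : TimeSmooth q₀ N i n fun _ => 1 := by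
  simpa using TimeSmooth.const (q₀ := q₀) (N := N) (i := i) (n := n) 1

lemma timeSmooth_vel {i : ℝ} {n : ℕ} (h1 : TimeSmooth q₀ N i n ϑ)
    (h2 : TimeSmooth q₀ N i n w) : TimeSmooth q₀ N i n fun q => vel q (ϑ q) (w q) :=
  (h1.smul (c := fun q => q.1.s) (by fun_prop)).add (h2.smul (c := fun q => q.1.τ) (by fun_prop))

lemma timeSmooth_act {i : ℝ} {n : ℕ} (h1 : TimeSmooth q₀ N i n κ) :
    TimeSmooth q₀ N i n fun q => act e (κ q) :=
  TimeSmooth.one.add ((h1.sub TimeSmooth.one).smul (c := fun _ => e) (by fun_prop))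

lemma timeSmooth_feedback {i : ℝ} {n : ℕ} (h1 : TimeSmooth q₀ N i n ϑ)
    (h2 : TimeSmooth q₀ N i n fun q => vel q (ϑ q) (w q)) :
    TimeSmooth q₀ N (i + 1) n fun q => feedback q (ϑ q) (w q) :=
  ((h1.smul (c := fun q => q.1.a) (by fun_prop)).add
    (h2.smul (c := fun q => q.1.b) (by fun_prop))).delay

lemma IsOnFamily.timeSmooth_zero (h : IsOnFamily e N q₀ ϑ σ κ w) (i : ℝ) : TimeSmooth q₀ N i 0 ϑ ∧ TimeSmooth q₀ N i 0 σ ∧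
    TimeSmooth q₀ N i 0 κ ∧ TimeSmooth q₀ N i 0 w := ⟨h.pos, h.sin, h.cos, h.dev⟩

/-- Each unknown is an integral of families that are continuous in time. For `w` the interval starts
at `1`, where the feedback sets in and produces a corner. -/
lemma IsOnFamily.timeSmooth_one (h : IsOnFamily e N q₀ ϑ σ κ w) :
    TimeSmooth q₀ N 0 1 ϑ ∧ TimeSmooth q₀ N 0 1 σ ∧ TimeSmooth q₀ N 0 1 κ ∧ TimeSmooth q₀ N 1 1 w := by
  have Z := h.timeSmooth_zero
  have hv := fun i => timeSmooth_vel (Z i).1 (Z i).2.2.2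
  have hC : ∀ k, TimeSmooth q₀ N 0 1 fun q => algebraMap ℝ TimeFun (trigSqrt k q.2) := fun k =>
    (TimeSmooth.one.smul (contDiffAt_trigSqrt_snd k)).congr
      (Eventually.of_forall fun q => Algebra.algebraMap_eq_smul_one _)
  refine ⟨?_, ?_, ?_, ?_⟩
  · exact (TimeSmooth.one.add (((hv 0).integ_succ le_rfl).smul (c := fun q => q.1.τ)
      (by fun_prop))).congr (h.eq.mono fun q hq => hq.pos)
  · exact ((hC 1).add ((((Z 0).2.2.1.mul (hv 0)).integ_succ le_rfl).smul (c := fun q => q.1.τ)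
      (by fun_prop))).congr (h.eq.mono fun q hq => hq.sin)
  · exact ((hC 0).sub ((((Z 0).2.1.mul (hv 0)).integ_succ le_rfl).smul (c := fun q => q.2 * q.1.τ)
      (by fun_prop))).congr (h.eq.mono fun q hq => hq.cos)
  · have hf : TimeSmooth q₀ N 1 0 fun q => feedback q (ϑ q) (w q) := by
      simpa using timeSmooth_feedback (Z 0).1 (hv 0)
    exact ((((Z 1).2.1.integ_succ zero_le_one).sub (((hv 1).integ_succ zero_le_one).smul
      (c := fun q => q.1.s) (by fun_prop))).sub
      ((hf.mul (timeSmooth_act (Z 1).2.2.1)).integ_succ le_rfl)).congr (h.eq.mono fun q hq => hq.dev)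

lemma IsOnFamily.timeSmooth_forcing (h : IsOnFamily e N q₀ ϑ σ κ w) : TimeSmooth q₀ N 2 1 fun q => feedback q (ϑ q) (w q) * act e (κ q) := by
  obtain ⟨h1, h2, h3, h4⟩ := h.timeSmooth_one
  have hf := timeSmooth_feedback (h1.mono zero_le_one) (timeSmooth_vel (h1.mono zero_le_one) h4)
  norm_num at hf
  exact hf.mul (timeSmooth_act (h3.mono zero_le_two))

/-- The corner of `w` at time `1` reappears in the delayed feedback at time `2`; past `2` the
forcing is once and `w` twice differentiable. This is the reason for requiring crossing times above
`2`. -/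
lemma IsOnFamily.timeSmooth_dev (h : IsOnFamily e N q₀ ϑ σ κ w) : TimeSmooth q₀ N 2 2 w := by
  obtain ⟨h1, h2, h3, h4⟩ := h.timeSmooth_one
  have hv := timeSmooth_vel (h1.mono zero_le_one) h4
  exact ((((h2.mono zero_le_two).integ_succ zero_le_two).sub
    (((hv.mono one_le_two).integ_succ zero_le_two).smul (c := fun q => q.1.s) (by fun_prop))).sub
    (h.timeSmooth_forcing.integ_succ one_le_two)).congr (h.eq.mono fun q hq => hq.dev)

lemma IsOnFamily.timeSmooth_posWork (h : IsOnFamily e N q₀ ϑ σ κ w) : TimeSmooth q₀ N 2 2 (posWork e N ϑ κ w) :=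
  (h.timeSmooth_forcing.mul (h.timeSmooth_one.1.mono zero_le_two)).integ_succ one_le_two

lemma IsOnFamily.timeSmooth_devWork (h : IsOnFamily e N q₀ ϑ σ κ w) : TimeSmooth q₀ N 2 2 (devWork e N ϑ κ w) :=
  (h.timeSmooth_forcing.mul (h.timeSmooth_one.2.2.2.mono one_le_two)).integ_succ one_le_two

/-- The position changes at rate `τ (s ϑ + τ w)`, in which every term is of second order. -/
lemma IsOnFamily.order_pos (h : IsOnFamily e N q₀ ϑ σ κ w) : (fun q => ϑ q - 1) ∈ TimeOrder q₀ N 0 1 2 := by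
  have Z := h.timeSmooth_zero
  have M := isModuleClass_timeSmooth q₀ N 0 1
  have h1 : (fun q : Params × ℝ => q.1.τ • q.1.s • integ 0 N (ϑ q)) ∈ TimeOrder q₀ N 0 1 (0 + 1 + 1) :=
    M.smul_right (M.smul_left ((Z 0).1.integ_succ le_rfl))
  have h2 : (fun q : Params × ℝ => q.1.τ • q.1.τ • integ 0 N (w q)) ∈ TimeOrder q₀ N 0 1 (0 + 1 + 1) :=
    M.smul_right (M.smul_right ((Z 0).2.2.2.integ_succ le_rfl))
  refine (isModuleClass_timeOrder q₀ N 0 1 2).congr ((isModuleClass_timeOrder q₀ N 0 1 2).add h1 h2) ?_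
  filter_upwards [h.eq] with q hq
  nth_rewrite 1 [hq.pos]
  simp only [vel, map_add, map_smul]
  module

lemma IsOnFamily.order_sin (h : IsOnFamily e N q₀ ϑ σ κ w) : (fun q => σ q - algebraMap ℝ TimeFun (trigSqrt 1 q.2)) ∈
    TimeOrder q₀ N 0 1 2 := by
  have Z := h.timeSmooth_zero
  have M := isModuleClass_timeSmooth q₀ N 0 1
  have h1 : (fun q : Params × ℝ => q.1.τ • q.1.s • integ 0 N (κ q * ϑ q)) ∈ TimeOrder q₀ N 0 1 (0 + 1 + 1) :=
    M.smul_right (M.smul_left (((Z 0).2.2.1.mul (Z 0).1).integ_succ le_rfl))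
  have h2 : (fun q : Params × ℝ => q.1.τ • q.1.τ • integ 0 N (κ q * w q)) ∈ TimeOrder q₀ N 0 1 (0 + 1 + 1) :=
    M.smul_right (M.smul_right (((Z 0).2.2.1.mul (Z 0).2.2.2).integ_succ le_rfl))
  refine (isModuleClass_timeOrder q₀ N 0 1 2).congr ((isModuleClass_timeOrder q₀ N 0 1 2).add h1 h2) ?_
  filter_upwards [h.eq] with q hq
  rw [hq.sin]
  simp only [vel, mul_add, mul_smul_comm, map_add, map_smul]
  module

lemma IsOnFamily.order_cos (h : IsOnFamily e N q₀ ϑ σ κ w) : (fun q => κ q - algebraMap ℝ TimeFun (trigSqrt 0 q.2)) ∈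
    TimeOrder q₀ N 0 1 2 := by
  have Z := h.timeSmooth_zero
  have M := isModuleClass_timeSmooth q₀ N 0 1
  have h1 : (fun q : Params × ℝ => q.1.τ • q.1.s • q.2 • integ 0 N (σ q * ϑ q)) ∈
      TimeOrder q₀ N 0 1 (0 + 1 + 1) :=
    M.smul_right (M.smul_left (show TimeSmooth q₀ N 0 1 fun q => q.2 • integ 0 N (σ q * ϑ q) from
      (((Z 0).2.1.mul (Z 0).1).integ_succ le_rfl).smul (by fun_prop)))
  have h2 : (fun q : Params × ℝ => q.1.τ • q.1.τ • q.2 • integ 0 N (σ q * w q)) ∈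
      TimeOrder q₀ N 0 1 (0 + 1 + 1) :=
    M.smul_right (M.smul_right (show TimeSmooth q₀ N 0 1 fun q => q.2 • integ 0 N (σ q * w q) from
      (((Z 0).2.1.mul (Z 0).2.2.2).integ_succ le_rfl).smul (by fun_prop)))
  refine (isModuleClass_timeOrder q₀ N 0 1 2).congr
    ((isModuleClass_timeOrder q₀ N 0 1 2).neg ((isModuleClass_timeOrder q₀ N 0 1 2).add h1 h2)) ?_
  filter_upwards [h.eq] with q hq
  rw [hq.cos]
  simp only [vel, mul_add, mul_smul_comm, map_add, map_smul]
  module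

lemma IsOnFamily.order_act (h : IsOnFamily e N q₀ ϑ σ κ w) : (fun q => act e (κ q) - algebraMap ℝ TimeFun (actCoeff e q.2)) ∈
    TimeOrder q₀ N 0 1 2 := by
  refine (isModuleClass_timeOrder q₀ N 0 1 2).congr
    (TimeOrder.smul (c := fun _ => e) (by fun_prop) h.order_cos) (Eventually.of_forall fun q => ?_)
  simp only [act, actCoeff, Algebra.algebraMap_eq_smul_one]
  module

/-- the feedback to first order -/
def feedback₁ (e N : ℝ) (q : Params × ℝ) : TimeFun :=
  algebraMap ℝ TimeFun (q.1.a + q.1.b * q.1.s) + (q.1.b * q.1.τ) • delay (dev₀ e N q)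

lemma timeSmooth_dev₀ : TimeSmooth q₀ N 1 1 (dev₀ e N) := by
  have h0 := contDiffAt_trigSqrt_snd (q₀ := q₀) 1
  have h1 := contDiffAt_actCoeff_snd (e := e) (q₀ := q₀)
  exact ((TimeSmooth.one.integ_succ zero_le_one).smul h0).sub
    ((TimeSmooth.one.integ_succ le_rfl).smul (c := fun q => q.1.a * actCoeff e q.2) (by fun_prop))

lemma timeSmooth_feedback₁ : TimeSmooth q₀ N 2 1 (feedback₁ e N) := by
  have h2 := (timeSmooth_dev₀ (q₀ := q₀) (N := N) (e := e)).delay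
  norm_num at h2
  refine TimeSmooth.congr ((TimeSmooth.one.smul (c := fun q => q.1.a + q.1.b * q.1.s) (by fun_prop)).add
    (h2.smul (c := fun q => q.1.b * q.1.τ) (by fun_prop))) (Eventually.of_forall fun _ => ?_)
  simp only [feedback₁, Algebra.algebraMap_eq_smul_one]

/-- First order accuracy is enough here, since this approximation is used only inside terms that
carry another factor `τ`. -/
lemma IsOnFamily.order_dev₀ (h : IsOnFamily e N q₀ ϑ σ κ w) :
    (fun q => w q - dev₀ e N q) ∈ TimeOrder q₀ N 1 1 1 := by
  have Z := h.timeSmooth_zero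
  have M := isModuleClass_timeSmooth q₀ N 1 0
  have M0 := isModuleClass_timeOrder q₀ N 0 0 1
  have M1 := isModuleClass_timeOrder q₀ N 1 0 1
  have N1 := isModuleClass_timeOrder q₀ N 1 1 1
  have A0 : ∀ {f}, f ∈ TimeOrder q₀ N 0 1 2 → f ∈ TimeOrder q₀ N 0 0 1 := fun hf =>
    TimeOrder.order_le (TimeOrder.of_succ hf)
  have A1 : ∀ {f}, f ∈ TimeOrder q₀ N 0 1 2 → f ∈ TimeOrder q₀ N 1 0 1 := fun hf =>
    TimeOrder.mono zero_le_one (A0 hf)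
  have s1 : (fun q => q.1.s • ϑ q) ∈ TimeOrder q₀ N 0 0 (0 + 1) :=
    (isModuleClass_timeSmooth q₀ N 0 0).smul_left (Z 0).1
  have t1 : (fun q => q.1.τ • w q) ∈ TimeOrder q₀ N 0 0 (0 + 1) :=
    (isModuleClass_timeSmooth q₀ N 0 0).smul_right (Z 0).2.2.2
  have h1 : (fun q => feedback q (ϑ q) (w q) - algebraMap ℝ TimeFun q.1.a) ∈ TimeOrder q₀ N 1 0 1 := by
    have := TimeOrder.delay (M0.add (TimeOrder.smul (c := fun q => q.1.a) (by fun_prop) (A0 h.order_pos))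
      (TimeOrder.smul (c := fun q => q.1.b) (by fun_prop) (M0.add s1 t1)))
    norm_num at this
    refine M1.congr this (Eventually.of_forall fun q => ?_)
    have : TimeFun.delay (1 : TimeFun) = 1 := rfl
    simp only [feedback, vel, map_add, map_smul, Algebra.algebraMap_eq_smul_one, this]
    module
  have h2 : (fun q => feedback q (ϑ q) (w q) * act e (κ q) - (q.1.a * actCoeff e q.2) • 1) ∈
      TimeOrder q₀ N 1 0 1 := by
    refine M1.congr (M1.add (TimeOrder.mul_left (timeSmooth_act (e := e) (Z 1).2.2.1) h1)
      (TimeOrder.smul (c := fun q => q.1.a) (by fun_prop) (A1 h.order_act)))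
      (Eventually.of_forall fun q => ?_)
    simp only [Algebra.algebraMap_eq_smul_one]
    ext u
    simp only [BoundedContinuousFunction.coe_add, BoundedContinuousFunction.coe_sub,
      BoundedContinuousFunction.coe_mul, BoundedContinuousFunction.coe_smul, Pi.add_apply,
      Pi.sub_apply, Pi.mul_apply, smul_eq_mul, BoundedContinuousFunction.coe_one,
      Pi.one_apply]
    ring
  have h3 := N1.sub (N1.sub (TimeOrder.integ zero_le_one (A1 h.order_sin))
    (TimeOrder.smul (c := fun q => q.1.s) (by fun_prop) (TimeOrder.integ zero_le_one
      (M1.add (TimeOrder.mono zero_le_one s1) (TimeOrder.mono zero_le_one t1)))))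
    (TimeOrder.integ le_rfl h2)
  refine N1.congr h3 ?_
  filter_upwards [h.eq] with q hq
  nth_rewrite 1 [hq.dev]
  simp only [dev₀, vel, map_add, map_sub, map_smul, Algebra.algebraMap_eq_smul_one]
  module

/-- The deviation enters the feedback with the factor `b τ`, so its zeroth order approximation gives
the forcing with second order error; position and actuation differ from constants by second order
terms. -/
lemma IsOnFamily.order_forcing (h : IsOnFamily e N q₀ ϑ σ κ w) :
    (fun q => feedback q (ϑ q) (w q) * act e (κ q) - actCoeff e q.2 • feedback₁ e N q) ∈
      TimeOrder q₀ N 2 1 2 := by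
  have M0 := isModuleClass_timeOrder q₀ N 1 1 2
  have M2 := isModuleClass_timeOrder q₀ N 2 1 2
  have t1 := (isModuleClass_timeSmooth q₀ N 1 1).smul_right h.order_dev₀
  have h1 : (fun q => feedback q (ϑ q) (w q) - feedback₁ e N q) ∈ TimeOrder q₀ N 2 1 2 := by
    have := TimeOrder.delay (M0.add (TimeOrder.smul (c := fun q => q.1.a + q.1.b * q.1.s) (by fun_prop)
      (TimeOrder.mono zero_le_one h.order_pos))
      (TimeOrder.smul (c := fun q => q.1.b) (by fun_prop) t1))
    norm_num at this
    refine M2.congr this (Eventually.of_forall fun q => ?_)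
    have : TimeFun.delay (1 : TimeFun) = 1 := rfl
    simp only [feedback, feedback₁, vel, map_add, map_smul, Algebra.algebraMap_eq_smul_one,
      this]
    module
  refine M2.congr (M2.add (TimeOrder.mul_left (timeSmooth_act (e := e)
    (h.timeSmooth_one.2.2.1.mono zero_le_two)) h1)
    (TimeOrder.mul_left (timeSmooth_feedback₁ (e := e)) (TimeOrder.mono zero_le_two h.order_act)))
    (Eventually.of_forall fun q => ?_)
  simp only [Algebra.algebraMap_eq_smul_one]
  ext u
  simp only [BoundedContinuousFunction.coe_add, BoundedContinuousFunction.coe_sub,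
    BoundedContinuousFunction.coe_mul, BoundedContinuousFunction.coe_smul, Pi.add_apply,
    Pi.sub_apply, Pi.mul_apply, smul_eq_mul, BoundedContinuousFunction.coe_one,
    Pi.one_apply]
  ring

lemma IsOnFamily.order_dev (h : IsOnFamily e N q₀ ϑ σ κ w) :
    (fun q => w q - dev₁ e N q) ∈ TimeOrder q₀ N 2 1 2 := by
  have Z := h.timeSmooth_zero
  have M2 := isModuleClass_timeOrder q₀ N 2 1 2
  have s1 : (fun q => q.1.s • q.1.s • integ 0 N (ϑ q)) ∈ TimeOrder q₀ N 2 1 (0 + 1 + 1) :=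
    (isModuleClass_timeSmooth q₀ N 2 1).smul_left ((isModuleClass_timeSmooth q₀ N 2 1).smul_left
      ((Z 2).1.integ_succ zero_le_two))
  have t1 : (fun q => q.1.s • q.1.τ • integ 0 N (w q)) ∈ TimeOrder q₀ N 2 1 (0 + 1 + 1) :=
    (isModuleClass_timeSmooth q₀ N 2 1).smul_left ((isModuleClass_timeSmooth q₀ N 2 1).smul_right
      ((Z 2).2.2.2.integ_succ zero_le_two))
  refine M2.congr (M2.sub (M2.sub (TimeOrder.of_succ (TimeOrder.integ zero_le_two
    (TimeOrder.mono zero_le_two h.order_sin))) (M2.add s1 t1))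
    (TimeOrder.of_succ (TimeOrder.integ one_le_two h.order_forcing))) ?_
  filter_upwards [h.eq] with q hq
  nth_rewrite 1 [hq.dev]
  simp only [dev₁, feedback₁, vel, map_add, map_sub, map_smul, Algebra.algebraMap_eq_smul_one]
  module

lemma IsOnFamily.order_posWork (h : IsOnFamily e N q₀ ϑ σ κ w) :
    (fun q => posWork e N ϑ κ w q - actCoeff e q.2 • integ 1 N (feedback₁ e N q)) ∈
      TimeOrder q₀ N 2 1 2 := by
  have M2 := isModuleClass_timeOrder q₀ N 2 1 2
  refine M2.congr (TimeOrder.of_succ (TimeOrder.integ one_le_two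
    (M2.add (TimeOrder.mul_left (h.timeSmooth_one.1.mono zero_le_two) h.order_forcing)
      (TimeOrder.smul (contDiffAt_actCoeff_snd (e := e)) (TimeOrder.mul_left
        (timeSmooth_feedback₁ (e := e)) (TimeOrder.mono zero_le_two h.order_pos))))))
    (Eventually.of_forall fun q => ?_)
  simp only [posWork, ← map_smul, ← map_sub]
  congr 1
  ext u
  simp only [BoundedContinuousFunction.coe_add, BoundedContinuousFunction.coe_sub,
    BoundedContinuousFunction.coe_mul, BoundedContinuousFunction.coe_smul, Pi.add_apply,
    Pi.sub_apply, Pi.mul_apply, smul_eq_mul, BoundedContinuousFunction.coe_one,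
    Pi.one_apply]
  ring

/-- In the product of forcing and deviation, the constant part of the forcing requires `dev₁`, but
the part with factor `τ` only `dev₀`. -/
lemma IsOnFamily.order_devWork (h : IsOnFamily e N q₀ ϑ σ κ w) :
    (fun q => devWork e N ϑ κ w q - integ 1 N (((q.1.a + q.1.b * q.1.s) * actCoeff e q.2) • dev₁ e N q
      + (q.1.b * q.1.τ * actCoeff e q.2) • (delay (dev₀ e N q) * dev₀ e N q))) ∈
      TimeOrder q₀ N 2 1 2 := by
  have M2 := isModuleClass_timeOrder q₀ N 2 1 2
  have hK := contDiffAt_actCoeff_snd (e := e) (q₀ := q₀)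
  have t1 := TimeOrder.mono one_le_two ((isModuleClass_timeSmooth q₀ N 1 1).smul_right h.order_dev₀)
  have h2 := (timeSmooth_dev₀ (q₀ := q₀) (N := N) (e := e)).delay
  norm_num at h2
  refine M2.congr (TimeOrder.of_succ (TimeOrder.integ one_le_two
    (M2.add (TimeOrder.mul_left (h.timeSmooth_one.2.2.2.mono one_le_two) h.order_forcing)
    (M2.add (TimeOrder.smul (c := fun q => (q.1.a + q.1.b * q.1.s) * actCoeff e q.2) (by fun_prop)
      h.order_dev) (TimeOrder.smul (c := fun q => q.1.b * actCoeff e q.2) (by fun_prop)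
        (TimeOrder.mul_left h2 t1))))))
    (Eventually.of_forall fun q => ?_)
  simp only [devWork, ← map_sub]
  congr 1
  simp only [feedback₁, Algebra.algebraMap_eq_smul_one]
  ext u
  simp only [BoundedContinuousFunction.coe_add, BoundedContinuousFunction.coe_sub,
    BoundedContinuousFunction.coe_mul, BoundedContinuousFunction.coe_smul, Pi.add_apply,
    Pi.sub_apply, Pi.mul_apply, smul_eq_mul, BoundedContinuousFunction.coe_one, Pi.one_apply]
  ring

end Family
end Pendulum

namespace Pendulum
open TimeFun

/-! ### Evaluation of the first order expansions -/

/-- All functions of time in the first order expansions are quadratic on either side of `u = 2`,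
which turns every integral that occurs into an explicit polynomial. -/
lemma _root_.TimeFun.integ_eq_of_quadratic {N x y u : ℝ} {h : TimeFun} {α₀ α₁ α₂ β₀ β₁ β₂ : ℝ} (hxy : x ≤ y)
    (hu : y ≤ u) (huN : u ≤ N) (h1 : ∀ r ∈ Icc x y, h r = α₀ + α₁ * r + α₂ * r ^ 2)
    (h2 : ∀ r ∈ Icc y u, h r = β₀ + β₁ * r + β₂ * r ^ 2) :
    integ x N h u = α₀ * (y - x) + α₁ * ((y ^ 2 - x ^ 2) / 2) + α₂ * ((y ^ 3 - x ^ 3) / 3) +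
      (β₀ * (u - y) + β₁ * ((u ^ 2 - y ^ 2) / 2) + β₂ * ((u ^ 3 - y ^ 3) / 3)) := by
  have key : ∀ {x y α₀ α₁ α₂ : ℝ}, x ≤ y → (∀ r ∈ Icc x y, h r = α₀ + α₁ * r + α₂ * r ^ 2) →
      ∫ r in x..y, h r = α₀ * (y - x) + α₁ * ((y ^ 2 - x ^ 2) / 2) + α₂ * ((y ^ 3 - x ^ 3) / 3) := by
    intro x y α₀ α₁ α₂ hxy hh
    have hd : ∀ r, HasDerivAt (fun r => α₀ * r + α₁ * (r ^ 2 / 2) + α₂ * (r ^ 3 / 3))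
        (α₀ + α₁ * r + α₂ * r ^ 2) r := fun r => by
      refine ((((hasDerivAt_id r).const_mul α₀).add ((((hasDerivAt_id r).pow 2).div_const 2).const_mul α₁)).add
        ((((hasDerivAt_id r).pow 3).div_const 3).const_mul α₂)).congr_deriv ?_
      simp
    rw [intervalIntegral.integral_eq_sub_of_hasDerivAt
      (f := fun r => α₀ * r + α₁ * (r ^ 2 / 2) + α₂ * (r ^ 3 / 3))
      (fun r hr => (hd r).congr_deriv (hh r (by rwa [uIcc_of_le hxy] at hr)).symm)
      (h.continuous.intervalIntegrable _ _)]
    ring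
  rw [integ_of_mem ⟨hxy.trans hu, huN⟩, ← intervalIntegral.integral_add_adjacent_intervals
    (h.continuous.intervalIntegrable x y) (h.continuous.intervalIntegrable y u), key hxy h1, key hu h2]

lemma _root_.TimeFun.integ_one {c N u : ℝ} (hu : u ∈ Icc c N) : integ c N 1 u = u - c := by
  rw [integ_of_mem hu]; simp

section Eval
variable {e N u : ℝ} {q : Params × ℝ}

lemma dev₀_of_le_one (hu : 0 ≤ u) (hu1 : u ≤ 1) (hN : 1 ≤ N) : dev₀ e N q u = trigSqrt 1 q.2 * u := by
  have h1 := TimeFun.integ_one (c := 0) (N := N) ⟨hu, hu1.trans hN⟩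
  simp [dev₀, h1, integ_of_le hu1]

lemma dev₀_of_one_le (hu1 : 1 ≤ u) (hN : u ≤ N) :
    dev₀ e N q u = trigSqrt 1 q.2 * u - q.1.a * actCoeff e q.2 * (u - 1) := by
  have h1 := TimeFun.integ_one (c := 0) (N := N) ⟨zero_le_one.trans hu1, hN⟩
  have h2 := TimeFun.integ_one (c := 1) (N := N) ⟨hu1, hN⟩
  simp [dev₀, h1, h2]

lemma integ_delay_dev₀ (hu : 2 ≤ u) (hN : u ≤ N) :
    integ 1 N (delay (dev₀ e N q)) u =
      (trigSqrt 1 q.2 * (u - 1) ^ 2 - q.1.a * actCoeff e q.2 * (u - 2) ^ 2) / 2 := by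
  rw [TimeFun.integ_eq_of_quadratic (α₀ := -trigSqrt 1 q.2) (α₁ := trigSqrt 1 q.2) (α₂ := 0)
    (β₀ := -trigSqrt 1 q.2 + 2 * (q.1.a * actCoeff e q.2))
    (β₁ := trigSqrt 1 q.2 - q.1.a * actCoeff e q.2) (β₂ := 0) one_le_two hu hN]
  · ring
  · intro r hr
    rw [delay_apply, dev₀_of_le_one (by linarith [hr.1]) (by linarith [hr.2]) (by linarith)]
    ring
  · intro r hr
    rw [delay_apply, dev₀_of_one_le (by linarith [hr.1]) (by linarith [hr.2])]
    ring

lemma integ_delay_dev₀_of_le_two (hu : 1 ≤ u) (hu2 : u ≤ 2) (hN : u ≤ N) :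
    integ 1 N (delay (dev₀ e N q)) u = trigSqrt 1 q.2 * (u - 1) ^ 2 / 2 := by
  have hl : ∀ r ∈ Icc 1 u, (delay (dev₀ e N q)) r = -trigSqrt 1 q.2 + trigSqrt 1 q.2 * r + 0 * r ^ 2 := by
    intro r hr
    rw [delay_apply, dev₀_of_le_one (by linarith [hr.1]) (by linarith [hr.2]) (by linarith)]
    ring
  rw [TimeFun.integ_eq_of_quadratic (N := N) hu le_rfl hN hl
    (fun r hr => hl r ⟨hu.trans hr.1, hr.2⟩)]
  ring

lemma dev₁_of_two_le (hu : 2 ≤ u) (hN : u ≤ N) : dev₁ e N q u =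
    devPoly q.1.a q.1.b q.1.s q.1.τ (trigSqrt 1 q.2) (actCoeff e q.2) u := by
  have h1 := TimeFun.integ_one (c := 0) (N := N) ⟨by linarith, hN⟩
  have h2 := TimeFun.integ_one (c := 1) (N := N) ⟨by linarith, hN⟩
  simp only [dev₁, BoundedContinuousFunction.coe_sub, BoundedContinuousFunction.coe_smul,
    Pi.sub_apply, smul_eq_mul, h1, h2, integ_delay_dev₀ hu hN, devPoly]
  ring

lemma dev₁_of_le_two (hu : 1 ≤ u) (hu2 : u ≤ 2) (hN : u ≤ N) : dev₁ e N q u =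
    trigSqrt 1 q.2 * u - (q.1.a + q.1.b * q.1.s) * actCoeff e q.2 * (u - 1) -
      q.1.b * q.1.τ * actCoeff e q.2 * (trigSqrt 1 q.2 * (u - 1) ^ 2 / 2) := by
  have h1 := TimeFun.integ_one (c := 0) (N := N) ⟨by linarith, hN⟩
  have h2 := TimeFun.integ_one (c := 1) (N := N) ⟨by linarith, hN⟩
  simp only [dev₁, BoundedContinuousFunction.coe_sub, BoundedContinuousFunction.coe_smul,
    Pi.sub_apply, smul_eq_mul, h1, h2, integ_delay_dev₀_of_le_two hu hu2 hN]
  ring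

lemma integ_feedback₁ (hu : 2 ≤ u) (hN : u ≤ N) :
    actCoeff e q.2 * integ 1 N (feedback₁ e N q) u =
      posWorkPoly q.1.a q.1.b q.1.s q.1.τ (trigSqrt 1 q.2) (actCoeff e q.2) u := by
  have h2 := TimeFun.integ_one (c := 1) (N := N) ⟨by linarith, hN⟩
  simp only [feedback₁, Algebra.algebraMap_eq_smul_one, map_add, map_smul,
    BoundedContinuousFunction.coe_add, BoundedContinuousFunction.coe_smul,
    Pi.add_apply, smul_eq_mul, h2, integ_delay_dev₀ hu hN, posWorkPoly]
  ring

lemma integ_devWork₁ (hu : 2 ≤ u) (hN : u ≤ N) :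
    integ 1 N (((q.1.a + q.1.b * q.1.s) * actCoeff e q.2) • dev₁ e N q
      + (q.1.b * q.1.τ * actCoeff e q.2) • (delay (dev₀ e N q) * dev₀ e N q)) u =
      devWorkPoly q.1.a q.1.b q.1.s q.1.τ (trigSqrt 1 q.2) (actCoeff e q.2) u := by
  set S := trigSqrt 1 q.2
  set K := actCoeff e q.2
  set g := q.1.a + q.1.b * q.1.s with hg
  set h := q.1.b * q.1.τ with hh
  rw [map_add, map_smul, map_smul]
  simp only [BoundedContinuousFunction.coe_add, BoundedContinuousFunction.coe_smul,
    Pi.add_apply, smul_eq_mul]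
  -- The `α`s are the coefficients on `[1, 2]`, the `β`s those on `[2, u]`.
  rw [TimeFun.integ_eq_of_quadratic (h := dev₁ e N q) (α₀ := g * K - h * K * S / 2)
    (α₁ := S - g * K + h * K * S) (α₂ := - h * K * S / 2)
    (β₀ := g * K - h * K * ((S - q.1.a * K * 4) / 2))
    (β₁ := S - g * K - h * K * ((-2 * S + q.1.a * K * 4) / 2)) (β₂ := - h * K * ((S - q.1.a * K) / 2))
    one_le_two hu hN,
    TimeFun.integ_eq_of_quadratic (h := delay (dev₀ e N q) * dev₀ e N q)
    (α₀ := - S * q.1.a * K) (α₁ := -S * (S - q.1.a * K) + S * q.1.a * K) (α₂ := S * (S - q.1.a * K))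
    (β₀ := (-S + 2 * q.1.a * K) * (q.1.a * K))
    (β₁ := (-S + 2 * q.1.a * K) * (S - q.1.a * K) + (S - q.1.a * K) * (q.1.a * K))
    (β₂ := (S - q.1.a * K) ^ 2) one_le_two hu hN]
  · simp only [devWorkPoly]
    rw [← hg, ← hh]
    ring
  · intro r hr
    rw [BoundedContinuousFunction.coe_mul, Pi.mul_apply, delay_apply,
      dev₀_of_le_one (by linarith [hr.1]) (by linarith [hr.2]) (by linarith),
      dev₀_of_one_le (by linarith [hr.1]) (by linarith [hr.2])]
    ring
  · intro r hr
    rw [BoundedContinuousFunction.coe_mul, Pi.mul_apply, delay_apply,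
      dev₀_of_one_le (by linarith [hr.1]) (by linarith [hr.2]),
      dev₀_of_one_le (by linarith [hr.1]) (by linarith [hr.2])]
    ring
  · intro r hr
    rw [dev₁_of_le_two hr.1 hr.2 (by linarith [hr.2])]
    ring
  · intro r hr
    rw [dev₁_of_two_le hr.1 (by linarith [hr.2])]
    simp only [devPoly]
    ring

end Eval

/-! ### Expansion of the energy rate -/

/-- The energy change, divided by `τ` and the squared position when the control sets in. -/
def energyRate (e N : ℝ) (ϑ κ w : Params × ℝ → TimeFun) (U : Params × ℝ → ℝ) (q : Params × ℝ) : ℝ :=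
  -(q.1.s * posWork e N ϑ κ w q (U q + 1) + q.1.τ * devWork e N ϑ κ w q (U q + 1)) / ϑ q 1 ^ 2

/-- The energy rate to third order -/
def energyCoeffAt (e : ℝ) (q : Params × ℝ) : ℝ :=
  energyCoeff q.1.a q.1.b q.1.s q.1.τ (trigSqrt 1 q.2) (actCoeff e q.2)

/-- The class `𝒜` of coefficients is left open because two are needed: bounded functions along `2 ≤
U`, which require no regularity of the crossing time, and C¹ functions, which allow the remainder to
be differentiated. -/
theorem energyRate_expansion {e N : ℝ} {q₀ : Params × ℝ} {ϑ σ κ w : Params × ℝ → TimeFun}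
    (h : IsOnFamily e N q₀ ϑ σ κ w) {l : Filter (Params × ℝ)} (hl : l ≤ 𝓝 q₀)
    {𝒜 : Set (Params × ℝ → ℝ)} (hA : IsRingClass l 𝒜)
    (hcont : ∀ f : Params × ℝ → ℝ, ContDiffAt ℝ (↑(⊤ : ℕ∞)) f q₀ → f ∈ 𝒜)
    {U : Params × ℝ → ℝ} (hU : U ∈ 𝒜)
    (hev : ∀ f, TimeSmooth q₀ N 2 1 f → (fun q => f q (U q)) ∈ 𝒜)
    (hev' : ∀ f, TimeSmooth q₀ N 2 1 f → (fun q => f q (U q + 1)) ∈ 𝒜)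
    (hU2 : ∀ᶠ q in l, 2 ≤ U q) (hUN : ∀ᶠ q in l, U q + 1 ≤ N) (hwU : ∀ᶠ q in l, w q (U q) = 0)
    (hn : q₀.1.a * actCoeff e q₀.2 - trigSqrt 1 q₀.2 ≠ 0) (hϑ : ϑ q₀ 1 ≠ 0) :
    (fun q => energyRate e N ϑ κ w U q - energyCoeffAt e q) ∈
      OrderClass (fun q : Params × ℝ => q.1.s) (fun q => q.1.τ) l 𝒜 3 := by
  have M := hA.isModuleClass
  have M1 := M.orderClass (s := fun q : Params × ℝ => q.1.s) (τ := fun q => q.1.τ) 1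
  have M2 := M.orderClass (s := fun q : Params × ℝ => q.1.s) (τ := fun q => q.1.τ) 2
  have M3 := M.orderClass (s := fun q : Params × ℝ => q.1.s) (τ := fun q => q.1.τ) 3
  have hSc := contDiffAt_trigSqrt_snd (q₀ := q₀) 1
  have hKc := contDiffAt_actCoeff_snd (e := e) (q₀ := q₀)
  have ha := hcont (fun q => q.1.a) (by fun_prop)
  have hb := hcont (fun q => q.1.b) (by fun_prop)
  have hs := hcont (fun q => q.1.s) (by fun_prop)
  have hτ := hcont (fun q => q.1.τ) (by fun_prop)
  have hS := hcont _ hSc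
  have hK := hcont _ hKc
  have hnc : ContDiffAt ℝ (↑(⊤ : ℕ∞)) (fun q : Params × ℝ =>
      q.1.a * actCoeff e q.2 - trigSqrt 1 q.2) q₀ := by fun_prop
  have hm : (fun q : Params × ℝ => (q.1.a * actCoeff e q.2 - trigSqrt 1 q.2)⁻¹) ∈ 𝒜 :=
    hcont _ (hnc.inv hn)
  have hϑc : ∀ {f : Params × ℝ → TimeFun}, ContDiffAt ℝ (↑(⊤ : ℕ∞)) f q₀ →
      ContDiffAt ℝ (↑(⊤ : ℕ∞)) (fun q => f q 1) q₀ := fun hf =>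
    (BoundedContinuousFunction.evalCLM ℝ (α := ℝ) (β := ℝ) 1).contDiff.contDiffAt.comp q₀ hf
  have hr : (fun q => (ϑ q 1)⁻¹) ∈ 𝒜 := hcont _ ((hϑc h.pos).inv hϑ)
  have ev : ∀ {f k}, f ∈ TimeOrder q₀ N 2 1 k → (fun q => f q (U q)) ∈
      OrderClass (fun q : Params × ℝ => q.1.s) (fun q => q.1.τ) l 𝒜 k := fun hf =>
    OrderClass.map (D := 𝒜) hl (fun q (v : TimeFun) => v (U q)) (fun _ _ _ => rfl) (fun _ _ _ => rfl)
      hev hf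
  have ev' : ∀ {f k}, f ∈ TimeOrder q₀ N 2 1 k → (fun q => f q (U q + 1)) ∈
      OrderClass (fun q : Params × ℝ => q.1.s) (fun q => q.1.τ) l 𝒜 k := fun hf =>
    OrderClass.map (D := 𝒜) hl (fun q (v : TimeFun) => v (U q + 1)) (fun _ _ _ => rfl)
      (fun _ _ _ => rfl) hev' hf
  have key := energy_expansion hA ha hb hs hτ hS hK hU hm
    (A := fun q => posWork e N ϑ κ w q (U q + 1)) (B := fun q => devWork e N ϑ κ w q (U q + 1))
    (((hnc.continuousAt.eventually_ne hn).filter_mono hl).mono fun q hq => inv_mul_cancel₀ hq)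
    (M2.congr (M2.neg (ev h.order_dev)) (by
      filter_upwards [hU2, hUN, hwU] with q h1 h2 h3
      rw [← dev₁_of_two_le (N := N) h1 (by linarith)]
      simp [h3]))
    (M2.congr (ev' h.order_posWork) (by
      filter_upwards [hU2, hUN] with q h1 h2
      rw [← integ_feedback₁ (N := N) (by linarith) h2]
      simp))
    (M2.congr (ev' h.order_devWork) (by
      filter_upwards [hU2, hUN] with q h1 h2
      rw [← integ_devWork₁ (N := N) (by linarith) h2]
      simp))
  -- division by the squared position
  have hr1 : (fun q => ϑ q 1 - 1) ∈ OrderClass (fun q : Params × ℝ => q.1.s) (fun q => q.1.τ) l 𝒜 2 :=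
    OrderClass.map (D := 𝒜) hl (fun q (v : TimeFun) => v 1) (fun _ _ _ => rfl) (fun _ _ _ => rfl)
      (fun f hf => hcont _ (hϑc (TimeSmooth.contDiffAt hf))) h.order_pos
  have half := hA.const (1 / 2)
  have sixth := hA.const (1 / 6)
  have haK := hA.mul ha hK
  have hK2 := hA.pow hK 2
  -- `energyCoeffAt` is of first order and `ϑ(1)² - 1` of second, so the division changes third
  -- order terms only.
  have hE : energyCoeffAt e ∈ OrderClass (fun q : Params × ℝ => q.1.s) (fun q => q.1.τ) l 𝒜 (0 + 1) := by
    have hbK := hA.mul (hA.mul (hA.mul ha hb) hK2) (hA.pow hm 2)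
    have hSK := hA.sub haK (hA.mul (hA.const 2) hS)
    have h1 := hA.mul (hA.mul (hA.pow ha 2) hK2) hm
    have h2 := hA.mul (hA.mul h1 hSK) half
    have h3 := hA.mul (hA.mul hbK hSK) hs
    have h4 := hA.mul (hA.mul (hA.mul hbK (hA.add (hA.sub (hA.mul (hA.pow ha 2) hK2)
      (hA.mul (hA.const 3) (hA.mul haK hS))) (hA.mul (hA.const 4) (hA.pow hS 2)))) half) hτ
    have h5 := hA.mul (hA.mul (hA.mul hbK (hA.add (hA.add (hA.sub (hA.mul (hA.const 3)
      (hA.mul (hA.pow ha 3) (hA.pow hK 3))) (hA.mul (hA.const 9) (hA.mul (hA.mul (hA.pow ha 2) hK2) hS)))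
      (hA.mul (hA.const 7) (hA.mul haK (hA.pow hS 2)))) (hA.pow hS 3))) sixth) hτ
    refine ⟨_, hA.add (hA.sub (hA.neg h1) h3) h4, _, hA.add h2 h5, Eventually.of_forall fun q => ?_⟩
    simp only [energyCoeffAt, energyCoeff, smul_eq_mul, div_eq_mul_inv, mul_inv, one_mul, inv_pow]
    ring
  have h6 : (fun q => energyCoeffAt e q * ((ϑ q 1)⁻¹ ^ 2 * (-(ϑ q 1 + 1) * (ϑ q 1 - 1)))) ∈
      OrderClass (fun q : Params × ℝ => q.1.s) (fun q => q.1.τ) l 𝒜 (1 + 2) :=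
    hA.order_mul_order hE (hA.mul_order (hA.pow hr 2)
      (hA.mul_order (hA.neg (hA.add (hcont _ (hϑc h.pos)) (hA.const 1))) hr1))
  refine M3.congr (M3.sub h6 (hA.mul_order (hA.pow hr 2) key)) ?_
  filter_upwards [hl ((hϑc h.pos).continuousAt.eventually_ne hϑ)] with q hq
  simp only [energyRate, energyCoeffAt]
  field_simp
  ring

end Pendulum

namespace Pendulum
open TimeFun

/-! ### The crossing time -/

/-- The rescaled curve crosses the switching line at time `U` and keeps close to the starting
point. -/
structure IsOnPhase (e N : ℝ) (q : Params × ℝ) (ϑ σ κ w : TimeFun) (U : ℝ) : Prop where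
  curve : IsOnCurve e N q ϑ σ κ w
  one_lt : 1 < U
  lt_end : U + 1 < N
  cross : w U = 0
  dev_pos : ∀ u ∈ Ioo 0 U, 0 < w u
  dev_neg : ∀ u ∈ Ioc U N, w u < 0
  pos_close : ∀ u, |ϑ u - 1| ≤ 1 / 20
  vel_small : ∀ u, |vel q ϑ w u| ≤ 1 / 20

section
variable {e N a₀ b₀ : ℝ} {ϑ σ κ w : Params × ℝ → TimeFun}

lemma _root_.TimeFun.abs_sub_lt {f g : TimeFun} {δ : ℝ} (h : dist f g < δ) (u : ℝ) : |f u - g u| < δ :=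
  (BoundedContinuousFunction.dist_coe_le_dist u).trans_lt h

lemma IsOnCurve.hasDerivAt_dev_of_lt {q : Params × ℝ} {ϑ σ κ w : TimeFun}
    (h : IsOnCurve e N q ϑ σ κ w) {u : ℝ} (hu : u ∈ Ioo 0 1) (hN : 1 ≤ N) :
    HasDerivAt w (σ u - q.1.s * vel q ϑ w u) u := by
  have h1 := ((hasDerivAt_integ (c := 0) (N := N) ⟨hu.1, hu.2.trans_le hN⟩ σ).sub
    ((hasDerivAt_integ (c := 0) (N := N) ⟨hu.1, hu.2.trans_le hN⟩ (vel q ϑ w)).const_mul q.1.s))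
  refine h1.congr_of_eventuallyEq ?_
  filter_upwards [Iio_mem_nhds hu.2] with r hr
  have := congrArg (fun f : TimeFun => f r) h.dev
  simpa [integ_of_le (N := N) hr.le] using this

lemma IsOnCurve.hasDerivAt_dev {q : Params × ℝ} {ϑ σ κ w : TimeFun}
    (h : IsOnCurve e N q ϑ σ κ w) {u : ℝ} (hu : u ∈ Ioo 1 N) :
    HasDerivAt w (σ u - q.1.s * vel q ϑ w u - (feedback q ϑ w * act e κ) u) u := by
  have hu' : u ∈ Ioo 0 N := ⟨zero_lt_one.trans hu.1, hu.2⟩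
  have h1 := ((hasDerivAt_integ (c := 0) (N := N) hu' σ).sub
    ((hasDerivAt_integ (c := 0) (N := N) hu' (vel q ϑ w)).const_mul q.1.s)).sub
    (hasDerivAt_integ (c := 1) (N := N) hu (feedback q ϑ w * act e κ))
  refine h1.congr_of_eventuallyEq (Eventually.of_forall fun r => ?_)
  exact congrArg (fun f : TimeFun => f r) h.dev

lemma IsOnCurve.dev_zero {q : Params × ℝ} {ϑ σ κ w : TimeFun} (h : IsOnCurve e N q ϑ σ κ w) :
    w 0 = 0 := by
  have := congrArg (fun f : TimeFun => f 0) h.dev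
  simpa [integ_of_le (N := N) le_rfl, integ_of_le (N := N) zero_le_one] using this

/-- The family at the base point. -/
structure IsBased (N a₀ b₀ : ℝ) (ϑ σ κ w : Params × ℝ → TimeFun) : Prop where
  pos : ϑ (basePoint a₀ b₀) = 1
  sin : σ (basePoint a₀ b₀) = 1
  cos : κ (basePoint a₀ b₀) = 1
  dev : w (basePoint a₀ b₀) = integ 0 N 1 - a₀ • integ 1 N 1

lemma IsBased.dev_apply (hb : IsBased N a₀ b₀ ϑ σ κ w) {u : ℝ} (hu : u ∈ Icc 1 N) :
    w (basePoint a₀ b₀) u = u - a₀ * (u - 1) := by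
  rw [hb.dev]
  simp [TimeFun.integ_one (c := 0) (N := N) ⟨zero_le_one.trans hu.1, hu.2⟩, TimeFun.integ_one hu]

/-- At the base point `w` has slope `1` before time `1` and slope `1 - a₀ < 0` afterwards. Uniformly
close slopes still make `w` increase on `[0, 1]` and decrease on `[1, N]`, which leaves exactly one
positive zero. No differentiability of the crossing time is involved, so all `a₀ > 1` are covered.
-/
theorem exists_isOnPhase (h : IsOnFamily e N (basePoint a₀ b₀) ϑ σ κ w)
    (hb : IsBased N a₀ b₀ ϑ σ κ w) (ha : 1 < a₀) (hN : a₀ / (a₀ - 1) + 1 < N) :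
    ∃ U : Params × ℝ → ℝ, ∀ᶠ q in 𝓝 (basePoint a₀ b₀),
      IsOnPhase e N q (ϑ q) (σ q) (κ q) (w q) (U q) := by
  set q₀ := basePoint a₀ b₀ with hq₀
  have ha' : 0 < a₀ - 1 := by linarith
  have hU₀ : 1 < a₀ / (a₀ - 1) := by rw [lt_div_iff₀ ha']; linarith
  have bϑ : ϑ q₀ = 1 := hb.pos
  have bσ : σ q₀ = 1 := hb.sin
  have bκ : κ q₀ = 1 := hb.cos
  have hs0 : q₀.1.s = 0 := rfl
  have hτ0 : q₀.1.τ = 0 := rfl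
  have ha0 : q₀.1.a = a₀ := rfl
  have cϑ := h.pos.continuousAt
  have cσ := h.sin.continuousAt
  have cκ := h.cos.continuousAt
  have cw := h.dev.continuousAt
  have cs : ContinuousAt (fun q : Params × ℝ => q.1.s) q₀ := (by fun_prop : ContDiff ℝ 0 fun q : Params × ℝ => q.1.s).continuous.continuousAt
  have cτ : ContinuousAt (fun q : Params × ℝ => q.1.τ) q₀ := (by fun_prop : ContDiff ℝ 0 fun q : Params × ℝ => q.1.τ).continuous.continuousAt
  have ca : ContinuousAt (fun q : Params × ℝ => q.1.a) q₀ := (by fun_prop : ContDiff ℝ 0 fun q : Params × ℝ => q.1.a).continuous.continuousAt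
  have cb : ContinuousAt (fun q : Params × ℝ => q.1.b) q₀ := (by fun_prop : ContDiff ℝ 0 fun q : Params × ℝ => q.1.b).continuous.continuousAt
  have cv : ContinuousAt (fun q => vel q (ϑ q) (w q)) q₀ := (cs.smul cϑ).add (cτ.smul cw)
  have v0 : vel q₀ (ϑ q₀) (w q₀) = 0 := by simp [vel, hs0, hτ0]
  have cD : ContinuousAt (fun q => σ q - q.1.s • vel q (ϑ q) (w q)) q₀ := cσ.sub (cs.smul cv)
  have D0 : σ q₀ - q₀.1.s • vel q₀ (ϑ q₀) (w q₀) = 1 := by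
    simp [v0, bσ]
  have cF : ContinuousAt (fun q => feedback q (ϑ q) (w q) * act e (κ q)) q₀ :=
    (delay.continuous.continuousAt.comp ((ca.smul cϑ).add (cb.smul cv))).mul
      (continuousAt_const.add ((cκ.sub continuousAt_const).const_smul e))
  have hda : delay (1 : TimeFun) = 1 := rfl
  have F0 : feedback q₀ (ϑ q₀) (w q₀) * act e (κ q₀) = a₀ • 1 := by
    simp only [feedback, v0, act]
    simp [bϑ, bκ, ha0, hda]
  -- With these tolerances the slope is at least `3/4` before time `1` and at most `-(a₀ - 1)/2`
  -- after it.
  have E1 := Metric.continuousAt_iff'.1 cD ((min 1 (a₀ - 1)) / 4) (by positivity)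
  have E2 := Metric.continuousAt_iff'.1 cF ((a₀ - 1) / 4) (by positivity)
  have E3 := Metric.continuousAt_iff'.1 cϑ (1 / 20) (by positivity)
  have E4 := Metric.continuousAt_iff'.1 cv (1 / 20) (by positivity)
  have hNe : w q₀ (N - 1) < 0 := by
    rw [hq₀, hb.dev_apply ⟨by linarith, by linarith⟩]
    have : a₀ / (a₀ - 1) < N - 1 := by linarith
    rw [div_lt_iff₀ ha'] at this
    nlinarith
  have E5 : ∀ᶠ q in 𝓝 q₀, w q (N - 1) < 0 :=
    ((BoundedContinuousFunction.evalCLM ℝ (α := ℝ) (β := ℝ) (N - 1)).continuous.continuousAt.comp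
      cw).eventually_lt_const hNe
  have key : ∀ᶠ q in 𝓝 q₀, ∃ U, IsOnPhase e N q (ϑ q) (σ q) (κ q) (w q) U := by
    filter_upwards [h.eq, E1, E2, E3, E4, E5] with q hq e1 e2 e3 e4 e5
    rw [D0] at e1
    rw [F0] at e2
    rw [v0] at e4
    have e3' : dist (ϑ q) 1 < 1 / 20 := by rw [← hb.pos]; exact e3
    have hc := (w q).continuous
    have d1 : ∀ u, |σ q u - q.1.s * vel q (ϑ q) (w q) u - 1| < min 1 (a₀ - 1) / 4 := fun u => by
      simpa using TimeFun.abs_sub_lt e1 u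
    have d2 : ∀ u, |(feedback q (ϑ q) (w q) * act e (κ q)) u - a₀| < (a₀ - 1) / 4 := fun u => by
      simpa using TimeFun.abs_sub_lt e2 u
    have m1 : StrictMonoOn (w q) (Icc 0 1) := by
      refine strictMonoOn_of_deriv_pos (convex_Icc 0 1) hc.continuousOn fun u hu => ?_
      rw [interior_Icc] at hu
      rw [(hq.hasDerivAt_dev_of_lt hu (by linarith)).deriv]
      have := (abs_lt.1 (d1 u)).1
      have := min_le_left 1 (a₀ - 1)
      linarith
    have m2 : StrictAntiOn (w q) (Icc 1 N) := by
      refine strictAntiOn_of_deriv_neg (convex_Icc 1 N) hc.continuousOn fun u hu => ?_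
      rw [interior_Icc] at hu
      rw [(hq.hasDerivAt_dev hu).deriv]
      have := (abs_lt.1 (d1 u)).2
      have := (abs_lt.1 (d2 u)).1
      have := min_le_right 1 (a₀ - 1)
      linarith
    have w1 : 0 < w q 1 := by
      rw [← hq.dev_zero]
      exact m1 (left_mem_Icc.2 zero_le_one) (right_mem_Icc.2 zero_le_one) zero_lt_one
    obtain ⟨U, hU, hU0⟩ := intermediate_value_Ioo' (by linarith : (1 : ℝ) ≤ N - 1) hc.continuousOn
      (⟨e5, w1⟩ : (0 : ℝ) ∈ Ioo (w q (N - 1)) (w q 1))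
    refine ⟨U, hq, hU.1, by linarith [hU.2], hU0, fun u hu => ?_, fun u hu => ?_, fun u => ?_,
      fun u => ?_⟩
    · rcases le_or_gt u 1 with hu1 | hu1
      · rw [← hq.dev_zero]
        exact m1 (left_mem_Icc.2 zero_le_one) ⟨hu.1.le, hu1⟩ hu.1
      · rw [← hU0]
        exact m2 ⟨hu1.le, by linarith [hu.2, hU.2]⟩ ⟨hU.1.le, by linarith [hU.2]⟩ hu.2
    · rw [← hU0]
      exact m2 ⟨hU.1.le, by linarith [hU.2]⟩ ⟨hU.1.le.trans hu.1.le, hu.2⟩ hu.1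
    · simpa using (TimeFun.abs_sub_lt e3' u).le
    · simpa using (TimeFun.abs_sub_lt e4 u).le
  classical
  refine ⟨fun q => if hq : ∃ U, IsOnPhase e N q (ϑ q) (σ q) (κ q) (w q) U then hq.choose else 0, ?_⟩
  filter_upwards [key] with q hq
  rw [dif_pos hq]
  exact hq.choose_spec

lemma IsOnPhase.eq_of_zero {q : Params × ℝ} {ϑ σ κ w : TimeFun} {U u : ℝ}
    (h : IsOnPhase e N q ϑ σ κ w U) (hu : u ∈ Ioc 0 N) (h0 : w u = 0) : u = U := by
  rcases lt_trichotomy u U with h1 | h1 | h1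
  · exact absurd h0 (h.dev_pos u ⟨hu.1, h1⟩).ne'
  · exact h1
  · exact absurd h0 (h.dev_neg u ⟨h1, hu.2⟩).ne

/-- For `a₀ < 2` the unperturbed zero exceeds `2`, where `(q, u) ↦ w q u` is of class C² and has
time derivative `1 - a₀ ≠ 0`. The implicit function theorem applies, and uniqueness of the zero
identifies its branch with `U`. -/
lemma contDiffAt_crossing (h : IsOnFamily e N (basePoint a₀ b₀) ϑ σ κ w)
    (hb : IsBased N a₀ b₀ ϑ σ κ w) (ha : 1 < a₀) (ha2 : a₀ < 2) (hN : a₀ / (a₀ - 1) + 1 < N)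
    {U : Params × ℝ → ℝ}
    (hU : ∀ᶠ q in 𝓝 (basePoint a₀ b₀), IsOnPhase e N q (ϑ q) (σ q) (κ q) (w q) (U q)) :
    ContDiffAt ℝ 2 U (basePoint a₀ b₀) ∧ U (basePoint a₀ b₀) = a₀ / (a₀ - 1) := by
  set q₀ := basePoint a₀ b₀ with hq₀
  have ha' : 0 < a₀ - 1 := by linarith
  set U₀ := a₀ / (a₀ - 1) with hU₀
  have hU₀2 : 2 < U₀ := by rw [hU₀, lt_div_iff₀ ha']; linarith
  have hsm : ContDiffAt ℝ 2 (fun x : (Params × ℝ) × ℝ => w x.1 x.2) (q₀, U₀) :=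
    h.timeSmooth_dev.contDiffAt_eval ⟨hU₀2, by linarith⟩
  have hw0 : w q₀ U₀ = 0 := by
    rw [hq₀, hb.dev_apply ⟨by linarith, by linarith⟩, hU₀]
    field_simp
    ring
  have hder : HasDerivAt (w q₀) (1 - a₀) U₀ := by
    have h1 := h.eq.self_of_nhds.hasDerivAt_dev (u := U₀) ⟨by linarith, by linarith⟩
    have hda : delay (1 : TimeFun) = 1 := rfl
    have bϑ : ϑ q₀ = 1 := hb.pos
    have bσ : σ q₀ = 1 := hb.sin
    have bκ : κ q₀ = 1 := hb.cos
    have hs0 : q₀.1.s = 0 := rfl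
    have hτ0 : q₀.1.τ = 0 := rfl
    have ha0 : q₀.1.a = a₀ := rfl
    refine h1.congr_deriv ?_
    simp [feedback, vel, act, bσ, bϑ, bκ, hda, hs0, hτ0, ha0]
  have hinv : (fderiv ℝ (fun x : (Params × ℝ) × ℝ => w x.1 x.2) (q₀, U₀) ∘L
      .inr ℝ (Params × ℝ) ℝ).IsInvertible := by
    have h1 : HasFDerivAt (fun u : ℝ => (q₀, u)) (ContinuousLinearMap.inr ℝ (Params × ℝ) ℝ) U₀ :=
      (hasFDerivAt_const q₀ U₀).prodMk (hasFDerivAt_id U₀)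
    have h2 := ((hsm.differentiableAt (by simp)).hasFDerivAt).comp U₀ h1
    rw [← hder.hasFDerivAt.unique h2]
    refine ⟨ContinuousLinearEquiv.unitsEquivAut ℝ (Units.mk0 (1 - a₀) (by linarith)), ?_⟩
    ext
    simp
  set Y := hsm.implicitFunction (by simp) hinv with hY
  have hYs : ContDiffAt ℝ 2 Y q₀ := hsm.contDiffAt_implicitFunction (by simp) hinv
  have hY0 : Y q₀ = U₀ := hsm.implicitFunction_apply_self (by simp) hinv
  have hYe : ∀ᶠ q in 𝓝 q₀, w q (Y q) = w q₀ U₀ :=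
    hsm.eventually_apply_implicitFunction (by simp) hinv
  have hUY : ∀ᶠ q in 𝓝 q₀, U q = Y q := by
    have hm : ∀ᶠ q in 𝓝 q₀, Y q ∈ Ioo 0 N :=
      hYs.continuousAt.eventually (Ioo_mem_nhds (by rw [hY0]; linarith) (by rw [hY0]; linarith))
    filter_upwards [hYe, hU, hm] with q h1 h2 h3
    exact (h2.eq_of_zero ⟨h3.1, h3.2.le⟩ (h1.trans hw0)).symm
  exact ⟨hYs.congr_of_eventuallyEq hUY, hUY.self_of_nhds.trans hY0⟩

end
end Pendulum

/-! ### Size and derivatives of functions of given order -/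

section OrderBounds
variable {X : Type*} {l : Filter X} {s τ : X → ℝ}

/-- functions that are bounded along a filter -/
def boundedAlong (l : Filter X) : Set (X → ℝ) := {f | ∃ C, ∀ᶠ x in l, |f x| ≤ C}

lemma isRingClass_boundedAlong (l : Filter X) : IsRingClass l (boundedAlong l) where
  const c := ⟨|c|, Eventually.of_forall fun _ => le_rfl⟩
  add := by
    rintro f g ⟨C, hC⟩ ⟨D, hD⟩
    refine ⟨C + D, ?_⟩
    filter_upwards [hC, hD] with x h1 h2
    exact (abs_add_le _ _).trans (add_le_add h1 h2)
  mul := by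
    rintro f g ⟨C, hC⟩ ⟨D, hD⟩
    refine ⟨C * D, ?_⟩
    filter_upwards [hC, hD] with x h1 h2
    rw [abs_mul]
    exact mul_le_mul h1 h2 (abs_nonneg _) ((abs_nonneg _).trans h1)
  congr := by
    rintro f g ⟨C, hC⟩ h
    refine ⟨C, ?_⟩
    filter_upwards [hC, h] with x h1 h2
    rwa [h2]

lemma OrderClass.abs_le {k : ℕ} {f : X → ℝ} (hf : f ∈ OrderClass s τ l (boundedAlong l) k) :
    ∃ C, ∀ᶠ x in l, |f x| ≤ C * (|s x| + |τ x|) ^ k := by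
  induction k generalizing f with
  | zero =>
    obtain ⟨C, hC⟩ : f ∈ boundedAlong l := hf
    exact ⟨C, by simpa using hC⟩
  | succ k ih =>
    obtain ⟨g, hg, h, hh, he⟩ := hf
    obtain ⟨C, hC⟩ := ih hg
    obtain ⟨D, hD⟩ := ih hh
    refine ⟨|C| + |D|, ?_⟩
    filter_upwards [hC, hD, he] with x h1 h2 h3
    have h1' : |g x| ≤ |C| * (|s x| + |τ x|) ^ k := h1.trans (by gcongr; exact le_abs_self _)
    have h2' : |h x| ≤ |D| * (|s x| + |τ x|) ^ k := h2.trans (by gcongr; exact le_abs_self _)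
    rw [h3, smul_eq_mul, smul_eq_mul]
    have a1 : |s x| ≤ |s x| + |τ x| := le_add_of_nonneg_right (abs_nonneg _)
    have a2 : |τ x| ≤ |s x| + |τ x| := le_add_of_nonneg_left (abs_nonneg _)
    calc |s x * g x + τ x * h x| ≤ |s x| * |g x| + |τ x| * |h x| := by
          rw [← abs_mul, ← abs_mul]; exact abs_add_le _ _
      _ ≤ (|s x| + |τ x|) * (|C| * (|s x| + |τ x|) ^ k) +
          (|s x| + |τ x|) * (|D| * (|s x| + |τ x|) ^ k) := by gcongr
      _ = _ := by ring

end OrderBounds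

section OrderSmooth
variable {E : Type*} [NormedAddCommGroup E] [NormedSpace ℝ E] {q₀ : E} {s τ : E → ℝ}

lemma isRingClass_contDiffAt (q₀ : E) (n : WithTop ℕ∞) :
    IsRingClass (𝓝 q₀) {f : E → ℝ | ContDiffAt ℝ n f q₀} where
  const _ := contDiffAt_const
  add h1 h2 := ContDiffAt.add h1 h2
  mul h1 h2 := ContDiffAt.mul h1 h2
  congr h1 h2 := ContDiffAt.congr_of_eventuallyEq h1 h2

lemma ContDiffAt.mem_boundedAlong {n : WithTop ℕ∞} {f : E → ℝ} (hf : ContDiffAt ℝ n f q₀) :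
    f ∈ boundedAlong (𝓝 q₀) :=
  ⟨|f q₀| + 1, (hf.continuousAt.abs.eventually_lt_const (lt_add_one |f q₀|)).mono fun _ h => h.le⟩

/-- Directional derivatives along directions that do not change `s` and `τ`. -/
lemma OrderClass.fderiv_apply {k : ℕ} {f : E → ℝ} {v : E}
    (hf : f ∈ OrderClass s τ (𝓝 q₀) {f | ContDiffAt ℝ 1 f q₀} k)
    (hs : Differentiable ℝ s) (hτ : Differentiable ℝ τ) (hsv : ∀ q, fderiv ℝ s q v = 0)
    (hτv : ∀ q, fderiv ℝ τ q v = 0) :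
    (fun q => fderiv ℝ f q v) ∈ OrderClass s τ (𝓝 q₀) (boundedAlong (𝓝 q₀)) k ∧
      ∀ᶠ q in 𝓝 q₀, DifferentiableAt ℝ f q := by
  induction k generalizing f with
  | zero =>
    have hf' : ContDiffAt ℝ 1 f q₀ := hf
    have h1 : ContDiffAt ℝ 0 (fun q => fderiv ℝ f q v) q₀ :=
      (hf'.fderiv_right (m := 0) (by norm_num)).clm_apply contDiffAt_const
    exact ⟨h1.mem_boundedAlong,
      (hf'.eventually (by simp)).mono fun q hq => hq.differentiableAt (by simp)⟩
  | succ k ih =>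
    obtain ⟨g, hg, h, hh, he⟩ := hf
    obtain ⟨g1, g2⟩ := ih hg
    obtain ⟨h1, h2⟩ := ih hh
    -- In the direction `v` the terms with the derivatives of `s` and `τ` drop out, so
    -- differentiation acts on the coefficients alone and the order is preserved.
    have key : ∀ᶠ q in 𝓝 q₀, HasFDerivAt f (s q • fderiv ℝ g q + g q • fderiv ℝ s q +
        (τ q • fderiv ℝ h q + h q • fderiv ℝ τ q)) q := by
      filter_upwards [he.eventually_nhds, g2, h2] with q e1 e2 e3
      exact (((hs q).hasFDerivAt.mul e2.hasFDerivAt).add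
        ((hτ q).hasFDerivAt.mul e3.hasFDerivAt)).congr_of_eventuallyEq e1
    refine ⟨⟨_, g1, _, h1, ?_⟩, key.mono fun q hq => hq.differentiableAt⟩
    filter_upwards [key] with q hq
    rw [hq.fderiv]
    simp [hsv, hτv]

end OrderSmooth

/-! ### The energy rate of the family: bounds and smoothness -/

namespace Pendulum

section
variable {e N a₀ b₀ : ℝ} {ϑ σ κ w : Params × ℝ → TimeFun} {U : Params × ℝ → ℝ}

lemma actCoeff_zero (e : ℝ) : actCoeff e 0 = 1 := by
  simp [actCoeff, trigSqrt_zero_right]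

/-- bound for the energy rate when the crossing time exceeds twice the delay -/
theorem energyRate_bound (h : IsOnFamily e N (basePoint a₀ b₀) ϑ σ κ w)
    (hb : IsBased N a₀ b₀ ϑ σ κ w) (ha : 1 < a₀)
    (hU : ∀ᶠ q in 𝓝 (basePoint a₀ b₀), IsOnPhase e N q (ϑ q) (σ q) (κ q) (w q) (U q)) :
    ∃ C, ∀ᶠ q in 𝓝 (basePoint a₀ b₀), 2 ≤ U q →
      |energyRate e N ϑ κ w U q - energyCoeffAt e q| ≤ C * (|q.1.s| + |q.1.τ|) ^ 3 := by
  set q₀ := basePoint a₀ b₀ with hq₀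
  -- The polynomial formulas hold for crossing times at least `2`, so the filter is restricted to
  -- these. Values at `U` are bounded by sup norms, whatever the regularity of `U`.
  set l := 𝓝 q₀ ⊓ 𝓟 {q | 2 ≤ U q} with hl
  have hle : l ≤ 𝓝 q₀ := inf_le_left
  have hbd : ∀ f : Params × ℝ → TimeFun, ContDiffAt ℝ (↑(⊤ : ℕ∞)) f q₀ → ∀ V : Params × ℝ → ℝ,
      (fun q => f q (V q)) ∈ boundedAlong l := fun f hf V => by
    refine ⟨‖f q₀‖ + 1, ?_⟩
    filter_upwards [(hf.continuousAt.norm.eventually_lt_const (lt_add_one _)).filter_mono hle] with q hq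
    exact ((f q).norm_coe_le_norm (V q)).trans hq.le
  have key := energyRate_expansion h hle (isRingClass_boundedAlong l) (U := U)
    (fun f hf => by
      obtain ⟨C, hC⟩ := hf.mem_boundedAlong
      exact ⟨C, hC.filter_mono hle⟩)
    ⟨|N|, by
      filter_upwards [hU.filter_mono hle] with q hq
      have := hq.one_lt
      have := hq.lt_end
      rw [abs_of_pos (by linarith), abs_of_pos (by linarith)]
      linarith⟩
    (fun f hf => hbd f hf.contDiffAt _) (fun f hf => hbd f hf.contDiffAt _)
    (by rw [hl]; exact (eventually_principal.2 fun q hq => hq).filter_mono inf_le_right)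
    ((hU.filter_mono hle).mono fun q hq => hq.lt_end.le)
    ((hU.filter_mono hle).mono fun q hq => hq.cross)
    (by
      change a₀ * actCoeff e 0 - trigSqrt 1 0 ≠ 0
      rw [actCoeff_zero, trigSqrt_zero_right]
      norm_num
      linarith)
    (by rw [hb.pos]; simp)
  obtain ⟨C, hC⟩ := OrderClass.abs_le key
  exact ⟨C, eventually_inf_principal.1 hC⟩

/-- expansion of the energy rate with continuously differentiable coefficients, and its smoothness -/
theorem energyRate_smooth (h : IsOnFamily e N (basePoint a₀ b₀) ϑ σ κ w)
    (hb : IsBased N a₀ b₀ ϑ σ κ w) (ha : 1 < a₀) (ha2 : a₀ < 2) (hN : a₀ / (a₀ - 1) + 1 < N)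
    (hU : ∀ᶠ q in 𝓝 (basePoint a₀ b₀), IsOnPhase e N q (ϑ q) (σ q) (κ q) (w q) (U q)) :
    (∀ᶠ q in 𝓝 (basePoint a₀ b₀), 2 ≤ U q) ∧
    ContDiffAt ℝ 2 (energyRate e N ϑ κ w U) (basePoint a₀ b₀) ∧
    ContDiffAt ℝ 2 (fun q => ϑ q 1) (basePoint a₀ b₀) ∧
    (fun q => energyRate e N ϑ κ w U q - energyCoeffAt e q) ∈
      OrderClass (fun q : Params × ℝ => q.1.s) (fun q => q.1.τ) (𝓝 (basePoint a₀ b₀))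
        {f | ContDiffAt ℝ 1 f (basePoint a₀ b₀)} 3 := by
  obtain ⟨hUs, hU0⟩ := contDiffAt_crossing h hb ha ha2 hN hU
  set q₀ := basePoint a₀ b₀ with hq₀
  have ha' : 0 < a₀ - 1 := by linarith
  have hU2 : 2 < U q₀ := by rw [hU0, lt_div_iff₀ ha']; linarith
  have hUN : U q₀ + 1 < N := by rw [hU0]; exact hN
  have h2 : (2 : WithTop ℕ∞) ≤ (↑(⊤ : ℕ∞)) := WithTop.coe_le_coe.2 le_top
  have hϑ1 : ContDiffAt ℝ (↑(⊤ : ℕ∞)) (fun q => ϑ q 1) q₀ :=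
    (BoundedContinuousFunction.evalCLM ℝ (α := ℝ) (β := ℝ) 1).contDiff.contDiffAt.comp q₀ h.pos
  have hϑ0 : ϑ q₀ 1 ≠ 0 := by rw [hb.pos]; simp
  have ev : ∀ {f : Params × ℝ → TimeFun} {n : ℕ} {V : Params × ℝ → ℝ}, TimeSmooth q₀ N 2 n f →
      ContDiffAt ℝ n V q₀ → V q₀ ∈ Ioo 2 N → ContDiffAt ℝ n (fun q => f q (V q)) q₀ :=
    fun {f n V} hf hV hV0 => ContDiffAt.comp (g := fun x : (Params × ℝ) × ℝ => f x.1 x.2)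
      (f := fun q => (q, V q)) q₀ (hf.contDiffAt_eval hV0) (contDiffAt_id.prodMk hV)
  have hU1 : ContDiffAt ℝ 2 (fun q => U q + 1) q₀ := hUs.add contDiffAt_const
  have one : (1 : WithTop ℕ∞) ≤ 2 := by norm_num
  refine ⟨?_, ?_, hϑ1.of_le h2, ?_⟩
  · exact (hUs.continuousAt.eventually_const_lt hU2).mono fun q hq => hq.le
  · have hA := ev (n := 2) h.timeSmooth_posWork hU1 ⟨by linarith, hUN⟩
    have hB := ev (n := 2) h.timeSmooth_devWork hU1 ⟨by linarith, hUN⟩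
    have hm := (hϑ1.of_le h2).pow 2
    have hm0 : ϑ q₀ 1 ^ 2 ≠ 0 := pow_ne_zero _ hϑ0
    unfold energyRate
    refine ContDiffAt.div (ContDiffAt.neg (ContDiffAt.add (ContDiffAt.mul ?_ hA)
      (ContDiffAt.mul ?_ hB))) hm hm0 <;> fun_prop
  · refine energyRate_expansion h le_rfl (isRingClass_contDiffAt q₀ 1)
      (fun f hf => hf.of_le (one.trans h2)) (U := U) (hUs.of_le one)
      (fun f hf => ev (n := 1) hf (hUs.of_le one) ⟨hU2, by linarith⟩)
      (fun f hf => ev (n := 1) hf (hU1.of_le one) ⟨by linarith, hUN⟩)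
      ((hUs.continuousAt.eventually_const_lt hU2).mono fun q hq => hq.le)
      (hU.mono fun q hq => hq.lt_end.le) (hU.mono fun q hq => hq.cross) ?_ hϑ0
    change a₀ * actCoeff e 0 - trigSqrt 1 0 ≠ 0
    rw [actCoeff_zero, trigSqrt_zero_right]
    norm_num
    linarith

end
end Pendulum

namespace Pendulum

/-! ### Shifts, uniqueness and free motion -/

section Orbits
variable {G θ φ θ' φ' : ℝ → ℝ} {p : Params}

lemma IsSolution.shift (hG : IsActuation G) (h : IsSolution G p θ φ)
    (hθ : Continuous θ) (hφ : Continuous φ) {t₁ : ℝ} (ht₁ : 0 ≤ t₁) :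
    IsSolution G p (fun t => θ (t + t₁)) (fun t => φ (t + t₁)) := by
  have hc : ∀ r, control p (fun t => θ (t + t₁)) (fun t => φ (t + t₁)) r = control p θ φ (r + t₁) := by
    intro r
    simp only [control, show r - p.τ + t₁ = r + t₁ - p.τ by ring]
  have hI : ∀ t t', IntervalIntegrable (fun r => Real.sin (θ r) + control p θ φ r * G (θ r)) volume t t' :=
    fun t t' => intervalIntegrable_mul_actuation hG hθ (intervalIntegrable_control p hθ hφ t t')
  refine ⟨by fun_prop, by fun_prop, fun t ht => ?_, fun t ht => ?_⟩
  · have h1 := h.pos_eq (t + t₁) (by linarith)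
    have h2 := h.pos_eq t₁ ht₁
    rw [intervalIntegral.integral_comp_add_right (fun r => φ r), zero_add, h1, h2, add_assoc,
      intervalIntegral.integral_add_adjacent_intervals (hφ.intervalIntegrable _ _)
        (hφ.intervalIntegrable _ _)]
  · have h1 := h.vel_eq (t + t₁) (by linarith)
    have h2 := h.vel_eq t₁ ht₁
    simp only [hc]
    rw [intervalIntegral.integral_comp_add_right
      (fun r => Real.sin (θ r) + control p θ φ r * G (θ r)), zero_add, h1, h2, add_assoc,
      intervalIntegral.integral_add_adjacent_intervals (hI _ _) (hI _ _)]

lemma control_eq_zero {t : ℝ} (h : region p (θ (t - p.τ)) (φ (t - p.τ)) ≤ 0) :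
    control p θ φ t = 0 := if_neg h.not_gt

/-- The forward orbit of a point is unique. -/
lemma IsForwardOrbit.unique (hG : IsActuation G) (hτ : 0 < p.τ) {x : ℝ} (h : IsForwardOrbit G p x θ φ)
    (h' : IsForwardOrbit G p x θ' φ') {t : ℝ} (ht : 0 ≤ t) : θ t = θ' t ∧ φ t = φ' t := by
  have main : ∀ {θ φ θ' φ' : ℝ → ℝ}, Continuous θ → Continuous φ → Continuous θ' → Continuous φ' →
      IsForwardOrbit G p x θ φ → IsForwardOrbit G p x θ' φ' → θ t = θ' t ∧ φ t = φ' t := by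
    intro θ φ θ' φ' c1 c2 c3 c4 h h'
    refine h.isSolution.eq_model hG hτ c1 c2 c3 c4 (h'.isSolution.solvesOn t)
      (h.pos_zero.trans h'.pos_zero.symm) (h.vel_zero.trans h'.vel_zero.symm) countable_empty ?_
      t ⟨ht, le_rfl⟩
    intro r hr hag
    rcases le_or_gt 0 (r - p.τ) with h1 | h1
    · exact control_congr (hag h1).1 (hag h1).2
    · rw [control_eq_zero (h.off_before _ ⟨by linarith [hr.1.1], h1.le⟩),
        control_eq_zero (h'.off_before _ ⟨by linarith [hr.1.1], h1.le⟩)]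
  obtain ⟨θ₁, φ₁, c1, c2, e1, e2, o1⟩ := h.exists_continuous hτ
  obtain ⟨θ₂, φ₂, c3, c4, e3, e4, o2⟩ := h'.exists_continuous hτ
  have htI : t ∈ Ici (-p.τ) := by simp only [mem_Ici]; linarith
  rw [e1 htI, e2 htI, e3 htI, e4 htI]
  exact main c1 c2 c3 c4 o1 o2

lemma SolvesOn.hasDerivAt_free {t₀ t₁ t : ℝ} (h : SolvesOn G (fun _ => 0) θ φ t₀ t₁)
    (hθ : Continuous θ) (hφ : Continuous φ) (ht : t ∈ Ioo t₀ t₁) :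
    HasDerivAt θ (φ t) t ∧ HasDerivAt φ (Real.sin (θ t)) t := by
  have hs : Continuous fun r => Real.sin (θ r) := Real.continuous_sin.comp hθ
  have hn : Ioo t₀ t₁ ∈ 𝓝 t := Ioo_mem_nhds ht.1 ht.2
  constructor
  · refine (((hφ.integral_hasStrictDerivAt t₀ t).hasDerivAt).const_add (θ t₀)).congr_of_eventuallyEq ?_
    filter_upwards [hn] with r hr using h.pos_eq r (Ioo_subset_Icc_self hr)
  · refine (((hs.integral_hasStrictDerivAt t₀ t).hasDerivAt).const_add (φ t₀)).congr_of_eventuallyEq ?_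
    filter_upwards [hn] with r hr
    simpa using h.vel_eq r (Ioo_subset_Icc_self hr)

lemma eq_of_hasDerivAt_zero {f : ℝ → ℝ} {t₀ t₁ : ℝ} (hf : Continuous f) (h01 : t₀ ≤ t₁)
    (hd : ∀ t ∈ Ioo t₀ t₁, HasDerivAt f 0 t) : f t₁ = f t₀ := by
  rcases h01.eq_or_lt with rfl | h01
  · rfl
  obtain ⟨c, hc, hc'⟩ := exists_hasDerivAt_eq_slope f (fun _ => 0) h01 hf.continuousOn hd
  have := sub_pos.2 h01
  field_simp at hc'
  linarith

/-- Conservation of energy in free motion. -/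
lemma SolvesOn.hamiltonian_eq {t₀ t₁ : ℝ} (h : SolvesOn G (fun _ => 0) θ φ t₀ t₁)
    (hθ : Continuous θ) (hφ : Continuous φ) (h01 : t₀ ≤ t₁) :
    hamiltonian (θ t₁) (φ t₁) = hamiltonian (θ t₀) (φ t₀) := by
  refine eq_of_hasDerivAt_zero (f := fun t => hamiltonian (θ t) (φ t)) (by unfold hamiltonian; fun_prop)
    h01 fun t ht => ?_
  obtain ⟨h1, h2⟩ := h.hasDerivAt_free hθ hφ ht
  refine (((h2.pow 2).div_const 2).add h1.cos).congr_deriv ?_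
  simp
  ring

/-- The upright position is unstable: close to `x`, gravity pushes outwards with strength comparable
to `|x|`. This is what makes a free orbit in the OFF region move back to the line. -/
lemma mul_sin_ge {x y : ℝ} (hx : |x| ≤ 1 / 2) (hy : |y - x| ≤ |x| / 10) : x ^ 2 * (3 / 5) ≤ x * Real.sin y := by
  wlog hx0 : 0 ≤ x generalizing x y
  · have := this (x := -x) (y := -y) (by rwa [abs_neg]) (by
      rw [abs_neg, ← abs_neg]; simpa [sub_eq_add_neg, add_comm] using hy) (by linarith)
    simpa using this
  rw [abs_of_nonneg hx0] at hx hy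
  obtain ⟨h1, h2⟩ := abs_le.1 hy
  rcases hx0.eq_or_lt with rfl | hx0
  · simp
  have h3 : y - y ^ 3 / 6 < Real.sin y := Real.sin_gt_sub_cube (by linarith)
  have h4 : y ^ 2 ≤ 1 / 2 := by nlinarith
  have h5 : y ^ 3 ≤ y / 2 := by nlinarith
  have : 3 / 5 * x ≤ Real.sin y := by linarith
  nlinarith

/-- Free motion from a point in the OFF region returns to the switching line. -/
lemma exists_free_return (hG : IsActuation G) {x s β θ₁ φ₁ : ℝ} (hx : x ≠ 0) (hx2 : |x| ≤ 1 / 2)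
    (hs : |s| ≤ 1 / 2) (hβ : β ≤ 1 / 100) (hθ₁ : |θ₁ - x| ≤ |x| / 20) (hφ₁ : |φ₁| ≤ |x| / 20)
    (hψ : x * (φ₁ - s * θ₁) < 0) (hψ' : |φ₁ - s * θ₁| ≤ |x| * β) :
    ∃ (ℓ : ℝ) (θ φ : ℝ → ℝ), 0 < ℓ ∧ ℓ ≤ 4 * β ∧ Continuous θ ∧ Continuous φ ∧ θ 0 = θ₁ ∧ φ 0 = φ₁ ∧
      SolvesOn G (fun _ => 0) θ φ 0 ℓ ∧ (∀ t ∈ Icc 0 ℓ, |θ t - x| ≤ |x| / 10 ∧ |φ t| ≤ |x| / 10) ∧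
      (∀ t ∈ Ico 0 ℓ, x * (φ t - s * θ t) < 0) ∧ φ ℓ = s * θ ℓ := by
  have hx0 : 0 < |x| := abs_pos.2 hx
  have hβ0 : 0 < β := by
    by_contra hc
    have h1 : |φ₁ - s * θ₁| ≤ 0 := hψ'.trans (mul_nonpos_of_nonneg_of_nonpos hx0.le (not_lt.1 hc))
    rw [abs_nonpos_iff.1 h1] at hψ
    simp at hψ
  -- The quantity `x (φ - s θ)` starts above `-x² β` and grows at rate at least `x²/2`, so it is
  -- positive at time `4 β`. As `β ≤ 1/100`, position and velocity move by at most `|x|/20`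
  -- meanwhile.
  obtain ⟨θ, φ, cθ, cφ, hθ0, hφ0, hsol⟩ := exists_solvesOn (t₀ := 0) (ℓ := 4 * β) (M := 0) hG
    (by positivity) (F := fun _ => 0) measurable_const (fun _ _ => by simp) θ₁ φ₁
  rw [zero_add] at hsol
  have hz : SolvesOn G (fun _ => 0) (fun _ => 0) (fun _ => 0) 0 (4 * β) :=
    ⟨fun t _ => by simp, fun t _ => by simp⟩
  have hθ₁' : |θ₁| ≤ |x| * (21 / 20) := by
    have := abs_sub_abs_le_abs_sub θ₁ x
    linarith
  have hexp : Real.exp (2 * (4 * β)) ≤ 12 / 11 := by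
    have h1 : Real.exp (2 * (4 * β)) ≤ Real.exp (2 / 25) := Real.exp_le_exp.2 (by linarith)
    have h2 := Real.exp_bound_div_one_sub_of_interval (x := 2 / 25) (by norm_num) (by norm_num)
    norm_num at h2
    linarith
  have hbd : ∀ t ∈ Icc 0 (4 * β), |θ t| + |φ t| ≤ |x| * (6 / 5) := fun t ht => by
    have h1 := hsol.abs_sub_le hG hz cθ cφ continuous_const continuous_const (by simp) (by simp)
      (M := 0) (fun _ _ => by simp) le_rfl ht
    simp only [sub_zero, sub_self, abs_zero, intervalIntegral.integral_zero, add_zero, hθ0, hφ0] at h1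
    have h2 : Real.exp (2 * t) ≤ 12 / 11 := (Real.exp_le_exp.2 (by linarith [ht.2])).trans hexp
    calc _ ≤ _ := h1
      _ ≤ (|x| * (21 / 20) + |x| / 20) * (12 / 11) := by gcongr
      _ = _ := by ring
  have hb1 : ∀ t ∈ Icc 0 (4 * β), |θ t - x| ≤ |x| / 10 ∧ |φ t| ≤ |x| / 10 := fun t ht => by
    have i1 : ‖∫ r in (0:ℝ)..t, φ r‖ ≤ |x| * (6 / 5) * |t - 0| := by
      refine intervalIntegral.norm_integral_le_of_norm_le_const fun r hr => ?_
      rw [uIoc_of_le ht.1] at hr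
      have := hbd r ⟨hr.1.le, hr.2.trans ht.2⟩
      rw [Real.norm_eq_abs]
      linarith [abs_nonneg (θ r)]
    have i2 : ‖∫ r in (0:ℝ)..t, (Real.sin (θ r) + (fun _ => (0:ℝ)) r * G (θ r))‖ ≤
        |x| * (6 / 5) * |t - 0| := by
      refine intervalIntegral.norm_integral_le_of_norm_le_const fun r hr => ?_
      rw [uIoc_of_le ht.1] at hr
      have := hbd r ⟨hr.1.le, hr.2.trans ht.2⟩
      have h3 : |Real.sin (θ r)| ≤ |θ r| := Real.abs_sin_le_abs
      rw [Real.norm_eq_abs, zero_mul, add_zero]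
      linarith [abs_nonneg (φ r)]
    rw [Real.norm_eq_abs] at i1 i2
    have h3 := hsol.pos_eq t ht
    have h4 := hsol.vel_eq t ht
    rw [hθ0] at h3
    rw [hφ0] at h4
    have h5 : |x| * (6 / 5) * |t - 0| ≤ |x| / 20 := by
      rw [sub_zero, abs_of_nonneg ht.1]
      have : t ≤ 1 / 25 := by linarith [ht.2]
      nlinarith
    constructor
    · rw [h3, show θ₁ + (∫ r in (0:ℝ)..t, φ r) - x = (θ₁ - x) + ∫ r in (0:ℝ)..t, φ r by ring]
      exact (abs_add_le _ _).trans (by linarith)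
    · rw [h4]
      exact (abs_add_le _ _).trans (by linarith)
  have hd : ∀ t ∈ Ioo 0 (4 * β), HasDerivAt (fun t => x * (φ t - s * θ t) - x ^ 2 / 2 * t)
      (x * (Real.sin (θ t) - s * φ t) - x ^ 2 / 2 * 1) t := fun t ht => by
    obtain ⟨h1, h2⟩ := hsol.hasDerivAt_free cθ cφ ht
    exact ((h2.sub (h1.const_mul s)).const_mul x).sub ((hasDerivAt_id t).const_mul _)
  -- Gravity contributes at least `3 x²/5` to the rate and the slope term takes away at most
  -- `x²/20`; this leaves more than `x²/2`.
  have hmono : MonotoneOn (fun t => x * (φ t - s * θ t) - x ^ 2 / 2 * t) (Icc 0 (4 * β)) := by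
    refine monotoneOn_of_deriv_nonneg (convex_Icc _ _) (by fun_prop) ?_ ?_
    · rw [interior_Icc]
      exact fun t ht => (hd t ht).differentiableAt.differentiableWithinAt
    · rw [interior_Icc]
      intro t ht
      rw [(hd t ht).deriv]
      obtain ⟨h1, h2⟩ := hb1 t (Ioo_subset_Icc_self ht)
      have h3 := mul_sin_ge hx2 h1
      have h4 : |x * (s * φ t)| ≤ x ^ 2 / 20 := by
        rw [abs_mul, abs_mul, ← sq_abs x]
        have : |s| * |φ t| ≤ 1 / 2 * (|x| / 10) := by gcongr
        nlinarith
      have := (abs_le.1 h4).2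
      have : 0 ≤ x ^ 2 := sq_nonneg x
      linarith
  have hinc : ∀ t ∈ Icc 0 (4 * β), ∀ t' ∈ Icc 0 (4 * β), t < t' →
      x * (φ t - s * θ t) < x * (φ t' - s * θ t') := fun t ht t' ht' htt => by
    have h1 := hmono ht ht' htt.le
    have h2 : 0 < x ^ 2 := by positivity
    simp only at h1
    nlinarith
  have hend : 0 < x * (φ (4 * β) - s * θ (4 * β)) := by
    have h1 := hmono (left_mem_Icc.2 (by positivity)) (right_mem_Icc.2 (by positivity)) (by positivity)
    simp only [hθ0, hφ0] at h1
    have h2 : |x * (φ₁ - s * θ₁)| ≤ x ^ 2 * β := by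
      rw [abs_mul, ← sq_abs x]
      nlinarith
    have := (abs_le.1 h2).1
    have h3 : 0 < x ^ 2 * β := by positivity
    nlinarith
  obtain ⟨ℓ, hℓ, hℓ0⟩ := intermediate_value_Ioo (f := fun t => x * (φ t - s * θ t))
    (by positivity : (0:ℝ) ≤ 4 * β) (by fun_prop) (⟨by simpa [hθ0, hφ0] using hψ, hend⟩ :
      (0:ℝ) ∈ Ioo (x * (φ 0 - s * θ 0)) (x * (φ (4 * β) - s * θ (4 * β))))
  refine ⟨ℓ, θ, φ, hℓ.1, hℓ.2.le, cθ, cφ, hθ0, hφ0, hsol.mono hℓ.2.le,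
    fun t ht => hb1 t ⟨ht.1, ht.2.trans hℓ.2.le⟩, fun t ht => ?_, ?_⟩
  · rw [← hℓ0]
    exact hinc t ⟨ht.1, ht.2.le.trans hℓ.2.le⟩ ℓ (Ioo_subset_Icc_self hℓ) ht.2
  · have := (mul_eq_zero.1 hℓ0).resolve_left hx
    linarith

end Orbits
end Pendulum

namespace Pendulum
open TimeFun

/-! ### The controlled phase -/

section OnCurve
variable {e N : ℝ} {q : Params × ℝ} {ϑ σ κ w : TimeFun}

lemma IsOnCurve.hasDerivAt_pos (h : IsOnCurve e N q ϑ σ κ w) {u : ℝ} (hu : u ∈ Ioo 0 N) :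
    HasDerivAt ϑ (q.1.τ * vel q ϑ w u) u := by
  refine (((hasDerivAt_integ hu (vel q ϑ w)).const_mul q.1.τ).const_add 1).congr_of_eventuallyEq
    (Eventually.of_forall fun r => ?_)
  simpa using congrArg (fun f : TimeFun => f r) h.pos

lemma IsOnCurve.hasDerivAt_sin (h : IsOnCurve e N q ϑ σ κ w) {u : ℝ} (hu : u ∈ Ioo 0 N) :
    HasDerivAt σ (q.1.τ * (κ u * vel q ϑ w u)) u := by
  refine (((hasDerivAt_integ hu (κ * vel q ϑ w)).const_mul q.1.τ).const_add
    (trigSqrt 1 q.2)).congr_of_eventuallyEq (Eventually.of_forall fun r => ?_)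
  simpa using congrArg (fun f : TimeFun => f r) h.sin

lemma IsOnCurve.hasDerivAt_cos (h : IsOnCurve e N q ϑ σ κ w) {u : ℝ} (hu : u ∈ Ioo 0 N) :
    HasDerivAt κ (-(q.2 * q.1.τ * (σ u * vel q ϑ w u))) u := by
  refine (((hasDerivAt_integ hu (σ * vel q ϑ w)).const_mul (q.2 * q.1.τ)).const_sub
    (trigSqrt 0 q.2)).congr_of_eventuallyEq (Eventually.of_forall fun r => ?_)
  simpa using congrArg (fun f : TimeFun => f r) h.cos

lemma IsOnCurve.at_zero (h : IsOnCurve e N q ϑ σ κ w) :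
    ϑ 0 = 1 ∧ σ 0 = trigSqrt 1 q.2 ∧ κ 0 = trigSqrt 0 q.2 := by
  have h1 := congrArg (fun f : TimeFun => f 0) h.pos
  have h2 := congrArg (fun f : TimeFun => f 0) h.sin
  have h3 := congrArg (fun f : TimeFun => f 0) h.cos
  simp [integ_of_le (N := N) le_rfl] at h1 h2 h3
  exact ⟨h1, h2, h3⟩

/-- The errors `x σ - sin (x ϑ)` and `κ - cos (x ϑ)` rotate into each other, so the sum of their
squares is conserved; it vanishes at time `0`. -/
lemma IsOnCurve.trig_eq (h : IsOnCurve e N q ϑ σ κ w) {x : ℝ} (hx : q.2 = x ^ 2) {u : ℝ}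
    (hu : u ∈ Ico 0 N) : x * σ u = Real.sin (x * ϑ u) ∧ κ u = Real.cos (x * ϑ u) := by
  have hc := ϑ.continuous
  have hc' := σ.continuous
  have hc'' := κ.continuous
  have key := eq_of_hasDerivAt_zero (t₀ := 0) (t₁ := u)
    (f := fun u => (x * σ u - Real.sin (x * ϑ u)) ^ 2 + (κ u - Real.cos (x * ϑ u)) ^ 2)
    (by fun_prop) hu.1 fun t ht => by
      have ht' : t ∈ Ioo 0 N := ⟨ht.1, ht.2.trans hu.2⟩
      have h1 := (h.hasDerivAt_pos ht').const_mul x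
      have h2 := (h.hasDerivAt_sin ht').const_mul x
      have h3 := h.hasDerivAt_cos ht'
      refine (((h2.sub h1.sin).pow 2).add ((h3.sub h1.cos).pow 2)).congr_deriv ?_
      rw [hx]
      simp
      ring
  obtain ⟨h1, h2, h3⟩ := h.at_zero
  simp only [h1, h2, h3, hx, mul_one, mul_trigSqrt_one_sq, trigSqrt_zero_sq, sub_self] at key
  have e1 : (x * σ u - Real.sin (x * ϑ u)) ^ 2 = 0 := by
    nlinarith [sq_nonneg (x * σ u - Real.sin (x * ϑ u)), sq_nonneg (κ u - Real.cos (x * ϑ u))]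
  have e2 : (κ u - Real.cos (x * ϑ u)) ^ 2 = 0 := by
    nlinarith [sq_nonneg (x * σ u - Real.sin (x * ϑ u)), sq_nonneg (κ u - Real.cos (x * ϑ u))]
  exact ⟨sub_eq_zero.1 (pow_eq_zero_iff two_ne_zero |>.1 e1),
    sub_eq_zero.1 (pow_eq_zero_iff two_ne_zero |>.1 e2)⟩

/-- velocity in the free part of the controlled phase -/
lemma IsOnCurve.hasDerivAt_vel_of_lt (h : IsOnCurve e N q ϑ σ κ w) {u : ℝ} (hu : u ∈ Ioo 0 1)
    (hN : 1 ≤ N) : HasDerivAt (vel q ϑ w) (q.1.τ * σ u) u := by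
  refine (((h.hasDerivAt_pos ⟨hu.1, hu.2.trans_le hN⟩).const_mul q.1.s).add
    ((h.hasDerivAt_dev_of_lt hu hN).const_mul q.1.τ)).congr_deriv ?_
  ring

lemma IsOnCurve.hasDerivAt_vel (h : IsOnCurve e N q ϑ σ κ w) {u : ℝ} (hu : u ∈ Ioo 1 N) :
    HasDerivAt (vel q ϑ w) (q.1.τ * (σ u - (feedback q ϑ w * act e κ) u)) u := by
  refine (((h.hasDerivAt_pos ⟨zero_lt_one.trans hu.1, hu.2⟩).const_mul q.1.s).add
    ((h.hasDerivAt_dev hu).const_mul q.1.τ)).congr_deriv ?_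
  ring

/-- Energy in the free part. -/
lemma IsOnCurve.energy_one (h : IsOnCurve e N q ϑ σ κ w) (hN : 1 ≤ N) :
    q.2 * vel q ϑ w 1 ^ 2 / 2 + κ 1 = q.2 * vel q ϑ w 0 ^ 2 / 2 + κ 0 := by
  have hc := (vel q ϑ w).continuous
  have hc'' := κ.continuous
  refine eq_of_hasDerivAt_zero (t₀ := 0) (t₁ := 1) (f := fun u => q.2 * vel q ϑ w u ^ 2 / 2 + κ u)
    (by fun_prop) zero_le_one fun t ht => ?_
  have h1 := h.hasDerivAt_vel_of_lt ht hN
  have h3 := h.hasDerivAt_cos ⟨ht.1, ht.2.trans_le hN⟩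
  refine ((((h1.pow 2).const_mul q.2).div_const 2).add h3).congr_deriv ?_
  simp
  ring

/-- Work of the control. -/
lemma IsOnCurve.energy_work (h : IsOnCurve e N q ϑ σ κ w) {u : ℝ} (hu : u ∈ Ico 1 N) :
    q.2 * vel q ϑ w u ^ 2 / 2 + κ u - (q.2 * vel q ϑ w 1 ^ 2 / 2 + κ 1) =
      -(q.2 * q.1.τ * (q.1.s * integ 1 N (feedback q ϑ w * act e κ * ϑ) u +
        q.1.τ * integ 1 N (feedback q ϑ w * act e κ * w) u)) := by
  have hc := (vel q ϑ w).continuous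
  have hc'' := κ.continuous
  have c1 := (integ 1 N (feedback q ϑ w * act e κ * ϑ)).continuous
  have c2 := (integ 1 N (feedback q ϑ w * act e κ * w)).continuous
  have key := eq_of_hasDerivAt_zero (t₀ := 1) (t₁ := u)
    (f := fun u => q.2 * vel q ϑ w u ^ 2 / 2 + κ u + q.2 * q.1.τ * (q.1.s *
      integ 1 N (feedback q ϑ w * act e κ * ϑ) u + q.1.τ * integ 1 N (feedback q ϑ w * act e κ * w) u))
    (by fun_prop) hu.1 fun t ht => by
      have ht' : t ∈ Ioo 1 N := ⟨ht.1, ht.2.trans hu.2⟩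
      have h1 := h.hasDerivAt_vel ht'
      have h3 := h.hasDerivAt_cos ⟨zero_lt_one.trans ht'.1, ht'.2⟩
      have h4 := hasDerivAt_integ ht' (feedback q ϑ w * act e κ * ϑ)
      have h5 := hasDerivAt_integ ht' (feedback q ϑ w * act e κ * w)
      refine (((((h1.pow 2).const_mul q.2).div_const 2).add h3).add
        (((h4.const_mul q.1.s).add (h5.const_mul q.1.τ)).const_mul (q.2 * q.1.τ))).congr_deriv ?_
      have hv : vel q ϑ w t = q.1.s * ϑ t + q.1.τ * w t := rfl
      simp only [BoundedContinuousFunction.coe_mul, Pi.mul_apply, hv]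
      ring
  simp only [integ_of_le (N := N) le_rfl] at key
  linarith

end OnCurve

section Cycle
variable {e N : ℝ} {p : Params} {x U : ℝ} {ϑ σ κ w : TimeFun} {θ φ G : ℝ → ℝ}

/-- The rescaled curve solves the equations with the delayed control switched on after the delay. -/
lemma IsOnPhase.solvesOn (h : IsOnPhase e N (p, x ^ 2) ϑ σ κ w U) (hG : IsActuation G)
    (hGe : ∀ y, G y = 1 + e * (Real.cos y - 1)) (hτ : 0 < p.τ) :
    SolvesOn G (fun t => if p.τ < t then -(x * feedback (p, x ^ 2) ϑ w (t / p.τ)) else 0)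
      (fun t => x * ϑ (t / p.τ)) (fun t => x * vel (p, x ^ 2) ϑ w (t / p.τ)) 0 (p.τ * (U + 1)) := by
  have hU := h.one_lt
  have hUN := h.lt_end
  have c1 := ϑ.continuous
  have c2 := (vel (p, x ^ 2) ϑ w).continuous
  have c3 := (feedback (p, x ^ 2) ϑ w).continuous
  have hdiv : ∀ t, HasDerivAt (fun t => t / p.τ) (1 / p.τ) t := fun t => (hasDerivAt_id t).div_const _
  have hmem : ∀ {t}, t ∈ Ioo 0 (p.τ * (U + 1)) → t / p.τ ∈ Ioo 0 N := fun {t} ht =>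
    ⟨div_pos ht.1 hτ, ((div_lt_iff₀' hτ).2 ht.2).trans hUN⟩
  refine solvesOn_of_hasDerivAt (S := {p.τ}) (countable_singleton _) hG (by fun_prop) (by fun_prop)
    (fun t => ?_) (fun t ht => ?_) (fun t ht => ?_)
  · have : (fun t => if p.τ < t then -(x * feedback (p, x ^ 2) ϑ w (t / p.τ)) else 0) =
        (Ioi p.τ).indicator fun t => -(x * feedback (p, x ^ 2) ϑ w (t / p.τ)) := by
      funext t
      simp only [indicator, mem_Ioi]
    rw [this, intervalIntegrable_iff]
    exact ((Continuous.intervalIntegrable (by fun_prop) 0 t).def').indicator measurableSet_Ioi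
  · have h1 := ((h.curve.hasDerivAt_pos (hmem ht.1)).comp t (hdiv t)).const_mul x
    refine h1.congr_deriv ?_
    field_simp
  · obtain ⟨e1, e2⟩ := h.curve.trig_eq rfl ⟨(hmem ht.1).1.le, (hmem ht.1).2⟩
    rcases lt_trichotomy t p.τ with hlt | rfl | hlt
    · have hu : t / p.τ ∈ Ioo 0 1 := ⟨(hmem ht.1).1, (div_lt_one hτ).2 hlt⟩
      have h1 := ((h.curve.hasDerivAt_vel_of_lt hu (by linarith)).comp t (hdiv t)).const_mul x
      refine h1.congr_deriv ?_
      rw [if_neg hlt.not_gt, ← e1]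
      field_simp
      ring
    · exact absurd rfl ht.2
    · have hu : t / p.τ ∈ Ioo 1 N := ⟨(one_lt_div hτ).2 hlt, (hmem ht.1).2⟩
      have h1 := ((h.curve.hasDerivAt_vel hu).comp t (hdiv t)).const_mul x
      refine h1.congr_deriv ?_
      have hact : (act e κ) (t / p.τ) = 1 + e * (κ (t / p.τ) - 1) := by simp [act]
      rw [if_pos hlt, ← e1, hGe, ← e2, BoundedContinuousFunction.coe_mul, Pi.mul_apply, hact]
      field_simp
      ring

lemma region_scaled : region p (x * ϑ U) (x * vel (p, x ^ 2) ϑ w U) = x ^ 2 * p.τ * (ϑ U * w U) := by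
  have hv : vel (p, x ^ 2) ϑ w U = p.s * ϑ U + p.τ * w U := rfl
  simp only [region, hv]
  ring

/-- A forward orbit follows the rescaled curve until the control is switched off. -/
lemma IsOnPhase.orbit_eq (h : IsOnPhase e N (p, x ^ 2) ϑ σ κ w U) (hG : IsActuation G)
    (hGe : ∀ y, G y = 1 + e * (Real.cos y - 1)) (hτ : 0 < p.τ) (hx : x ≠ 0)
    (ho : IsForwardOrbit G p x θ φ) (hθ : Continuous θ) (hφ : Continuous φ) :
    ∀ t ∈ Icc 0 (p.τ * (U + 1)), θ t = x * ϑ (t / p.τ) ∧ φ t = x * vel (p, x ^ 2) ϑ w (t / p.τ) := by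
  have c1 := ϑ.continuous
  have c2 := (vel (p, x ^ 2) ϑ w).continuous
  obtain ⟨z1, z2, z3⟩ := h.curve.at_zero
  have hv : ∀ u, vel (p, x ^ 2) ϑ w u = p.s * ϑ u + p.τ * w u := fun _ => rfl
  refine ho.isSolution.eq_model hG hτ hθ hφ (θ' := fun t => x * ϑ (t / p.τ))
    (φ' := fun t => x * vel (p, x ^ 2) ϑ w (t / p.τ)) (by fun_prop) (by fun_prop)
    (h.solvesOn hG hGe hτ) ?_ ?_ (countable_singleton p.τ) ?_
  · simp [ho.pos_zero, z1]
  · simp [ho.vel_zero, hv, z1, h.curve.dev_zero]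
    ring
  · intro t ht hag
    rcases lt_trichotomy t p.τ with hlt | rfl | hlt
    · rw [if_neg hlt.not_gt, control_eq_zero (ho.off_before _ ⟨by linarith [ht.1.1], by linarith⟩)]
    · exact absurd rfl ht.2
    · obtain ⟨a1, a2⟩ := hag (by linarith)
      have hu : t / p.τ - 1 ∈ Ioo 0 U :=
        ⟨by linarith [(one_lt_div hτ).2 hlt], by linarith [(div_lt_iff₀' hτ).2 ht.1.2]⟩
      have hdiv : (t - p.τ) / p.τ = t / p.τ - 1 := by field_simp
      rw [hdiv] at a1 a2
      -- One delay earlier the orbit is already known to be on the curve, which is in the ON region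
      -- for rescaled times in `(0, U)`; thus the control is on exactly as in the model.
      have hr : 0 < region p (θ (t - p.τ)) (φ (t - p.τ)) := by
        rw [a1, a2, region_scaled]
        have h1 := h.dev_pos _ hu
        have h2 := (abs_le.1 (h.pos_close (t / p.τ - 1))).1
        have h3 : 0 < ϑ (t / p.τ - 1) := by linarith
        positivity
      rw [if_pos hlt, control, if_pos hr, a1, a2]
      have hf : feedback (p, x ^ 2) ϑ w (t / p.τ) =
          p.a * ϑ (t / p.τ - 1) + p.b * vel (p, x ^ 2) ϑ w (t / p.τ - 1) := rfl
      rw [hf]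
      ring

lemma region_neg_of_close {y y' : ℝ} (hy : |y - x| ≤ |x| / 10) (h : x * (y' - p.s * y) < 0) :
    region p y y' < 0 := by
  have hx : x ≠ 0 := by rintro rfl; simp at h
  have hxy : 0 < x * y := by
    have h1 : |x * (y - x)| ≤ x ^ 2 / 10 := by
      rw [abs_mul, ← sq_abs x]; nlinarith [abs_nonneg x]
    have := (abs_le.1 h1).1
    have : 0 < x ^ 2 := by positivity
    nlinarith
  have h2 : x ^ 2 * region p y y' < 0 := by
    have : x ^ 2 * region p y y' = (x * y) * (x * (y' - p.s * y)) := by simp only [region]; ring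
    rw [this]
    exact mul_neg_of_pos_of_neg hxy h
  by_contra hc
  exact absurd (mul_nonneg (sq_nonneg x) (not_lt.1 hc)) h2.not_ge

/-- One zigzag oscillation of a forward orbit. -/
structure IsCycle (p : Params) (x : ℝ) (θ φ : ℝ → ℝ) (T P : ℝ) : Prop where
  zigzag : IsZigzag p θ φ T P
  pos_close : ∀ t ∈ Icc 0 P, |θ t - x| ≤ |x| / 10
  vel_small : ∀ t ∈ Icc 0 P, |φ t| ≤ |x| / 10
  energy : hamiltonian (θ P) (φ P) = hamiltonian (θ 0) (φ 0) + energyChange p θ φ T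

/-- Up to time `t₁ = τ (U + 1)` the orbit is the rescaled curve, and the points it passes in the
last delay interval are in the OFF region. Afterwards the delayed state stays OFF until the return,
so the motion is free and conserves energy; the first delay interval is free as well. All energy
change is the work done on `[τ, T + τ]`. -/
theorem IsOnPhase.exists_isCycle (h : IsOnPhase e N (p, x ^ 2) ϑ σ κ w U) (hG : IsActuation G)
    (hGe : ∀ y, G y = 1 + e * (Real.cos y - 1)) (hτ : 0 < p.τ) (hx : x ≠ 0) (hx2 : |x| ≤ 1 / 2)
    (hs : |p.s| ≤ 1 / 2) {W : ℝ} (hW : ‖w‖ ≤ W) (hτW : p.τ * W ≤ 1 / 100)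
    (ho : IsForwardOrbit G p x θ φ) (hθ : Continuous θ) (hφ : Continuous φ) :
    ∃ P, IsCycle p x θ φ (p.τ * U) P ∧ P ≤ p.τ * (N + 4 * W) ∧ θ p.τ = x * ϑ 1 ∧
      energyChange p θ φ (p.τ * U) = -(x ^ 2 * p.τ * (p.s * integ 1 N (feedback (p, x ^ 2) ϑ w * act e κ * ϑ) (U + 1) +
        p.τ * integ 1 N (feedback (p, x ^ 2) ϑ w * act e κ * w) (U + 1))) := by
  have hor := h.orbit_eq hG hGe hτ hx ho hθ hφ
  have hU := h.one_lt
  have hUN := h.lt_end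
  have hv : ∀ u, vel (p, x ^ 2) ϑ w u = p.s * ϑ u + p.τ * w u := fun _ => rfl
  have hx0 : 0 < |x| := abs_pos.2 hx
  set t₁ := p.τ * (U + 1) with ht₁
  have ht₁0 : 0 < t₁ := by positivity
  have hdivU : p.τ * U / p.τ = U := by field_simp
  have hdiv1 : t₁ / p.τ = U + 1 := by rw [ht₁]; field_simp
  have hUt : p.τ * U ∈ Icc 0 t₁ := ⟨by positivity, by rw [ht₁]; nlinarith⟩
  obtain ⟨aT, bT⟩ := hor _ hUt
  obtain ⟨a1, b1⟩ := hor t₁ ⟨ht₁0.le, le_rfl⟩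
  obtain ⟨aτ, bτ⟩ := hor p.τ ⟨hτ.le, by rw [ht₁]; nlinarith⟩
  rw [hdivU] at aT bT
  rw [hdiv1] at a1 b1
  rw [div_self hτ.ne'] at aτ bτ
  have hclose : ∀ t ∈ Icc 0 t₁, |θ t - x| ≤ |x| / 20 ∧ |φ t| ≤ |x| / 20 := fun t ht => by
    obtain ⟨h1, h2⟩ := hor t ht
    rw [h1, h2, show x * ϑ (t / p.τ) - x = x * (ϑ (t / p.τ) - 1) by ring, abs_mul, abs_mul]
    have h3 := h.pos_close (t / p.τ)
    have h4 := h.vel_small (t / p.τ)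
    constructor <;> nlinarith
  have hdevt : ∀ t ∈ Icc 0 t₁, x * (φ t - p.s * θ t) = x ^ 2 * p.τ * w (t / p.τ) := fun t ht => by
    obtain ⟨h1, h2⟩ := hor t ht
    rw [h1, h2, hv]
    ring
  have hwneg : ∀ t ∈ Ioc (p.τ * U) t₁, x * (φ t - p.s * θ t) < 0 := fun t ht => by
    rw [hdevt t ⟨hUt.1.trans ht.1.le, ht.2⟩]
    refine mul_neg_of_pos_of_neg (by positivity) (h.dev_neg _ ⟨(lt_div_iff₀' hτ).2 ht.1, ?_⟩)
    exact ((div_le_iff₀' hτ).2 ht.2).trans hUN.le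
  have hW0 : 0 ≤ W := (norm_nonneg w).trans hW
  obtain ⟨ℓ, θ₂, φ₂, hℓ0, hℓ, c1, c2, i1, i2, hsol, hcl, hneg, hret⟩ := exists_free_return hG hx hx2 hs
    hτW (hclose t₁ ⟨ht₁0.le, le_rfl⟩).1 (hclose t₁ ⟨ht₁0.le, le_rfl⟩).2
    (hwneg t₁ ⟨by rw [ht₁]; nlinarith, le_rfl⟩) (by
      rw [a1, b1, hv, show x * (p.s * ϑ (U + 1) + p.τ * w (U + 1)) - p.s * (x * ϑ (U + 1)) =
        x * (p.τ * w (U + 1)) by ring, abs_mul, abs_mul, abs_of_pos hτ]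
      gcongr
      exact (w.norm_coe_le_norm _).trans hW)
  -- the orbit follows the free motion
  have hfree : ∀ t ∈ Icc 0 ℓ, θ (t + t₁) = θ₂ t ∧ φ (t + t₁) = φ₂ t := by
    -- The delayed state is either on the free motion before its return or on the curve after the
    -- crossing time; both are OFF, so the control vanishes.
    refine (ho.isSolution.shift hG hθ hφ ht₁0.le).eq_model hG hτ (by fun_prop) (by fun_prop) c1 c2
      hsol (by simp [i1]) (by simp [i2]) countable_empty ?_
    intro t ht hag
    refine control_eq_zero (le_of_lt ?_)
    rcases le_or_gt 0 (t - p.τ) with h0 | h0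
    · obtain ⟨h1, h2⟩ := hag h0
      rw [h1, h2]
      exact region_neg_of_close (hcl _ ⟨h0, by linarith [ht.1.2]⟩).1
        (hneg _ ⟨h0, by linarith [ht.1.2]⟩)
    · have hm : t - p.τ + t₁ ∈ Ioc (p.τ * U) t₁ := ⟨by rw [ht₁]; linarith [ht.1.1], by linarith⟩
      have hm' : t - p.τ + t₁ ∈ Icc 0 t₁ := ⟨hUt.1.trans hm.1.le, hm.2⟩
      exact region_neg_of_close ((hclose _ hm').1.trans (by linarith)) (hwneg _ hm)
  have hfree' : ∀ t ∈ Icc t₁ (t₁ + ℓ), θ t = θ₂ (t - t₁) ∧ φ t = φ₂ (t - t₁) := fun t ht => by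
    have := hfree (t - t₁) ⟨by linarith [ht.1], by linarith [ht.2]⟩
    rwa [sub_add_cancel] at this
  have hall : ∀ t ∈ Icc 0 (t₁ + ℓ), |θ t - x| ≤ |x| / 10 ∧ |φ t| ≤ |x| / 10 := fun t ht => by
    rcases le_total t t₁ with h1 | h1
    · obtain ⟨h2, h3⟩ := hclose t ⟨ht.1, h1⟩
      exact ⟨by linarith, by linarith⟩
    · obtain ⟨h2, h3⟩ := hfree' t ⟨h1, ht.2⟩
      rw [h2, h3]
      exact hcl _ ⟨by linarith, by linarith [ht.2]⟩
  have hP := hfree' (t₁ + ℓ) ⟨by linarith, le_rfl⟩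
  rw [add_sub_cancel_left] at hP
  have hHam : hamiltonian (θ (t₁ + ℓ)) (φ (t₁ + ℓ)) = hamiltonian (θ t₁) (φ t₁) := by
    rw [hP.1, hP.2, hsol.hamiltonian_eq c1 c2 hℓ0.le, i1, i2]
  have hκ : ∀ t ∈ Icc 0 t₁, hamiltonian (θ t) (φ t) =
      x ^ 2 * vel (p, x ^ 2) ϑ w (t / p.τ) ^ 2 / 2 + κ (t / p.τ) := fun t ht => by
    obtain ⟨h1, h2⟩ := hor t ht
    have hu : t / p.τ ∈ Ico 0 N := ⟨div_nonneg ht.1 hτ.le, ((div_le_iff₀' hτ).2 ht.2).trans_lt hUN⟩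
    rw [hamiltonian, h1, h2, (h.curve.trig_eq rfl hu).2]
    ring
  -- Before time `τ` the control is off, so the energy at `τ` is still that of the starting point.
  have hH0 : hamiltonian (θ p.τ) (φ p.τ) = hamiltonian (θ 0) (φ 0) := by
    rw [hκ p.τ ⟨hτ.le, by rw [ht₁]; nlinarith⟩, hκ 0 ⟨le_rfl, ht₁0.le⟩, div_self hτ.ne', zero_div]
    exact h.curve.energy_one (by linarith)
  have hend : p.τ * U + p.τ = t₁ := by rw [ht₁]; ring
  have hE : energyChange p θ φ (p.τ * U) = hamiltonian (θ t₁) (φ t₁) - hamiltonian (θ p.τ) (φ p.τ) := by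
    rw [energyChange, hend]
  refine ⟨t₁ + ℓ, ⟨⟨by positivity, by linarith, ?_, ?_, ?_, ?_, ?_⟩, fun t ht => (hall t ht).1,
    fun t ht => (hall t ht).2, ?_⟩, ?_, aτ, ?_⟩
  · rw [ho.vel_zero, ho.pos_zero]
  · intro t ht
    obtain ⟨h1, h2⟩ := hor t ⟨ht.1.le, ht.2.le.trans hUt.2⟩
    rw [h1, h2, region_scaled]
    have h3 := h.dev_pos (t / p.τ) ⟨div_pos ht.1 hτ, (div_lt_iff₀' hτ).2 ht.2⟩
    have h4 : 0 < ϑ (t / p.τ) := by linarith [(abs_le.1 (h.pos_close (t / p.τ))).1]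
    positivity
  · rw [aT, bT, hv, h.cross]
    ring
  · intro t ht
    refine region_neg_of_close (hall t ⟨hUt.1.trans ht.1.le, ht.2.le⟩).1 ?_
    rcases le_or_gt t t₁ with h1 | h1
    · exact hwneg t ⟨ht.1, h1⟩
    · obtain ⟨h2, h3⟩ := hfree' t ⟨h1.le, ht.2.le⟩
      rw [h2, h3]
      exact hneg _ ⟨by linarith, by linarith [ht.2]⟩
  · rw [hP.1, hP.2, hret]
  · rw [hHam, hE, hH0]
    ring
  · have : t₁ ≤ p.τ * N := by rw [ht₁]; gcongr
    linarith [mul_add p.τ N (4 * W)]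
  · rw [hE, hκ t₁ ⟨ht₁0.le, le_rfl⟩, hκ p.τ ⟨hτ.le, by rw [ht₁]; nlinarith⟩, hdiv1, div_self hτ.ne']
    exact h.curve.energy_work ⟨by linarith, hUN⟩

end Cycle
end Pendulum

namespace Pendulum

/-! ### The return map -/

/-- energy on the switching line -/
def lineEnergy (s x : ℝ) : ℝ := hamiltonian x (s * x)

lemma lineEnergy_neg (s x : ℝ) : lineEnergy s (-x) = lineEnergy s x := by
  simp [lineEnergy, hamiltonian]

lemma lineEnergy_abs (s x : ℝ) : lineEnergy s |x| = lineEnergy s x := by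
  rcases abs_choice x with h | h <;> rw [h]
  exact lineEnergy_neg s x

/-- On `[0, 3/5]` the derivative `s² u - sin u + u/2` is nonpositive, so adding `u²/4` keeps the
line energy antitone. Consequently energy determines `|x|` on the line, a gain of energy moves the
orbit inwards, and the size of the step is controlled by the energy change. -/
lemma sq_sub_sq_le_lineEnergy {s x y : ℝ} (hs : |s| ≤ 1 / 2) (hxy : |x| ≤ |y|) (hy : |y| ≤ 3 / 5) :
    (y ^ 2 - x ^ 2) / 4 ≤ lineEnergy s x - lineEnergy s y := by
  rw [← lineEnergy_abs s x, ← lineEnergy_abs s y, ← sq_abs x, ← sq_abs y]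
  set x' := |x|
  set y' := |y|
  have hx : 0 ≤ x' := abs_nonneg x
  have hs2 : s ^ 2 ≤ 1 / 4 := by rw [← sq_abs]; nlinarith [abs_nonneg s]
  have hd : ∀ u, HasDerivAt (fun u => lineEnergy s u + u ^ 2 / 4)
      (s ^ 2 * u - Real.sin u + u / 2) u := fun u => by
    unfold lineEnergy hamiltonian
    refine ((((((hasDerivAt_id u).const_mul s).pow 2).div_const 2).add (Real.hasDerivAt_cos u)).add
      (((hasDerivAt_id u).pow 2).div_const 4)).congr_deriv ?_
    simp
    ring
  have hanti : AntitoneOn (fun u => lineEnergy s u + u ^ 2 / 4) (Icc 0 (3 / 5)) := by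
    refine antitoneOn_of_deriv_nonpos (convex_Icc _ _)
      (fun u _ => (hd u).continuousAt.continuousWithinAt)
      (fun u _ => (hd u).differentiableAt.differentiableWithinAt) fun u hu => ?_
    rw [interior_Icc] at hu
    rw [(hd u).deriv]
    have h1 := Real.sin_gt_sub_cube hu.1
    have h2 : u ^ 2 ≤ 1 := by nlinarith [hu.1, hu.2]
    have h3 : u ^ 3 ≤ u := by nlinarith [hu.1]
    nlinarith [hu.1]
  have := hanti ⟨hx, hxy.trans hy⟩ ⟨hx.trans hxy, hy⟩ hxy
  simp only at this
  linarith

lemma lineEnergy_lt {s x y : ℝ} (hs : |s| ≤ 1 / 2) (hxy : |x| < |y|) (hy : |y| ≤ 3 / 5) :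
    lineEnergy s y < lineEnergy s x := by
  have h1 := sq_sub_sq_le_lineEnergy hs hxy.le hy
  have h2 := sq_lt_sq.2 hxy
  linarith

section Zigzag
variable {G θ φ θ' φ' : ℝ → ℝ} {p : Params} {x T P T' P' : ℝ}

lemma region_eq_zero {y y' : ℝ} (h : y' = p.s * y) : region p y y' = 0 := by
  simp [region, h]

lemma IsZigzag.time_unique (h : IsZigzag p θ φ T P) (h' : IsZigzag p θ φ T' P') (hτ : 0 < p.τ) :
    T = T' ∧ P = P' := by
  have key : ∀ {T P T' P'}, IsZigzag p θ φ T P → IsZigzag p θ φ T' P' → ¬ T < T' := by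
    intro T P T' P' h h' hlt
    have := h'.on_first T ⟨h.pos, hlt⟩
    rw [region_eq_zero h.cross] at this
    exact this.false
  have hT : T = T' := le_antisymm (not_lt.1 (key h' h)) (not_lt.1 (key h h'))
  subst hT
  have key' : ∀ {P P'}, IsZigzag p θ φ T P → IsZigzag p θ φ T P' → ¬ P < P' := by
    intro P P' h h' hlt
    have := h'.off_second P ⟨by linarith [h.delay_le], hlt⟩
    rw [region_eq_zero h.return_line] at this
    exact this.false
  exact ⟨rfl, le_antisymm (not_lt.1 (key' h' h)) (not_lt.1 (key' h h'))⟩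

lemma IsZigzag.congr (h : IsZigzag p θ φ T P) (hτ : 0 < p.τ) (hθ : EqOn θ θ' (Ici 0))
    (hφ : EqOn φ φ' (Ici 0)) : IsZigzag p θ' φ' T P := by
  have hT := h.pos
  have hP := h.delay_le
  have m0 : (0 : ℝ) ∈ Ici (0 : ℝ) := mem_Ici.2 le_rfl
  have mT : T ∈ Ici (0 : ℝ) := hT.le
  have mP : P ∈ Ici (0 : ℝ) := by simp only [mem_Ici]; linarith
  refine ⟨hT, hP, ?_, fun t ht => ?_, ?_, fun t ht => ?_, ?_⟩
  · rw [← hθ m0, ← hφ m0, h.start]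
  · have m : t ∈ Ici (0 : ℝ) := ht.1.le
    rw [← hθ m, ← hφ m]
    exact h.on_first t ht
  · rw [← hθ mT, ← hφ mT, h.cross]
  · have m : t ∈ Ici (0 : ℝ) := (hT.trans ht.1).le
    rw [← hθ m, ← hφ m]
    exact h.off_second t ht
  · rw [← hθ mP, ← hφ mP, h.return_line]

lemma energyChange_congr (hτ : 0 < p.τ) (hT : 0 < T) (hθ : EqOn θ θ' (Ici 0))
    (hφ : EqOn φ φ' (Ici 0)) : energyChange p θ' φ' T = energyChange p θ φ T := by
  have m1 : T + p.τ ∈ Ici (0 : ℝ) := by simp only [mem_Ici]; linarith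
  have m2 : p.τ ∈ Ici (0 : ℝ) := hτ.le
  rw [energyChange, energyChange, hθ m1, hφ m1, hθ m2, hφ m2]

lemma IsCycle.period_pos (h : IsCycle p x θ φ T P) (hτ : 0 < p.τ) : 0 < P := by
  linarith [h.zigzag.pos, h.zigzag.delay_le]

lemma IsCycle.congr (h : IsCycle p x θ φ T P) (hτ : 0 < p.τ) (hθ : EqOn θ θ' (Ici 0))
    (hφ : EqOn φ φ' (Ici 0)) : IsCycle p x θ' φ' T P := by
  have hP := h.period_pos hτ
  refine ⟨h.zigzag.congr hτ hθ hφ, fun t ht => ?_, fun t ht => ?_, ?_⟩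
  · rw [← hθ ht.1]
    exact h.pos_close t ht
  · rw [← hφ ht.1]
    exact h.vel_small t ht
  · have m0 : (0 : ℝ) ∈ Ici (0 : ℝ) := mem_Ici.2 le_rfl
    have mP : P ∈ Ici (0 : ℝ) := hP.le
    rw [energyChange_congr hτ h.zigzag.pos hθ hφ, ← hθ mP, ← hφ mP, ← hθ m0, ← hφ m0, h.energy]

/-- After one zigzag oscillation the orbit is again a forward orbit of a point of the line. -/
lemma IsZigzag.isForwardOrbit_shift (h : IsZigzag p θ φ T P) (hG : IsActuation G) (hτ : 0 < p.τ)
    (hs : IsSolution G p θ φ) (hθ : Continuous θ) (hφ : Continuous φ) :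
    IsForwardOrbit G p (θ P) (fun t => θ (t + P)) (fun t => φ (t + P)) := by
  have hT := h.pos
  have hP := h.delay_le
  refine ⟨hs.shift hG hθ hφ (by linarith), by simp, by simp [h.return_line], fun t ht => ?_⟩
  rcases ht.2.eq_or_lt with rfl | h0
  · simp only [zero_add]
    exact (region_eq_zero h.return_line).le
  rcases (show T ≤ t + P by linarith [ht.1]).eq_or_lt with h1 | h1
  · rw [← h1]
    exact (region_eq_zero h.cross).le
  · exact (h.off_second _ ⟨h1, by linarith⟩).le

/-- All forward orbits of points of the line at distance less than `r` oscillate; the energy change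
is a function of the square of the initial position. -/
structure HasCycles (G : ℝ → ℝ) (p : Params) (r L : ℝ) (E : ℝ → ℝ) : Prop where
  actuation : IsActuation G
  delay_pos : 0 < p.τ
  radius_pos : 0 < r
  radius_le : r ≤ 1 / 2
  slope_le : |p.s| ≤ 1 / 2
  cycle : ∀ x, x ≠ 0 → |x| < r → ∀ θ φ : ℝ → ℝ, IsForwardOrbit G p x θ φ →
    ∃ T P, IsCycle p x θ φ T P ∧ P ≤ L ∧ energyChange p θ φ T = E (x ^ 2)

variable {r L : ℝ} {E : ℝ → ℝ}

lemma mul_pos_of_close {y : ℝ} (hx : x ≠ 0) (h : |y - x| ≤ |x| / 10) : 0 < y * x := by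
  have h1 : |x * (y - x)| ≤ x ^ 2 / 10 := by
    rw [abs_mul, ← sq_abs x]; nlinarith [abs_nonneg x]
  have := (abs_le.1 h1).1
  have : 0 < x ^ 2 := by positivity
  nlinarith

lemma abs_le_of_close {y : ℝ} (h : |y - x| ≤ |x| / 10) : |y| ≤ 11 / 10 * |x| ∧ 9 / 10 * |x| ≤ |y| := by
  have h1 := abs_sub_abs_le_abs_sub y x
  have h2 := abs_sub_abs_le_abs_sub x y
  rw [abs_sub_comm] at h2
  exact ⟨by linarith, by linarith⟩

lemma IsCycle.lineEnergy_return (hc : IsCycle p x θ φ T P) (ho : IsForwardOrbit G p x θ φ)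
    (hE : energyChange p θ φ T = E (x ^ 2)) :
    lineEnergy p.s (θ P) = lineEnergy p.s x + E (x ^ 2) := by
  have := hc.energy
  rw [hE, hc.zigzag.return_line, ho.vel_zero, ho.pos_zero] at this
  exact this

/-- The line energy is injective in `|x|` on the relevant range, and a cycle keeps the sign of the
position. -/
lemma HasCycles.return_eq_iff (h : HasCycles G p r L E) (hx : x ≠ 0) (hxr : |x| < r)
    (ho : IsForwardOrbit G p x θ φ)
    (hc : IsCycle p x θ φ T P) (hE : energyChange p θ φ T = E (x ^ 2)) :
    θ P = x ↔ E (x ^ 2) = 0 := by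
  have hl := hc.lineEnergy_return ho hE
  constructor
  · intro h1
    rw [h1] at hl
    linarith
  · intro h1
    rw [h1, add_zero] at hl
    have hP := hc.period_pos h.delay_pos
    have hcl := hc.pos_close P ⟨hP.le, le_rfl⟩
    have hr := h.radius_le
    have hle := (abs_le_of_close hcl).1
    have habs : |θ P| = |x| := by
      rcases lt_trichotomy |θ P| |x| with h2 | h2 | h2
      · exact absurd hl (lineEnergy_lt h.slope_le h2 (by linarith)).ne'
      · exact h2
      · exact absurd hl (lineEnergy_lt h.slope_le h2 (by linarith)).ne
    have hpos := mul_pos_of_close hx hcl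
    rcases abs_eq_abs.1 habs with h2 | h2
    · exact h2
    · rw [h2] at hpos
      nlinarith [sq_nonneg x]

lemma IsSolution.neg (hG : IsActuation G) (h : IsSolution G p θ φ) : IsSolution G p (-θ) (-φ) := by
  have hc : ∀ t, control p (-θ) (-φ) t = -control p θ φ t := fun t => by
    have hr : region p (-θ (t - p.τ)) (-φ (t - p.τ)) = region p (θ (t - p.τ)) (φ (t - p.τ)) := by
      simp only [region]; ring
    simp only [control, Pi.neg_apply, hr]
    split_ifs
    · ring
    · simp
  refine ⟨h.continuousOn_pos.neg, h.continuousOn_vel.neg, fun t ht => ?_, fun t ht => ?_⟩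
  · simp only [Pi.neg_apply, intervalIntegral.integral_neg]
    rw [h.pos_eq t ht]
    ring
  · have : (fun r => Real.sin ((-θ) r) + control p (-θ) (-φ) r * G ((-θ) r)) =
        fun r => -(Real.sin (θ r) + control p θ φ r * G (θ r)) := by
      funext r
      rw [hc, Pi.neg_apply, Real.sin_neg, hG.even]
      ring
    rw [this, intervalIntegral.integral_neg, Pi.neg_apply, Pi.neg_apply, h.vel_eq t ht]
    ring

lemma IsZigzagPeriodicOrbit.neg (hG : IsActuation G) (h : IsZigzagPeriodicOrbit G p x θ φ P) :
    IsZigzagPeriodicOrbit G p (-x) (-θ) (-φ) P := by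
  obtain ⟨ho, ⟨T, hz⟩, h1, h2⟩ := h
  have hr : ∀ t, region p ((-θ) t) ((-φ) t) = region p (θ t) (φ t) := fun t => by
    simp only [region, Pi.neg_apply]; ring
  refine ⟨⟨ho.isSolution.neg hG, by simp [ho.pos_zero], by simp [ho.vel_zero], fun t ht => ?_⟩,
    ⟨T, hz.pos, hz.delay_le, by simp [hz.start], fun t ht => ?_, by simp [hz.cross], fun t ht => ?_,
      by simp [hz.return_line]⟩, fun t => by simp [h1 t], fun t => by simp [h2 t]⟩
  · rw [hr]; exact ho.off_before t ht
  · rw [hr]; exact hz.on_first t ht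
  · rw [hr]; exact hz.off_second t ht

/-- An orbit that returns to its starting point can be continued to a periodic orbit. -/
lemma exists_periodicOrbit (hG : IsActuation G) (hτ : 0 < p.τ) (ho : IsForwardOrbit G p x θ φ)
    (hθ : Continuous θ) (hφ : Continuous φ) (hz : IsZigzag p θ φ T P) (hP : θ P = x) :
    ∃ θ' φ' : ℝ → ℝ, IsZigzagPeriodicOrbit G p x θ' φ' P := by
  have hT := hz.pos
  have hPτ := hz.delay_le
  have hP0 : 0 < P := by linarith
  have hs := hz.isForwardOrbit_shift hG hτ ho.isSolution hθ hφ
  rw [hP] at hs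
  have hper : ∀ t, 0 ≤ t → θ (t + P) = θ t ∧ φ (t + P) = φ t := fun t ht => hs.unique hG hτ ho ht
  have hpern : ∀ (n : ℕ) (t : ℝ), 0 ≤ t → θ (t + n * P) = θ t ∧ φ (t + n * P) = φ t := by
    intro n
    induction n with
    | zero => simp
    | succ n ih =>
      intro t ht
      have h1 := hper (t + n * P) (by positivity)
      obtain ⟨h2, h3⟩ := ih t ht
      push_cast
      rw [show t + (n + 1) * P = t + n * P + P by ring, h1.1, h1.2, h2, h3]
      exact ⟨rfl, rfl⟩
  -- Uniqueness of forward orbits already gives periodicity for `t ≥ 0`; reduction of time modulo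
  -- `P` extends it to negative times.
  set ρ : ℝ → ℝ := fun t => P * Int.fract (t / P) with hρ
  have hρper : ∀ t, ρ (t + P) = ρ t := fun t => by
    simp only [hρ]
    rw [add_div, div_self hP0.ne', Int.fract_add_one]
  have hag : ∀ t, 0 ≤ t → θ (ρ t) = θ t ∧ φ (ρ t) = φ t := fun t ht => by
    have hn : 0 ≤ ⌊t / P⌋ := Int.floor_nonneg.2 (by positivity)
    obtain ⟨n, hn'⟩ := Int.eq_ofNat_of_zero_le hn
    have h0 : 0 ≤ ρ t := mul_nonneg hP0.le (Int.fract_nonneg _)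
    have ht' : t = ρ t + n * P := by
      have := Int.fract_add_floor (t / P)
      rw [hn'] at this
      simp only [hρ]
      push_cast at this
      field_simp at this
      linarith
    have := hpern n (ρ t) h0
    rw [← ht'] at this
    exact ⟨this.1.symm, this.2.symm⟩
  have hag' : ∀ t ∈ Ici (-p.τ), θ (t + P) = θ (ρ t) ∧ φ (t + P) = φ (ρ t) := fun t ht => by
    have h0 : -p.τ ≤ t := ht
    have := hag (t + P) (by linarith)
    rw [hρper] at this
    exact ⟨this.1.symm, this.2.symm⟩
  -- On `[-τ, 0]` the extension repeats the stretch before `P`, which lies in the OFF region because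
  -- `T + τ ≤ P`.
  refine ⟨fun t => θ (ρ t), fun t => φ (ρ t),
    hs.congr hτ (fun t ht => (hag' t ht).1) (fun t ht => (hag' t ht).2),
    ⟨T, hz.congr hτ (fun t ht => (hag t ht).1.symm) (fun t ht => (hag t ht).2.symm)⟩,
    fun t => by simp only [hρper], fun t => by simp only [hρper]⟩

lemma HasCycles.exists_periodic_iff (h : HasCycles G p r L E) (hx : x ≠ 0) (hxr : |x| < r) :
    (∃ (θ φ : ℝ → ℝ) (P : ℝ), IsZigzagPeriodicOrbit G p x θ φ P) ↔ E (x ^ 2) = 0 := by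
  constructor
  · rintro ⟨θ, φ, P, ho, ⟨T, hz⟩, h1, h2⟩
    obtain ⟨T', P', hc, -, hE⟩ := h.cycle x hx hxr θ φ ho
    obtain ⟨rfl, rfl⟩ := hz.time_unique hc.zigzag h.delay_pos
    rw [← h.return_eq_iff hx hxr ho hc hE]
    have := h1 0
    rw [zero_add] at this
    rw [this, ho.pos_zero]
  · intro hE
    obtain ⟨θ₀, φ₀, ho⟩ := exists_isForwardOrbit h.actuation h.delay_pos x
    obtain ⟨θ, φ, c1, c2, -, -, ho⟩ := ho.exists_continuous h.delay_pos
    obtain ⟨T, P, hc, -, hE'⟩ := h.cycle x hx hxr θ φ ho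
    obtain ⟨θ', φ', hp⟩ := exists_periodicOrbit h.actuation h.delay_pos ho c1 c2 hc.zigzag
      ((h.return_eq_iff hx hxr ho hc hE').2 hE)
    exact ⟨θ', φ', P, hp⟩

lemma HasCycles.periodic_bounds (h : HasCycles G p r L E) (hx : x ≠ 0) (hxr : |x| < r)
    (hp : IsZigzagPeriodicOrbit G p x θ φ P) :
    P ≤ L ∧ ∀ t : ℝ, 0 < θ t * x ∧ |x| / 2 ≤ |θ t| ∧ |θ t| ≤ 2 * |x| ∧ |φ t| ≤ |x| := by
  obtain ⟨ho, ⟨T, hz⟩, h1, h2⟩ := hp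
  obtain ⟨T', P', hc, hL, hE⟩ := h.cycle x hx hxr θ φ ho
  obtain ⟨rfl, rfl⟩ := hz.time_unique hc.zigzag h.delay_pos
  have hP := hc.period_pos h.delay_pos
  refine ⟨hL, fun t => ?_⟩
  have e1 : ∃ t' ∈ Ico 0 P, θ t = θ t' ∧ φ t = φ t' := by
    have hpair : Function.Periodic (fun t => (θ t, φ t)) P := fun t => by simp [h1 t, h2 t]
    obtain ⟨t', ht', e⟩ := hpair.exists_mem_Ico₀ hP t
    exact ⟨t', ht', congrArg Prod.fst e, congrArg Prod.snd e⟩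
  obtain ⟨t', ht', e1, e2⟩ := e1
  have m := Ico_subset_Icc_self ht'
  have hcl := hc.pos_close t' m
  obtain ⟨h3, h4⟩ := abs_le_of_close hcl
  rw [e1, e2]
  refine ⟨mul_pos_of_close hx hcl, ?_, ?_, ?_⟩
  · linarith [abs_nonneg x]
  · linarith [abs_nonneg x]
  · linarith [abs_nonneg x, hc.vel_small t' m]

end Zigzag
end Pendulum

namespace Pendulum

/-! ### Continuous dependence -/

section Dependence
variable {G : ℝ → ℝ} {p : Params} {x : ℝ} {θ φ : ℝ → ℝ}

/-- The control jumps only on the boundary of the regions; a strict sign of `region` is inherited by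
nearby curves. -/
lemma tendsto_control {θ' φ' : ℝ → ℝ → ℝ} {l : Filter ℝ} {t : ℝ}
    (hr : region p (θ (t - p.τ)) (φ (t - p.τ)) ≠ 0)
    (h1 : Tendsto (fun y => θ' y (t - p.τ)) l (𝓝 (θ (t - p.τ))))
    (h2 : Tendsto (fun y => φ' y (t - p.τ)) l (𝓝 (φ (t - p.τ)))) :
    Tendsto (fun y => control p (θ' y) (φ' y) t) l (𝓝 (control p θ φ t)) := by
  have hreg : Tendsto (fun y => region p (θ' y (t - p.τ)) (φ' y (t - p.τ))) l
      (𝓝 (region p (θ (t - p.τ)) (φ (t - p.τ)))) := h1.mul (h2.sub (h1.const_mul _))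
  rcases hr.lt_or_gt with hneg | hpos
  · rw [control_eq_zero hneg.le]
    refine tendsto_const_nhds.congr' ?_
    filter_upwards [hreg.eventually_lt_const hneg] with y hy
    exact (control_eq_zero hy.le).symm
  · rw [control, if_pos hpos]
    refine (((h1.const_mul p.a).add (h2.const_mul p.b)).neg).congr' ?_
    filter_upwards [hreg.eventually_const_lt hpos] with y hy
    rw [control, if_pos hy]

/-- Induction over delay intervals. If the curves are close on one interval, the controls on the
next converge at all times except countably many, hence in the integral by dominated convergence,
and the Gronwall estimate carries closeness over. -/
lemma eventually_close (hG : IsActuation G) (hτ : 0 < p.τ) (ho : IsForwardOrbit G p x θ φ)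
    (hθ : Continuous θ) (hφ : Continuous φ)
    (hS : {t | 0 ≤ t ∧ region p (θ t) (φ t) = 0}.Countable) {Θ Φ : ℝ → ℝ → ℝ}
    (cΘ : ∀ y, Continuous (Θ y)) (cΦ : ∀ y, Continuous (Φ y))
    (hO : ∀ y, IsForwardOrbit G p y (Θ y) (Φ y)) (k : ℕ) {ε : ℝ} (hε : 0 < ε) :
    ∀ᶠ y in 𝓝 x, ∀ t ∈ Icc 0 (k * p.τ), |Θ y t - θ t| + |Φ y t - φ t| < ε := by
  induction k generalizing ε with
  | zero =>
    have h1 : Tendsto (fun y => |y - x| + |p.s * y - p.s * x|) (𝓝 x) (𝓝 (|x - x| + |p.s * x - p.s * x|)) :=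
      Continuous.tendsto (by fun_prop) x
    simp only [sub_self, abs_zero, add_zero] at h1
    filter_upwards [h1.eventually_lt_const hε] with y hy t ht
    have ht0 : t = 0 := le_antisymm (by simpa using ht.2) ht.1
    rw [ht0, (hO y).pos_zero, (hO y).vel_zero, ho.pos_zero, ho.vel_zero]
    exact hy
  | succ k ih =>
    set L : ℝ := (k + 1) * p.τ with hL
    have hL0 : 0 ≤ L := by positivity
    have hk : ∀ {t}, t ∈ Icc 0 L → 0 ≤ t - p.τ → t - p.τ ∈ Icc 0 (k * p.τ) := fun ht h0 =>
      ⟨h0, by rw [hL] at ht; linarith [ht.2]⟩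
    obtain ⟨M, hM0, hM⟩ := exists_abs_control_le p hθ hφ 0 L
    have hlim : ∀ t ∈ Icc 0 L, 0 ≤ t - p.τ →
        Tendsto (fun y => Θ y (t - p.τ)) (𝓝 x) (𝓝 (θ (t - p.τ))) ∧
        Tendsto (fun y => Φ y (t - p.τ)) (𝓝 x) (𝓝 (φ (t - p.τ))) := fun t ht h0 => by
      constructor <;> refine Metric.tendsto_nhds.2 fun ε hε => ?_
      · filter_upwards [ih hε] with y hy
        rw [Real.dist_eq]
        linarith [hy _ (hk ht h0), abs_nonneg (Φ y (t - p.τ) - φ (t - p.τ))]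
      · filter_upwards [ih hε] with y hy
        rw [Real.dist_eq]
        linarith [hy _ (hk ht h0), abs_nonneg (Θ y (t - p.τ) - θ (t - p.τ))]
    have hzero : ∀ {y θ φ}, IsForwardOrbit G p y θ φ → ∀ {t}, 0 ≤ t → t - p.τ < 0 →
        control p θ φ t = 0 := fun h t h0 h1 =>
      control_eq_zero (h.off_before _ ⟨by linarith, h1.le⟩)
    -- Closeness within `1` on the earlier interval bounds the perturbed controls by the data of the
    -- fixed orbit.
    have hbound : ∀ᶠ y in 𝓝 x, ∀ᵐ t, t ∈ uIoc 0 L →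
        ‖|control p (Θ y) (Φ y) t - control p θ φ t|‖ ≤ M + (M + (|p.a| + |p.b|)) + (|p.a| + |p.b|) *
          (|θ (t - p.τ)| + |φ (t - p.τ)|) := by
      filter_upwards [ih one_pos] with y hy
      refine Eventually.of_forall fun t ht => ?_
      rw [uIoc_of_le hL0] at ht
      have ht' : t ∈ Icc 0 L := ⟨ht.1.le, ht.2⟩
      have h1 := hM t ht'
      have h2 : |control p (Θ y) (Φ y) t| ≤ (|p.a| + |p.b|) + (|p.a| + |p.b|) *
          (|θ (t - p.τ)| + |φ (t - p.τ)|) := by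
        rcases le_or_gt 0 (t - p.τ) with h0 | h0
        · refine (abs_control_le p (Θ y) (Φ y) t).trans ?_
          have h3 := hy _ (hk ht' h0)
          have h4 := abs_sub_abs_le_abs_sub (Θ y (t - p.τ)) (θ (t - p.τ))
          have h5 := abs_sub_abs_le_abs_sub (Φ y (t - p.τ)) (φ (t - p.τ))
          have h6 : |Θ y (t - p.τ)| ≤ 1 + (|θ (t - p.τ)| + |φ (t - p.τ)|) := by
            linarith [abs_nonneg (Φ y (t - p.τ) - φ (t - p.τ)), abs_nonneg (φ (t - p.τ))]
          have h7 : |Φ y (t - p.τ)| ≤ 1 + (|θ (t - p.τ)| + |φ (t - p.τ)|) := by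
            linarith [abs_nonneg (Θ y (t - p.τ) - θ (t - p.τ)), abs_nonneg (θ (t - p.τ))]
          calc _ ≤ |p.a| * (1 + (|θ (t - p.τ)| + |φ (t - p.τ)|)) +
              |p.b| * (1 + (|θ (t - p.τ)| + |φ (t - p.τ)|)) := by gcongr
            _ = _ := by ring
        · rw [hzero (hO y) ht'.1 h0, abs_zero]
          positivity
      rw [Real.norm_eq_abs, abs_abs]
      have := abs_sub (control p (Θ y) (Φ y) t) (control p θ φ t)
      linarith
    -- The excluded times are the meeting times with the switching line, shifted by the delay.
    have hae : ∀ᵐ t, t ∈ uIoc 0 L → Tendsto (fun y => |control p (Θ y) (Φ y) t - control p θ φ t|)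
        (𝓝 x) (𝓝 ((fun _ => (0:ℝ)) t)) := by
      have hcount : ((fun t => t + p.τ) '' {t | 0 ≤ t ∧ region p (θ t) (φ t) = 0}).Countable :=
        hS.image _
      filter_upwards [hcount.ae_notMem volume] with t ht htL
      rw [uIoc_of_le hL0] at htL
      have ht' : t ∈ Icc 0 L := ⟨htL.1.le, htL.2⟩
      rcases le_or_gt 0 (t - p.τ) with h0 | h0
      · have hr : region p (θ (t - p.τ)) (φ (t - p.τ)) ≠ 0 := fun hr =>
          ht ⟨t - p.τ, ⟨h0, hr⟩, by simp⟩
        have h1 := (tendsto_control hr (hlim t ht' h0).1 (hlim t ht' h0).2).sub_const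
          (control p θ φ t)
        simpa using h1.abs
      · simp only [hzero (hO _) ht'.1 h0, hzero ho ht'.1 h0, sub_self, abs_zero]
        exact tendsto_const_nhds
    have hint := intervalIntegral.tendsto_integral_filter_of_dominated_convergence (μ := volume)
      (a := 0) (b := L) (l := 𝓝 x) _ (Eventually.of_forall fun y =>
        (((measurable_control p (cΘ y) (cΦ y)).sub (measurable_control p hθ hφ)).norm).aestronglyMeasurable)
      hbound (Continuous.intervalIntegrable (by fun_prop) _ _) hae
    rw [intervalIntegral.integral_zero] at hint
    have h1 : Tendsto (fun y => (|y - x| + |p.s * y - p.s * x| +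
        ∫ t in (0:ℝ)..L, |control p (Θ y) (Φ y) t - control p θ φ t|) * Real.exp ((2 + M) * L)) (𝓝 x)
        (𝓝 ((|x - x| + |p.s * x - p.s * x| + 0) * Real.exp ((2 + M) * L))) :=
      ((Continuous.tendsto (by fun_prop) x).add hint).mul_const _
    simp only [sub_self, abs_zero, add_zero, zero_mul] at h1
    filter_upwards [h1.eventually_lt_const hε] with y hy t ht
    push_cast at ht
    have h2 := ((hO y).isSolution.solvesOn L).abs_sub_le hG (ho.isSolution.solvesOn L) (cΘ y) (cΦ y) hθ hφ
      (intervalIntegrable_control p (cΘ y) (cΦ y) 0 L) (intervalIntegrable_control p hθ hφ 0 L)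
      (fun t ht => hM t (Ioc_subset_Icc_self ht)) hM0 ht
    rw [(hO y).pos_zero, (hO y).vel_zero, ho.pos_zero, ho.vel_zero] at h2
    refine (h2.trans ?_).trans_lt hy
    have hn : 0 ≤ ∫ t in (0:ℝ)..L, |control p (Θ y) (Φ y) t - control p θ φ t| :=
      intervalIntegral.integral_nonneg hL0 fun _ _ => abs_nonneg _
    have : (2 + M) * (t - 0) ≤ (2 + M) * L := by
      have := ht.2
      gcongr
      linarith
    gcongr

/-- Forward orbits depend continuously on the initial point, uniformly on bounded time intervals. -/
theorem exists_close (hG : IsActuation G) (hτ : 0 < p.τ) (ho : IsForwardOrbit G p x θ φ)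
    (hS : {t | 0 ≤ t ∧ region p (θ t) (φ t) = 0}.Countable) (L : ℝ) {ε : ℝ} (hε : 0 < ε) :
    ∃ δ > 0, ∀ (y : ℝ) (θ' φ' : ℝ → ℝ), |y - x| < δ → IsForwardOrbit G p y θ' φ' →
      ∀ t ∈ Icc 0 L, dist (θ' t, φ' t) (θ t, φ t) < ε := by
  have hc : ∀ y, ∃ θφ : (ℝ → ℝ) × (ℝ → ℝ), Continuous θφ.1 ∧ Continuous θφ.2 ∧
      IsForwardOrbit G p y θφ.1 θφ.2 := fun y => by
    obtain ⟨θ₀, φ₀, h0⟩ := exists_isForwardOrbit hG hτ y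
    obtain ⟨θ₁, φ₁, c1, c2, -, -, h1⟩ := h0.exists_continuous hτ
    exact ⟨(θ₁, φ₁), c1, c2, h1⟩
  choose Ψ c1 c2 hΨ using hc
  obtain ⟨θ₁, φ₁, c3, c4, e1, e2, o1⟩ := ho.exists_continuous hτ
  have hmem : ∀ {t : ℝ}, 0 ≤ t → t ∈ Ici (-p.τ) := fun ht => by
    simp only [mem_Ici]; linarith
  have hS' : {t | 0 ≤ t ∧ region p (θ₁ t) (φ₁ t) = 0}.Countable := by
    refine hS.mono ?_
    rintro t ⟨h0, ht⟩
    refine ⟨h0, ?_⟩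
    rwa [e1 (hmem h0), e2 (hmem h0)]
  obtain ⟨k, hk⟩ := exists_nat_ge (L / p.τ)
  have hLk : L ≤ k * p.τ := (div_le_iff₀ hτ).1 hk
  obtain ⟨δ, hδ, h⟩ := Metric.eventually_nhds_iff.1 (eventually_close hG hτ o1 c3 c4 hS' c1 c2 hΨ k hε)
  refine ⟨δ, hδ, fun y θ' φ' hy ho' t ht => ?_⟩
  have h1 := h hy t ⟨ht.1, ht.2.trans hLk⟩
  obtain ⟨h2, h3⟩ := ho'.unique hG hτ (hΨ y) ht.1
  rw [h2, h3, e1 (hmem ht.1), e2 (hmem ht.1), Prod.dist_eq, Real.dist_eq, Real.dist_eq]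
  refine max_lt ?_ ?_
  · linarith [abs_nonneg ((Ψ y).2 t - φ₁ t)]
  · linarith [abs_nonneg ((Ψ y).1 t - θ₁ t)]

end Dependence
end Pendulum

namespace Pendulum

/-! ### Stability of zigzag periodic orbits -/

section Stability
variable {G θ φ : ℝ → ℝ} {p : Params} {x P r L : ℝ} {E : ℝ → ℝ}

/-- the meeting times of a zigzag periodic orbit with the switching line -/
lemma IsZigzagPeriodicOrbit.exists_reduced (hτ : 0 < p.τ) (hp : IsZigzagPeriodicOrbit G p x θ φ P)
    {T : ℝ} (hz : IsZigzag p θ φ T P) (t : ℝ) :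
    ∃ (n : ℤ) (t' : ℝ), t' ∈ Ico 0 P ∧ t = t' + n * P ∧ θ t = θ t' ∧ φ t = φ t' ∧
      (region p (θ t) (φ t) = 0 → t' = 0 ∨ t' = T) := by
  obtain ⟨ho, -, h1, h2⟩ := hp
  have hP0 : 0 < P := by linarith [hz.pos, hz.delay_le]
  have hpair : Function.Periodic (fun t => (θ t, φ t)) P := fun t => by simp [h1 t, h2 t]
  have hf := Int.fract_add_floor (t / P)
  have ht : t = P * Int.fract (t / P) + ⌊t / P⌋ * P := by
    field_simp at hf
    linarith
  have hm : P * Int.fract (t / P) ∈ Ico 0 P :=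
    ⟨mul_nonneg hP0.le (Int.fract_nonneg _), by nlinarith [Int.fract_lt_one (t / P)]⟩
  have e := hpair.int_mul ⌊t / P⌋ (P * Int.fract (t / P))
  rw [← ht] at e
  have e1 : θ t = θ (P * Int.fract (t / P)) := congrArg Prod.fst e
  have e2 : φ t = φ (P * Int.fract (t / P)) := congrArg Prod.snd e
  refine ⟨⌊t / P⌋, _, hm, ht, e1, e2, fun hr => ?_⟩
  rw [e1, e2] at hr
  rcases hm.1.eq_or_lt with h0 | h0
  · exact Or.inl h0.symm
  rcases lt_trichotomy (P * Int.fract (t / P)) T with h3 | h3 | h3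
  · exact absurd hr (hz.on_first _ ⟨h0, h3⟩).ne'
  · exact Or.inr h3
  · exact absurd hr (hz.off_second _ ⟨h3, hm.2⟩).ne

lemma IsZigzagPeriodicOrbit.countable_zero (hτ : 0 < p.τ) (hp : IsZigzagPeriodicOrbit G p x θ φ P) :
    {t | 0 ≤ t ∧ region p (θ t) (φ t) = 0}.Countable := by
  obtain ⟨T, hz⟩ := hp.2.1
  refine ((countable_range fun n : ℤ => 0 + n * P).union
    (countable_range fun n : ℤ => T + n * P)).mono ?_
  rintro t ⟨-, ht⟩
  obtain ⟨n, t', -, e, -, -, h⟩ := hp.exists_reduced hτ hz t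
  rcases h ht with rfl | rfl
  · exact Or.inl ⟨n, e.symm⟩
  · exact Or.inr ⟨n, e.symm⟩

/-- One step of the return map. -/
lemma HasCycles.exists_return (h : HasCycles G p r L E) {y : ℝ} (hy : y ≠ 0) (hyr : |y| < r)
    {θ φ : ℝ → ℝ} (ho : IsForwardOrbit G p y θ φ) (hθ : Continuous θ) (hφ : Continuous φ) :
    ∃ P y', p.τ ≤ P ∧ P ≤ L ∧ |y' - y| ≤ |y| / 10 ∧
      lineEnergy p.s y' = lineEnergy p.s y + E (y ^ 2) ∧
      θ P = y' ∧ φ P = p.s * y' ∧ IsForwardOrbit G p y' (fun t => θ (t + P)) (fun t => φ (t + P)) := by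
  obtain ⟨T, P, hc, hL, hE⟩ := h.cycle y hy hyr θ φ ho
  refine ⟨P, θ P, by linarith [hc.zigzag.pos, hc.zigzag.delay_le], hL,
    hc.pos_close P ⟨(hc.period_pos h.delay_pos).le, le_rfl⟩, hc.lineEnergy_return ho hE, rfl,
    hc.zigzag.return_line, hc.zigzag.isForwardOrbit_shift h.actuation h.delay_pos ho.isSolution hθ hφ⟩

lemma abs_sub_abs_of_mul_pos {x y : ℝ} (h : 0 < y * x) : |(|y| - |x|)| = |y - x| := by
  rcases lt_or_gt_of_ne (right_ne_zero_of_mul h.ne') with hx | hx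
  · have hy : y < 0 := by by_contra hc; nlinarith
    rw [abs_of_neg hx, abs_of_neg hy, show -y - -x = -(y - x) by ring, abs_neg]
  · have hy : 0 < y := by by_contra hc; nlinarith
    rw [abs_of_pos hx, abs_of_pos hy]

lemma abs_le_of_lineEnergy_le {s u v : ℝ} (hs : |s| ≤ 1 / 2) (hu : |u| ≤ 3 / 5)
    (h : lineEnergy s v ≤ lineEnergy s u) : |u| ≤ |v| := by
  by_contra hc
  exact absurd (lineEnergy_lt hs (not_le.1 hc) hu) h.not_gt

/-- If the energy change pulls towards `x`, one step of the return map brings the orbit closer to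
`x`, without changing sides. -/
lemma return_between {s y y' x e : ℝ} (hs : |s| ≤ 1 / 2) (hx : |x| ≤ 1 / 2) (hy : |y| ≤ 1 / 2)
    (hyy : |y' - y| ≤ |y| / 10) (he : lineEnergy s y' = lineEnergy s y + e)
    (he1 : |e| ≤ |y ^ 2 - x ^ 2| / 4) (he2 : 0 ≤ e * (y ^ 2 - x ^ 2)) :
    (|x| ≤ |y| → |x| ≤ |y'| ∧ |y'| ≤ |y|) ∧ (|y| ≤ |x| → |y| ≤ |y'| ∧ |y'| ≤ |x|) := by
  have hy' : |y'| ≤ 3 / 5 := by linarith [(abs_le_of_close hyy).1]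
  obtain ⟨e1, e2⟩ := abs_le.1 he1
  constructor
  · intro hle
    have hsq : 0 ≤ y ^ 2 - x ^ 2 := sub_nonneg.2 (sq_le_sq.2 hle)
    -- The energy gap between `x` and `y` is at least `(y² - x²)/4`, hence at least `|e|`: the step
    -- cannot overshoot `x`.
    have h1 := sq_sub_sq_le_lineEnergy hs hle (by linarith)
    rw [abs_of_nonneg hsq] at e1 e2
    have h0 : 0 ≤ e := by
      rcases hsq.eq_or_lt with h0 | h0
      · rw [← h0] at e1; linarith
      · exact nonneg_of_mul_nonneg_left he2 h0
    exact ⟨abs_le_of_lineEnergy_le hs (by linarith) (by linarith),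
      abs_le_of_lineEnergy_le hs hy' (by linarith)⟩
  · intro hle
    have hsq : y ^ 2 - x ^ 2 ≤ 0 := sub_nonpos.2 (sq_le_sq.2 hle)
    have h1 := sq_sub_sq_le_lineEnergy hs hle (by linarith)
    rw [abs_of_nonpos hsq] at e1 e2
    have h0 : e ≤ 0 := by
      rcases hsq.eq_or_lt with h0 | h0
      · rw [h0] at e2; linarith
      · by_contra hc
        exact absurd he2 (mul_neg_of_pos_of_neg (not_le.1 hc) h0).not_ge
    exact ⟨abs_le_of_lineEnergy_le hs (by linarith) (by linarith),
      abs_le_of_lineEnergy_le hs hy' (by linarith)⟩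

/-- The predicate `D` plays the role of an invariant set on which the return map can be iterated.
Its invariance may be deduced from where the orbit is at the return time, which the instability
argument needs. -/
lemma HasCycles.exists_return_sequence (h : HasCycles G p r L E) {D : ℝ → Prop}
    (hD : ∀ y, D y → y ≠ 0 ∧ |y| < r) {y₀ : ℝ} (hy₀ : D y₀) {θ φ : ℝ → ℝ}
    (ho : IsForwardOrbit G p y₀ θ φ) (hθ : Continuous θ) (hφ : Continuous φ)
    (hstep : ∀ t y y', 0 ≤ t → D y → |y' - y| ≤ |y| / 10 →
      lineEnergy p.s y' = lineEnergy p.s y + E (y ^ 2) → θ t = y' → φ t = p.s * y' → D y') :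
    ∃ Y t : ℕ → ℝ, Y 0 = y₀ ∧ t 0 = 0 ∧ ∀ n, D (Y n) ∧ t n + p.τ ≤ t (n + 1) ∧ t (n + 1) ≤ t n + L ∧
      |Y (n + 1) - Y n| ≤ |Y n| / 10 ∧
      lineEnergy p.s (Y (n + 1)) = lineEnergy p.s (Y n) + E (Y n ^ 2) ∧
      IsForwardOrbit G p (Y n) (fun r => θ (r + t n)) (fun r => φ (r + t n)) := by
  let S := {a : ℝ × ℝ // D a.1 ∧ 0 ≤ a.2 ∧
    IsForwardOrbit G p a.1 (fun r => θ (r + a.2)) (fun r => φ (r + a.2))}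
  have hex : ∀ a : S, ∃ b : S, a.1.2 + p.τ ≤ b.1.2 ∧ b.1.2 ≤ a.1.2 + L ∧
      |b.1.1 - a.1.1| ≤ |a.1.1| / 10 ∧
      lineEnergy p.s b.1.1 = lineEnergy p.s a.1.1 + E (a.1.1 ^ 2) := by
    rintro ⟨⟨y, t⟩, hDy, ht, hoy⟩
    obtain ⟨P, y', h1, h2, h3, h4, h5, h6, h7⟩ := h.exists_return (hD y hDy).1 (hD y hDy).2 hoy
      (by fun_prop) (by fun_prop)
    have hτ := h.delay_pos
    refine ⟨⟨(y', t + P), hstep (t + P) y y' (by linarith) hDy h3 h4 ?_ ?_, by simp only; linarith, ?_⟩,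
      by simpa using h1, by simpa using h2, h3, h4⟩
    · rw [← h5, add_comm]
    · rw [← h6, add_comm]
    · simpa only [add_assoc, add_comm P t] using h7
  choose f hf using hex
  let a₀ : S := ⟨(y₀, 0), hy₀, le_rfl, by simpa using ho⟩
  refine ⟨fun n => (f^[n] a₀).1.1, fun n => (f^[n] a₀).1.2, rfl, rfl, fun n => ?_⟩
  obtain ⟨h1, h2, h3, h4⟩ := hf (f^[n] a₀)
  simp only [Function.iterate_succ_apply']
  exact ⟨(f^[n] a₀).2.1, h1, h2, h3, h4, (f^[n] a₀).2.2.2⟩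

lemma continuous_lineEnergy (s : ℝ) : Continuous (lineEnergy s) := by
  unfold lineEnergy hamiltonian
  fun_prop

/-- A limit of the return map is a zero of the energy change. -/
lemma energy_zero_of_tendsto {s a r : ℝ} {E : ℝ → ℝ} (hE : ContinuousOn E (Ioo 0 (r ^ 2))) {Y : ℕ → ℝ}
    (ha : 0 < a) (har : a < r) (hY : Tendsto (fun n => |Y n|) atTop (𝓝 a))
    (hrec : ∀ n, lineEnergy s (Y (n + 1)) = lineEnergy s (Y n) + E (Y n ^ 2)) : E (a ^ 2) = 0 := by
  have hmem : a ^ 2 ∈ Ioo 0 (r ^ 2) := ⟨by positivity, by nlinarith⟩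
  have h1 : Tendsto (fun n => E (Y n ^ 2)) atTop (𝓝 (E (a ^ 2))) := by
    have := (hE.continuousAt (Ioo_mem_nhds hmem.1 hmem.2)).tendsto.comp (hY.pow 2)
    simpa [Function.comp_def] using this
  have h2 : Tendsto (fun n => lineEnergy s (Y n)) atTop (𝓝 (lineEnergy s a)) := by
    have := (continuous_lineEnergy s).continuousAt.tendsto.comp hY
    simpa [Function.comp_def, lineEnergy_abs] using this
  have h3 := (tendsto_add_atTop_iff_nat 1).2 h2
  have h4 := h3.sub h2
  simp only [hrec, add_sub_cancel_left, sub_self] at h4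
  exact tendsto_nhds_unique h1 h4

/-- Return times grow by at least `τ` and at most `L` per step, so every time lies within `L` after
some return, and late times after late returns. Statements on returns thereby become statements on
all times. -/
lemma exists_index {t : ℕ → ℝ} {τ L T : ℝ} (hτ : 0 < τ) (h0 : t 0 = 0)
    (hstep : ∀ n, t n + τ ≤ t (n + 1) ∧ t (n + 1) ≤ t n + L) (hT : 0 ≤ T) (m : ℕ) (hm : t m ≤ T) :
    ∃ n, m ≤ n ∧ T - t n ∈ Icc 0 L := by
  have hgrow : ∀ n : ℕ, n * τ ≤ t n := fun n => by
    induction n with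
    | zero => simp [h0]
    | succ n ih => push_cast; linarith [(hstep n).1]
  obtain ⟨k, hk⟩ := exists_nat_gt (T / τ)
  have hTk : T < t k := ((div_lt_iff₀ hτ).1 hk).trans_le (hgrow k)
  classical
  have hex : ∃ n, T < t (n + 1) := ⟨k, hTk.trans_le (by linarith [(hstep k).1])⟩
  have hmono : Monotone t := monotone_nat_of_le_succ fun n => by linarith [(hstep n).1]
  refine ⟨Nat.find hex, ?_, ?_, ?_⟩
  · by_contra hc
    have := Nat.find_spec hex
    have h2 : t (Nat.find hex + 1) ≤ t m := hmono (by omega)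
    linarith
  · rcases Nat.eq_zero_or_pos (Nat.find hex) with h1 | h1
    · rw [h1, h0]; linarith
    · have := Nat.find_min hex (Nat.sub_lt h1 one_pos)
      rw [show Nat.find hex - 1 + 1 = Nat.find hex by omega] at this
      linarith
  · linarith [Nat.find_spec hex, (hstep (Nat.find hex)).2]

/-- Outside `x` energy is gained and inside it is lost, and `hE1` excludes overshooting; so `|Y n|`
is monotone and stays on its side of `|x|`. Its limit is a zero of `E`, hence `|x|`. Between returns
the orbit is close to the periodic one by continuous dependence on `[0, L]`. -/
theorem HasCycles.isAsymptoticallyStable (h : HasCycles G p r L E) (hx : x ≠ 0) (hxr : |x| < r)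
    (hE : ContinuousOn E (Ioo 0 (r ^ 2))) (hE1 : ∀ z ∈ Ioo 0 (r ^ 2), |E z| ≤ |z - x ^ 2| / 4)
    (hE2 : ∀ z ∈ Ioo 0 (r ^ 2), z ≠ x ^ 2 → 0 < E z * (z - x ^ 2))
    (hp : IsZigzagPeriodicOrbit G p x θ φ P) : IsAsymptoticallyStable G p θ φ := by
  have hτ := h.delay_pos
  have hG := h.actuation
  have hr2 := h.radius_le
  have hx0 : 0 < |x| := abs_pos.2 hx
  have hsq : ∀ {y : ℝ}, y ≠ 0 → |y| < r → y ^ 2 ∈ Ioo 0 (r ^ 2) := fun hy hyr =>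
    ⟨by positivity, sq_lt_sq.2 (by rwa [abs_of_pos h.radius_pos])⟩
  -- the return map near `x`
  have key : ∃ δ₀ > 0, ∀ (y : ℝ) (θ' φ' : ℝ → ℝ), |y - x| < δ₀ → IsForwardOrbit G p y θ' φ' →
      ∃ Y t : ℕ → ℝ, t 0 = 0 ∧ (∀ n, t n + p.τ ≤ t (n + 1) ∧ t (n + 1) ≤ t n + L) ∧
        (∀ n, |Y n - x| ≤ |y - x|) ∧ Tendsto Y atTop (𝓝 x) ∧
        ∀ n, ∃ θ₁ φ₁ : ℝ → ℝ, IsForwardOrbit G p (Y n) θ₁ φ₁ ∧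
          ∀ t', 0 ≤ t' → θ' (t' + t n) = θ₁ t' ∧ φ' (t' + t n) = φ₁ t' := by
    -- The first bound gives `y` the sign of `x`, the second keeps `|y|` below `r`.
    refine ⟨min (|x| / 10) (r - |x|), lt_min (by positivity) (by linarith), fun y θ' φ' hy ho => ?_⟩
    have hy1 : |y - x| ≤ |x| / 10 := (hy.trans_le (min_le_left _ _)).le
    have hy2 : |y - x| < r - |x| := hy.trans_le (min_le_right _ _)
    have hyx := mul_pos_of_close hx hy1
    have hyr : |y| < r := by linarith [abs_sub_abs_le_abs_sub y x]
    obtain ⟨θ₁, φ₁, c1, c2, e1, e2, o1⟩ := ho.exists_continuous hτ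
    let D : ℝ → Prop := fun u => 0 < u * x ∧
      ((|x| ≤ |u| ∧ |u| ≤ |y|) ∨ (|y| ≤ |u| ∧ |u| ≤ |x|))
    have hD : ∀ u, D u → u ≠ 0 ∧ |u| < r := by
      rintro u ⟨h1, h2⟩
      refine ⟨left_ne_zero_of_mul h1.ne', ?_⟩
      rcases h2 with h2 | h2 <;> linarith [h2.2]
    have hstep : ∀ u u', D u → |u' - u| ≤ |u| / 10 →
        lineEnergy p.s u' = lineEnergy p.s u + E (u ^ 2) → 0 < u' * x ∧
        (|x| ≤ |u| → |x| ≤ |u'| ∧ |u'| ≤ |u|) ∧ (|u| ≤ |x| → |u| ≤ |u'| ∧ |u'| ≤ |x|) := by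
      intro u u' hu huu hl
      obtain ⟨h1, h2⟩ := hD u hu
      have hm := hsq h1 h2
      have hux := mul_pos_of_close h1 huu
      refine ⟨?_, return_between h.slope_le (by linarith) (by linarith) huu hl (hE1 _ hm) ?_⟩
      · have : 0 < (u' * u) * (u * x) := mul_pos hux hu.1
        have h3 : 0 < u ^ 2 := by positivity
        have h4 : (u' * u) * (u * x) = u ^ 2 * (u' * x) := by ring
        rw [h4] at this
        exact pos_of_mul_pos_right this h3.le
      · by_cases hc : u ^ 2 = x ^ 2
        · rw [hc]; simp
        · exact (hE2 _ hm hc).le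
    have hDy : D y := by
      refine ⟨hyx, ?_⟩
      rcases le_total |x| |y| with h1 | h1
      · exact Or.inl ⟨h1, le_rfl⟩
      · exact Or.inr ⟨le_rfl, h1⟩
    obtain ⟨Y, t, hY0, ht0, hYt⟩ := h.exists_return_sequence hD hDy o1 c1 c2
      (fun _ u u' _ hu huu hl _ _ => by
        obtain ⟨h1, h2, h3⟩ := hstep u u' hu huu hl
        refine ⟨h1, ?_⟩
        rcases hu.2 with h4 | h4
        · have := h2 h4.1
          exact Or.inl ⟨this.1, this.2.trans h4.2⟩
        · have := h3 h4.2
          exact Or.inr ⟨h4.1.trans this.1, this.2⟩)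
    have hst : ∀ n, (|x| ≤ |Y n| → |x| ≤ |Y (n + 1)| ∧ |Y (n + 1)| ≤ |Y n|) ∧
        (|Y n| ≤ |x| → |Y n| ≤ |Y (n + 1)| ∧ |Y (n + 1)| ≤ |x|) := fun n =>
      (hstep _ _ (hYt n).1 (hYt n).2.2.2.1 (hYt n).2.2.2.2.1).2
    -- By `hE2` the only zero of `E` in the range is `x²`.
    have hlim : ∀ a, 0 < a → a < r → Tendsto (fun n => |Y n|) atTop (𝓝 a) → a = |x| := by
      intro a ha har hta
      have h1 := energy_zero_of_tendsto hE ha har hta (fun n => (hYt n).2.2.2.2.1)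
      have hm : a ^ 2 ∈ Ioo 0 (r ^ 2) := ⟨by positivity, by nlinarith⟩
      by_contra hne
      have h2 := hE2 _ hm (fun hc => hne (by
        rw [← sq_abs x] at hc
        exact (pow_left_inj₀ ha.le (abs_nonneg x) two_ne_zero).1 hc))
      rw [h1, zero_mul] at h2
      exact h2.false
    have hYx : ∀ n, 0 < Y n * x := fun n => (hYt n).1.1
    have htend : Tendsto (fun n => |Y n|) atTop (𝓝 |x|) := by
      rcases le_total |x| |y| with h1 | h1
      · have hge : ∀ n, |x| ≤ |Y n| := fun n => by
          induction n with
          | zero => rwa [hY0]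
          | succ n ih => exact ((hst n).1 ih).1
        have hanti : Antitone fun n => |Y n| := antitone_nat_of_succ_le fun n => ((hst n).1 (hge n)).2
        have hl := tendsto_atTop_ciInf hanti ⟨|x|, by rintro _ ⟨n, rfl⟩; exact hge n⟩
        have h2 := ge_of_tendsto' hl hge
        have h3 := le_of_tendsto' hl (fun n => (hanti (Nat.zero_le n)))
        simp only [hY0] at h3
        rwa [hlim _ (by linarith) (by linarith) hl] at hl
      · have hge : ∀ n, |Y n| ≤ |x| := fun n => by
          induction n with
          | zero => rwa [hY0]
          | succ n ih => exact ((hst n).2 ih).2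
        have hmono : Monotone fun n => |Y n| := monotone_nat_of_le_succ fun n => ((hst n).2 (hge n)).1
        have hl := tendsto_atTop_ciSup hmono ⟨|x|, by rintro _ ⟨n, rfl⟩; exact hge n⟩
        have h2 := le_of_tendsto' hl hge
        have h3 := ge_of_tendsto' hl (fun n => (hmono (Nat.zero_le n)))
        simp only [hY0] at h3
        have hy0 : 0 < |y| := abs_pos.2 (left_ne_zero_of_mul hyx.ne')
        rwa [hlim _ (by linarith) (by linarith) hl] at hl
    refine ⟨Y, t, ht0, fun n => ⟨(hYt n).2.1, (hYt n).2.2.1⟩, fun n => ?_, ?_, fun n =>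
      ⟨_, _, (hYt n).2.2.2.2.2, fun t' ht' => ?_⟩⟩
    · rw [← abs_sub_abs_of_mul_pos (hYx n), ← abs_sub_abs_of_mul_pos hyx]
      rcases (hYt n).1.2 with h1 | h1
      · rw [abs_of_nonneg (show 0 ≤ |Y n| - |x| by linarith),
          abs_of_nonneg (show 0 ≤ |y| - |x| by linarith [h1.1.trans h1.2])]
        linarith [h1.2]
      · rw [abs_of_nonpos (show |Y n| - |x| ≤ 0 by linarith),
          abs_of_nonpos (show |y| - |x| ≤ 0 by linarith [h1.1.trans h1.2])]
        linarith [h1.1]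
    · rw [tendsto_iff_norm_sub_tendsto_zero]
      have := (htend.sub_const |x|).abs
      rw [sub_self, abs_zero] at this
      refine this.congr fun n => ?_
      rw [Real.norm_eq_abs, abs_sub_abs_of_mul_pos (hYx n)]
    · have htn : 0 ≤ t n := by
        induction n with
        | zero => rw [ht0]
        | succ n ih => linarith [(hYt n).2.1]
      have hm : t' + t n ∈ Ici (-p.τ) := by simp only [mem_Ici]; linarith
      exact ⟨e1 hm, e2 hm⟩
  obtain ⟨δ₀, hδ₀, hkey⟩ := key
  have hclose : ∀ ε > 0, ∃ δ > 0, ∀ (y : ℝ) (θ' φ' : ℝ → ℝ), |y - x| < δ → IsForwardOrbit G p y θ' φ' →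
      ∀ t ∈ Icc 0 L, Metric.infDist (θ' t, φ' t) (orbitSet θ φ) < ε := by
    intro ε hε
    obtain ⟨δ, hδ, hd⟩ := exists_close hG hτ hp.1 (hp.countable_zero hτ) L hε
    exact ⟨δ, hδ, fun y θ' φ' hy ho t ht =>
      (Metric.infDist_le_dist_of_mem (mem_range_self t)).trans_lt (hd y θ' φ' hy ho t ht)⟩
  have hθ0 : θ 0 = x := hp.1.pos_zero
  rw [IsAsymptoticallyStable, IsStable, hθ0]
  refine ⟨fun ε hε => ?_, δ₀, hδ₀, fun y θ' φ' hy ho => ?_⟩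
  · obtain ⟨δ, hδ, hd⟩ := hclose ε hε
    refine ⟨min δ δ₀, lt_min hδ hδ₀, fun y θ' φ' hy ho T hT => ?_⟩
    obtain ⟨Y, t, ht0, ht, hY, -, hO⟩ := hkey y θ' φ' (hy.trans_le (min_le_right _ _)) ho
    -- After the `n`-th return the orbit starts from `Y n`, no farther from `x` than `y`, and the
    -- remaining time is at most `L`.
    obtain ⟨n, -, hn⟩ := exists_index hτ ht0 ht hT 0 (by rw [ht0]; exact hT)
    obtain ⟨θ₁, φ₁, o1, e1⟩ := hO n
    have := hd (Y n) θ₁ φ₁ ((hY n).trans_lt (hy.trans_le (min_le_left _ _))) o1 _ hn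
    obtain ⟨e2, e3⟩ := e1 _ hn.1
    rwa [← e2, ← e3, sub_add_cancel] at this
  · obtain ⟨Y, t, ht0, ht, hY, hlim, hO⟩ := hkey y θ' φ' hy ho
    rw [Metric.tendsto_atTop]
    intro ε hε
    obtain ⟨δ, hδ, hd⟩ := hclose ε hε
    obtain ⟨m, hm⟩ := Metric.tendsto_atTop.1 hlim δ hδ
    refine ⟨max 0 (t m), fun T hT => ?_⟩
    obtain ⟨n, hmn, hn⟩ := exists_index hτ ht0 ht ((le_max_left _ _).trans hT) m
      ((le_max_right _ _).trans hT)
    obtain ⟨θ₁, φ₁, o1, e1⟩ := hO n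
    have := hd (Y n) θ₁ φ₁ (hm n hmn) o1 _ hn
    obtain ⟨e2, e3⟩ := e1 _ hn.1
    rw [← e2, ← e3, sub_add_cancel] at this
    rwa [Real.dist_eq, sub_zero, abs_of_nonneg Metric.infDist_nonneg]

/-- Starting slightly outside `x`, energy is lost at each return, so `|Y n|` increases. Stability
would confine the sequence below a window on the line that is separated from the periodic curve,
because a single return is too short to jump across. The sequence would then converge to a zero of
`E` outside `x²`, and there is none. -/
theorem HasCycles.not_isStable (h : HasCycles G p r L E) (hx : x ≠ 0) (hxr : |x| < r)
    (hE : ContinuousOn E (Ioo 0 (r ^ 2))) (hE1 : ∀ z ∈ Ioo 0 (r ^ 2), |E z| ≤ |z - x ^ 2| / 4)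
    (hE2 : ∀ z ∈ Ioo 0 (r ^ 2), z ≠ x ^ 2 → E z * (z - x ^ 2) < 0)
    (hp : IsZigzagPeriodicOrbit G p x θ φ P) : ¬ IsStable G p θ φ := by
  intro hst
  have hτ := h.delay_pos
  have hG := h.actuation
  have hr2 := h.radius_le
  have hx0 : 0 < x ^ 2 := by positivity
  have hxr2 : x ^ 2 < r ^ 2 := sq_lt_sq.2 (by rwa [abs_of_pos h.radius_pos])
  obtain ⟨T, hz⟩ := hp.2.1
  have hP0 : 0 < P := by linarith [hz.pos, hz.delay_le]
  -- a window that the periodic orbit avoids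
  obtain ⟨η, hη0, hηr, hηT⟩ : ∃ η > 0, 2 * η < r ^ 2 - x ^ 2 ∧
      ¬ (x ^ 2 + η ≤ θ T ^ 2 ∧ θ T ^ 2 ≤ x ^ 2 + 2 * η) := by
    rcases le_or_gt (θ T ^ 2) (x ^ 2) with h1 | h1
    · exact ⟨(r ^ 2 - x ^ 2) / 3, by linarith, by linarith, fun h2 => by linarith [h2.1]⟩
    · refine ⟨min ((r ^ 2 - x ^ 2) / 3) ((θ T ^ 2 - x ^ 2) / 3), lt_min (by linarith) (by linarith),
        ?_, fun h2 => ?_⟩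
      · linarith [min_le_left ((r ^ 2 - x ^ 2) / 3) ((θ T ^ 2 - x ^ 2) / 3)]
      · linarith [min_le_right ((r ^ 2 - x ^ 2) / 3) ((θ T ^ 2 - x ^ 2) / 3), h2.2]
  -- The window, placed on the switching line. The periodic curve meets the line only at its start
  -- and at its crossing point, and `η` was chosen so that both avoid the window; two disjoint
  -- compact sets have positive distance.
  set K : Set (ℝ × ℝ) := (fun u => (u, p.s * u)) '' {u | x ^ 2 + η ≤ u ^ 2 ∧ u ^ 2 ≤ x ^ 2 + 2 * η}
    with hK
  have hKc : IsCompact K := by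
    refine IsCompact.image ?_ (by fun_prop)
    refine Metric.isCompact_of_isClosed_isBounded ?_ ?_
    · exact (isClosed_le (f := fun _ : ℝ => x ^ 2 + η) (g := fun u => u ^ 2) (by fun_prop)
        (by fun_prop)).inter (isClosed_le (f := fun u : ℝ => u ^ 2) (g := fun _ => x ^ 2 + 2 * η)
        (by fun_prop) (by fun_prop))
    · refine (Metric.isBounded_Icc (-r) r).subset fun u hu => ?_
      exact abs_le.1 (abs_le_of_sq_le_sq (by linarith [hu.2]) h.radius_pos.le)
  have hOim : orbitSet θ φ = (fun t => (θ t, φ t)) '' Icc 0 P := by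
    refine Subset.antisymm ?_ (image_subset_range _ _)
    rintro _ ⟨t, rfl⟩
    obtain ⟨n, t', ht', -, e1, e2, -⟩ := hp.exists_reduced hτ hz t
    exact ⟨t', Ico_subset_Icc_self ht', by simp only [e1, e2]⟩
  have hOc : IsCompact (orbitSet θ φ) := by
    rw [hOim]
    have hsub : Icc 0 P ⊆ Ici (-p.τ) := fun t ht => by
      simp only [mem_Ici]; linarith [ht.1]
    exact isCompact_Icc.image_of_continuousOn ((hp.1.isSolution.continuousOn_pos.mono hsub).prodMk
      (hp.1.isSolution.continuousOn_vel.mono hsub))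
  have hdisj : Disjoint K (orbitSet θ φ) := by
    rw [Set.disjoint_left]
    rintro _ ⟨u, hu, rfl⟩ ⟨t, ht⟩
    obtain ⟨h1, h2⟩ := Prod.mk.inj ht
    obtain ⟨n, t', ht', -, e1, e2, h3⟩ := hp.exists_reduced hτ hz t
    rw [← h1] at hu
    rw [e1] at hu
    rcases h3 (region_eq_zero (by rw [h2, h1])) with rfl | rfl
    · rw [hp.1.pos_zero] at hu
      linarith [hu.1]
    · exact hηT hu
  obtain ⟨ε, hε, hthick⟩ := hdisj.exists_thickenings hKc hOc.isClosed
  have hne : (orbitSet θ φ).Nonempty := range_nonempty _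
  have hfar : ∀ k ∈ K, ¬ Metric.infDist k (orbitSet θ φ) < ε := fun k hk hlt =>
    Set.disjoint_left.1 hthick (Metric.self_subset_thickening hε K hk)
      ((Metric.mem_thickening_iff_infDist_lt hne).2 hlt)
  obtain ⟨δ, hδ, hd⟩ := hst ε hε
  rw [hp.1.pos_zero] at hd
  -- The start `x (1 + ι)` is outside `x`, below the window, and within the `δ` of the supposed
  -- stability.
  obtain ⟨ι, hι0, hι1, hι2⟩ : ∃ ι : ℝ, 0 < ι ∧ |x * (1 + ι) - x| < δ ∧ (x * (1 + ι)) ^ 2 < x ^ 2 + η := by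
    have t1 : Tendsto (fun ι : ℝ => |x * (1 + ι) - x|) (𝓝[>] 0) (𝓝 |x * (1 + 0) - x|) :=
      (Continuous.tendsto (by fun_prop) 0).mono_left nhdsWithin_le_nhds
    have t2 : Tendsto (fun ι : ℝ => (x * (1 + ι)) ^ 2) (𝓝[>] 0) (𝓝 ((x * (1 + 0)) ^ 2)) :=
      (Continuous.tendsto (by fun_prop) 0).mono_left nhdsWithin_le_nhds
    simp only [add_zero, mul_one, sub_self, abs_zero] at t1 t2
    obtain ⟨ι, h1, h2, h3⟩ := ((eventually_mem_nhdsWithin : ∀ᶠ ι : ℝ in 𝓝[>] 0, ι ∈ Ioi (0:ℝ)).and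
      ((t1.eventually_lt_const hδ).and (t2.eventually_lt_const (lt_add_of_pos_right _ hη0)))).exists
    exact ⟨ι, h1, h2, h3⟩
  set y := x * (1 + ι) with hy
  have hyx : 0 < y * x := by rw [hy, show x * (1 + ι) * x = x ^ 2 * (1 + ι) by ring]; positivity
  have hy2 : x ^ 2 < y ^ 2 := by
    rw [hy, mul_pow]
    nlinarith
  obtain ⟨θ₀, φ₀, o0⟩ := exists_isForwardOrbit hG hτ y
  obtain ⟨θ₁, φ₁, c1, c2, -, -, o1⟩ := o0.exists_continuous hτ
  let D : ℝ → Prop := fun u => y ^ 2 ≤ u ^ 2 ∧ u ^ 2 ≤ x ^ 2 + η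
  have hD : ∀ u, D u → u ≠ 0 ∧ |u| < r := fun u hu => by
    refine ⟨fun h0 => ?_, abs_lt_of_sq_lt_sq (by linarith [hu.2]) h.radius_pos.le⟩
    have := hu.1
    rw [h0] at this
    nlinarith
  have hmem : ∀ {u}, D u → u ^ 2 ∈ Ioo 0 (r ^ 2) := fun hu =>
    ⟨by linarith [hu.1], by linarith [hu.2]⟩
  have hEneg : ∀ {u}, D u → E (u ^ 2) < 0 := fun {u} hu => by
    have h1 : 0 < u ^ 2 - x ^ 2 := by linarith [hu.1]
    have := hE2 _ (hmem hu) (by linarith)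
    by_contra hc
    exact absurd (mul_nonneg (not_lt.1 hc) h1.le) this.not_ge
  -- The energy lost is at most `(u² - x²)/4`, so the excess over `x²` at most doubles per return.
  -- The window from `x² + η` to `x² + 2 η` is exactly wide enough to be hit.
  have hgrow : ∀ {u u'}, D u → |u' - u| ≤ |u| / 10 →
      lineEnergy p.s u' = lineEnergy p.s u + E (u ^ 2) → |u| ≤ |u'| ∧ u' ^ 2 ≤ 2 * u ^ 2 - x ^ 2 := by
    intro u u' hu huu hl
    have hur := (hD u hu).2
    have h1 := hEneg hu
    have h2 : |u| ≤ |u'| := abs_le_of_lineEnergy_le h.slope_le (by linarith) (by linarith)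
    have h3 := sq_sub_sq_le_lineEnergy h.slope_le h2 (by linarith [(abs_le_of_close huu).1])
    have h4 := hE1 _ (hmem hu)
    rw [abs_of_neg h1, abs_of_pos (by linarith [hu.1])] at h4
    exact ⟨h2, by linarith⟩
  obtain ⟨Y, t, hY0, ht0, hYt⟩ := h.exists_return_sequence hD (y₀ := y) ⟨le_rfl, hι2.le⟩ o1 c1 c2
    (fun t u u' ht hu huu hl hθt hφt => by
      obtain ⟨h1, h2⟩ := hgrow hu huu hl
      have h3 := sq_le_sq.2 h1
      refine ⟨hu.1.trans h3, ?_⟩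
      -- A return beyond `x² + η` would lie in the window, hence at distance at least `ε` from the
      -- periodic curve.
      by_contra hc
      refine hfar (θ₁ t, φ₁ t) ⟨u', ⟨(not_le.1 hc).le, by linarith [hu.2]⟩, ?_⟩
        (hd y θ₁ φ₁ hι1 o1 t ht)
      simp only [hθt, hφt])
  have hmono : Monotone fun n => |Y n| := monotone_nat_of_le_succ fun n =>
    (hgrow (hYt n).1 (hYt n).2.2.2.1 (hYt n).2.2.2.2.1).1
  have hle : ∀ n, |Y n| ≤ Real.sqrt (x ^ 2 + η) := fun n =>
    Real.abs_le_sqrt (hYt n).1.2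
  have hl := tendsto_atTop_ciSup hmono ⟨_, by rintro _ ⟨n, rfl⟩; exact hle n⟩
  set a := ⨆ n, |Y n|
  have h1 : a ≤ Real.sqrt (x ^ 2 + η) := le_of_tendsto' hl hle
  have h2 : |Y 0| ≤ a := ge_of_tendsto' hl fun n => hmono (Nat.zero_le n)
  rw [hY0] at h2
  have ha : 0 < a := (abs_pos.2 (left_ne_zero_of_mul hyx.ne')).trans_le h2
  have ha2 : a ^ 2 ≤ x ^ 2 + η := by
    rw [← Real.sq_sqrt (show 0 ≤ x ^ 2 + η by positivity)]
    exact pow_le_pow_left₀ ha.le h1 2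
  have har : a < r := lt_of_pow_lt_pow_left₀ 2 h.radius_pos.le (by linarith)
  have hya : y ^ 2 ≤ a ^ 2 := sq_le_sq.2 (by rwa [abs_of_pos ha])
  have h3 := energy_zero_of_tendsto hE ha har hl (fun n => (hYt n).2.2.2.2.1)
  exact absurd h3 (hEneg ⟨hya, ha2⟩).ne

end Stability
end Pendulum

namespace Pendulum
open TimeFun

/-! ### The local model -/

/-- Near the base point, forward orbits of small points `x` of the switching line, with
`q.2 = x ^ 2`, perform zigzag oscillations with intersection time `τ U`, first controlled position
`x m`, and energy change `τ f (x m)²`. -/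
structure LocalModel (e a₀ b₀ : ℝ) (f m U : Params × ℝ → ℝ) (M : ℝ) : Prop where
  cycle : ∀ᶠ q in 𝓝 (basePoint a₀ b₀), ∀ (G : ℝ → ℝ) (x : ℝ) (θ φ : ℝ → ℝ), IsActuation G →
    (∀ y, G y = 1 + e * (Real.cos y - 1)) → q.2 = x ^ 2 → x ≠ 0 → 0 < q.1.τ →
    IsForwardOrbit G q.1 x θ φ → ∃ P, IsCycle q.1 x θ φ (q.1.τ * U q) P ∧ P ≤ M * q.1.τ ∧
      θ q.1.τ = x * m q ∧ energyChange q.1 θ φ (q.1.τ * U q) = q.1.τ * f q * (x * m q) ^ 2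
  bound_pos : 0 < M
  close : ∀ᶠ q in 𝓝 (basePoint a₀ b₀), |m q - 1| ≤ 1 / 20
  approx : ∃ C, ∀ᶠ q in 𝓝 (basePoint a₀ b₀), 2 ≤ U q →
    |f q - energyCoeffAt e q| ≤ C * (|q.1.s| + |q.1.τ|) ^ 3
  two_le : a₀ < 2 → ∀ᶠ q in 𝓝 (basePoint a₀ b₀), 2 ≤ U q
  smooth : a₀ < 2 → ContDiffAt ℝ 2 f (basePoint a₀ b₀)
  smooth_pos : a₀ < 2 → ContDiffAt ℝ 2 m (basePoint a₀ b₀)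
  order : a₀ < 2 → (fun q => f q - energyCoeffAt e q) ∈
    OrderClass (fun q : Params × ℝ => q.1.s) (fun q => q.1.τ) (𝓝 (basePoint a₀ b₀))
      {f | ContDiffAt ℝ 1 f (basePoint a₀ b₀)} 3

section
variable {e e' N a₀ b₀ : ℝ} {ϑ σ κ w : Params × ℝ → TimeFun} {U : Params × ℝ → ℝ}

lemma localModel_of_family (h : IsOnFamily e N (basePoint a₀ b₀) ϑ σ κ w)
    (hb : IsBased N a₀ b₀ ϑ σ κ w) (ha : 1 < a₀) (hN : a₀ / (a₀ - 1) + 1 < N)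
    (hU : ∀ᶠ q in 𝓝 (basePoint a₀ b₀), IsOnPhase e N q (ϑ q) (σ q) (κ q) (w q) (U q)) :
    LocalModel e a₀ b₀ (energyRate e N ϑ κ w U) (fun q => ϑ q 1) U
      (N + 4 * (‖w (basePoint a₀ b₀)‖ + 1)) := by
  have hN0 : 0 < N := by
    have : 0 < a₀ / (a₀ - 1) := div_pos (by linarith) (by linarith)
    linarith
  set q₀ := basePoint a₀ b₀ with hq₀
  set W := ‖w q₀‖ + 1 with hW
  have hW0 : 0 < W := by positivity
  have hws : ∀ᶠ q in 𝓝 q₀, ‖w q‖ ≤ W :=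
    (h.dev.continuousAt.norm.eventually_lt_const (lt_add_one _)).mono fun _ h => h.le
  have hτ : ∀ᶠ q : Params × ℝ in 𝓝 q₀, q.1.τ * W < 1 / 100 :=
    ((by fun_prop : ContDiff ℝ 0 fun q : Params × ℝ => q.1.τ * W).continuous.tendsto q₀).eventually_lt_const
      (by simp [hq₀, basePoint, Params.τ])
  have hs : ∀ᶠ q : Params × ℝ in 𝓝 q₀, |q.1.s| < 1 / 2 :=
    ((by fun_prop : ContDiff ℝ 0 fun q : Params × ℝ => q.1.s).continuous.abs.tendsto q₀).eventually_lt_const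
      (by simp [hq₀, basePoint, Params.s])
  have hz : ∀ᶠ q : Params × ℝ in 𝓝 q₀, q.2 < 1 / 4 :=
    (continuous_snd.tendsto q₀).eventually_lt_const (by simp [hq₀, basePoint])
  refine ⟨?_, by positivity, ?_, energyRate_bound h hb ha hU,
    fun ha2 => (energyRate_smooth h hb ha ha2 hN hU).1,
    fun ha2 => (energyRate_smooth h hb ha ha2 hN hU).2.1,
    fun ha2 => (energyRate_smooth h hb ha ha2 hN hU).2.2.1,
    fun ha2 => (energyRate_smooth h hb ha ha2 hN hU).2.2.2⟩
  · filter_upwards [hU, hws, hτ, hs, hz] with q h1 h2 h3 h4 h5 G x θ φ hG hGe hq hx hτ0 ho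
    obtain ⟨p, z⟩ := q
    simp only at *
    subst hq
    have hx2 : |x| ≤ 1 / 2 := abs_le_of_sq_le_sq (by norm_num; linarith) (by norm_num)
    obtain ⟨θ', φ', c1, c2, e1, e2, ho'⟩ := ho.exists_continuous hτ0
    obtain ⟨P, hc, hP, hθ, hE⟩ := h1.exists_isCycle hG hGe hτ0 hx hx2 h4.le h2 h3.le ho' c1 c2
    have hsub : Ici (0:ℝ) ⊆ Ici (-p.τ) := Ici_subset_Ici.2 (by linarith)
    have e1' : EqOn θ' θ (Ici 0) := (e1.mono hsub).symm
    have e2' : EqOn φ' φ (Ici 0) := (e2.mono hsub).symm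
    refine ⟨P, hc.congr hτ0 e1' e2', by linarith, ?_, ?_⟩
    · rw [← e1' (mem_Ici.2 hτ0.le), hθ]
    · rw [energyChange_congr hτ0 hc.zigzag.pos e1' e2', hE]
      have h6 : ϑ (p, x ^ 2) 1 ≠ 0 := by
        have := (abs_le.1 (h1.pos_close 1)).1
        intro h0
        rw [h0] at this
        norm_num at this
      simp only [energyRate, posWork, devWork]
      field_simp
  · filter_upwards [hU] with q hq using hq.pos_close 1

/-- At amplitude zero the rescaled cosine is constantly `1`, so the actuation is `1` whatever `e`
is. -/
lemma IsOnCurve.of_zero {q : Params × ℝ} {ϑ σ κ w : TimeFun} (h : IsOnCurve e N q ϑ σ κ w)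
    (hq : q.2 = 0) : IsOnCurve e' N q ϑ σ κ w := by
  have hκ : κ = 1 := by
    rw [h.cos, hq]
    simp [trigSqrt_zero_right]
  refine ⟨h.pos, h.sin, h.cos, ?_⟩
  have := h.dev
  rw [hκ] at this ⊢
  simpa [act] using this

end

/-- Local models for all actuations. At amplitude zero, they all have the same energy rate. -/
theorem exists_localModel {a₀ : ℝ} (ha : 1 < a₀) (b₀ : ℝ) :
    ∃ (f m U : ℝ → Params × ℝ → ℝ) (M : ℝ → ℝ),
      (∀ e, LocalModel e a₀ b₀ (f e) (m e) (U e) (M e)) ∧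
      ∀ e e', ∀ᶠ q in 𝓝 (basePoint a₀ b₀), q.2 = 0 → f e q = f e' q := by
  obtain ⟨N, hN⟩ : ∃ N, a₀ / (a₀ - 1) + 1 < N := exists_gt _
  have hN1 : 1 < N := by
    have : 0 < a₀ / (a₀ - 1) := div_pos (by linarith) (by linarith)
    linarith
  choose ϑ σ κ w hfam hϑ hσ hκ hw huniq using fun e => exists_onFamily e N a₀ b₀
  have hb : ∀ e, IsBased N a₀ b₀ (ϑ e) (σ e) (κ e) (w e) := fun e => ⟨hϑ e, hσ e, hκ e, hw e⟩
  choose U hU using fun e => exists_isOnPhase (hfam e) (hb e) ha hN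
  refine ⟨_, _, U, _, fun e => localModel_of_family (hfam e) (hb e) ha hN (hU e), fun e e' => ?_⟩
  have ht : Tendsto (fun q => (q, (((ϑ e' q, σ e' q, κ e' q), w e' q) :
      (TimeFun × TimeFun × TimeFun) × TimeFun))) (𝓝 (basePoint a₀ b₀))
      (𝓝 (basePoint a₀ b₀, (((1, 1, 1), integ 0 N 1 - a₀ • integ 1 N 1) :
        (TimeFun × TimeFun × TimeFun) × TimeFun))) := by
    have h1 := (hfam e').pos.continuousAt.tendsto
    have h2 := (hfam e').sin.continuousAt.tendsto
    have h3 := (hfam e').cos.continuousAt.tendsto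
    have h4 := (hfam e').dev.continuousAt.tendsto
    rw [hϑ] at h1
    rw [hσ] at h2
    rw [hκ] at h3
    rw [hw] at h4
    exact tendsto_id.prodMk_nhds ((h1.prodMk_nhds (h2.prodMk_nhds h3)).prodMk_nhds h4)
  -- For small parameters the curve of the family `e'` lies in the uniqueness neighbourhood of the
  -- family `e`; at amplitude zero the two curves therefore coincide, and so do their crossing
  -- times.
  filter_upwards [ht.eventually (huniq e), hU e, hU e', (hfam e').eq] with q h1 h2 h3 h4 hq
  have h5 := h1 (h4.of_zero hq)
  simp only [Prod.mk.injEq] at h5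
  obtain ⟨⟨i1, i2, i3⟩, i4⟩ := h5
  have hκ1 : κ e' q = 1 := by
    rw [h4.cos, hq]
    simp [trigSqrt_zero_right]
  have hUU : U e q = U e' q := by
    refine h3.eq_of_zero ⟨by linarith [h2.one_lt], by linarith [h2.lt_end]⟩ ?_
    rw [← i4]
    exact h2.cross
  simp only [energyRate, posWork, devWork, i1, i3, i4, hUU, hκ1, act, sub_self, smul_zero]

end Pendulum

namespace Pendulum

/-! ### Zero curves -/

lemma hasDerivAt_of_quadratic_bound {f : ℝ → ℝ} {β C : ℝ} (h : ∀ᶠ x in 𝓝 0, |f x - β * x| ≤ C * x ^ 2) :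
    HasDerivAt f β 0 := by
  have h0 : f 0 = 0 := by simpa using h.self_of_nhds
  rw [hasDerivAt_iff_isLittleO]
  have h1 : (fun x => f x - f 0 - (x - 0) • β) =O[𝓝 0] fun x : ℝ => x ^ 2 := by
    refine Asymptotics.IsBigO.of_bound C (h.mono fun x hx => ?_)
    rw [h0, Real.norm_eq_abs, Real.norm_eq_abs, abs_of_nonneg (sq_nonneg x), smul_eq_mul]
    rwa [show f x - 0 - (x - 0) * β = f x - β * x by ring]
  refine h1.trans_isLittleO ?_
  simpa using Asymptotics.isLittleO_pow_id (𝕜 := ℝ) one_lt_two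

/-- The polynomial of degree two in `s` and `τ` without constant term. -/
def quadPoly (α β γ₁ γ₂ γ₃ : ℝ × ℝ → ℝ) (p : Params) : ℝ :=
  α (p.a, p.b) * p.s + β (p.a, p.b) * p.τ + γ₁ (p.a, p.b) * p.s ^ 2 + γ₂ (p.a, p.b) * (p.s * p.τ)
    + γ₃ (p.a, p.b) * p.τ ^ 2

section ZeroCurve
variable {F : Params → ℝ} {a₀ b₀ : ℝ} {α β γ₁ γ₂ γ₃ A₁ A₂ : ℝ × ℝ → ℝ}

/-- The linear coefficient is the derivative with respect to the delay. -/
lemma fderiv_delay (hF : ContDiffAt ℝ 1 F (a₀, b₀, 0, 0))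
    (hQ : ∃ C, ∀ᶠ p : Params in 𝓝 (a₀, b₀, 0, 0),
      |F p - quadPoly α β γ₁ γ₂ γ₃ p| ≤ C * (|p.s| + |p.τ|) ^ 3) :
    fderiv ℝ F (a₀, b₀, 0, 0) (0, 0, 0, 1) = β (a₀, b₀) := by
  obtain ⟨C, hC⟩ := hQ
  have hd := (hF.differentiableAt (by simp)).hasFDerivAt
  have hline : HasDerivAt (fun τ : ℝ => ((a₀, b₀, 0, τ) : Params)) (0, 0, 0, 1) 0 :=
    (hasDerivAt_const _ _).prodMk ((hasDerivAt_const _ _).prodMk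
      ((hasDerivAt_const _ _).prodMk (hasDerivAt_id _)))
  have h1 := hd.comp_hasDerivAt (f := fun τ : ℝ => ((a₀, b₀, 0, τ) : Params)) 0 hline
  refine h1.unique (hasDerivAt_of_quadratic_bound (C := |C| + |γ₃ (a₀, b₀)|) ?_)
  have h2 : Tendsto (fun τ : ℝ => ((a₀, b₀, 0, τ) : Params)) (𝓝 0) (𝓝 (a₀, b₀, 0, 0)) :=
    (Continuous.tendsto (by fun_prop) 0)
  filter_upwards [h2.eventually hC, Metric.ball_mem_nhds (0:ℝ) one_pos] with τ h3 h4
  simp only [quadPoly, Params.a, Params.b, Params.s, Params.τ, Function.comp] at h3 ⊢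
  rw [mem_ball_zero_iff, Real.norm_eq_abs] at h4
  have h5 : C * (|0| + |τ|) ^ 3 ≤ |C| * τ ^ 2 := by
    rw [abs_zero, zero_add, ← sq_abs τ]
    calc C * |τ| ^ 3 ≤ |C| * |τ| ^ 3 := by gcongr; exact le_abs_self C
      _ ≤ |C| * |τ| ^ 2 := by
        gcongr ?_ * ?_
        exact pow_le_pow_of_le_one (abs_nonneg _) h4.le (by norm_num)
  calc _ = |(F (a₀, b₀, 0, τ) - (α (a₀, b₀) * 0 + β (a₀, b₀) * τ + γ₁ (a₀, b₀) * 0 ^ 2 +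
        γ₂ (a₀, b₀) * (0 * τ) + γ₃ (a₀, b₀) * τ ^ 2)) + γ₃ (a₀, b₀) * τ ^ 2| := by congr 1; ring
    _ ≤ _ := abs_add_le _ _
    _ ≤ |C| * τ ^ 2 + |γ₃ (a₀, b₀)| * τ ^ 2 := by
      rw [abs_mul, abs_of_nonneg (sq_nonneg τ)]
      exact add_le_add (h3.trans h5) le_rfl
    _ = _ := by ring

/-- A function of slope above `B` whose value at `A` is at most `B D` in absolute value changes sign
within `D` of `A`; monotonicity makes its zero unique. -/
lemma exists_zero_near {g g' : ℝ → ℝ} {B A D ε : ℝ} (hB : 0 < B)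
    (hg : ∀ τ, |τ| ≤ ε → B < g' τ ∧ HasDerivAt g (g' τ) τ) (hAD : |g A| ≤ B * D)
    (h0 : 0 < A - D) (hε : A + D < ε) : ∃ τ' : ℝ, 0 < τ' ∧ τ' < ε ∧ |τ' - A| ≤ D ∧
      ∀ τ : ℝ, 0 < τ → τ < ε → (g τ = 0 ↔ τ = τ') := by
  have hD : 0 ≤ D := by
    by_contra hc
    exact absurd ((abs_nonneg _).trans hAD) (mul_neg_of_pos_of_neg hB (not_le.1 hc)).not_ge
  have hgd : ∀ τ ∈ Icc (-ε) ε, B < g' τ ∧ HasDerivAt g (g' τ) τ := fun τ h => hg τ (abs_le.2 h)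
  have hgc : ContinuousOn g (Icc (-ε) ε) := fun τ hτ =>
    (hgd τ hτ).2.continuousAt.continuousWithinAt
  have hgrow : ∀ τ₁ ∈ Icc (-ε) ε, ∀ τ₂ ∈ Icc (-ε) ε, τ₁ ≤ τ₂ → B * (τ₂ - τ₁) ≤ g τ₂ - g τ₁ := by
    refine (convex_Icc (-ε) ε).mul_sub_le_image_sub_of_le_deriv hgc ?_ ?_
    · exact fun τ hτ => (hgd τ (interior_subset hτ)).2.differentiableAt.differentiableWithinAt
    · intro τ hτ
      rw [(hgd τ (interior_subset hτ)).2.deriv]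
      exact (hgd τ (interior_subset hτ)).1.le
  have hAm : A ∈ Icc (-ε) ε := ⟨by linarith, by linarith⟩
  have m1 : A - D ∈ Icc (-ε) ε := ⟨by linarith, by linarith⟩
  have m2 : A + D ∈ Icc (-ε) ε := ⟨by linarith, by linarith⟩
  obtain ⟨g1, g2⟩ := abs_le.1 hAD
  have hup : 0 ≤ g (A + D) := by
    have := hgrow _ hAm _ m2 (by linarith)
    rw [add_sub_cancel_left] at this
    linarith
  have hdn : g (A - D) ≤ 0 := by
    have := hgrow _ m1 _ hAm (by linarith)
    rw [sub_sub_cancel] at this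
    linarith
  obtain ⟨τ', hτ', hz⟩ := intermediate_value_Icc (by linarith)
    (hgc.mono (Icc_subset_Icc m1.1 m2.2)) ⟨hdn, hup⟩
  have hτ0 : 0 < τ' := lt_of_lt_of_le h0 hτ'.1
  have hτε : τ' < ε := lt_of_le_of_lt hτ'.2 hε
  refine ⟨τ', hτ0, hτε, abs_le.2 ⟨by linarith [hτ'.1], by linarith [hτ'.2]⟩, fun τ h3 h4 => ?_⟩
  refine ⟨fun h5 => ?_, fun h5 => h5 ▸ hz⟩
  have n1 : τ ∈ Icc (-ε) ε := ⟨by linarith, h4.le⟩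
  have n2 : τ' ∈ Icc (-ε) ε := ⟨by linarith, hτε.le⟩
  rcases lt_trichotomy τ τ' with h6 | h6 | h6
  · have := hgrow _ n1 _ n2 h6.le
    rw [hz, h5, sub_zero] at this
    exact absurd this (mul_pos hB (sub_pos.2 h6)).not_ge
  · exact h6
  · have := hgrow _ n2 _ n1 h6.le
    rw [hz, h5, sub_zero] at this
    exact absurd this (mul_pos hB (sub_pos.2 h6)).not_ge

/-- Bounds the residual of `F` at the approximate root `A`, where the quadratic polynomial has been
reduced to `R s³` and `A` is comparable to `|s|`. -/
lemma abs_le_at_approx {p : Params} {C k CR R A : ℝ} (hA0 : 0 ≤ A) (hA : A ≤ 8 * k * |p.s|) (hk : 0 < k)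
    (hR : |R| < CR) {v Q : ℝ} (hQ : Q = R * p.s ^ 3) (h : |v - Q| ≤ C * (|p.s| + |A|) ^ 3) :
    |v| ≤ (|C| * (1 + 8 * k) ^ 3 + CR) * |p.s| ^ 3 := by
  have h5 : C * (|p.s| + |A|) ^ 3 ≤ |C| * (1 + 8 * k) ^ 3 * |p.s| ^ 3 := by
    rw [abs_of_nonneg hA0]
    calc C * (|p.s| + A) ^ 3 ≤ |C| * ((1 + 8 * k) * |p.s|) ^ 3 := by
          gcongr
          · exact le_abs_self C
          · linarith
      _ = _ := by ring
  have h6 : |Q| ≤ CR * |p.s| ^ 3 := by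
    rw [hQ, abs_mul, abs_pow]
    exact mul_le_mul_of_nonneg_right hR.le (by positivity)
  calc |v| = |(v - Q) + Q| := by rw [sub_add_cancel]
    _ ≤ _ := abs_add_le _ _
    _ ≤ |C| * (1 + 8 * k) ^ 3 * |p.s| ^ 3 + CR * |p.s| ^ 3 := add_le_add (h.trans h5) h6
    _ = _ := by ring

/-- The conditions `h1` and `h2` say that `A₁ s + A₂ s²` annihilates the quadratic polynomial in
orders one and two, so `F` is `O(|s|³)` there. As the delay derivative of `F` stays above half of `β
(a₀, b₀)`, the true root is within `O(|s|³)` of this approximation. -/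
lemma exists_zero_curve_of_pos (hF : ContDiffAt ℝ 1 F (a₀, b₀, 0, 0))
    (hγ₂ : ContinuousAt γ₂ (a₀, b₀)) (hγ₃ : ContinuousAt γ₃ (a₀, b₀))
    (hA₁ : ContinuousAt A₁ (a₀, b₀)) (hA₂ : ContinuousAt A₂ (a₀, b₀))
    (hQ : ∃ C, ∀ᶠ p : Params in 𝓝 (a₀, b₀, 0, 0),
      |F p - quadPoly α β γ₁ γ₂ γ₃ p| ≤ C * (|p.s| + |p.τ|) ^ 3)
    (hβ : 0 < β (a₀, b₀)) (hA : A₁ (a₀, b₀) < 0)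
    (h1 : ∀ᶠ y in 𝓝 (a₀, b₀), α y + β y * A₁ y = 0)
    (h2 : ∀ᶠ y in 𝓝 (a₀, b₀), β y * A₂ y + γ₁ y + γ₂ y * A₁ y + γ₃ y * A₁ y ^ 2 = 0)
    {ε₀ : ℝ} (hε₀ : 0 < ε₀) :
    ∃ ε > 0, ε ≤ ε₀ ∧ ∃ δ > 0, δ ≤ ε₀ ∧ ∃ C > 0, ∀ a b s : ℝ,
      |a - a₀| < δ → |b - b₀| < δ → -δ < s → s < 0 →
        ∃ τ' : ℝ, 0 < τ' ∧ τ' < ε ∧ |τ' - (A₁ (a, b) * s + A₂ (a, b) * s ^ 2)| ≤ C * |s| ^ 3 ∧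
          ∀ τ : ℝ, 0 < τ → τ < ε → (F (a, b, s, τ) = 0 ↔ τ = τ') := by
  have hfd := fderiv_delay hF hQ
  obtain ⟨C, hC⟩ := hQ
  set p₀ : Params := (a₀, b₀, 0, 0) with hp₀
  set B₀ := β (a₀, b₀) with hB₀
  have e1 : ∀ᶠ p in 𝓝 p₀, DifferentiableAt ℝ F p :=
    (hF.eventually (by simp)).mono fun p hp => hp.differentiableAt (by simp)
  have e2 : ∀ᶠ p in 𝓝 p₀, B₀ / 2 < fderiv ℝ F p (0, 0, 0, 1) := by
    have : ContinuousAt (fun p => fderiv ℝ F p (0, 0, 0, 1)) p₀ :=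
      (((hF.fderiv_right (m := 0) (by norm_num)).clm_apply contDiffAt_const).continuousAt)
    refine this.eventually_const_lt ?_
    change _ < fderiv ℝ F p₀ (0, 0, 0, 1)
    rw [hfd]; linarith
  obtain ⟨r, hr, hball⟩ := Metric.eventually_nhds_iff_ball.1 (e1.and (e2.and hC))
  set ε := min (r / 2) ε₀ with hε
  have hεpos : 0 < ε := lt_min (by positivity) hε₀
  have hεr : ε < r := (min_le_left _ _).trans_lt (by linarith)
  -- Near `(a₀, b₀)` the approximate root lies between `2 k |s|` and `8 k |s|`. An error below `k
  -- |s|` keeps the root positive, and `9 k |s| < ε` keeps it inside the range.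
  set k := - A₁ (a₀, b₀) / 4 with hk
  have hkpos : 0 < k := by rw [hk]; linarith
  set y₀ : ℝ × ℝ × ℝ := (a₀, b₀, 0) with hy₀
  have pr : Tendsto (fun y : ℝ × ℝ × ℝ => (y.1, y.2.1)) (𝓝 y₀) (𝓝 (a₀, b₀)) :=
    Continuous.tendsto (by fun_prop) y₀
  have ps : Tendsto (fun y : ℝ × ℝ × ℝ => y.2.2) (𝓝 y₀) (𝓝 0) := Continuous.tendsto (by fun_prop) y₀
  have tA₁ := hA₁.tendsto.comp pr
  have tA₂ := hA₂.tendsto.comp pr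
  have tγ₂ := hγ₂.tendsto.comp pr
  have tγ₃ := hγ₃.tendsto.comp pr
  have tB := tA₁.neg.sub (tA₂.mul ps)
  rw [mul_zero, sub_zero] at tB
  have E1 := tB.eventually_const_lt (u := 2 * k) (by linarith)
  have E2 := tB.eventually_lt_const (u := 8 * k) (by linarith)
  have tR := ((tγ₂.mul tA₂).add ((tγ₃.mul tA₁).mul tA₂ |>.const_mul 2)).add
    ((tγ₃.mul (tA₂.pow 2)).mul ps)
  obtain ⟨CR, hCR⟩ := exists_gt |γ₂ (a₀, b₀) * A₂ (a₀, b₀) +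
    2 * (γ₃ (a₀, b₀) * A₁ (a₀, b₀) * A₂ (a₀, b₀)) + γ₃ (a₀, b₀) * A₂ (a₀, b₀) ^ 2 * 0|
  have E3 := tR.abs.eventually_lt_const hCR
  have hCR0 : 0 < CR := (abs_nonneg _).trans_lt hCR
  set C₁ := |C| * (1 + 8 * k) ^ 3 + CR with hC₁
  have hC₁0 : 0 < C₁ := by positivity
  -- The residual `C₁ |s|³` divided by the lower slope bound `B₀ / 2`.
  set D := 2 * C₁ / B₀ with hD
  have hDpos : 0 < D := by positivity
  have tD := (ps.pow 2).const_mul D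
  rw [zero_pow two_ne_zero, mul_zero] at tD
  have E4 := tD.eventually_lt_const hkpos
  have t9 := ps.abs.const_mul (9 * k)
  rw [abs_zero, mul_zero] at t9
  have E5 := t9.eventually_lt_const hεpos
  obtain ⟨δ', hδ', hδball⟩ := Metric.eventually_nhds_iff_ball.1
    (E1.and (E2.and (E3.and (E4.and (E5.and ((pr.eventually h1).and (pr.eventually h2)))))))
  set δ := min (min δ' (r / 2)) ε₀ with hδ
  have hδδ : δ ≤ δ' := (min_le_left _ _).trans (min_le_left _ _)
  have hδr : δ < r := ((min_le_left _ _).trans (min_le_right _ _)).trans_lt (by linarith)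
  refine ⟨ε, hεpos, min_le_right _ _, δ, by positivity, min_le_right _ _, D, hDpos, ?_⟩
  intro a b s ha hb hs hs0
  have hsabs : |s| = -s := abs_of_neg hs0
  have hspos : 0 < |s| := by rw [hsabs]; linarith
  have hsδ : |s| < δ := by rw [hsabs]; linarith
  obtain ⟨f1, f2, f3, f4, f5, f6, f7⟩ := hδball (a, b, s) (by
    rw [Metric.mem_ball, Prod.dist_eq, Prod.dist_eq]
    simp only [Real.dist_eq, hy₀, sub_zero]
    exact max_lt (ha.trans_le hδδ) (max_lt (hb.trans_le hδδ) (hsδ.trans_le hδδ)))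
  have hmem : ∀ τ : ℝ, |τ| ≤ ε → ((a, b, s, τ) : Params) ∈ Metric.ball p₀ r := fun τ hτ => by
    rw [Metric.mem_ball, Prod.dist_eq, Prod.dist_eq, Prod.dist_eq]
    simp only [Real.dist_eq, hp₀, sub_zero]
    exact max_lt (ha.trans hδr) (max_lt (hb.trans hδr) (max_lt (hsδ.trans hδr) (hτ.trans_lt hεr)))
  set A := A₁ (a, b) * s + A₂ (a, b) * s ^ 2 with hAdef
  simp only [Function.comp] at f1 f2 f3 f4 f5 f6 f7
  have hAB : A = (-A₁ (a, b) - A₂ (a, b) * s) * |s| := by rw [hsabs, hAdef]; ring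
  have hA1 : 2 * k * |s| ≤ A := hAB ▸ mul_le_mul_of_nonneg_right f1.le hspos.le
  have hA2 : A ≤ 8 * k * |s| := hAB ▸ mul_le_mul_of_nonneg_right f2.le hspos.le
  have hDs : D * |s| ^ 3 < k * |s| := by
    rw [← sq_abs s] at f4
    calc D * |s| ^ 3 = D * |s| ^ 2 * |s| := by ring
      _ < k * |s| := mul_lt_mul_of_pos_right f4 hspos
  have hks : 0 < k * |s| := mul_pos hkpos hspos
  have hApos : 0 < A := by linarith
  have hAε : |A| ≤ ε := by rw [abs_of_pos hApos]; linarith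
  refine exists_zero_near (g := fun τ => F (a, b, s, τ))
    (g' := fun τ => fderiv ℝ F (a, b, s, τ) (0, 0, 0, 1)) (half_pos hβ) (fun τ hτ => ?_) ?_
    (by linarith) (by linarith)
  · obtain ⟨d1, d2, -⟩ := hball _ (hmem τ hτ)
    have hline : HasDerivAt (fun τ : ℝ => ((a, b, s, τ) : Params)) (0, 0, 0, 1) τ :=
      (hasDerivAt_const _ _).prodMk ((hasDerivAt_const _ _).prodMk
        ((hasDerivAt_const _ _).prodMk (hasDerivAt_id _)))
    exact ⟨d2, d1.hasFDerivAt.comp_hasDerivAt (f := fun τ : ℝ => ((a, b, s, τ) : Params)) τ hline⟩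
  · obtain ⟨-, -, h3⟩ := hball _ (hmem A hAε)
    have h4 : quadPoly α β γ₁ γ₂ γ₃ (a, b, s, A) = (γ₂ (a, b) * A₂ (a, b) +
        2 * (γ₃ (a, b) * A₁ (a, b) * A₂ (a, b)) + γ₃ (a, b) * A₂ (a, b) ^ 2 * s) * s ^ 3 := by
      simp only [quadPoly, Params.a, Params.b, Params.s, Params.τ]
      rw [hAdef]
      linear_combination s * f6 + s ^ 2 * f7
    have hBD : B₀ / 2 * (D * |s| ^ 3) = C₁ * |s| ^ 3 := by rw [hD]; field_simp
    rw [hBD]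
    exact abs_le_at_approx (p := (a, b, s, A)) hApos.le hA2 hkpos f3 h4 h3

/-- A function of the parameters with nonzero derivative with respect to the delay vanishes on a
curve that is determined to second order by its expansion to second order. -/
theorem exists_zero_curve (hF : ContDiffAt ℝ 1 F (a₀, b₀, 0, 0))
    (hγ₂ : ContinuousAt γ₂ (a₀, b₀)) (hγ₃ : ContinuousAt γ₃ (a₀, b₀))
    (hA₁ : ContinuousAt A₁ (a₀, b₀)) (hA₂ : ContinuousAt A₂ (a₀, b₀))
    (hQ : ∃ C, ∀ᶠ p : Params in 𝓝 (a₀, b₀, 0, 0),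
      |F p - quadPoly α β γ₁ γ₂ γ₃ p| ≤ C * (|p.s| + |p.τ|) ^ 3)
    (hβ : β (a₀, b₀) ≠ 0) (hA : A₁ (a₀, b₀) < 0)
    (h1 : ∀ᶠ y in 𝓝 (a₀, b₀), α y + β y * A₁ y = 0)
    (h2 : ∀ᶠ y in 𝓝 (a₀, b₀), β y * A₂ y + γ₁ y + γ₂ y * A₁ y + γ₃ y * A₁ y ^ 2 = 0)
    {ε₀ : ℝ} (hε₀ : 0 < ε₀) :
    ∃ ε > 0, ε ≤ ε₀ ∧ ∃ δ > 0, δ ≤ ε₀ ∧ ∃ C > 0, ∀ a b s : ℝ,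
      |a - a₀| < δ → |b - b₀| < δ → -δ < s → s < 0 →
        ∃ τ' : ℝ, 0 < τ' ∧ τ' < ε ∧ |τ' - (A₁ (a, b) * s + A₂ (a, b) * s ^ 2)| ≤ C * |s| ^ 3 ∧
          ∀ τ : ℝ, 0 < τ → τ < ε → (F (a, b, s, τ) = 0 ↔ τ = τ') := by
  rcases hβ.lt_or_gt with h | h
  · have hQ' : ∃ C, ∀ᶠ p : Params in 𝓝 (a₀, b₀, 0, 0),
        |-F p - quadPoly (-α) (-β) (-γ₁) (-γ₂) (-γ₃) p| ≤ C * (|p.s| + |p.τ|) ^ 3 := by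
      obtain ⟨C, hC⟩ := hQ
      refine ⟨C, hC.mono fun p hp => ?_⟩
      rwa [show -F p - quadPoly (-α) (-β) (-γ₁) (-γ₂) (-γ₃) p = -(F p - quadPoly α β γ₁ γ₂ γ₃ p) by
        simp only [quadPoly, Pi.neg_apply]; ring, abs_neg]
    obtain ⟨ε, r1, r2, δ, r3, r4, C, r5, r6⟩ := exists_zero_curve_of_pos hF.neg hγ₂.neg
      hγ₃.neg hA₁ hA₂ hQ' (by simpa using h) hA
      (h1.mono fun y hy => by simp only [Pi.neg_apply]; linarith)
      (h2.mono fun y hy => by simp only [Pi.neg_apply]; linarith) hε₀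
    refine ⟨ε, r1, r2, δ, r3, r4, C, r5, fun a b s ha hb hs hs0 => ?_⟩
    obtain ⟨τ', q1, q2, q3, q4⟩ := r6 a b s ha hb hs hs0
    exact ⟨τ', q1, q2, q3, fun τ h3 h4 => by rw [← q4 τ h3 h4, neg_eq_zero]⟩
  · exact exists_zero_curve_of_pos hF hγ₂ hγ₃ hA₁ hA₂ hQ h hA h1 h2 hε₀

end ZeroCurve
end Pendulum

namespace Pendulum

/-! ### Coefficients of the energy rate at amplitude zero -/

/-- coefficient of `s` in the energy rate -/
def rateS (y : ℝ × ℝ) : ℝ := -(y.1 ^ 2 / (y.1 - 1))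

/-- coefficient of `τ` in the energy rate -/
def rateT (y : ℝ × ℝ) : ℝ := y.1 ^ 2 * (y.1 - 2) / (2 * (y.1 - 1))

/-- coefficient of `s²` in the energy rate -/
def rateSS (y : ℝ × ℝ) : ℝ := -(y.1 * y.2 * (y.1 - 2) / (y.1 - 1) ^ 2)

/-- coefficient of `s τ` in the energy rate -/
def rateST (y : ℝ × ℝ) : ℝ := y.1 * y.2 * (y.1 ^ 2 - 3 * y.1 + 4) / (2 * (y.1 - 1) ^ 2)

/-- coefficient of `τ²` in the energy rate -/
def rateTT (y : ℝ × ℝ) : ℝ :=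
  y.1 * y.2 * (3 * y.1 ^ 3 - 9 * y.1 ^ 2 + 7 * y.1 + 1) / (6 * (y.1 - 1) ^ 2)

lemma energyCoeffAt_zero (e : ℝ) (p : Params) :
    energyCoeffAt e (p, 0) = quadPoly rateS rateT rateSS rateST rateTT p := by
  simp only [energyCoeffAt, energyCoeff, actCoeff_zero, trigSqrt_zero_right, quadPoly, rateS, rateT,
    rateSS, rateST, rateTT]
  norm_num
  ring

lemma quadCoeff_eq (p : Params) :
    quadCoeff p = p.τ * quadPoly rateS rateT rateSS rateST rateTT p := by
  simp only [quadCoeff, quadPoly, rateS, rateT, rateSS, rateST, rateTT]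
  ring

/-- derivative of `a K - S` with respect to the squared amplitude -/
def denomSlope (e a : ℝ) : ℝ := -(e / 2) * a + 1 / 6

/-- derivative of `K² (a K - 2 S)` with respect to the squared amplitude -/
def numSlope (e a : ℝ) : ℝ := -e * (a - 2) + (-(e / 2) * a + 1 / 3)

/-- derivative of the coefficient of `s` with respect to the squared amplitude -/
def slopeS (e : ℝ) (y : ℝ × ℝ) : ℝ :=
  -(y.1 ^ 2 * (-e * (y.1 - 1) - denomSlope e y.1) / (y.1 - 1) ^ 2)

/-- derivative of the coefficient of `τ` with respect to the squared amplitude -/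
def slopeT (e : ℝ) (y : ℝ × ℝ) : ℝ :=
  y.1 ^ 2 * (numSlope e y.1 * (y.1 - 1) - (y.1 - 2) * denomSlope e y.1) / (2 * (y.1 - 1) ^ 2)

/-- derivative of the coefficient of `s²` with respect to the squared amplitude -/
def slopeSS (e : ℝ) (y : ℝ × ℝ) : ℝ :=
  -(y.1 * y.2 * (numSlope e y.1 * (y.1 - 1) - 2 * (y.1 - 2) * denomSlope e y.1) / (y.1 - 1) ^ 3)

/-- derivative of the coefficient of `s τ` with respect to the squared amplitude -/
def slopeST (e : ℝ) (y : ℝ × ℝ) : ℝ :=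
  y.1 * y.2 * ((-e * (y.1 ^ 2 - 3 * y.1 + 4) + (-e * y.1 ^ 2 - 3 * y.1 * (-(e / 2) - 1 / 6) - 4 / 3)) *
    (y.1 - 1) - 2 * (y.1 ^ 2 - 3 * y.1 + 4) * denomSlope e y.1) / (2 * (y.1 - 1) ^ 3)

/-- derivative of the coefficient of `τ²` with respect to the squared amplitude -/
def slopeTT (e : ℝ) (y : ℝ × ℝ) : ℝ :=
  y.1 * y.2 * ((-e * (3 * y.1 ^ 3 - 9 * y.1 ^ 2 + 7 * y.1 + 1) + (-(9 * e / 2) * y.1 ^ 3 -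
    9 * y.1 ^ 2 * (-e - 1 / 6) + 7 * y.1 * (-(e / 2) - 1 / 3) - 1 / 2)) * (y.1 - 1) -
    2 * (3 * y.1 ^ 3 - 9 * y.1 ^ 2 + 7 * y.1 + 1) * denomSlope e y.1) / (6 * (y.1 - 1) ^ 3)

lemma hasDerivAt_actCoeff_zero (e : ℝ) : HasDerivAt (actCoeff e) (-(e / 2)) 0 := by
  have h := (((hasDerivAt_trigSqrt_zero 0).sub_const 1).const_mul e).const_add 1
  refine h.congr_deriv ?_
  norm_num [trigCoeff, Nat.factorial]
  ring

/-- The dependence on the squared amplitude runs only through `K` and `S`, both equal to `1` at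
zero. Later `k = -e/2` and `σ = -1/6`, the linear Taylor coefficients of the actuation and of `sin
√z / √z`. -/
lemma hasDerivAt_energyCoeff {K S : ℝ → ℝ} {k σ : ℝ} (hK : HasDerivAt K k 0) (hS : HasDerivAt S σ 0)
    (hK0 : K 0 = 1) (hS0 : S 0 = 1) {a : ℝ} (ha : a ≠ 1) (b s τ : ℝ) :
    HasDerivAt (fun z => energyCoeff a b s τ (S z) (K z))
      (-(a ^ 2 * (2 * k * (a - 1) - (a * k - σ)) / (a - 1) ^ 2) * s +
      a ^ 2 * ((2 * k * (a - 2) + (a * k - 2 * σ)) * (a - 1) - (a - 2) * (a * k - σ)) /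
        (2 * (a - 1) ^ 2) * τ
      - a * b * ((2 * k * (a - 2) + (a * k - 2 * σ)) * (a - 1) - 2 * (a - 2) * (a * k - σ)) /
        (a - 1) ^ 3 * s ^ 2
      + a * b * ((2 * k * (a ^ 2 - 3 * a + 4) + (2 * a ^ 2 * k - 3 * a * (k + σ) + 8 * σ)) * (a - 1)
        - 2 * (a ^ 2 - 3 * a + 4) * (a * k - σ)) / (2 * (a - 1) ^ 3) * (s * τ)
      + a * b * ((2 * k * (3 * a ^ 3 - 9 * a ^ 2 + 7 * a + 1) + (9 * a ^ 3 * k - 9 * a ^ 2 * (2 * k + σ)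
        + 7 * a * (k + 2 * σ) + 3 * σ)) * (a - 1) - 2 * (3 * a ^ 3 - 9 * a ^ 2 + 7 * a + 1) *
        (a * k - σ)) / (6 * (a - 1) ^ 3) * τ ^ 2) 0 := by
  have ha' : a - 1 ≠ 0 := sub_ne_zero.2 ha
  have hn0 : a * K 0 - S 0 ≠ 0 := by rw [hK0, hS0, mul_one]; exact ha'
  have hn : HasDerivAt (fun z => a * K z - S z) (a * k - σ) 0 := (hK.const_mul a).sub hS
  have h2 : HasDerivAt (fun z => a * K z - 2 * S z) (a * k - 2 * σ) 0 :=
    (hK.const_mul a).sub (hS.const_mul 2)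
  have hK2 := hK.pow 2
  have hS2 := hS.pow 2
  have t1 := ((hK2.const_mul (a ^ 2)).div hn hn0).neg.mul_const s
  have t2 := (((hK2.const_mul (a ^ 2)).mul h2).div (hn.const_mul 2)
    (mul_ne_zero two_ne_zero hn0)).mul_const τ
  have t3 := (((hK2.const_mul (a * b)).mul h2).div (hn.pow 2) (pow_ne_zero 2 hn0)).mul_const (s ^ 2)
  have r4 := (((hK.pow 2).const_mul (a ^ 2)).sub ((hK.const_mul (3 * a)).mul hS)).add (hS2.const_mul 4)
  have t4 := (((hK2.const_mul (a * b)).mul r4).div ((hn.pow 2).const_mul 2)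
    (mul_ne_zero two_ne_zero (pow_ne_zero 2 hn0))).mul_const (s * τ)
  have r5 := ((((hK.pow 3).const_mul (3 * a ^ 3)).sub ((hK2.const_mul (9 * a ^ 2)).mul hS)).add
    ((hK.const_mul (7 * a)).mul hS2)).add (hS.pow 3)
  have t5 := (((hK2.const_mul (a * b)).mul r5).div ((hn.pow 2).const_mul 6)
    (mul_ne_zero (by norm_num) (pow_ne_zero 2 hn0))).mul_const (τ ^ 2)
  have key := (((t1.add t2).sub t3).add t4).add t5
  refine (key.congr_of_eventuallyEq (Eventually.of_forall fun z => ?_)).congr_deriv ?_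
  · simp only [energyCoeff, Pi.add_apply, Pi.sub_apply, Pi.mul_apply, Pi.div_apply, Pi.neg_apply,
      Pi.pow_apply]
  · simp only [Pi.add_apply, Pi.sub_apply, Pi.mul_apply, Pi.pow_apply, hK0, hS0]
    field_simp
    ring

lemma hasDerivAt_energyCoeffAt (e : ℝ) {p : Params} (hp : p.a ≠ 1) :
    HasDerivAt (fun z => energyCoeffAt e (p, z))
      (quadPoly (slopeS e) (slopeT e) (slopeSS e) (slopeST e) (slopeTT e) p) 0 := by
  have h1 : HasDerivAt (trigSqrt 1) (-(1 / 6)) 0 := by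
    refine (hasDerivAt_trigSqrt_zero 1).congr_deriv ?_
    norm_num [trigCoeff, Nat.factorial]
  have := hasDerivAt_energyCoeff (hasDerivAt_actCoeff_zero e) h1 (actCoeff_zero e)
    (by simp [trigSqrt_zero_right]) hp p.b p.s p.τ
  refine this.congr_deriv ?_
  have hp' : p.a - 1 ≠ 0 := sub_ne_zero.2 hp
  simp only [quadPoly, slopeS, slopeT, slopeSS, slopeST, slopeTT, denomSlope, numSlope]
  field_simp
  ring

end Pendulum

namespace Pendulum

/-! ### The zero curves of the coefficients -/

section
variable {y : ℝ × ℝ}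

/-- The first order condition for the delay at which the rate vanishes; the companion identity is
the second order condition. Together they are the hypotheses `h1` and `h2` of `exists_zero_curve`.
-/
lemma bifurcation_identity₁ (h1 : y.1 - 1 ≠ 0) (h2 : y.1 - 2 ≠ 0) :
    rateS y + rateT y * (2 / (y.1 - 2)) = 0 := by
  simp only [rateS, rateT]
  field_simp
  ring

lemma bifurcation_identity₂ (h0 : y.1 ≠ 0) (h1 : y.1 - 1 ≠ 0) (h2 : y.1 - 2 ≠ 0) :
    rateT y * (-(2 * (2 + 8 * y.1 - 15 * y.1 ^ 2 + 6 * y.1 ^ 3) /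
      (3 * y.1 * (y.1 - 1) * (y.1 - 2) ^ 3) * y.2)) + rateSS y + rateST y * (2 / (y.1 - 2)) +
      rateTT y * (2 / (y.1 - 2)) ^ 2 = 0 := by
  simp only [rateSS, rateT, rateST, rateTT]
  field_simp
  ring

lemma slope_one_eq (h1 : y.1 - 1 ≠ 0) : slopeS 1 y = y.1 ^ 2 * (3 * y.1 - 5) / (6 * (y.1 - 1) ^ 2) ∧
    slopeT 1 y = -(y.1 ^ 2 * (3 * y.1 ^ 2 - 8 * y.1 + 6)) / (6 * (y.1 - 1) ^ 2) := by
  simp only [slopeS, slopeT, denomSlope, numSlope]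
  constructor <;> field_simp <;> ring

lemma slope_zero_eq (h1 : y.1 - 1 ≠ 0) : slopeS 0 y = y.1 ^ 2 / (6 * (y.1 - 1) ^ 2) ∧
    slopeT 0 y = y.1 ^ 3 / (12 * (y.1 - 1) ^ 2) := by
  simp only [slopeS, slopeT, denomSlope, numSlope]
  constructor <;> field_simp <;> ring

lemma criticalCos_identity₁ (h1 : y.1 - 1 ≠ 0) (h2 : 3 * y.1 ^ 2 - 8 * y.1 + 6 ≠ 0) :
    slopeS 1 y + slopeT 1 y * ((3 * y.1 - 5) / (3 * y.1 ^ 2 - 8 * y.1 + 6)) = 0 := by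
  rw [(slope_one_eq h1).1, (slope_one_eq h1).2]
  generalize 3 * y.1 ^ 2 - 8 * y.1 + 6 = n at *
  field_simp
  ring

lemma criticalCos_identity₂ (h0 : y.1 ≠ 0) (h1 : y.1 - 1 ≠ 0) (h2 : 3 * y.1 ^ 2 - 8 * y.1 + 6 ≠ 0) :
    slopeT 1 y * (y.2 * (-243 * y.1 ^ 6 + 1674 * y.1 ^ 5 - 4491 * y.1 ^ 4 + 5862 * y.1 ^ 3 -
      3611 * y.1 ^ 2 + 642 * y.1 + 175) / (6 * y.1 * (y.1 - 1) * (3 * y.1 ^ 2 - 8 * y.1 + 6) ^ 3)) +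
      slopeSS 1 y + slopeST 1 y * ((3 * y.1 - 5) / (3 * y.1 ^ 2 - 8 * y.1 + 6)) +
      slopeTT 1 y * ((3 * y.1 - 5) / (3 * y.1 ^ 2 - 8 * y.1 + 6)) ^ 2 = 0 := by
  rw [(slope_one_eq h1).2]
  simp only [slopeSS, slopeST, slopeTT, denomSlope, numSlope]
  -- The quadratic denominator is treated as an atom while fractions are cleared and expanded only
  -- afterwards.
  generalize h : 3 * y.1 ^ 2 - 8 * y.1 + 6 = n at *
  field_simp
  rw [← h]
  ring

lemma criticalOne_identity₁ (h0 : y.1 ≠ 0) (h1 : y.1 - 1 ≠ 0) :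
    slopeS 0 y + slopeT 0 y * (-(2 / y.1)) = 0 := by
  rw [(slope_zero_eq h1).1, (slope_zero_eq h1).2]
  field_simp
  ring

lemma criticalOne_identity₂ (h0 : y.1 ≠ 0) (h1 : y.1 - 1 ≠ 0) :
    slopeT 0 y * (-(2 * y.2 * (y.1 ^ 2 - 2) * (3 * y.1 - 1) / (3 * y.1 ^ 4 * (y.1 - 1)))) +
      slopeSS 0 y + slopeST 0 y * (-(2 / y.1)) + slopeTT 0 y * (-(2 / y.1)) ^ 2 = 0 := by
  rw [(slope_zero_eq h1).2]
  simp only [slopeSS, slopeST, slopeTT, denomSlope, numSlope]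
  field_simp
  ring

end

section
variable {e a₀ b₀ M : ℝ} {f m U : Params × ℝ → ℝ}

lemma tendsto_zero_amplitude (a₀ b₀ : ℝ) : Tendsto (fun p : Params => (p, (0:ℝ))) (𝓝 (a₀, b₀, 0, 0))
    (𝓝 (basePoint a₀ b₀)) :=
  Continuous.tendsto (by fun_prop) _

lemma LocalModel.contDiffAt_rate (h : LocalModel e a₀ b₀ f m U M) (ha2 : a₀ < 2) :
    ContDiffAt ℝ 2 (fun p : Params => f (p, 0)) (a₀, b₀, 0, 0) :=
  (h.smooth ha2).comp (a₀, b₀, 0, 0) (f := fun p : Params => (p, (0:ℝ)))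
    (contDiffAt_id.prodMk contDiffAt_const)

lemma LocalModel.contDiffAt_slope (h : LocalModel e a₀ b₀ f m U M) (ha2 : a₀ < 2) :
    ContDiffAt ℝ 1 (fun q => fderiv ℝ f q (0, 1)) (basePoint a₀ b₀) :=
  ((h.smooth ha2).fderiv_right (m := 1) (by norm_num)).clm_apply contDiffAt_const

lemma LocalModel.contDiffAt_slope_zero (h : LocalModel e a₀ b₀ f m U M) (ha2 : a₀ < 2) :
    ContDiffAt ℝ 1 (fun p : Params => fderiv ℝ f (p, 0) (0, 1)) (a₀, b₀, 0, 0) :=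
  (h.contDiffAt_slope ha2).comp (a₀, b₀, 0, 0) (f := fun p : Params => (p, (0:ℝ)))
    (contDiffAt_id.prodMk contDiffAt_const)

lemma LocalModel.rate_approx (h : LocalModel e a₀ b₀ f m U M) (ha2 : a₀ < 2) :
    ∃ C, ∀ᶠ p : Params in 𝓝 (a₀, b₀, 0, 0),
      |f (p, 0) - quadPoly rateS rateT rateSS rateST rateTT p| ≤ C * (|p.s| + |p.τ|) ^ 3 := by
  obtain ⟨C, hC⟩ := h.approx
  refine ⟨C, ?_⟩
  filter_upwards [(tendsto_zero_amplitude a₀ b₀).eventually (hC.and (h.two_le ha2))] with p hp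
  rw [← energyCoeffAt_zero e]
  exact hp.1 hp.2

/-- Directional derivatives of the energy rate. -/
lemma LocalModel.fderiv_approx (h : LocalModel e a₀ b₀ f m U M) (ha2 : a₀ < 2) {v : Params × ℝ}
    (hs : v.1.s = 0) (hτ : v.1.τ = 0) :
    ∃ C, ∀ᶠ p : Params in 𝓝 (a₀, b₀, 0, 0), ∀ D,
      HasDerivAt (fun t : ℝ => energyCoeffAt e ((p, (0 : ℝ)) + t • v)) D 0 →
        |fderiv ℝ f (p, 0) v - D| ≤ C * (|p.s| + |p.τ|) ^ 3 := by
  let Ls : Params × ℝ →L[ℝ] ℝ := (ContinuousLinearMap.fst ℝ ℝ ℝ).comp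
    ((ContinuousLinearMap.snd ℝ ℝ (ℝ × ℝ)).comp ((ContinuousLinearMap.snd ℝ ℝ (ℝ × ℝ × ℝ)).comp
      (ContinuousLinearMap.fst ℝ Params ℝ)))
  let Lτ : Params × ℝ →L[ℝ] ℝ := (ContinuousLinearMap.snd ℝ ℝ ℝ).comp
    ((ContinuousLinearMap.snd ℝ ℝ (ℝ × ℝ)).comp ((ContinuousLinearMap.snd ℝ ℝ (ℝ × ℝ × ℝ)).comp
      (ContinuousLinearMap.fst ℝ Params ℝ)))
  have hs' : ∀ q : Params × ℝ, HasFDerivAt (fun q : Params × ℝ => q.1.s) Ls q :=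
    fun q => Ls.hasFDerivAt
  have hτ' : ∀ q : Params × ℝ, HasFDerivAt (fun q : Params × ℝ => q.1.τ) Lτ q :=
    fun q => Lτ.hasFDerivAt
  obtain ⟨k1, k2⟩ := OrderClass.fderiv_apply (v := v) (h.order ha2)
    (fun q => (hs' q).differentiableAt) (fun q => (hτ' q).differentiableAt)
    (fun q => by rw [(hs' q).fderiv]; exact hs) (fun q => by rw [(hτ' q).fderiv]; exact hτ)
  obtain ⟨C, hC⟩ := OrderClass.abs_le k1
  have hfd : ∀ᶠ q in 𝓝 (basePoint a₀ b₀), DifferentiableAt ℝ f q :=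
    ((h.smooth ha2).eventually (by simp)).mono fun q hq => hq.differentiableAt (by simp)
  refine ⟨C, ?_⟩
  filter_upwards [(tendsto_zero_amplitude a₀ b₀).eventually (hC.and (k2.and hfd))] with p hp D hD
  obtain ⟨h1, h2, h3⟩ := hp
  have hline : HasDerivAt (fun t : ℝ => (p, (0 : ℝ)) + t • v) v 0 := by
    simpa using ((hasDerivAt_id (0 : ℝ)).smul_const v).const_add (p, (0 : ℝ))
  have h0 : (p, (0 : ℝ)) + (0 : ℝ) • v = (p, 0) := by simp
  rw [← h0] at h2 h3
  have d1 := h2.hasFDerivAt.comp_hasDerivAt (f := fun t : ℝ => (p, (0 : ℝ)) + t • v) 0 hline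
  have d2 := h3.hasFDerivAt.comp_hasDerivAt (f := fun t : ℝ => (p, (0 : ℝ)) + t • v) 0 hline
  -- Along the line through `(p, 0)` in direction `v`, the remainder has the difference of the two
  -- derivatives as its own derivative, and that is still of third order.
  have d3 := d1.unique (d2.sub hD)
  rw [h0] at d3
  rw [d3] at h1
  exact h1

lemma eventually_gain_ne (ha : 1 < a₀) : ∀ᶠ p : Params in 𝓝 (a₀, b₀, 0, 0), p.a ≠ 1 :=
  ((Params.contDiff_a (n := 0)).continuous.tendsto _).eventually_ne (by simp only [Params.a]; linarith)

lemma LocalModel.slope_approx (h : LocalModel e a₀ b₀ f m U M) (ha : 1 < a₀) (ha2 : a₀ < 2) :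
    ∃ C, ∀ᶠ p : Params in 𝓝 (a₀, b₀, 0, 0),
      |fderiv ℝ f (p, 0) (0, 1) - quadPoly (slopeS e) (slopeT e) (slopeSS e) (slopeST e) (slopeTT e) p|
        ≤ C * (|p.s| + |p.τ|) ^ 3 := by
  obtain ⟨C, hC⟩ := h.fderiv_approx ha2 (v := (0, 1)) rfl rfl
  refine ⟨C, ?_⟩
  filter_upwards [hC, eventually_gain_ne ha] with p hp hp1
  refine hp _ ?_
  simpa using hasDerivAt_energyCoeffAt e hp1

/-- The first order part of a quadratic polynomial. -/
lemma exists_linear_bound {F : Params → ℝ} {α β γ₁ γ₂ γ₃ : ℝ × ℝ → ℝ}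
    (h₁ : ContinuousAt γ₁ (a₀, b₀)) (h₂ : ContinuousAt γ₂ (a₀, b₀)) (h₃ : ContinuousAt γ₃ (a₀, b₀))
    (hQ : ∃ C, ∀ᶠ p : Params in 𝓝 (a₀, b₀, 0, 0),
      |F p - quadPoly α β γ₁ γ₂ γ₃ p| ≤ C * (|p.s| + |p.τ|) ^ 3) :
    ∃ C, ∀ᶠ p : Params in 𝓝 (a₀, b₀, 0, 0),
      |F p - (α (p.a, p.b) * p.s + β (p.a, p.b) * p.τ)| ≤ C * (|p.s| + |p.τ|) ^ 2 := by
  obtain ⟨C, hC⟩ := hQ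
  have pr : Tendsto (fun p : Params => (p.a, p.b)) (𝓝 (a₀, b₀, 0, 0)) (𝓝 (a₀, b₀)) :=
    Continuous.tendsto (((Params.contDiff_a (n := 0)).continuous).prodMk (Params.contDiff_b (n := 0)).continuous) _
  have hs : Tendsto (fun p : Params => |p.s| + |p.τ|) (𝓝 (a₀, b₀, 0, 0)) (𝓝 0) := by
    have hc : Continuous fun p : Params => |p.s| + |p.τ| :=
      (Params.contDiff_s (n := 0)).continuous.abs.add (Params.contDiff_τ (n := 0)).continuous.abs
    have := hc.tendsto (a₀, b₀, 0, 0)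
    simpa [Params.s, Params.τ] using this
  obtain ⟨C₁, hC₁⟩ := exists_gt |γ₁ (a₀, b₀)|
  obtain ⟨C₂, hC₂⟩ := exists_gt |γ₂ (a₀, b₀)|
  obtain ⟨C₃, hC₃⟩ := exists_gt |γ₃ (a₀, b₀)|
  have hC₁0 := (abs_nonneg _).trans hC₁.le
  have hC₂0 := (abs_nonneg _).trans hC₂.le
  have hC₃0 := (abs_nonneg _).trans hC₃.le
  refine ⟨|C| + C₁ + C₂ + C₃, ?_⟩
  filter_upwards [hC, pr.eventually (h₁.abs.eventually_lt_const hC₁),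
    pr.eventually (h₂.abs.eventually_lt_const hC₂), pr.eventually (h₃.abs.eventually_lt_const hC₃),
    hs.eventually_lt_const one_pos] with p g0 g1 g2 g3 g4
  set r := |p.s| + |p.τ| with hr
  have hr0 : 0 ≤ r := by positivity
  have hsr : |p.s| ≤ r := le_add_of_nonneg_right (abs_nonneg _)
  have hτr : |p.τ| ≤ r := le_add_of_nonneg_left (abs_nonneg _)
  have b0 : C * r ^ 3 ≤ |C| * r ^ 2 := by
    calc C * r ^ 3 ≤ |C| * r ^ 3 := by gcongr; exact le_abs_self C
      _ ≤ |C| * r ^ 2 := by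
        gcongr ?_ * ?_
        exact pow_le_pow_of_le_one hr0 g4.le (by norm_num)
  have b1 : |γ₁ (p.a, p.b) * p.s ^ 2| ≤ C₁ * r ^ 2 := by
    rw [abs_mul, abs_pow]; gcongr
  have b2 : |γ₂ (p.a, p.b) * (p.s * p.τ)| ≤ C₂ * r ^ 2 := by
    rw [abs_mul, abs_mul, sq]; gcongr
  have b3 : |γ₃ (p.a, p.b) * p.τ ^ 2| ≤ C₃ * r ^ 2 := by
    rw [abs_mul, abs_pow]; gcongr
  have e : F p - (α (p.a, p.b) * p.s + β (p.a, p.b) * p.τ) = (F p - quadPoly α β γ₁ γ₂ γ₃ p) +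
      γ₁ (p.a, p.b) * p.s ^ 2 + γ₂ (p.a, p.b) * (p.s * p.τ) + γ₃ (p.a, p.b) * p.τ ^ 2 := by
    simp only [quadPoly]; ring
  rw [e]
  refine (abs_add_le _ _).trans ?_
  have := abs_add_le ((F p - quadPoly α β γ₁ γ₂ γ₃ p) + γ₁ (p.a, p.b) * p.s ^ 2)
    (γ₂ (p.a, p.b) * (p.s * p.τ))
  have := abs_add_le (F p - quadPoly α β γ₁ γ₂ γ₃ p) (γ₁ (p.a, p.b) * p.s ^ 2)
  linarith

/-- Only the linear coefficients matter for the sign of the gain derivative; the quadratic ones need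
merely be continuous, so that they fit `exists_linear_bound`. -/
lemma hasDerivAt_quadPoly_gain {p : Params} (hp : p.a ≠ 1) :
    HasDerivAt (fun t : ℝ => quadPoly rateS rateT rateSS rateST rateTT (p.a + t, p.b, p.s, p.τ))
      (quadPoly (fun y => -(y.1 * (y.1 - 2) / (y.1 - 1) ^ 2))
        (fun y => y.1 * (2 * y.1 ^ 2 - 5 * y.1 + 4) / (2 * (y.1 - 1) ^ 2))
        (fun y => -(y.2 * ((2 * y.1 - 2) * (y.1 - 1) - 2 * (y.1 ^ 2 - 2 * y.1)) / (y.1 - 1) ^ 3))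
        (fun y => y.2 * ((3 * y.1 ^ 2 - 6 * y.1 + 4) * (y.1 - 1) -
          2 * (y.1 ^ 3 - 3 * y.1 ^ 2 + 4 * y.1)) / (2 * (y.1 - 1) ^ 3))
        (fun y => y.2 * ((12 * y.1 ^ 3 - 27 * y.1 ^ 2 + 14 * y.1 + 1) * (y.1 - 1) -
          2 * (3 * y.1 ^ 4 - 9 * y.1 ^ 3 + 7 * y.1 ^ 2 + y.1)) / (6 * (y.1 - 1) ^ 3)) p) 0 := by
  obtain ⟨a, b, s, τ⟩ := p
  simp only [Params.a, Params.b, Params.s, Params.τ] at hp ⊢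
  have hp' : a - 1 ≠ 0 := sub_ne_zero.2 hp
  have hx : HasDerivAt (fun t : ℝ => a + t) 1 0 := (hasDerivAt_id 0).const_add a
  have hn : HasDerivAt (fun t : ℝ => a + t - 1) 1 0 := hx.sub_const 1
  have hn0 : a + 0 - 1 ≠ 0 := by rwa [add_zero]
  have t1 := (((hx.pow 2).div hn hn0).neg).mul_const s
  have t2 := (((hx.pow 2).mul (hx.sub_const 2)).div (hn.const_mul 2)
    (mul_ne_zero two_ne_zero hn0)).mul_const τ
  have t3 := (((((hx.mul_const b).mul (hx.sub_const 2)).div (hn.pow 2) (pow_ne_zero 2 hn0))).neg).mul_const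
    (s ^ 2)
  have t4 := (((hx.mul_const b).mul (((hx.pow 2).sub (hx.const_mul 3)).add_const 4)).div
    ((hn.pow 2).const_mul 2) (mul_ne_zero two_ne_zero (pow_ne_zero 2 hn0))).mul_const (s * τ)
  have t5 := (((hx.mul_const b).mul (((((hx.pow 3).const_mul 3).sub ((hx.pow 2).const_mul 9)).add
    (hx.const_mul 7)).add_const 1)).div
    ((hn.pow 2).const_mul 6) (mul_ne_zero (by norm_num) (pow_ne_zero 2 hn0))).mul_const (τ ^ 2)
  refine ((((t1.add t2).add t3).add t4).add t5).congr_deriv ?_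
  simp only [quadPoly, Params.a, Params.b, Params.s, Params.τ, Pi.add_apply, Pi.sub_apply,
    Pi.mul_apply, Pi.pow_apply, add_zero]
  field_simp
  ring

/-- The derivative of the energy rate with respect to the position gain. -/
lemma LocalModel.rate_fderiv_gain (h : LocalModel e a₀ b₀ f m U M) (ha : 1 < a₀) (ha2 : a₀ < 2) :
    ∃ C, ∀ᶠ p : Params in 𝓝 (a₀, b₀, 0, 0), |fderiv ℝ f (p, 0) ((1, 0, 0, 0), 0) -
      (-(p.a * (p.a - 2) / (p.a - 1) ^ 2) * p.s +
        p.a * (2 * p.a ^ 2 - 5 * p.a + 4) / (2 * (p.a - 1) ^ 2) * p.τ)| ≤ C * (|p.s| + |p.τ|) ^ 2 := by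
  have h1 : ((a₀, b₀) : ℝ × ℝ).1 - 1 ≠ 0 := sub_ne_zero.2 ha.ne'
  refine exists_linear_bound (α := fun y => -(y.1 * (y.1 - 2) / (y.1 - 1) ^ 2))
    (β := fun y => y.1 * (2 * y.1 ^ 2 - 5 * y.1 + 4) / (2 * (y.1 - 1) ^ 2))
    (F := fun p => fderiv ℝ f (p, 0) ((1, 0, 0, 0), 0))
    (γ₁ := fun y => -(y.2 * ((2 * y.1 - 2) * (y.1 - 1) - 2 * (y.1 ^ 2 - 2 * y.1)) / (y.1 - 1) ^ 3))
    (γ₂ := fun y => y.2 * ((3 * y.1 ^ 2 - 6 * y.1 + 4) * (y.1 - 1) -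
      2 * (y.1 ^ 3 - 3 * y.1 ^ 2 + 4 * y.1)) / (2 * (y.1 - 1) ^ 3))
    (γ₃ := fun y => y.2 * ((12 * y.1 ^ 3 - 27 * y.1 ^ 2 + 14 * y.1 + 1) * (y.1 - 1) -
      2 * (3 * y.1 ^ 4 - 9 * y.1 ^ 3 + 7 * y.1 ^ 2 + y.1)) / (6 * (y.1 - 1) ^ 3)) ?_ ?_ ?_ ?_
  · exact (ContinuousAt.div (by fun_prop) (by fun_prop) (by positivity)).neg
  · exact ContinuousAt.div (by fun_prop) (by fun_prop) (by positivity)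
  · exact ContinuousAt.div (by fun_prop) (by fun_prop) (by positivity)
  · obtain ⟨C, hC⟩ := h.fderiv_approx ha2 (v := ((1, 0, 0, 0), 0)) rfl rfl
    refine ⟨C, ?_⟩
    filter_upwards [hC, eventually_gain_ne ha] with p hp hp1
    refine hp _ ?_
    refine (hasDerivAt_quadPoly_gain hp1).congr_of_eventuallyEq (Eventually.of_forall fun t => ?_)
    have : ((p, (0 : ℝ)) + t • (((1, 0, 0, 0), 0) : Params × ℝ)) = ((p.a + t, p.b, p.s, p.τ), 0) := by
      obtain ⟨a, b, s, τ⟩ := p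
      simp [Params.a, Params.b, Params.s, Params.τ]
    simp only [this, energyCoeffAt_zero]

end
end Pendulum

/-! ### Taylor expansion in the last variable, uniform in the others -/

section Taylor
variable {E : Type*} [NormedAddCommGroup E] [NormedSpace ℝ E] {f : E × ℝ → ℝ} {x₀ : E}

lemma hasDerivAt_snd {q : E × ℝ} (h : DifferentiableAt ℝ f q) :
    HasDerivAt (fun z => f (q.1, z)) (fderiv ℝ f q (0, 1)) q.2 :=
  h.hasFDerivAt.comp_hasDerivAt (f := fun z : ℝ => (q.1, z)) q.2
    ((hasDerivAt_const _ _).prodMk (hasDerivAt_id _))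

set_option linter.unusedSectionVars false in
lemma mem_ball_snd {r : ℝ} {q : E × ℝ} (hq : q ∈ Metric.ball (x₀, (0 : ℝ)) r) {z : ℝ}
    (hz : |z| ≤ |q.2|) : (q.1, z) ∈ Metric.ball (x₀, (0 : ℝ)) r := by
  rw [Metric.mem_ball, Prod.dist_eq, max_lt_iff] at hq ⊢
  simp only [Real.dist_eq, sub_zero] at hq ⊢
  exact ⟨hq.1, hz.trans_lt hq.2⟩

lemma exists_lipschitz_snd (hf : ContDiffAt ℝ 1 f (x₀, 0)) :
    ∃ C, ∀ᶠ q in 𝓝 (x₀, (0 : ℝ)), |f q - f (q.1, 0)| ≤ C * |q.2| := by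
  obtain ⟨K, t, ht, hK⟩ := hf.exists_lipschitzOnWith
  obtain ⟨r, hr, hball⟩ := Metric.mem_nhds_iff.1 ht
  refine ⟨K, ?_⟩
  filter_upwards [Metric.ball_mem_nhds _ hr] with q hq
  have := hK.dist_le_mul q (hball hq) (q.1, 0) (hball (mem_ball_snd hq (by simp)))
  rw [Prod.dist_eq, Real.dist_eq, Real.dist_eq, dist_self, sub_zero] at this
  simpa using this

/-- The partial derivative is Lipschitz near the point because `f` is C²; the mean value inequality
for `f (q, z)` minus its tangent in `z` gives a constant that does not depend on the first variable.
-/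
lemma exists_taylor_snd (hf : ContDiffAt ℝ 2 f (x₀, 0)) :
    ∃ C, ∀ᶠ q in 𝓝 (x₀, (0 : ℝ)),
      |f q - f (q.1, 0) - fderiv ℝ f (q.1, 0) (0, 1) * q.2| ≤ C * q.2 ^ 2 := by
  obtain ⟨K, hK⟩ := exists_lipschitz_snd (f := fun q => fderiv ℝ f q (0, 1))
    ((hf.fderiv_right (m := 1) (by norm_num)).clm_apply contDiffAt_const)
  have hd : ∀ᶠ q in 𝓝 (x₀, (0 : ℝ)), DifferentiableAt ℝ f q :=
    (hf.eventually (by simp)).mono fun q hq => hq.differentiableAt (by simp)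
  obtain ⟨r, hr, hball⟩ := Metric.eventually_nhds_iff_ball.1 (hK.and hd)
  refine ⟨|K|, ?_⟩
  filter_upwards [Metric.ball_mem_nhds _ hr] with q hq
  set g₀ := fderiv ℝ f (q.1, 0) (0, 1)
  have key := Convex.norm_image_sub_le_of_norm_hasDerivWithin_le (C := |K| * |q.2|)
    (f := fun z => f (q.1, z) - g₀ * z) (f' := fun z => fderiv ℝ f (q.1, z) (0, 1) - g₀ * 1)
    (s := Icc (-|q.2|) |q.2|) (x := 0) (y := q.2) ?_ ?_ (convex_Icc _ _) ?_ ?_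
  · simp only [mul_zero, sub_zero, Real.norm_eq_abs] at key
    rw [← sq_abs q.2, sq, ← mul_assoc]
    convert key using 2
    ring
  · intro z hz
    have := (hball _ (mem_ball_snd hq (abs_le.2 hz))).2
    exact ((hasDerivAt_snd this).sub ((hasDerivAt_id z).const_mul g₀)).hasDerivWithinAt
  · intro z hz
    have := (hball _ (mem_ball_snd hq (abs_le.2 hz))).1
    rw [mul_one, Real.norm_eq_abs]
    exact this.trans (mul_le_mul (le_abs_self K) (abs_le.2 hz) (abs_nonneg _) (abs_nonneg _))
  · exact ⟨by simp, by simp⟩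
  · exact ⟨neg_abs_le _, le_abs_self _⟩

end Taylor

namespace Pendulum

/-! ### Expansion of the energy change -/

/-- `c θ₁² + d θ₁⁴` is an expansion of the energy change at the parameters `p`. -/
def HasExpansion (G : ℝ → ℝ) (p : Params) (c d : ℝ) : Prop :=
  ∃ C, ∀ᶠ x in 𝓝 (0 : ℝ), x ≠ 0 → ∀ (θ φ : ℝ → ℝ) (T P : ℝ), IsForwardOrbit G p x θ φ →
    IsZigzag p θ φ T P →
      |energyChange p θ φ T - c * θ p.τ ^ 2 - d * θ p.τ ^ 4| ≤ C * θ p.τ ^ 6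

/-- Small points of the switching line have zigzagging orbits. -/
def HasZigzags (G : ℝ → ℝ) (p : Params) : Prop :=
  ∀ᶠ x in 𝓝[>] (0 : ℝ), ∃ (θ φ : ℝ → ℝ) (T P : ℝ), IsForwardOrbit G p x θ φ ∧
    IsZigzag p θ φ T P ∧ x / 2 ≤ θ p.τ ∧ θ p.τ ≤ 2 * x

lemma eq_zero_of_frequently_le {u : ℝ} {g : ℝ → ℝ} (hg : ContinuousAt g 0) (hg0 : g 0 = 0)
    (h : ∃ᶠ y in 𝓝[>] (0 : ℝ), |u| ≤ g y) : u = 0 := by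
  by_contra hu
  have : ∀ᶠ y in 𝓝[>] (0 : ℝ), g y < |u| :=
    (hg.eventually_lt_const (by rw [hg0]; exact abs_pos.2 hu)).filter_mono nhdsWithin_le_nhds
  obtain ⟨y, h1, h2⟩ := (h.and_eventually this).exists
  exact h2.not_ge h1

/-- Division by `y²`, then by `y⁴`, and passage to the limit. Values of `y` accumulating at `0`
suffice, as only those attained by `θ₁` are available. -/
lemma coeff_eq_zero {u v C : ℝ} (h : ∃ᶠ y in 𝓝[>] (0 : ℝ), |u * y ^ 2 + v * y ^ 4| ≤ C * y ^ 6) :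
    u = 0 ∧ v = 0 := by
  have hpos : ∀ᶠ y in 𝓝[>] (0 : ℝ), 0 < y := eventually_mem_nhdsWithin
  have hu : u = 0 := by
    refine eq_zero_of_frequently_le (g := fun y => |v| * y ^ 2 + C * y ^ 4) (by fun_prop) (by simp)
      ((h.and_eventually hpos).mono fun y hy => ?_)
    obtain ⟨h1, h2⟩ := hy
    have h3 : |u| * y ^ 2 ≤ (|v| * y ^ 2 + C * y ^ 4) * y ^ 2 := by
      calc |u| * y ^ 2 = |(u * y ^ 2 + v * y ^ 4) - v * y ^ 4| := by
            rw [add_sub_cancel_right, abs_mul, abs_of_pos (pow_pos h2 2)]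
        _ ≤ |u * y ^ 2 + v * y ^ 4| + |v * y ^ 4| := abs_sub _ _
        _ ≤ C * y ^ 6 + |v| * y ^ 4 := by
            rw [abs_mul v, abs_of_pos (pow_pos h2 4)]
            exact add_le_add h1 le_rfl
        _ = _ := by ring
    exact le_of_mul_le_mul_right h3 (pow_pos h2 2)
  refine ⟨hu, eq_zero_of_frequently_le (g := fun y => C * y ^ 2) (by fun_prop) (by simp)
    ((h.and_eventually hpos).mono fun y hy => ?_)⟩
  obtain ⟨h1, h2⟩ := hy
  rw [hu, zero_mul, zero_add, abs_mul, abs_of_pos (pow_pos h2 4)] at h1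
  exact le_of_mul_le_mul_right (h1.trans_eq (by ring)) (pow_pos h2 4)

section
variable {G : ℝ → ℝ} {p : Params} {c d c' d' : ℝ}

lemma HasExpansion.unique (h : HasExpansion G p c d) (h' : HasExpansion G p c' d')
    (hz : HasZigzags G p) : c = c' ∧ d = d' := by
  obtain ⟨C, hC⟩ := h
  obtain ⟨C', hC'⟩ := h'
  have key : ∀ᶠ x in 𝓝[>] (0 : ℝ), ∃ y, x / 2 ≤ y ∧ y ≤ 2 * x ∧
      |(c - c') * y ^ 2 + (d - d') * y ^ 4| ≤ (C + C') * y ^ 6 := by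
    filter_upwards [hz, hC.filter_mono nhdsWithin_le_nhds, hC'.filter_mono nhdsWithin_le_nhds,
      (eventually_mem_nhdsWithin : ∀ᶠ x in 𝓝[>] (0 : ℝ), x ∈ Ioi (0 : ℝ))] with x h1 h2 h3 h4
    obtain ⟨θ, φ, T, P, ho, hzz, h5, h6⟩ := h1
    refine ⟨θ p.τ, h5, h6, ?_⟩
    have h7 := h2 (ne_of_gt h4) θ φ T P ho hzz
    have h8 := h3 (ne_of_gt h4) θ φ T P ho hzz
    rw [abs_sub_comm] at h7
    have h9 := abs_add_le (d * θ p.τ ^ 4 - (energyChange p θ φ T - c * θ p.τ ^ 2))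
      (energyChange p θ φ T - c' * θ p.τ ^ 2 - d' * θ p.τ ^ 4)
    rw [show (c - c') * θ p.τ ^ 2 + (d - d') * θ p.τ ^ 4 =
      (d * θ p.τ ^ 4 - (energyChange p θ φ T - c * θ p.τ ^ 2)) +
      (energyChange p θ φ T - c' * θ p.τ ^ 2 - d' * θ p.τ ^ 4) by ring]
    linarith
  have key2 : ∃ᶠ y in 𝓝[>] (0 : ℝ), |(c - c') * y ^ 2 + (d - d') * y ^ 4| ≤ (C + C') * y ^ 6 := by
    rw [(nhdsGT_basis (0 : ℝ)).frequently_iff]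
    intro r hr
    -- The attained positions lie between `x/2` and `2 x`, so they enter every interval `(0, r)`.
    obtain ⟨x, ⟨y, h1, h2, h3⟩, hx⟩ := (key.and (Ioo_mem_nhdsGT (show (0 : ℝ) < r / 4 by positivity))).exists
    exact ⟨y, ⟨by linarith [hx.1], by linarith [hx.2, hx.1]⟩, h3⟩
  obtain ⟨h1, h2⟩ := coeff_eq_zero key2
  exact ⟨sub_eq_zero.1 h1, sub_eq_zero.1 h2⟩

open Classical in
/-- The coefficients of the expansion of the energy change, where there is one. -/
def expansionCoeffs (G : ℝ → ℝ) (p : Params) : ℝ × ℝ :=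
  if h : ∃ y : ℝ × ℝ, HasExpansion G p y.1 y.2 then h.choose else 0

lemma HasExpansion.coeffs_eq (h : HasExpansion G p c d) (hz : HasZigzags G p) :
    expansionCoeffs G p = (c, d) := by
  have hex : ∃ y : ℝ × ℝ, HasExpansion G p y.1 y.2 := ⟨(c, d), h⟩
  rw [expansionCoeffs, dif_pos hex]
  obtain ⟨h1, h2⟩ := hex.choose_spec.unique h hz
  exact Prod.ext h1 h2

end

section
variable {e a₀ b₀ M : ℝ} {f m U : Params × ℝ → ℝ} {G : ℝ → ℝ}

lemma tendsto_amplitude (p : Params) : Tendsto (fun x : ℝ => (p, x ^ 2)) (𝓝 0) (𝓝 (p, 0)) := by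
  have : Continuous fun x : ℝ => (p, x ^ 2) := by fun_prop
  simpa using this.tendsto 0

lemma LocalModel.hasZigzags (h : LocalModel e a₀ b₀ f m U M) (hG : IsActuation G)
    (hGe : ∀ y, G y = 1 + e * (Real.cos y - 1)) :
    ∀ᶠ p : Params in 𝓝 (a₀, b₀, 0, 0), 0 < p.τ → HasZigzags G p := by
  filter_upwards [(tendsto_zero_amplitude a₀ b₀).eventually (h.cycle.and h.close).eventually_nhds]
    with p hp hτ
  have hp' := ((tendsto_amplitude p).mono_left nhdsWithin_le_nhds :
    Tendsto (fun x : ℝ => (p, x ^ 2)) (𝓝[>] 0) (𝓝 (p, 0))).eventually hp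
  filter_upwards [hp', eventually_mem_nhdsWithin] with x hx hx0
  obtain ⟨θ, φ, ho⟩ := exists_isForwardOrbit hG hτ x
  obtain ⟨P, hc, -, hθ, -⟩ := hx.1 G x θ φ hG hGe rfl (ne_of_gt hx0) hτ ho
  obtain ⟨h1, h2⟩ := abs_le.1 hx.2
  have hx0' : 0 < x := hx0
  refine ⟨θ, φ, _, P, ho, hc.zigzag, ?_, ?_⟩
  · rw [hθ]; nlinarith
  · rw [hθ]; nlinarith

/-- The remainder of the expansion, for all parameters and amplitudes close to the base point. -/
lemma LocalModel.exists_remainder (h : LocalModel e a₀ b₀ f m U M) (ha2 : a₀ < 2) :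
    ∃ C, 0 < C ∧ ∀ᶠ q in 𝓝 (basePoint a₀ b₀), 0 < q.1.τ → ∀ x : ℝ, q.2 = x ^ 2 →
      |q.1.τ * f q * (x * m q) ^ 2 - q.1.τ * f (q.1, 0) * (x * m q) ^ 2 -
        q.1.τ * fderiv ℝ f (q.1, 0) (0, 1) / m (q.1, 0) ^ 2 * (x * m q) ^ 4| ≤ C * (x * m q) ^ 6 := by
  obtain ⟨C₁, hC₁⟩ := exists_taylor_snd (x₀ := ((a₀, b₀, 0, 0) : Params)) (h.smooth ha2)
  obtain ⟨C₂, hC₂⟩ := exists_lipschitz_snd (x₀ := ((a₀, b₀, 0, 0) : Params))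
    ((h.smooth_pos ha2).of_le (by norm_num))
  obtain ⟨C₃, hC₃⟩ := exists_gt |fderiv ℝ f (basePoint a₀ b₀) (0, 1)|
  have hg : ∀ᶠ q in 𝓝 (basePoint a₀ b₀), |fderiv ℝ f (q.1, 0) (0, 1)| < C₃ := by
    have t : Tendsto (fun q : Params × ℝ => (q.1, (0 : ℝ))) (𝓝 (basePoint a₀ b₀))
        (𝓝 (basePoint a₀ b₀)) := Continuous.tendsto (by fun_prop) _
    exact t.eventually ((h.contDiffAt_slope ha2).continuousAt.abs.eventually_lt_const hC₃)
  have hm0 : ∀ᶠ q in 𝓝 (basePoint a₀ b₀), |m (q.1, 0) - 1| ≤ 1 / 20 := by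
    have t : Tendsto (fun q : Params × ℝ => (q.1, (0 : ℝ))) (𝓝 (basePoint a₀ b₀))
        (𝓝 (basePoint a₀ b₀)) := Continuous.tendsto (by fun_prop) _
    exact t.eventually h.close
  have hτ1 : ∀ᶠ q : Params × ℝ in 𝓝 (basePoint a₀ b₀), q.1.τ < 1 :=
    ((Params.contDiff_τ (n := 0)).continuous.comp continuous_fst |>.tendsto _).eventually_lt_const
      (by simp [basePoint, Params.τ])
  have hC₃0 : 0 ≤ C₃ := (abs_nonneg _).trans hC₃.le
  refine ⟨2 * (|C₁| + C₃ * (|C₂| * 4)) + 1, by positivity, ?_⟩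
  filter_upwards [hC₁, hC₂, hg, h.close, hm0, hτ1] with q e1 e2 e3 e4 e5 e6 hτ x hx
  obtain ⟨m1, m2⟩ := abs_le.1 e4
  obtain ⟨n1, n2⟩ := abs_le.1 e5
  set g := fderiv ℝ f (q.1, 0) (0, 1)
  set m₀ := m (q.1, 0)
  have hz : 0 ≤ q.2 := by rw [hx]; positivity
  have hm₀ : m₀ ≠ 0 := by intro h0; rw [h0] at n1; norm_num at n1
  have hq : q.2 ≤ (5 / 4) * (x * m q) ^ 2 := by
    have hm2 : 4 / 5 ≤ m q ^ 2 := by nlinarith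
    rw [mul_pow, ← hx]; nlinarith [mul_le_mul_of_nonneg_left hm2 hz]
  -- The expansion is in `θ₁² = z m(q)²`, while the coefficient `d` contains `m` at amplitude zero;
  -- the mismatch is of order `z` and goes into the remainder.
  have hratio : |m q ^ 2 / m₀ ^ 2 - 1| ≤ |C₂| * 4 * q.2 := by
    rw [div_sub_one (pow_ne_zero 2 hm₀), abs_div, abs_of_nonneg (sq_nonneg m₀),
      div_le_iff₀ (by positivity), sq_sub_sq, abs_mul]
    have h1 : |m q + m₀| ≤ 3 := by rw [abs_le]; constructor <;> linarith
    have h2 : |m q - m₀| ≤ |C₂| * q.2 := e2.trans (by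
      rw [abs_of_nonneg hz]; gcongr; exact le_abs_self _)
    have h3 : 3 / 4 ≤ m₀ ^ 2 := by nlinarith
    calc |m q + m₀| * |m q - m₀| ≤ 3 * (|C₂| * q.2) := by gcongr
      _ = |C₂| * 4 * q.2 * (3 / 4) := by ring
      _ ≤ _ := by gcongr
  have hmain : |f q - f (q.1, 0) - g / m₀ ^ 2 * (x * m q) ^ 2| ≤ (|C₁| + C₃ * (|C₂| * 4)) * q.2 ^ 2 := by
    have e : f q - f (q.1, 0) - g / m₀ ^ 2 * (x * m q) ^ 2 =
        (f q - f (q.1, 0) - g * q.2) - g * q.2 * (m q ^ 2 / m₀ ^ 2 - 1) := by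
      rw [mul_pow, ← hx]; field_simp; ring
    rw [e]
    refine (abs_sub _ _).trans ?_
    have h1 : |g * q.2 * (m q ^ 2 / m₀ ^ 2 - 1)| ≤ C₃ * q.2 * (|C₂| * 4 * q.2) := by
      rw [abs_mul, abs_mul, abs_of_nonneg hz]
      gcongr
    have h2 : C₁ * q.2 ^ 2 ≤ |C₁| * q.2 ^ 2 := by gcongr; exact le_abs_self _
    linarith
  set y := x * m q
  have hy : q.2 ^ 2 ≤ 2 * y ^ 4 := by nlinarith [sq_nonneg y]
  have e : q.1.τ * f q * y ^ 2 - q.1.τ * f (q.1, 0) * y ^ 2 - q.1.τ * g / m₀ ^ 2 * y ^ 4 =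
      q.1.τ * y ^ 2 * (f q - f (q.1, 0) - g / m₀ ^ 2 * y ^ 2) := by ring
  rw [e, abs_mul, abs_of_nonneg (by positivity)]
  calc q.1.τ * y ^ 2 * |f q - f (q.1, 0) - g / m₀ ^ 2 * y ^ 2|
      ≤ 1 * y ^ 2 * ((|C₁| + C₃ * (|C₂| * 4)) * (2 * y ^ 4)) := by
        gcongr
        exact hmain.trans (by gcongr)
    _ = 2 * (|C₁| + C₃ * (|C₂| * 4)) * y ^ 6 := by ring
    _ ≤ _ := by
      gcongr
      linarith

lemma LocalModel.hasExpansion (h : LocalModel e a₀ b₀ f m U M) (ha2 : a₀ < 2) (hG : IsActuation G)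
    (hGe : ∀ y, G y = 1 + e * (Real.cos y - 1)) :
    ∀ᶠ p : Params in 𝓝 (a₀, b₀, 0, 0), 0 < p.τ →
      HasExpansion G p (p.τ * f (p, 0)) (p.τ * fderiv ℝ f (p, 0) (0, 1) / m (p, 0) ^ 2) := by
  obtain ⟨C, -, hC⟩ := h.exists_remainder ha2
  filter_upwards [(tendsto_zero_amplitude a₀ b₀).eventually (h.cycle.and hC).eventually_nhds]
    with p hp hτ
  refine ⟨C, ?_⟩
  filter_upwards [(tendsto_amplitude p).eventually hp] with x hx hx0 θ φ T P ho hz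
  obtain ⟨P', hc, -, hθ, hE⟩ := hx.1 G x θ φ hG hGe rfl hx0 hτ ho
  obtain ⟨rfl, rfl⟩ := hz.time_unique hc.zigzag hτ
  rw [hE, hθ]
  exact hx.2 hτ x rfl

end
end Pendulum

namespace Pendulum

/-! ### The coefficients of the energy change -/

/-- coefficient of `θ₁²`, which is the same for both actuations -/
def quadAmp (p : Params) : ℝ := (expansionCoeffs (fun _ => 1) p).1

/-- coefficient of `θ₁⁴` -/
def quartAmp (G : ℝ → ℝ) (p : Params) : ℝ := (expansionCoeffs G p).2

/-- The actuations are the members `e = 1` and `e = 0` of one family. The coefficient `quadAmp` is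
defined through the constant actuation; equality of the rates at amplitude zero transfers it to the
model of `G`. -/
lemma exists_model {G : ℝ → ℝ} (hG : G ∈ actuations) {a₀ : ℝ} (ha : 1 < a₀) (b₀ : ℝ) :
    ∃ (e : ℝ) (f m U : Params × ℝ → ℝ) (M : ℝ), LocalModel e a₀ b₀ f m U M ∧
      (∀ y, G y = 1 + e * (Real.cos y - 1)) ∧
      (a₀ < 2 → ∀ᶠ p : Params in 𝓝 (a₀, b₀, 0, 0), 0 < p.τ → quadAmp p = p.τ * f (p, 0) ∧
        quartAmp G p = p.τ * fderiv ℝ f (p, 0) (0, 1) / m (p, 0) ^ 2) := by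
  obtain ⟨e, he⟩ : ∃ e : ℝ, ∀ y, G y = 1 + e * (Real.cos y - 1) := by
    rcases hG with rfl | rfl
    · exact ⟨1, fun y => by ring⟩
    · exact ⟨0, fun y => by ring⟩
  have h1 : (fun _ => 1 : ℝ → ℝ) ∈ actuations := Or.inr rfl
  have he1 : ∀ y : ℝ, (fun _ => 1 : ℝ → ℝ) y = 1 + 0 * (Real.cos y - 1) := fun y => by ring
  obtain ⟨f, m, U, M, hL, hzero⟩ := exists_localModel ha b₀
  refine ⟨e, f e, m e, U e, M e, hL e, he, fun ha2 => ?_⟩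
  filter_upwards [(hL e).hasExpansion ha2 (isActuation_of_mem hG) he,
    (hL e).hasZigzags (isActuation_of_mem hG) he,
    (hL 0).hasExpansion ha2 (isActuation_of_mem h1) he1,
    (hL 0).hasZigzags (isActuation_of_mem h1) he1,
    (tendsto_zero_amplitude a₀ b₀).eventually (hzero 0 e)] with p p1 p2 p3 p4 p5 hτ
  rw [quadAmp, quartAmp, (p1 hτ).coeffs_eq (p2 hτ), (p3 hτ).coeffs_eq (p4 hτ)]
  exact ⟨by rw [p5 rfl], rfl⟩

section
variable {a₀ b₀ : ℝ}

lemma exists_box {Q : Params × ℝ → Prop} (h : ∀ᶠ q in 𝓝 (basePoint a₀ b₀), Q q) :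
    ∃ ε > 0, ε ≤ 1 ∧ ∀ (p : Params) (z : ℝ), |p.a - a₀| < ε → |p.b - b₀| < ε → |p.s| < ε →
      |p.τ| < ε → |z| < ε → Q (p, z) := by
  obtain ⟨r, hr, hb⟩ := Metric.eventually_nhds_iff_ball.1 h
  refine ⟨min r 1, lt_min hr one_pos, min_le_right _ _, fun p z h1 h2 h3 h4 h5 => hb _ ?_⟩
  simp only [Metric.mem_ball, Prod.dist_eq, basePoint, Real.dist_eq, sub_zero, max_lt_iff]
  have := min_le_left r 1
  exact ⟨⟨h1.trans_le this, h2.trans_le this, h3.trans_le this, h4.trans_le this⟩, h5.trans_le this⟩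

lemma exists_param_box {Q : Params → Prop} (h : ∀ᶠ p : Params in 𝓝 (a₀, b₀, 0, 0), Q p) :
    ∃ ε > 0, ε ≤ 1 ∧ ∀ p : Params, |p.a - a₀| < ε → |p.b - b₀| < ε → |p.s| < ε →
      |p.τ| < ε → Q p := by
  obtain ⟨ε, h1, h2, h3⟩ := exists_box (a₀ := a₀) (b₀ := b₀) (Q := fun q => Q q.1)
    (continuous_fst.continuousAt.eventually h)
  exact ⟨ε, h1, h2, fun p k1 k2 k3 k4 => h3 p 0 k1 k2 k3 k4 (by simpa using h1)⟩

/-- For `a₀ ≥ 2` no smoothness of the energy rate is available. Its explicit approximation is smooth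
in the amplitude nevertheless, and this accounts for the error `O(θ₁⁴)`. -/
lemma contDiffAt_energyCoeffAt (e : ℝ) (ha : 1 < a₀) :
    ContDiffAt ℝ 1 (energyCoeffAt e) (basePoint a₀ b₀) := by
  have hS : ContDiff ℝ 1 fun q : Params × ℝ => trigSqrt 1 q.2 := (contDiff_trigSqrt 1).comp contDiff_snd
  have hK : ContDiffAt ℝ 1 (fun q : Params × ℝ => actCoeff e q.2) (basePoint a₀ b₀) :=
    contDiffAt_actCoeff_snd.of_le (WithTop.coe_le_coe.2 le_top)
  have hS' := hS.contDiffAt (x := basePoint a₀ b₀)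
  have hn0 : (basePoint a₀ b₀).1.a * actCoeff e (basePoint a₀ b₀).2 - trigSqrt 1 (basePoint a₀ b₀).2 ≠ 0 := by
    simp only [basePoint, Params.a, actCoeff_zero, trigSqrt_zero_right]
    norm_num
    linarith
  have ha : ContDiffAt ℝ 1 (fun q : Params × ℝ => q.1.a) (basePoint a₀ b₀) :=
    (by fun_prop : ContDiff ℝ 1 fun q : Params × ℝ => q.1.a).contDiffAt
  have hb : ContDiffAt ℝ 1 (fun q : Params × ℝ => q.1.b) (basePoint a₀ b₀) :=
    (by fun_prop : ContDiff ℝ 1 fun q : Params × ℝ => q.1.b).contDiffAt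
  have hs : ContDiffAt ℝ 1 (fun q : Params × ℝ => q.1.s) (basePoint a₀ b₀) :=
    (by fun_prop : ContDiff ℝ 1 fun q : Params × ℝ => q.1.s).contDiffAt
  have hτ : ContDiffAt ℝ 1 (fun q : Params × ℝ => q.1.τ) (basePoint a₀ b₀) :=
    (by fun_prop : ContDiff ℝ 1 fun q : Params × ℝ => q.1.τ).contDiffAt
  have n2 := pow_ne_zero 2 hn0
  unfold energyCoeffAt energyCoeff
  fun_prop (disch := first | exact hn0 | exact n2 | exact mul_ne_zero (by norm_num) hn0 |
    exact mul_ne_zero (by norm_num) n2)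

end
end Pendulum

/-! ### The energy expansion for all small orbits -/

namespace Pendulum

/-- Every small orbit zigzags, and the expansion of its energy change. -/
theorem zigzag_expansion {G : ℝ → ℝ} (hG : G ∈ actuations) {a₀ : ℝ} (b₀ : ℝ) (ha : 1 < a₀) :
    ∃ ε > 0, ∃ C > 0, ∀ p : Params,
      |p.a - a₀| < ε → |p.b - b₀| < ε → -ε < p.s → p.s ≤ 0 → 0 < p.τ → p.τ < ε →
        (a₀ < 2 → |quadAmp p - quadCoeff p| ≤ C * (|p.s| + p.τ) ^ 4) ∧
        ∀ x : ℝ, x ≠ 0 → |x| < ε →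
          (∃ θ φ : ℝ → ℝ, IsForwardOrbit G p x θ φ) ∧
          ∀ θ φ : ℝ → ℝ, IsForwardOrbit G p x θ φ →
            ∃ T P : ℝ, IsZigzag p θ φ T P ∧ P ≤ C * p.τ ∧
              (2 * p.τ ≤ T →
                |energyChange p θ φ T - quadCoeff p * θ p.τ ^ 2|
                  ≤ C * ((|p.s| + p.τ) ^ 4 * θ p.τ ^ 2 + θ p.τ ^ 4)) ∧
              (a₀ < 2 → 2 * p.τ ≤ T ∧
                |energyChange p θ φ T - quadAmp p * θ p.τ ^ 2 - quartAmp G p * θ p.τ ^ 4|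
                  ≤ C * θ p.τ ^ 6) := by
  obtain ⟨e, f, m, U, M, hL, hGe, hcd⟩ := exists_model hG ha b₀
  have hGa := isActuation_of_mem hG
  obtain ⟨C₁, hC₁⟩ := hL.approx
  obtain ⟨C₂, hC₂⟩ := exists_lipschitz_snd (x₀ := ((a₀, b₀, 0, 0) : Params))
    (contDiffAt_energyCoeffAt (b₀ := b₀) e ha)
  -- Collects what holds only for `a₀ < 2`; otherwise the statement is vacuous and any constant will
  -- do.
  obtain ⟨C₃, hC₃0, hC₃⟩ : ∃ C₃, 0 < C₃ ∧ ∀ᶠ q in 𝓝 (basePoint a₀ b₀), a₀ < 2 → 0 < q.1.τ →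
      2 ≤ U q ∧ |quadAmp q.1 - quadCoeff q.1| ≤ C₃ * (|q.1.s| + |q.1.τ|) ^ 4 ∧ ∀ x : ℝ, q.2 = x ^ 2 →
      |q.1.τ * f q * (x * m q) ^ 2 - quadAmp q.1 * (x * m q) ^ 2 - quartAmp G q.1 * (x * m q) ^ 4|
        ≤ C₃ * (x * m q) ^ 6 := by
    by_cases ha2 : a₀ < 2
    · obtain ⟨K, hK0, hK⟩ := hL.exists_remainder ha2
      obtain ⟨K', hK'⟩ := hL.rate_approx ha2
      refine ⟨K + |K'|, by positivity, ?_⟩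
      filter_upwards [hK, hL.two_le ha2, continuous_fst.continuousAt.eventually (hK'.and (hcd ha2))]
        with q h1 h2 h3 _ hτ
      obtain ⟨h4, h5⟩ := h3.2 hτ
      have hy : ∀ y : ℝ, 0 ≤ y ^ 6 := fun y => by positivity
      rw [h4, h5]
      refine ⟨h2, ?_, fun x hx => (h1 hτ x hx).trans (mul_le_mul_of_nonneg_right (by
        linarith [abs_nonneg K']) (hy _))⟩
      rw [quadCoeff_eq, ← mul_sub, abs_mul]
      calc |q.1.τ| * _ ≤ (|q.1.s| + |q.1.τ|) * (|K'| * (|q.1.s| + |q.1.τ|) ^ 3) := by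
            gcongr
            · exact le_add_of_nonneg_left (abs_nonneg _)
            · exact h3.1.trans (by gcongr; exact le_abs_self _)
        _ = |K'| * (|q.1.s| + |q.1.τ|) ^ 4 := by ring
        _ ≤ _ := by gcongr; linarith
    · exact ⟨1, one_pos, Eventually.of_forall fun q h => absurd h ha2⟩
  obtain ⟨ε, hε, hε1, hbox⟩ := exists_box (hL.cycle.and (hL.close.and (hC₁.and (hC₂.and hC₃))))
  refine ⟨ε, hε, M + |C₁| + 2 * |C₂| + C₃, by positivity [hL.bound_pos], ?_⟩
  intro p h1 h2 h3 h4 h5 h6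
  have hM := hL.bound_pos
  have hs : |p.s| < ε := abs_lt.2 ⟨h3, by linarith⟩
  have hτa : |p.τ| = p.τ := abs_of_pos h5
  have hτ : |p.τ| < ε := by rwa [hτa]
  refine ⟨fun ha2 => ?_, fun x hx hxε => ⟨exists_isForwardOrbit hGa h5 x, fun θ φ ho => ?_⟩⟩
  · have := ((hbox p 0 h1 h2 hs hτ (by simpa using hε)).2.2.2.2 ha2 h5).2.1
    rw [hτa] at this
    refine this.trans ?_
    gcongr
    have := abs_nonneg C₁
    have := abs_nonneg C₂
    linarith
  have hz : |x ^ 2| < ε := by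
    rw [abs_of_nonneg (sq_nonneg x), ← sq_abs]
    nlinarith [abs_nonneg x]
  obtain ⟨k1, k2, k3, k4, k5⟩ := hbox p (x ^ 2) h1 h2 hs hτ hz
  obtain ⟨P, hc, hP, hθ, hE⟩ := k1 G x θ φ hGa hGe rfl hx h5 ho
  simp only at hP hθ hE k3 k4
  rw [hθ]
  set q : Params × ℝ := (p, x ^ 2) with hq
  have n1 := abs_nonneg C₁
  have n2 := abs_nonneg C₂
  refine ⟨p.τ * U q, P, hc.zigzag, hP.trans (by gcongr; linarith), fun hT => ?_, fun ha2 => ?_⟩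
  · rw [hE]
    have hU : 2 ≤ U q := by nlinarith
    have hm : 4 / 5 ≤ m q ^ 2 := by nlinarith [(abs_le.1 k2).1]
    set y := x * m q with hy
    have hzy : x ^ 2 ≤ 2 * y ^ 2 := by
      rw [hy, mul_pow]
      nlinarith [mul_le_mul_of_nonneg_left hm (sq_nonneg x)]
    set r := |p.s| + p.τ with hr
    have hr0 : 0 ≤ r := by positivity
    have hτr : p.τ ≤ r := le_add_of_nonneg_left (abs_nonneg _)
    have hτ1 : p.τ ≤ 1 := by linarith
    have b1 : |f q - energyCoeffAt e q| ≤ |C₁| * r ^ 3 := by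
      have := k3 hU
      rw [hτa] at this
      exact this.trans (by gcongr; exact le_abs_self _)
    have b2 : |energyCoeffAt e q - energyCoeffAt e (p, 0)| ≤ |C₂| * (2 * y ^ 2) := by
      rw [abs_of_nonneg (sq_nonneg x)] at k4
      refine k4.trans ((mul_le_mul_of_nonneg_right (le_abs_self C₂) (sq_nonneg x)).trans ?_)
      gcongr
    rw [quadCoeff_eq, ← energyCoeffAt_zero e]
    -- The error splits into the approximation of the rate at the given amplitude and the change of
    -- the explicit coefficient from this amplitude to zero.
    have e1 : p.τ * f q * y ^ 2 - p.τ * energyCoeffAt e (p, 0) * y ^ 2 =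
        p.τ * y ^ 2 * (f q - energyCoeffAt e q) +
          p.τ * y ^ 2 * (energyCoeffAt e q - energyCoeffAt e (p, 0)) := by ring
    rw [e1]
    refine (abs_add_le _ _).trans ?_
    rw [abs_mul, abs_mul (p.τ * y ^ 2), abs_of_nonneg (show 0 ≤ p.τ * y ^ 2 by positivity)]
    calc p.τ * y ^ 2 * |f q - energyCoeffAt e q| +
          p.τ * y ^ 2 * |energyCoeffAt e q - energyCoeffAt e (p, 0)|
        ≤ r * y ^ 2 * (|C₁| * r ^ 3) + 1 * y ^ 2 * (|C₂| * (2 * y ^ 2)) := by gcongr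
      _ = |C₁| * (r ^ 4 * y ^ 2) + 2 * |C₂| * y ^ 4 := by ring
      _ ≤ (M + |C₁| + 2 * |C₂| + C₃) * (r ^ 4 * y ^ 2) + (M + |C₁| + 2 * |C₂| + C₃) * y ^ 4 := by
        gcongr <;> linarith
      _ = _ := by ring
  · obtain ⟨j1, -, j3⟩ := k5 ha2 h5
    rw [hE]
    refine ⟨by nlinarith, (j3 x rfl).trans ?_⟩
    gcongr
    linarith

/-! ### The zero curves -/

/-- A coefficient with the sign of `F`, where `F` has a zero curve. -/
lemma exists_hasZeroCurve {c F : Params → ℝ} {a₀ b₀ : ℝ} {α β γ₁ γ₂ γ₃ A₁ A₂ : ℝ × ℝ → ℝ}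
    (hc : ∀ᶠ p : Params in 𝓝 (a₀, b₀, 0, 0), 0 < p.τ → (c p = 0 ↔ F p = 0))
    (hF : ContDiffAt ℝ 1 F (a₀, b₀, 0, 0))
    (hγ₂ : ContinuousAt γ₂ (a₀, b₀)) (hγ₃ : ContinuousAt γ₃ (a₀, b₀))
    (hA₁ : ContinuousAt A₁ (a₀, b₀)) (hA₂ : ContinuousAt A₂ (a₀, b₀))
    (hQ : ∃ C, ∀ᶠ p : Params in 𝓝 (a₀, b₀, 0, 0),
      |F p - quadPoly α β γ₁ γ₂ γ₃ p| ≤ C * (|p.s| + |p.τ|) ^ 3)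
    (hβ : β (a₀, b₀) ≠ 0) (hA : A₁ (a₀, b₀) < 0)
    (h1 : ∀ᶠ y in 𝓝 (a₀, b₀), α y + β y * A₁ y = 0)
    (h2 : ∀ᶠ y in 𝓝 (a₀, b₀), β y * A₂ y + γ₁ y + γ₂ y * A₁ y + γ₃ y * A₁ y ^ 2 = 0)
    {approx : ℝ → ℝ → ℝ → ℝ}
    (ha : ∀ a b s, approx a b s = A₁ (a, b) * s + A₂ (a, b) * s ^ 2) :
    ∃ ε > 0, ∃ δ > 0, ∃ C > 0, ∀ a b s : ℝ,
      |a - a₀| < δ → |b - b₀| < δ → -δ < s → s < 0 →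
        ∃ τ' : ℝ, 0 < τ' ∧ τ' < ε ∧ |τ' - approx a b s| ≤ C * |s| ^ 3 ∧
          ∀ τ : ℝ, 0 < τ → τ < ε → (c (a, b, s, τ) = 0 ↔ τ = τ') := by
  obtain ⟨ε₀, hε₀, -, hbox⟩ := exists_param_box hc
  obtain ⟨ε, r1, r2, δ, r3, r4, C, r5, r6⟩ :=
    exists_zero_curve hF hγ₂ hγ₃ hA₁ hA₂ hQ hβ hA h1 h2 hε₀
  refine ⟨ε, r1, δ, r3, C, r5, fun a b s k1 k2 k3 k4 => ?_⟩
  obtain ⟨τ', q1, q2, q3, q4⟩ := r6 a b s k1 k2 k3 k4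
  refine ⟨τ', q1, q2, by rwa [ha], fun τ k5 k6 => ?_⟩
  rw [← q4 τ k5 k6]
  exact hbox (a, b, s, τ) (k1.trans_le r4) (k2.trans_le r4)
    (abs_lt.2 ⟨by simp only [Params.s]; linarith, by simp only [Params.s]; linarith⟩)
    (abs_lt.2 ⟨by simp only [Params.τ]; linarith, by simp only [Params.τ]; linarith⟩) k5

lemma eventually_fst_ne {a₀ b₀ r : ℝ} (h : a₀ ≠ r) : ∀ᶠ y : ℝ × ℝ in 𝓝 (a₀, b₀), y.1 - r ≠ 0 :=
  (continuous_fst.tendsto (a₀, b₀)).eventually_ne h |>.mono fun _ hy => sub_ne_zero.2 hy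

theorem hasZeroCurve_quadAmp : HasZeroCurve quadAmp (Ioo 1 2) bifurcationDelay := by
  rintro a₀ ⟨ha, ha2⟩ b₀
  obtain ⟨e, f, m, U, M, hL, -, hcd⟩ := exists_model (Or.inr rfl : (fun _ => 1) ∈ actuations) ha b₀
  have n0 : a₀ ≠ 0 := by linarith
  have n1 : a₀ - 1 ≠ 0 := by linarith
  have n2 : a₀ - 2 ≠ 0 := by linarith
  refine exists_hasZeroCurve (F := fun p => f (p, 0)) (A₁ := fun y => 2 / (y.1 - 2))
    (A₂ := fun y => -(2 * (2 + 8 * y.1 - 15 * y.1 ^ 2 + 6 * y.1 ^ 3) /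
      (3 * y.1 * (y.1 - 1) * (y.1 - 2) ^ 3) * y.2)) ?_ ((hL.contDiffAt_rate ha2).of_le (by norm_num))
    ?_ ?_ ?_ ?_ (hL.rate_approx ha2) ?_ ?_ ?_ ?_ ?_
  · filter_upwards [hcd ha2] with p hp hτ
    rw [(hp hτ).1, mul_eq_zero, or_iff_right hτ.ne']
  · exact ContinuousAt.div (by fun_prop) (by fun_prop) (mul_ne_zero two_ne_zero (pow_ne_zero 2 n1))
  · exact ContinuousAt.div (by fun_prop) (by fun_prop) (mul_ne_zero (by norm_num) (pow_ne_zero 2 n1))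
  · exact ContinuousAt.div (by fun_prop) (by fun_prop) n2
  · refine (ContinuousAt.mul (ContinuousAt.div (by fun_prop) (by fun_prop) ?_) (by fun_prop)).neg
    exact mul_ne_zero (mul_ne_zero (mul_ne_zero (by norm_num) n0) n1) (pow_ne_zero 3 n2)
  · exact div_ne_zero (mul_ne_zero (pow_ne_zero 2 n0) n2) (mul_ne_zero two_ne_zero n1)
  · exact div_neg_of_pos_of_neg two_pos (by linarith)
  · filter_upwards [eventually_fst_ne (sub_ne_zero.1 n1), eventually_fst_ne (sub_ne_zero.1 n2)] with y h1 h2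
    exact bifurcation_identity₁ h1 h2
  · filter_upwards [(continuous_fst.tendsto (a₀, b₀)).eventually_ne n0,
      eventually_fst_ne (sub_ne_zero.1 n1), eventually_fst_ne (sub_ne_zero.1 n2)] with y h0 h1 h2
    exact bifurcation_identity₂ h0 h1 h2
  · intro a b s
    simp only [bifurcationDelay]
    ring

lemma exists_slope_curve {G : ℝ → ℝ} (hG : G ∈ actuations) {e a₀ b₀ : ℝ}
    (hGe : ∀ y, G y = 1 + e * (Real.cos y - 1)) (ha : 1 < a₀) (ha2 : a₀ < 2)
    {A₁ A₂ : ℝ × ℝ → ℝ} {approx : ℝ → ℝ → ℝ → ℝ}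
    (hA₁ : ContinuousAt A₁ (a₀, b₀)) (hA₂ : ContinuousAt A₂ (a₀, b₀))
    (hβ : slopeT e (a₀, b₀) ≠ 0) (hA : A₁ (a₀, b₀) < 0)
    (h1 : ∀ᶠ y in 𝓝 (a₀, b₀), slopeS e y + slopeT e y * A₁ y = 0)
    (h2 : ∀ᶠ y in 𝓝 (a₀, b₀), slopeT e y * A₂ y + slopeSS e y + slopeST e y * A₁ y +
      slopeTT e y * A₁ y ^ 2 = 0)
    (happ : ∀ a b s, approx a b s = A₁ (a, b) * s + A₂ (a, b) * s ^ 2) :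
    ∃ ε > 0, ∃ δ > 0, ∃ C > 0, ∀ a b s : ℝ,
      |a - a₀| < δ → |b - b₀| < δ → -δ < s → s < 0 →
        ∃ τ' : ℝ, 0 < τ' ∧ τ' < ε ∧ |τ' - approx a b s| ≤ C * |s| ^ 3 ∧
          ∀ τ : ℝ, 0 < τ → τ < ε → (quartAmp G (a, b, s, τ) = 0 ↔ τ = τ') := by
  obtain ⟨e', f, m, U, M, hL, hGe', hcd⟩ := exists_model hG ha b₀
  -- The value at `π` determines `e`, as `cos π - 1 = -2`.
  obtain rfl : e = e' := by
    have h3 := hGe Real.pi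
    rw [hGe' Real.pi, Real.cos_pi] at h3
    linarith
  have n1 : a₀ - 1 ≠ 0 := by linarith
  refine exists_hasZeroCurve (F := fun p => fderiv ℝ f (p, 0) (0, 1)) ?_ (hL.contDiffAt_slope_zero ha2)
    ?_ ?_ hA₁ hA₂ (hL.slope_approx ha ha2) hβ hA h1 h2 happ
  · filter_upwards [hcd ha2, (tendsto_zero_amplitude a₀ b₀).eventually hL.close] with p hp hm hτ
    have hm0 : m (p, 0) ≠ 0 := by
      intro h0
      rw [h0] at hm
      norm_num at hm
    rw [(hp hτ).2, div_eq_zero_iff, or_iff_left (pow_ne_zero 2 hm0), mul_eq_zero, or_iff_right hτ.ne']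
  · unfold slopeST denomSlope
    exact ContinuousAt.div (by fun_prop) (by fun_prop) (mul_ne_zero two_ne_zero (pow_ne_zero 3 n1))
  · unfold slopeTT denomSlope
    exact ContinuousAt.div (by fun_prop) (by fun_prop) (mul_ne_zero (by norm_num) (pow_ne_zero 3 n1))

theorem hasZeroCurve_quartAmp_cos :
    HasZeroCurve (quartAmp Real.cos) (Ioo 1 (5 / 3)) criticalDelayCos := by
  rintro a₀ ⟨ha, ha2⟩ b₀
  have n0 : a₀ ≠ 0 := by linarith
  have n1 : a₀ - 1 ≠ 0 := by linarith
  -- Three times this quadratic equals `(3 a₀ - 4)² + 2`.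
  have n2 : 0 < 3 * a₀ ^ 2 - 8 * a₀ + 6 := by nlinarith [sq_nonneg (3 * a₀ - 4)]
  have hev : ∀ᶠ y : ℝ × ℝ in 𝓝 (a₀, b₀), 3 * y.1 ^ 2 - 8 * y.1 + 6 ≠ 0 :=
    (Continuous.tendsto (by fun_prop : Continuous fun y : ℝ × ℝ => 3 * y.1 ^ 2 - 8 * y.1 + 6)
      (a₀, b₀)).eventually_ne n2.ne'
  refine exists_slope_curve (e := 1) (Or.inl rfl) (fun y => by ring) ha (by linarith)
    (A₁ := fun y => (3 * y.1 - 5) / (3 * y.1 ^ 2 - 8 * y.1 + 6))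
    (A₂ := fun y => y.2 * (-243 * y.1 ^ 6 + 1674 * y.1 ^ 5 - 4491 * y.1 ^ 4 + 5862 * y.1 ^ 3 -
      3611 * y.1 ^ 2 + 642 * y.1 + 175) / (6 * y.1 * (y.1 - 1) * (3 * y.1 ^ 2 - 8 * y.1 + 6) ^ 3))
    ?_ ?_ ?_ ?_ ?_ ?_ ?_
  · exact ContinuousAt.div (by fun_prop) (by fun_prop) n2.ne'
  · exact ContinuousAt.div (by fun_prop) (by fun_prop)
      (mul_ne_zero (mul_ne_zero (mul_ne_zero (by norm_num) n0) n1) (pow_ne_zero 3 n2.ne'))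
  · rw [(slope_one_eq n1).2]
    exact div_ne_zero (neg_ne_zero.2 (mul_ne_zero (pow_ne_zero 2 n0) n2.ne'))
      (mul_ne_zero (by norm_num) (pow_ne_zero 2 n1))
  · exact div_neg_of_neg_of_pos (by simp only; linarith) n2
  · filter_upwards [eventually_fst_ne (sub_ne_zero.1 n1), hev] with y h1 h2
    exact criticalCos_identity₁ h1 h2
  · filter_upwards [(continuous_fst.tendsto (a₀, b₀)).eventually_ne n0,
      eventually_fst_ne (sub_ne_zero.1 n1), hev] with y h0 h1 h2
    exact criticalCos_identity₂ h0 h1 h2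
  · intro a b s
    simp only [criticalDelayCos]

theorem hasZeroCurve_quartAmp_one :
    HasZeroCurve (quartAmp fun _ => 1) (Ioo 1 2) criticalDelayOne := by
  rintro a₀ ⟨ha, ha2⟩ b₀
  have n0 : a₀ ≠ 0 := by linarith
  have n1 : a₀ - 1 ≠ 0 := by linarith
  refine exists_slope_curve (e := 0) (Or.inr rfl) (fun y => by ring) ha (by linarith)
    (A₁ := fun y => -(2 / y.1))
    (A₂ := fun y => -(2 * y.2 * (y.1 ^ 2 - 2) * (3 * y.1 - 1) / (3 * y.1 ^ 4 * (y.1 - 1))))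
    ?_ ?_ ?_ ?_ ?_ ?_ ?_
  · refine (ContinuousAt.div (by fun_prop) (by fun_prop) ?_).neg
    exact n0
  · refine (ContinuousAt.div (by fun_prop) (by fun_prop) ?_).neg
    exact mul_ne_zero (mul_ne_zero (by norm_num) (pow_ne_zero 4 n0)) n1
  · rw [(slope_zero_eq n1).2]
    exact div_ne_zero (pow_ne_zero 3 n0) (mul_ne_zero (by norm_num) (pow_ne_zero 2 n1))
  · exact neg_neg_of_pos (div_pos two_pos (by simp only; linarith))
  · filter_upwards [(continuous_fst.tendsto (a₀, b₀)).eventually_ne n0,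
      eventually_fst_ne (sub_ne_zero.1 n1)] with y h0 h1
    exact criticalOne_identity₁ h0 h1
  · filter_upwards [(continuous_fst.tendsto (a₀, b₀)).eventually_ne n0,
      eventually_fst_ne (sub_ne_zero.1 n1)] with y h0 h1
    exact criticalOne_identity₂ h0 h1
  · intro a b s
    simp only [criticalDelayOne]
    ring

end Pendulum

namespace Pendulum

/-! ### Signs at the zeros of the quadratic coefficient -/

/-- Where `α s + β τ` vanishes to second order, the sign of `μ s + ν τ` is that of `ν - μ β / α`. -/
lemma exists_leading_sign {α β μ ν : ℝ} (C : ℝ) (hα : α ≠ 0) (hl : ν - μ * (β / α) ≠ 0) :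
    ∃ ε > 0, ∀ s τ v : ℝ, |s| < ε → 0 < τ → τ < ε → |α * s + β * τ| ≤ C * (|s| + |τ|) ^ 2 →
      |v - (μ * s + ν * τ)| ≤ C * (|s| + |τ|) ^ 2 → 0 < v * (ν - μ * (β / α)) := by
  set l := ν - μ * (β / α) with hl'
  have hα0 : 0 < |α| := abs_pos.2 hα
  have hl0 : 0 < |l| := abs_pos.2 hl
  set K := 2 * (1 + |β| / |α|) with hK
  have hK0 : 0 < K := by positivity
  set D := (1 + |μ| / |α|) * |C| with hD
  have hD0 : 0 ≤ D := by positivity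
  -- The first bound allows the quadratic error to be absorbed when `|s|` is estimated by `τ`; the
  -- second keeps the total remainder below `|l| τ`.
  obtain ⟨ε, hε, h1, h2⟩ : ∃ ε > 0, 2 * ε * (|C| / |α|) < 1 / 2 ∧ D * K * (2 * ε) < |l| := by
    have t1 : Tendsto (fun ε : ℝ => 2 * ε * (|C| / |α|)) (𝓝[>] 0) (𝓝 (2 * 0 * (|C| / |α|))) :=
      (Continuous.tendsto (by fun_prop) 0).mono_left nhdsWithin_le_nhds
    have t2 : Tendsto (fun ε : ℝ => D * K * (2 * ε)) (𝓝[>] 0) (𝓝 (D * K * (2 * 0))) :=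
      (Continuous.tendsto (by fun_prop) 0).mono_left nhdsWithin_le_nhds
    obtain ⟨ε, h1, h2, h3⟩ := ((eventually_mem_nhdsWithin : ∀ᶠ ε : ℝ in 𝓝[>] 0, ε ∈ Ioi (0 : ℝ)).and
      ((t1.eventually_lt_const (by norm_num : 2 * 0 * (|C| / |α|) < 1 / 2)).and
        (t2.eventually_lt_const (by rwa [mul_zero, mul_zero] : D * K * (2 * 0) < |l|)))).exists
    exact ⟨ε, h1, h2, h3⟩
  refine ⟨ε, hε, fun s τ v hs hτ hτε g1 g2 => ?_⟩
  rw [abs_of_pos hτ] at g1 g2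
  set r := |s| + τ with hr
  have hr0 : 0 < r := by positivity
  have hrε : r < 2 * ε := by linarith
  have c1 : C * r ^ 2 ≤ |C| * r ^ 2 := by gcongr; exact le_abs_self C
  have k1 : |α| * |s| ≤ |β| * τ + |C| * r ^ 2 := by
    calc |α| * |s| = |(α * s + β * τ) - β * τ| := by rw [add_sub_cancel_right, abs_mul]
      _ ≤ |α * s + β * τ| + |β * τ| := abs_sub _ _
      _ ≤ _ := by rw [abs_mul β, abs_of_pos hτ]; linarith
  have k2 : |s| ≤ |β| / |α| * τ + |C| / |α| * r ^ 2 := by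
    rw [← mul_le_mul_iff_right₀ hα0]
    calc |α| * |s| ≤ _ := k1
      _ = _ := by field_simp
  have k3 : |C| / |α| * r ^ 2 ≤ r / 2 := by
    have : |C| / |α| * r ≤ 1 / 2 := by
      calc |C| / |α| * r ≤ |C| / |α| * (2 * ε) := by gcongr
        _ ≤ 1 / 2 := by linarith
    nlinarith
  -- The near relation `α s + β τ ≈ 0` makes `s` comparable to `τ`, so errors of second order in `r`
  -- are small against `τ`.
  have k4 : r ≤ K * τ := by rw [hK]; linarith
  have k5 : |v - l * τ| ≤ D * r ^ 2 := by
    have e : v - l * τ = (v - (μ * s + ν * τ)) + μ / α * (α * s + β * τ) := by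
      rw [hl']; field_simp; ring
    rw [e]
    refine (abs_add_le _ _).trans ?_
    rw [abs_mul, abs_div, hD]
    calc _ ≤ |C| * r ^ 2 + |μ| / |α| * (|C| * r ^ 2) := by
          gcongr
          · exact g2.trans c1
          · exact g1.trans c1
      _ = _ := by ring
  have k6 : |v - l * τ| < |l| * τ := by
    calc |v - l * τ| ≤ D * r ^ 2 := k5
      _ = D * (r * r) := by ring
      _ ≤ D * (K * τ * (2 * ε)) := by gcongr
      _ = D * K * (2 * ε) * τ := by ring
      _ < |l| * τ := by gcongr
  have k7 : |v * l - l ^ 2 * τ| < l ^ 2 * τ := by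
    calc |v * l - l ^ 2 * τ| = |l| * |v - l * τ| := by rw [← abs_mul]; congr 1; ring
      _ < |l| * (|l| * τ) := by gcongr
      _ = l ^ 2 * τ := by rw [← sq_abs l]; ring
  linarith [(abs_lt.1 k7).1]

section
variable {e a₀ b₀ M : ℝ} {f m U : Params × ℝ → ℝ}

lemma rate_ratio (ha : 1 < a₀) : rateT (a₀, b₀) / rateS (a₀, b₀) = -((a₀ - 2) / 2) := by
  have n0 : a₀ ≠ 0 := by linarith
  have n1 : a₀ - 1 ≠ 0 := by linarith
  simp only [rateT, rateS]
  field_simp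

/-- Signs at the points where the energy rate vanishes at amplitude zero. -/
lemma LocalModel.signs_of_rate_eq_zero (h : LocalModel e a₀ b₀ f m U M) (ha : 1 < a₀) (ha2 : a₀ < 2)
    (he : slopeT e (a₀, b₀) + slopeS e (a₀, b₀) * ((a₀ - 2) / 2) ≠ 0) :
    ∃ ε > 0, ∀ s₀ τ₀ : ℝ, |s₀| < ε → 0 < τ₀ → τ₀ < ε → f ((a₀, b₀, s₀, τ₀), 0) = 0 →
      0 < fderiv ℝ f ((a₀, b₀, s₀, τ₀), 0) (0, 1) *
        (slopeT e (a₀, b₀) + slopeS e (a₀, b₀) * ((a₀ - 2) / 2)) ∧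
      fderiv ℝ f ((a₀, b₀, s₀, τ₀), 0) ((1, 0, 0, 0), 0) ≠ 0 ∧
      fderiv ℝ f ((a₀, b₀, s₀, τ₀), 0) ((0, 0, 0, 1), 0) ≠ 0 := by
  have n0 : a₀ ≠ 0 := by linarith
  have n1 : a₀ - 1 ≠ 0 := by linarith
  have n2 : a₀ - 2 ≠ 0 := by linarith
  have hα : rateS (a₀, b₀) ≠ 0 := neg_ne_zero.2 (div_ne_zero (pow_ne_zero 2 n0) n1)
  have hβ : rateT (a₀, b₀) ≠ 0 :=
    div_ne_zero (mul_ne_zero (pow_ne_zero 2 n0) n2) (mul_ne_zero two_ne_zero n1)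
  have cSS : ContinuousAt rateSS (a₀, b₀) := by
    refine (ContinuousAt.div (by fun_prop) (by fun_prop) ?_).neg
    exact pow_ne_zero 2 n1
  have cST : ContinuousAt rateST (a₀, b₀) :=
    ContinuousAt.div (by fun_prop) (by fun_prop) (mul_ne_zero two_ne_zero (pow_ne_zero 2 n1))
  have cTT : ContinuousAt rateTT (a₀, b₀) :=
    ContinuousAt.div (by fun_prop) (by fun_prop) (mul_ne_zero (by norm_num) (pow_ne_zero 2 n1))
  have dSS : ContinuousAt (slopeSS e) (a₀, b₀) := by
    unfold slopeSS denomSlope numSlope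
    refine (ContinuousAt.div (by fun_prop) (by fun_prop) ?_).neg
    exact pow_ne_zero 3 n1
  have dST : ContinuousAt (slopeST e) (a₀, b₀) := by
    unfold slopeST denomSlope
    exact ContinuousAt.div (by fun_prop) (by fun_prop) (mul_ne_zero two_ne_zero (pow_ne_zero 3 n1))
  have dTT : ContinuousAt (slopeTT e) (a₀, b₀) := by
    unfold slopeTT denomSlope
    exact ContinuousAt.div (by fun_prop) (by fun_prop) (mul_ne_zero (by norm_num) (pow_ne_zero 3 n1))
  obtain ⟨C₁, hC₁⟩ := exists_linear_bound cSS cST cTT (h.rate_approx ha2)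
  obtain ⟨C₂, hC₂⟩ := exists_linear_bound dSS dST dTT (h.slope_approx ha ha2)
  obtain ⟨C₃, hC₃⟩ := h.rate_fderiv_gain ha ha2
  have hF := (h.contDiffAt_rate ha2).of_le (by norm_num : (1 : WithTop ℕ∞) ≤ 2)
  have hd : ∀ᶠ q in 𝓝 (basePoint a₀ b₀), DifferentiableAt ℝ f q :=
    ((h.smooth ha2).eventually (by simp)).mono fun q hq => hq.differentiableAt (by simp)
  -- At the base point the delay derivative of the rate is the linear coefficient `rateT`, which is
  -- not zero for `a₀ < 2`; continuity does the rest.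
  have hT : ∀ᶠ p : Params in 𝓝 (a₀, b₀, 0, 0), fderiv ℝ f (p, 0) ((0, 0, 0, 1), 0) ≠ 0 := by
    have h1 : ContinuousAt (fun q => fderiv ℝ f q ((0, 0, 0, 1), 0)) (basePoint a₀ b₀) :=
      (((h.smooth ha2).fderiv_right (m := 1) (by norm_num)).clm_apply contDiffAt_const).continuousAt
    have h2 := fderiv_delay hF (h.rate_approx ha2)
    have h3 : fderiv ℝ f (basePoint a₀ b₀) ((0, 0, 0, 1), 0) = rateT (a₀, b₀) := by
      rw [← h2]
      have hl : HasFDerivAt (fun p : Params => (p, (0 : ℝ))) (ContinuousLinearMap.inl ℝ Params ℝ)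
          (a₀, b₀, 0, 0) := (hasFDerivAt_id _).prodMk (hasFDerivAt_const _ _)
      have h4 := (hd.self_of_nhds.hasFDerivAt).comp (f := fun p : Params => (p, (0 : ℝ)))
        (a₀, b₀, 0, 0) hl
      have h5 := h4.fderiv
      simp only [Function.comp_def] at h5
      rw [h5]
      rfl
    refine (tendsto_zero_amplitude a₀ b₀).eventually (h1.eventually_ne ?_)
    rwa [h3]
  have l1 : slopeT e (a₀, b₀) - slopeS e (a₀, b₀) * (rateT (a₀, b₀) / rateS (a₀, b₀)) =
      slopeT e (a₀, b₀) + slopeS e (a₀, b₀) * ((a₀ - 2) / 2) := by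
    rw [rate_ratio ha]; ring
  have l2 : a₀ * (2 * a₀ ^ 2 - 5 * a₀ + 4) / (2 * (a₀ - 1) ^ 2) -
      -(a₀ * (a₀ - 2) / (a₀ - 1) ^ 2) * (rateT (a₀, b₀) / rateS (a₀, b₀)) ≠ 0 := by
    have : a₀ * (2 * a₀ ^ 2 - 5 * a₀ + 4) / (2 * (a₀ - 1) ^ 2) -
      -(a₀ * (a₀ - 2) / (a₀ - 1) ^ 2) * (rateT (a₀, b₀) / rateS (a₀, b₀)) = a₀ ^ 2 / (2 * (a₀ - 1)) := by
      rw [rate_ratio ha]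
      field_simp
      ring
    rw [this]
    exact div_ne_zero (pow_ne_zero 2 n0) (mul_ne_zero two_ne_zero n1)
  obtain ⟨ε₁, hε₁, k1⟩ := exists_leading_sign (|C₁| + |C₂|) hα (l1 ▸ he)
  obtain ⟨ε₂, hε₂, k2⟩ := exists_leading_sign (|C₁| + |C₃|) hα l2
  obtain ⟨ε₃, hε₃, -, k3⟩ := exists_param_box (hC₁.and (hC₂.and (hC₃.and hT)))
  refine ⟨min ε₁ (min ε₂ ε₃), by positivity, fun s τ hs hτ hτε h0 => ?_⟩
  simp only [lt_min_iff] at hs hτε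
  obtain ⟨j1, j2, j3, j4⟩ := k3 (a₀, b₀, s, τ) (by simpa [Params.a] using hε₃)
    (by simpa [Params.b] using hε₃) hs.2.2 (by simpa [Params.τ, abs_of_pos hτ] using hτε.2.2)
  rw [h0, zero_sub, abs_neg] at j1
  have hr : 0 ≤ (|s| + |τ|) ^ 2 := by positivity
  have w1 := le_abs_self C₁
  have w2 := le_abs_self C₂
  have w3 := le_abs_self C₃
  have v1 := abs_nonneg C₁
  have v2 := abs_nonneg C₂
  have v3 := abs_nonneg C₃
  refine ⟨?_, ?_, j4⟩
  · rw [← l1]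
    exact k1 s τ _ hs.1 hτ hτε.1 (j1.trans (mul_le_mul_of_nonneg_right (by linarith) hr))
      (j2.trans (mul_le_mul_of_nonneg_right (by linarith) hr))
  · exact left_ne_zero_of_mul (k2 s τ _ hs.2.1 hτ hτε.2.1
      (j1.trans (mul_le_mul_of_nonneg_right (by linarith) hr))
      (j3.trans (mul_le_mul_of_nonneg_right (by linarith) hr))).ne'

/-- Where the rate vanishes, `s ≈ (a₀ - 2) τ / 2`; this combination is the coefficient of `τ` that
the amplitude derivative acquires there. The opposite signs for the two actuations produce stable
and unstable orbits. -/
lemma slope_sign_one (ha : 1 < a₀) : slopeT 1 (a₀, b₀) + slopeS 1 (a₀, b₀) * ((a₀ - 2) / 2) < 0 := by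
  have n1 : a₀ - 1 ≠ 0 := by linarith
  rw [(slope_one_eq n1).1, (slope_one_eq n1).2]
  have : -(a₀ ^ 2 * (3 * a₀ ^ 2 - 8 * a₀ + 6)) / (6 * (a₀ - 1) ^ 2) +
      a₀ ^ 2 * (3 * a₀ - 5) / (6 * (a₀ - 1) ^ 2) * ((a₀ - 2) / 2) =
      -(a₀ ^ 2 * (3 * a₀ - 2) / (12 * (a₀ - 1))) := by
    field_simp; ring
  rw [this]
  have h1 : 0 < 3 * a₀ - 2 := by linarith
  have h2 : 0 < a₀ - 1 := by linarith
  have : 0 < a₀ := by linarith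
  exact neg_neg_of_pos (by positivity)

lemma slope_sign_zero (ha : 1 < a₀) : 0 < slopeT 0 (a₀, b₀) + slopeS 0 (a₀, b₀) * ((a₀ - 2) / 2) := by
  have n1 : a₀ - 1 ≠ 0 := by linarith
  rw [(slope_zero_eq n1).1, (slope_zero_eq n1).2]
  have : a₀ ^ 3 / (12 * (a₀ - 1) ^ 2) + a₀ ^ 2 / (6 * (a₀ - 1) ^ 2) * ((a₀ - 2) / 2) =
      a₀ ^ 2 / (6 * (a₀ - 1)) := by
    field_simp; ring
  rw [this]
  have h2 : 0 < a₀ - 1 := by linarith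
  have : 0 < a₀ := by linarith
  positivity

end
end Pendulum

namespace Pendulum

/-! ### The bifurcation -/

section Zero
variable {f : Params × ℝ → ℝ} {p₀ : Params} {g₀ : ℝ}

/-- `f` is, in its second argument, close to an affine function with slope `g₀`. -/
lemma eventually_slope_close (hf : ContDiffAt ℝ 1 f (p₀, 0)) {κ : ℝ} (hκ : 0 < κ) :
    ∃ r > 0, ∀ p z z', dist p p₀ < r → |z| < r → |z'| < r →
      |f (p, z) - f (p, z') - fderiv ℝ f (p₀, 0) (0, 1) * (z - z')| ≤ κ * |z - z'| := by
  -- A C¹ function is strictly differentiable, which gives the two-point estimate uniformly in the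
  -- parameters.
  have h1 := (hf.hasStrictFDerivAt (by simp)).isLittleO.def hκ
  rw [nhds_prod_eq, Filter.eventually_prod_iff] at h1
  obtain ⟨A, hA, B, hB, h2⟩ := h1
  obtain ⟨r, hr, hb⟩ := Metric.eventually_nhds_iff_ball.1 (hA.and hB)
  refine ⟨r, hr, fun p z z' hp hz hz' => ?_⟩
  have mem : ∀ z, |z| < r → (p, z) ∈ Metric.ball (p₀, (0 : ℝ)) r := fun z hz => by
    rw [Metric.mem_ball, Prod.dist_eq, max_lt_iff]
    exact ⟨hp, by simpa [Real.dist_eq] using hz⟩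
  have h3 := h2 (hb _ (mem z hz)).1 (hb _ (mem z' hz')).2
  have e : ((p, z) : Params × ℝ) - (p, z') = (z - z') • (0, 1) := by simp
  simp only [e, map_smul, norm_smul, Real.norm_eq_abs, smul_eq_mul] at h3
  rw [mul_comm (fderiv ℝ f (p₀, 0) (0, 1))]
  simpa using h3

lemma mul_pos_of_slope_close {y z : ℝ} (hg : g₀ ≠ 0) (h : |y - g₀ * z| ≤ |g₀| / 2 * |z|) (hz : z ≠ 0) :
    0 < y * g₀ * z := by
  have h0 : 0 < |g₀| * |z| := by positivity
  have h1 : |y * (g₀ * z) - (g₀ * z) ^ 2| < (g₀ * z) ^ 2 := by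
    calc |y * (g₀ * z) - (g₀ * z) ^ 2| = |g₀ * z| * |y - g₀ * z| := by rw [← abs_mul]; congr 1; ring
      _ ≤ (|g₀| * |z|) * (|g₀| / 2 * |z|) := by rw [abs_mul]; gcongr
      _ < (|g₀| * |z|) * (|g₀| * |z|) := by
        have := abs_pos.2 hg
        gcongr
        linarith
      _ = (g₀ * z) ^ 2 := by rw [← abs_mul, ← sq, sq_abs]
  have := (abs_lt.1 h1).1
  linarith [mul_assoc y g₀ z]

/-- Zeros of a monotone function -/
lemma exists_zero_iff {k : ℝ → ℝ} {R : ℝ} (hR : 0 < R) (hg : g₀ ≠ 0)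
    (hk : ∀ z ∈ Icc 0 R, ∀ z' ∈ Icc 0 R, |k z - k z' - g₀ * (z - z')| ≤ |g₀| / 2 * |z - z'|)
    (h0 : |k 0| < |g₀| * R / 4) : (∃ z ∈ Ioo 0 R, k z = 0) ↔ k 0 * g₀ < 0 := by
  have m0 : (0 : ℝ) ∈ Icc 0 R := ⟨le_rfl, hR.le⟩
  constructor
  · rintro ⟨z, hz, hkz⟩
    have h1 := hk z (Ioo_subset_Icc_self hz) 0 m0
    rw [hkz, sub_zero] at h1
    have h2 := mul_pos_of_slope_close hg h1 hz.1.ne'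
    have := pos_of_mul_pos_left h2 hz.1.le
    linarith
  · intro hneg
    -- Up to `3 R / 4` the function changes by at least `3 |g₀| R / 8`, which outweighs the initial
    -- value, smaller than `|g₀| R / 4`.
    have hz : 3 / 4 * R ∈ Icc 0 R := ⟨by positivity, by linarith⟩
    have h1 := hk _ hz 0 m0
    rw [sub_zero, abs_of_pos (show 0 < 3 / 4 * R by positivity)] at h1
    have hg0 : 0 < |g₀| := abs_pos.2 hg
    have hpos : 0 < k (3 / 4 * R) * g₀ := by
      have h2 : |k (3 / 4 * R) * g₀ - g₀ ^ 2 * (3 / 4 * R)| < g₀ ^ 2 * (3 / 4 * R) := by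
        calc |k (3 / 4 * R) * g₀ - g₀ ^ 2 * (3 / 4 * R)|
            = |g₀| * |(k (3 / 4 * R) - k 0 - g₀ * (3 / 4 * R)) + k 0| := by
              rw [← abs_mul]; congr 1; ring
          _ ≤ |g₀| * (|g₀| / 2 * (3 / 4 * R) + |k 0|) := by
              gcongr
              exact (abs_add_le _ _).trans (by gcongr)
          _ < |g₀| * (|g₀| / 2 * (3 / 4 * R) + |g₀| * R / 4) := by gcongr
          _ ≤ g₀ ^ 2 * (3 / 4 * R) := by rw [← sq_abs g₀]; nlinarith [mul_pos (mul_pos hg0 hg0) hR]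
      linarith [(abs_lt.1 h2).1]
    have hc : ContinuousOn (fun z => k z * g₀) (Icc 0 (3 / 4 * R)) := by
      refine ContinuousOn.mul ?_ continuousOn_const
      refine (LipschitzOnWith.of_dist_le_mul (K := Real.toNNReal (2 * |g₀|)) fun z hz' z' hz'' => ?_).continuousOn
      have := hk z ⟨hz'.1, hz'.2.trans hz.2⟩ z' ⟨hz''.1, hz''.2.trans hz.2⟩
      rw [Real.dist_eq, Real.dist_eq, Real.coe_toNNReal _ (by positivity)]
      calc |k z - k z'| = |(k z - k z' - g₀ * (z - z')) + g₀ * (z - z')| := by rw [sub_add_cancel]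
        _ ≤ |g₀| / 2 * |z - z'| + |g₀| * |z - z'| := by
          refine (abs_add_le _ _).trans (add_le_add this (abs_mul _ _).le)
        _ ≤ _ := by nlinarith [mul_nonneg hg0.le (abs_nonneg (z - z'))]
    obtain ⟨z, hz1, hz2⟩ := intermediate_value_Icc hz.1 hc ⟨hneg.le, hpos.le⟩
    have hkz : k z = 0 := (mul_eq_zero.1 hz2).resolve_right hg
    refine ⟨z, ⟨lt_of_le_of_ne hz1.1 ?_, by linarith [hz1.2]⟩, hkz⟩
    rintro rfl
    rw [hkz, zero_mul] at hneg
    exact hneg.false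

end Zero

open Classical in
/-- The amplitude: the square root of a zero of `f (p, ·)` in `(0, R)`. -/
def amplitude (f : Params × ℝ → ℝ) (R : ℝ) (p : Params) : ℝ :=
  if h : ∃ z ∈ Ioo 0 R, f (p, z) = 0 then Real.sqrt h.choose else 0

lemma amplitude_nonneg (f : Params × ℝ → ℝ) (R : ℝ) (p : Params) : 0 ≤ amplitude f R p := by
  unfold amplitude
  split_ifs
  · exact Real.sqrt_nonneg _
  · exact le_rfl

lemma amplitude_spec {f : Params × ℝ → ℝ} {R : ℝ} {p : Params} (h : ∃ z ∈ Ioo 0 R, f (p, z) = 0) :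
    amplitude f R p ^ 2 ∈ Ioo 0 R ∧ f (p, amplitude f R p ^ 2) = 0 := by
  have h1 := h.choose_spec
  rw [amplitude, dif_pos h, Real.sq_sqrt h1.1.1.le]
  exact h1

section
variable {f m U : Params × ℝ → ℝ} {p₀ : Params} {G : ℝ → ℝ} {M : ℝ}

/-- If the energy rate vanishes at `(p₀, 0)`, with nonzero derivative in the second argument, then
the zigzag periodic orbits close to the origin correspond to the zeros of the energy rate. -/
theorem exists_bifurcation (hG : IsActuation G) (hτ₀ : 0 < p₀.τ) (hs₀ : |p₀.s| < 1 / 2)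
    (hcyc : ∀ᶠ q in 𝓝 (p₀, (0 : ℝ)), ∀ (x : ℝ) (θ φ : ℝ → ℝ), q.2 = x ^ 2 → x ≠ 0 → 0 < q.1.τ →
      IsForwardOrbit G q.1 x θ φ → ∃ P, IsCycle q.1 x θ φ (q.1.τ * U q) P ∧ P ≤ M * q.1.τ ∧
        θ q.1.τ = x * m q ∧ energyChange q.1 θ φ (q.1.τ * U q) = q.1.τ * f q * (x * m q) ^ 2)
    (hm : ∀ᶠ q in 𝓝 (p₀, (0 : ℝ)), |m q - 1| ≤ 1 / 20 ∧ ContinuousAt m q)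
    (hf : ContDiffAt ℝ 1 f (p₀, 0)) (hf0 : f (p₀, 0) = 0)
    (hg : fderiv ℝ f (p₀, 0) (0, 1) ≠ 0) :
    ∃ ρ > 0, ∃ η > 0, ∃ X : Params → ℝ, (∀ p, 0 ≤ X p) ∧
      (∀ p : Params, dist p p₀ < η → ∀ x : ℝ, x ≠ 0 → |x| < ρ →
        ((∃ (θ φ : ℝ → ℝ) (P : ℝ), IsZigzagPeriodicOrbit G p x θ φ P) ↔
          f (p, 0) * fderiv ℝ f (p₀, 0) (0, 1) < 0 ∧ (x = X p ∨ x = -X p))) ∧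
      (∀ p : Params, dist p p₀ < η → f (p, 0) * fderiv ℝ f (p₀, 0) (0, 1) < 0 →
        0 < X p ∧ X p < ρ ∧ f (p, X p ^ 2) = 0 ∧
        |fderiv ℝ f (p₀, 0) (0, 1)| / 2 * X p ^ 2 ≤ |f (p, 0)| ∧
        ∀ (x : ℝ) (θ φ : ℝ → ℝ) (P : ℝ), (x = X p ∨ x = -X p) → IsZigzagPeriodicOrbit G p x θ φ P →
          P ≤ M * p.τ ∧ (∀ t : ℝ, 0 < θ t * x ∧ |x| / 2 ≤ |θ t| ∧ |θ t| ≤ 2 * |x| ∧ |φ t| ≤ |x|) ∧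
          (0 < fderiv ℝ f (p₀, 0) (0, 1) → IsAsymptoticallyStable G p θ φ) ∧
          (fderiv ℝ f (p₀, 0) (0, 1) < 0 → ¬ IsStable G p θ φ)) := by
  set g₀ := fderiv ℝ f (p₀, 0) (0, 1) with hg₀
  have hg0 : 0 < |g₀| := abs_pos.2 hg
  obtain ⟨r₁, hr₁, hslope⟩ := eventually_slope_close hf (half_pos hg0)
  obtain ⟨r₂, hr₂, hgood⟩ := Metric.eventually_nhds_iff_ball.1 (hcyc.and hm)
  set T := p₀.τ + 1 with hT
  -- The last condition bounds the energy change by `|z - x²| / 4`, as required by the stability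
  -- theorems: the slope in `z` is at most `2 |g₀|`, and the prefactors are at most `T` and `2 ρ²`.
  obtain ⟨ρ, hρ, hρ2, hρr₁, hρr₂, hρT⟩ : ∃ ρ > 0, ρ < 1 / 2 ∧ ρ ^ 2 < r₁ ∧ ρ ^ 2 < r₂ ∧
      T * ρ ^ 2 * (16 * |g₀|) < 1 := by
    have t1 : Tendsto (fun ρ : ℝ => ρ) (𝓝[>] 0) (𝓝 0) := tendsto_id.mono_left nhdsWithin_le_nhds
    have t2 := t1.pow 2
    have t3 := (t2.const_mul T).mul_const (16 * |g₀|)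
    rw [zero_pow two_ne_zero] at t2 t3
    rw [mul_zero, zero_mul] at t3
    obtain ⟨ρ, h1, h2, h3, h4, h5⟩ := ((eventually_mem_nhdsWithin : ∀ᶠ ε : ℝ in 𝓝[>] 0, ε ∈ Ioi (0 : ℝ)).and
      ((t1.eventually_lt_const one_half_pos).and ((t2.eventually_lt_const hr₁).and
        ((t2.eventually_lt_const hr₂).and (t3.eventually_lt_const one_pos))))).exists
    exact ⟨ρ, h1, h2, h3, h4, h5⟩
  set R := ρ ^ 2 with hR
  have hR0 : 0 < R := by positivity
  have hev : ∀ᶠ p in 𝓝 p₀, 0 < p.τ ∧ p.τ < T ∧ |p.s| < 1 / 2 ∧ |f (p, 0)| < |g₀| * R / 4 := by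
    have cτ : Tendsto Params.τ (𝓝 p₀) (𝓝 p₀.τ) := (Params.contDiff_τ (n := 0)).continuous.tendsto p₀
    have cs : Tendsto Params.s (𝓝 p₀) (𝓝 p₀.s) := (Params.contDiff_s (n := 0)).continuous.tendsto p₀
    have cf : Tendsto (fun p => f (p, 0)) (𝓝 p₀) (𝓝 (f (p₀, 0))) :=
      hf.continuousAt.tendsto.comp (Continuous.tendsto (by fun_prop) p₀)
    have cf' := cf.abs
    rw [hf0, abs_zero] at cf'
    exact (cτ.eventually_const_lt hτ₀).and ((cτ.eventually_lt_const (lt_add_one _)).and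
      ((cs.abs.eventually_lt_const hs₀).and (cf'.eventually_lt_const (by positivity))))
  obtain ⟨r₃, hr₃, hpar⟩ := Metric.eventually_nhds_iff_ball.1 hev
  set η := min r₁ (min r₂ r₃) with hη
  have hRabs : ∀ {z}, z ∈ Icc 0 R → |z| < r₁ ∧ |z| < r₂ := fun hz => by
    rw [abs_of_nonneg hz.1]; exact ⟨hz.2.trans_lt hρr₁, hz.2.trans_lt hρr₂⟩
  have hsl : ∀ {p}, dist p p₀ < η → ∀ z ∈ Icc 0 R, ∀ z' ∈ Icc 0 R,
      |f (p, z) - f (p, z') - g₀ * (z - z')| ≤ |g₀| / 2 * |z - z'| := fun hp z hz z' hz' =>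
    hslope _ z z' (hp.trans_le (min_le_left _ _)) (hRabs hz).1 (hRabs hz').1
  have hq : ∀ {p z}, dist p p₀ < η → z ∈ Icc 0 R → (p, z) ∈ Metric.ball (p₀, (0 : ℝ)) r₂ :=
    fun hp hz => by
      rw [Metric.mem_ball, Prod.dist_eq, max_lt_iff]
      exact ⟨hp.trans_le ((min_le_right _ _).trans (min_le_left _ _)), by
        simpa [Real.dist_eq] using (hRabs hz).2⟩
  have hpp : ∀ {p}, dist p p₀ < η → 0 < p.τ ∧ p.τ < T ∧ |p.s| < 1 / 2 ∧ |f (p, 0)| < |g₀| * R / 4 :=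
    fun hp => hpar _ (hp.trans_le ((min_le_right _ _).trans (min_le_right _ _)))
  have hzero : ∀ {p}, dist p p₀ < η → ((∃ z ∈ Ioo 0 R, f (p, z) = 0) ↔ f (p, 0) * g₀ < 0) := fun hp =>
    exists_zero_iff (k := fun z => f (_, z)) hR0 hg (hsl hp) (hpp hp).2.2.2
  have huniq : ∀ {p}, dist p p₀ < η → ∀ z ∈ Ioo 0 R, ∀ z' ∈ Ioo 0 R, f (p, z) = 0 → f (p, z') = 0 →
      z = z' := by
    intro p hp z hz z' hz' h1 h2
    by_contra hne
    have h3 := hsl hp z (Ioo_subset_Icc_self hz) z' (Ioo_subset_Icc_self hz')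
    rw [h1, h2, sub_zero] at h3
    have := mul_pos_of_slope_close hg h3 (sub_ne_zero.2 hne)
    simp at this
  have hcycles : ∀ {p}, dist p p₀ < η → HasCycles G p ρ (M * p.τ)
      (fun z => p.τ * f (p, z) * (z * m (p, z) ^ 2)) := fun {p} hp => by
    obtain ⟨p1, p2, p3, -⟩ := hpp hp
    refine ⟨hG, p1, hρ, hρ2.le, p3.le, fun x hx hxρ θ φ ho => ?_⟩
    have hx2 : x ^ 2 ∈ Icc 0 R := ⟨sq_nonneg x, by rw [hR, ← sq_abs x]; gcongr⟩
    obtain ⟨P, h1, h2, -, h3⟩ := (hgood _ (hq hp hx2)).1 x θ φ rfl hx p1 ho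
    exact ⟨_, P, h1, h2, by rw [h3, mul_pow]⟩
  have hmpos : ∀ {p z}, dist p p₀ < η → z ∈ Icc 0 R → 0 < m (p, z) ^ 2 ∧ m (p, z) ^ 2 ≤ 2 := by
    intro p z hp hz
    obtain ⟨m1, m2⟩ := abs_le.1 (hgood _ (hq hp hz)).2.1
    constructor
    · exact pow_pos (by linarith) 2
    · nlinarith
  refine ⟨ρ, hρ, η, lt_min hr₁ (lt_min hr₂ hr₃), amplitude f R, amplitude_nonneg f R, ?_, ?_⟩
  · intro p hp x hx hxρ
    have hx2 : x ^ 2 ∈ Ioo 0 R := ⟨by positivity, by rw [hR, ← sq_abs x]; gcongr⟩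
    have hm2 := (hmpos hp (Ioo_subset_Icc_self hx2)).1
    rw [(hcycles hp).exists_periodic_iff hx hxρ, mul_eq_zero, mul_eq_zero,
      or_iff_left (mul_pos hx2.1 hm2).ne', or_iff_right (hpp hp).1.ne']
    constructor
    · intro h0
      have hex : ∃ z ∈ Ioo 0 R, f (p, z) = 0 := ⟨_, hx2, h0⟩
      obtain ⟨a1, a2⟩ := amplitude_spec hex
      exact ⟨(hzero hp).1 hex, sq_eq_sq_iff_eq_or_eq_neg.1 (huniq hp _ hx2 _ a1 h0 a2)⟩
    · rintro ⟨h1, h2⟩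
      rw [sq_eq_sq_iff_eq_or_eq_neg.2 h2]
      exact (amplitude_spec ((hzero hp).2 h1)).2
  · intro p hp hneg
    obtain ⟨a1, a2⟩ := amplitude_spec ((hzero hp).2 hneg)
    obtain ⟨p1, p2, p3, -⟩ := hpp hp
    set X := amplitude f R p
    have hX0 : 0 < X := lt_of_le_of_ne (amplitude_nonneg f R p) fun h0 => by
      have := a1.1
      rw [show X = 0 from h0.symm] at this
      norm_num at this
    have hXρ : X < ρ := lt_of_pow_lt_pow_left₀ 2 hρ.le a1.2
    -- This makes the amplitude tend to zero with `f (p, 0)`, as is needed for the square root law.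
    have hXf : |g₀| / 2 * X ^ 2 ≤ |f (p, 0)| := by
      have h1 := hsl hp _ (Ioo_subset_Icc_self a1) 0 ⟨le_rfl, hR0.le⟩
      rw [a2, sub_zero, zero_sub, abs_of_nonneg (sq_nonneg X)] at h1
      have h2 : |g₀| * X ^ 2 = |(-f (p, 0) - g₀ * X ^ 2) + f (p, 0)| := by
        rw [show -f (p, 0) - g₀ * X ^ 2 + f (p, 0) = -(g₀ * X ^ 2) by ring, abs_neg, abs_mul,
          abs_of_nonneg (sq_nonneg X)]
      linarith [abs_add_le (-f (p, 0) - g₀ * X ^ 2) (f (p, 0))]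
    refine ⟨hX0, hXρ, a2, hXf, fun x θ φ P hx hper => ?_⟩
    have hxx : x ^ 2 = X ^ 2 := sq_eq_sq_iff_eq_or_eq_neg.2 hx
    have hx0 : x ≠ 0 := fun h0 => by rw [h0] at hxx; nlinarith
    have hxρ : |x| < ρ := abs_lt_of_sq_lt_sq (hxx ▸ a1.2) hρ.le
    have hH := hcycles hp
    obtain ⟨hP, hbd⟩ := hH.periodic_bounds hx0 hxρ hper
    have hxm : x ^ 2 ∈ Icc 0 R := hxx ▸ Ioo_subset_Icc_self a1
    have hfx : f (p, x ^ 2) = 0 := hxx ▸ a2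
    have hfl : ∀ z ∈ Icc 0 R, |f (p, z) - g₀ * (z - x ^ 2)| ≤ |g₀| / 2 * |z - x ^ 2| := fun z hz => by
      simpa [hfx] using hsl hp z hz _ hxm
    have hE : ContinuousOn (fun z => p.τ * f (p, z) * (z * m (p, z) ^ 2)) (Ioo 0 (ρ ^ 2)) := by
      have cm : ContinuousOn (fun z => m (p, z)) (Ioo 0 R) := fun z hz =>
        ((hgood _ (hq hp (Ioo_subset_Icc_self hz))).2.2.comp (f := fun z : ℝ => (p, z))
          (by fun_prop)).continuousWithinAt
      have cf : ContinuousOn (fun z => f (p, z)) (Ioo 0 R) := by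
        refine (LipschitzOnWith.of_dist_le_mul (K := Real.toNNReal (2 * |g₀|)) fun z hz z' hz' => ?_).continuousOn
        have := hsl hp z (Ioo_subset_Icc_self hz) z' (Ioo_subset_Icc_self hz')
        rw [Real.dist_eq, Real.dist_eq, Real.coe_toNNReal _ (by positivity)]
        calc |f (p, z) - f (p, z')| = |(f (p, z) - f (p, z') - g₀ * (z - z')) + g₀ * (z - z')| := by
              rw [sub_add_cancel]
          _ ≤ |g₀| / 2 * |z - z'| + |g₀| * |z - z'| :=
            (abs_add_le _ _).trans (add_le_add this (abs_mul _ _).le)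
          _ ≤ _ := by nlinarith [mul_nonneg hg0.le (abs_nonneg (z - z'))]
      exact (continuousOn_const.mul cf).mul (continuousOn_id.mul (cm.pow 2))
    have hE1 : ∀ z ∈ Ioo 0 (ρ ^ 2), |p.τ * f (p, z) * (z * m (p, z) ^ 2)| ≤ |z - x ^ 2| / 4 := by
      intro z hz
      have hz' := Ioo_subset_Icc_self hz
      obtain ⟨m1, m2⟩ := hmpos hp hz'
      have h1 : |f (p, z)| ≤ 2 * |g₀| * |z - x ^ 2| := by
        calc |f (p, z)| = |(f (p, z) - g₀ * (z - x ^ 2)) + g₀ * (z - x ^ 2)| := by rw [sub_add_cancel]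
          _ ≤ |g₀| / 2 * |z - x ^ 2| + |g₀| * |z - x ^ 2| :=
            (abs_add_le _ _).trans (add_le_add (hfl z hz') (abs_mul _ _).le)
          _ ≤ _ := by nlinarith [mul_nonneg hg0.le (abs_nonneg (z - x ^ 2))]
      rw [abs_mul, abs_mul, abs_of_pos p1, abs_of_pos (mul_pos hz.1 m1)]
      calc p.τ * |f (p, z)| * (z * m (p, z) ^ 2)
          ≤ T * (2 * |g₀| * |z - x ^ 2|) * (R * 2) := by
            gcongr
            · exact mul_nonneg hz.1.le m1.le
            · exact hz.2.le
        _ = T * R * (16 * |g₀|) * (|z - x ^ 2| / 4) := by ring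
        _ ≤ 1 * (|z - x ^ 2| / 4) := by gcongr
        _ = _ := one_mul _
    -- The energy change has the sign of `g₀ (z - x²)`; so the sign of `g₀` alone decides between
    -- attraction and repulsion.
    have hE2 : ∀ z ∈ Ioo 0 (ρ ^ 2), z ≠ x ^ 2 →
        0 < p.τ * f (p, z) * (z * m (p, z) ^ 2) * (z - x ^ 2) * g₀ := by
      intro z hz hne
      have hz' := Ioo_subset_Icc_self hz
      have h1 := mul_pos_of_slope_close hg (hfl z hz') (sub_ne_zero.2 hne)
      have h2 := mul_pos (mul_pos p1 (mul_pos hz.1 (hmpos hp hz').1)) h1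
      calc 0 < _ := h2
        _ = _ := by ring
    refine ⟨hP, hbd, fun hpos => hH.isAsymptoticallyStable hx0 hxρ hE hE1 (fun z hz hne => ?_) hper,
      fun hng => hH.not_isStable hx0 hxρ hE hE1 (fun z hz hne => ?_) hper⟩
    · exact pos_of_mul_pos_left (hE2 z hz hne) hpos.le
    · exact neg_of_mul_pos_left (hE2 z hz hne) hng.le

/-- The square of the amplitude is, to first order, proportional to the energy rate at amplitude
zero. -/
lemma tendsto_amplitude_ratio (hf : ContDiffAt ℝ 1 f (p₀, 0)) (hf0 : f (p₀, 0) = 0)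
    (hg : fderiv ℝ f (p₀, 0) (0, 1) ≠ 0) {X : Params → ℝ} {l : Filter Params} (hl : l ≤ 𝓝 p₀)
    (hX : ∀ᶠ p in l, 0 < X p ∧ f (p, X p ^ 2) = 0 ∧
      |fderiv ℝ f (p₀, 0) (0, 1)| / 2 * X p ^ 2 ≤ |f (p, 0)|) :
    Tendsto (fun p => f (p, 0) / X p ^ 2) l (𝓝 (-fderiv ℝ f (p₀, 0) (0, 1))) := by
  set g₀ := fderiv ℝ f (p₀, 0) (0, 1)
  have hg0 : 0 < |g₀| := abs_pos.2 hg
  rw [Metric.tendsto_nhds]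
  intro ε hε
  obtain ⟨r, hr, h1⟩ := eventually_slope_close hf (half_pos hε)
  have cf : Tendsto (fun p => f (p, 0)) (𝓝 p₀) (𝓝 (f (p₀, 0))) :=
    hf.continuousAt.tendsto.comp (Continuous.tendsto (by fun_prop) p₀)
  have cf' := cf.abs
  rw [hf0, abs_zero] at cf'
  filter_upwards [hX, hl (Metric.ball_mem_nhds p₀ hr),
    (cf'.eventually_lt_const (show 0 < |g₀| / 2 * r by positivity)).filter_mono hl] with p h2 h3 h4
  obtain ⟨x1, x2, x3⟩ := h2
  have hX2 : 0 < X p ^ 2 := by positivity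
  have h5 : X p ^ 2 < r := lt_of_mul_lt_mul_left (x3.trans_lt h4) (by positivity)
  have h6 := h1 p (X p ^ 2) 0 h3 (by rwa [abs_of_pos hX2]) (by rwa [abs_zero])
  rw [x2, sub_zero, zero_sub, abs_of_pos hX2] at h6
  rw [Real.dist_eq, sub_neg_eq_add]
  have e : f (p, 0) / X p ^ 2 + g₀ = -(-f (p, 0) - g₀ * X p ^ 2) / X p ^ 2 := by
    field_simp
    ring
  rw [e, abs_div, abs_neg, abs_of_pos hX2, div_lt_iff₀ hX2]
  exact h6.trans_lt (by gcongr; linarith)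

/-- Square-root growth of the amplitude. -/
lemma exists_tendsto_amplitude (hτ₀ : 0 < p₀.τ) (hf : ContDiffAt ℝ 1 f (p₀, 0)) (hf0 : f (p₀, 0) = 0)
    {d₀ : ℝ} (hd : 0 < d₀ * fderiv ℝ f (p₀, 0) (0, 1)) {c X : Params → ℝ} {L : Params →L[ℝ] ℝ}
    (hL : HasFDerivAt c L p₀) (hc : ∀ᶠ p in 𝓝 p₀, c p = p.τ * f (p, 0)) (hX0 : ∀ p, 0 ≤ X p)
    (hX : ∀ᶠ p in 𝓝 p₀, c p * d₀ < 0 → 0 < X p ∧ f (p, X p ^ 2) = 0 ∧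
      |fderiv ℝ f (p₀, 0) (0, 1)| / 2 * X p ^ 2 ≤ |f (p, 0)|)
    {γ : ℝ → Params} {v : Params} (hγ0 : γ 0 = p₀) (hγ : HasDerivAt γ v 0) (hv : L v ≠ 0) :
    ∃ κ > 0, Tendsto (fun μ => X (γ μ) / Real.sqrt |μ|) (𝓝[{μ : ℝ | μ * L v * d₀ < 0}] 0) (𝓝 κ) := by
  set g₀ := fderiv ℝ f (p₀, 0) (0, 1)
  have hg : g₀ ≠ 0 := right_ne_zero_of_mul hd.ne'
  have hd0 : d₀ ≠ 0 := left_ne_zero_of_mul hd.ne'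
  set S := {μ : ℝ | μ * L v * d₀ < 0} with hS
  have hSne : S ⊆ {0}ᶜ := by
    rintro μ hμ rfl
    simp [hS] at hμ
  have hc0 : c p₀ = 0 := by rw [hc.self_of_nhds, hf0, mul_zero]
  have tγ : Tendsto γ (𝓝[S] 0) (𝓝 p₀) := by
    have := hγ.continuousAt.tendsto
    rw [hγ0] at this
    exact this.mono_left nhdsWithin_le_nhds
  have t1 : Tendsto (fun μ => c (γ μ) / μ) (𝓝[S] 0) (𝓝 (L v)) := by
    rw [← hγ0] at hL
    have h1 := hasDerivAt_iff_tendsto_slope.1 (hL.comp_hasDerivAt (f := γ) 0 hγ)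
    refine (h1.mono_left (nhdsWithin_mono _ hSne)).congr fun μ => ?_
    simp [slope_def_field, hγ0, hc0]
  have hmem : ∀ᶠ μ in 𝓝[S] 0, μ ∈ S := eventually_mem_nhdsWithin
  have hsign : ∀ᶠ μ in 𝓝[S] 0, c (γ μ) * d₀ < 0 := by
    have t2 := t1.mul_const (L v)
    filter_upwards [hmem, t2.eventually_const_lt (mul_self_pos.2 hv)] with μ h1 h2
    have hμ : μ ≠ 0 := hSne h1
    have h3 : c (γ μ) / μ * L v * (μ * L v * d₀) < 0 := mul_neg_of_pos_of_neg h2 h1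
    have h4 : c (γ μ) / μ * L v * (μ * L v * d₀) = L v ^ 2 * (c (γ μ) * d₀) := by field_simp
    rw [h4] at h3
    exact neg_of_mul_neg_right h3 (sq_nonneg _)
  have hXγ : ∀ᶠ μ in 𝓝[S] 0, 0 < X (γ μ) ∧ f (γ μ, X (γ μ) ^ 2) = 0 ∧
      |g₀| / 2 * X (γ μ) ^ 2 ≤ |f (γ μ, 0)| := by
    filter_upwards [hsign, tγ.eventually hX] with μ h1 h2 using h2 h1
  have t3 : Tendsto (fun μ => f (γ μ, 0) / X (γ μ) ^ 2) (𝓝[S] 0) (𝓝 (-g₀)) :=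
    (tendsto_amplitude_ratio hf hf0 hg (X := X) (l := Filter.map γ (𝓝[S] 0)) tγ hXγ).comp tendsto_map
  have t4 : Tendsto (fun μ => (γ μ).τ) (𝓝[S] 0) (𝓝 p₀.τ) :=
    ((Params.contDiff_τ (n := 0)).continuous.tendsto p₀).comp tγ
  set k := L v * d₀ with hk
  have hk0 : k ≠ 0 := mul_ne_zero hv hd0
  -- This quotient equals `X² / |μ|`, since `c = τ f(p, 0)` and `-k / |k|` is the sign of `μ` on the
  -- side considered.
  have t5 := (t1.mul_const (-k / |k|)).div (t4.mul t3) (mul_ne_zero hτ₀.ne' (neg_ne_zero.2 hg))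
  have hlim : L v * (-k / |k|) / (p₀.τ * -g₀) = L v ^ 2 * (d₀ * g₀) / (|k| * p₀.τ * g₀ ^ 2) := by
    have : |k| ≠ 0 := abs_ne_zero.2 hk0
    rw [hk] at this ⊢
    field_simp
  have hpos : 0 < L v * (-k / |k|) / (p₀.τ * -g₀) := by
    rw [hlim]
    have : 0 < |k| := abs_pos.2 hk0
    have : 0 < L v ^ 2 := by positivity
    positivity
  refine ⟨_, Real.sqrt_pos.2 hpos, (t5.sqrt).congr' ?_⟩
  filter_upwards [hmem, hXγ, tγ.eventually hc, t4.eventually_const_lt hτ₀] with μ h1 h2 h3 h4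
  have hμ : μ ≠ 0 := hSne h1
  have hX2 : 0 < X (γ μ) ^ 2 := pow_pos h2.1 2
  have hf1 : f (γ μ, 0) ≠ 0 := by
    intro h0
    have := h2.2.2
    rw [h0, abs_zero] at this
    have := mul_pos (half_pos (abs_pos.2 hg)) hX2
    linarith
  have hsgn : -k / |k| = μ / |μ| := by
    have h5 : μ * k < 0 := by rw [hk, ← mul_assoc]; exact h1
    rcases mul_neg_iff.1 h5 with ⟨h6, h7⟩ | ⟨h6, h7⟩
    · rw [abs_of_neg h7, abs_of_pos h6, div_self hμ, div_self (neg_ne_zero.2 hk0)]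
    · rw [abs_of_pos h7, abs_of_neg h6, neg_div, div_self hk0, div_neg, div_self hμ]
  have e : c (γ μ) / μ * (-k / |k|) / ((γ μ).τ * (f (γ μ, 0) / X (γ μ) ^ 2)) = X (γ μ) ^ 2 / |μ| := by
    rw [hsgn, h3]
    have := abs_ne_zero.2 hμ
    field_simp
  simp only [Pi.div_apply, e]
  rw [Real.sqrt_div (sq_nonneg _), Real.sqrt_sq (hX0 _)]

end
end Pendulum

/-! ### The bifurcation in terms of the coefficients of the energy expansion -/

namespace Pendulum

lemma one_ne_cos : (fun _ => 1 : ℝ → ℝ) ≠ Real.cos := fun h => by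
  have := congrFun h Real.pi
  norm_num at this

/-- The sign of the quartic coefficient on the bifurcation curve. -/
lemma slope_sign {G : ℝ → ℝ} (hG : G ∈ actuations) {e a₀ : ℝ} (b₀ : ℝ) (ha : 1 < a₀)
    (he : ∀ y, G y = 1 + e * (Real.cos y - 1)) :
    slopeT e (a₀, b₀) + slopeS e (a₀, b₀) * ((a₀ - 2) / 2) ≠ 0 ∧
      (G = Real.cos → slopeT e (a₀, b₀) + slopeS e (a₀, b₀) * ((a₀ - 2) / 2) < 0) ∧
      (G = (fun _ => 1) → 0 < slopeT e (a₀, b₀) + slopeS e (a₀, b₀) * ((a₀ - 2) / 2)) := by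
  have hπ := he Real.pi
  rcases hG with rfl | rfl
  · obtain rfl : e = 1 := by
      rw [Real.cos_pi] at hπ; linarith
    have h := slope_sign_one (b₀ := b₀) ha
    exact ⟨h.ne, fun _ => h, fun h1 => absurd h1.symm one_ne_cos⟩
  · obtain rfl : e = 0 := by
      rw [Real.cos_pi] at hπ; linarith
    have h := slope_sign_zero (b₀ := b₀) ha
    exact ⟨h.ne', fun h1 => absurd h1 one_ne_cos, fun _ => h⟩

/-- The derivative of the quadratic coefficient at one of its zeros. -/
lemma hasFDerivAt_of_eq_delay_mul {c : Params → ℝ} {f : Params × ℝ → ℝ} {p₀ : Params}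
    (hc : ∀ᶠ p in 𝓝 p₀, c p = p.τ * f (p, 0)) (hf : DifferentiableAt ℝ f (p₀, 0))
    (hf0 : f (p₀, 0) = 0) :
    HasFDerivAt c (p₀.τ • (fderiv ℝ f (p₀, 0)).comp (ContinuousLinearMap.inl ℝ Params ℝ)) p₀ := by
  have h1 : HasFDerivAt (fun p : Params => f (p, 0))
      ((fderiv ℝ f (p₀, 0)).comp (ContinuousLinearMap.inl ℝ Params ℝ)) p₀ :=
    hf.hasFDerivAt.comp (f := fun p : Params => (p, (0 : ℝ))) p₀ (hasFDerivAt_prodMk_left p₀ 0)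
  have h2 := ((Params.contDiff_τ (n := 1)).differentiable one_ne_zero p₀).hasFDerivAt
  refine ((h2.mul h1).congr_of_eventuallyEq hc).congr_fderiv ?_
  simp [hf0]

/-- The bifurcation at the points where the quadratic coefficient vanishes. -/
theorem bifurcation {G : ℝ → ℝ} (hG : G ∈ actuations) {a₀ : ℝ} (b₀ : ℝ) (ha : 1 < a₀)
    (ha2 : a₀ < 2) :
    ∃ ε > 0, ∃ C > 0,
      ∀ s₀ τ₀ : ℝ, -ε < s₀ → s₀ < 0 → 0 < τ₀ → τ₀ < ε → quadAmp (a₀, b₀, s₀, τ₀) = 0 →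
        (G = Real.cos → quartAmp G (a₀, b₀, s₀, τ₀) < 0) ∧
        (G = (fun _ => 1) → 0 < quartAmp G (a₀, b₀, s₀, τ₀)) ∧
        ∃ L : Params →L[ℝ] ℝ, HasFDerivAt quadAmp L (a₀, b₀, s₀, τ₀) ∧
          L (1, 0, 0, 0) ≠ 0 ∧ L (0, 0, 0, 1) ≠ 0 ∧
          ∃ ρ > 0, ∃ η > 0, ∃ X : Params → ℝ,
            (∀ p : Params, dist p (a₀, b₀, s₀, τ₀) < η → ∀ x : ℝ, x ≠ 0 → |x| < ρ →
              ((∃ (θ φ : ℝ → ℝ) (P : ℝ), IsZigzagPeriodicOrbit G p x θ φ P) ↔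
                quadAmp p * quartAmp G (a₀, b₀, s₀, τ₀) < 0 ∧ (x = X p ∨ x = -X p))) ∧
            (∀ p : Params, dist p (a₀, b₀, s₀, τ₀) < η →
              quadAmp p * quartAmp G (a₀, b₀, s₀, τ₀) < 0 →
              0 < X p ∧ X p < ρ ∧
              ∀ (x : ℝ) (θ φ : ℝ → ℝ) (P : ℝ), (x = X p ∨ x = -X p) →
                IsZigzagPeriodicOrbit G p x θ φ P →
                  IsZigzagPeriodicOrbit G p (-x) (-θ) (-φ) P ∧
                  P ≤ C * p.τ ∧
                  (∀ t : ℝ, 0 < θ t * x ∧ |x| / 2 ≤ |θ t| ∧ |θ t| ≤ 2 * |x| ∧ |φ t| ≤ |x|) ∧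
                  (0 < quartAmp G (a₀, b₀, s₀, τ₀) → IsAsymptoticallyStable G p θ φ) ∧
                  (quartAmp G (a₀, b₀, s₀, τ₀) < 0 → ¬ IsStable G p θ φ)) ∧
            (∀ (γ : ℝ → Params) (v : Params), γ 0 = (a₀, b₀, s₀, τ₀) → HasDerivAt γ v 0 →
              L v ≠ 0 → ∃ κ > 0,
                Tendsto (fun μ => X (γ μ) / Real.sqrt |μ|)
                  (𝓝[{μ : ℝ | μ * L v * quartAmp G (a₀, b₀, s₀, τ₀) < 0}] 0) (𝓝 κ)) := by
  obtain ⟨e, f, m, U, M, hL, hGe, hcd⟩ := exists_model hG ha b₀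
  have hGa := isActuation_of_mem hG
  obtain ⟨hl0, hlcos, hlone⟩ := slope_sign hG b₀ ha hGe
  obtain ⟨ε₁, hε₁, hsigns⟩ := hL.signs_of_rate_eq_zero ha ha2 hl0
  obtain ⟨ε₂, hε₂, hε₂1, hbox⟩ := exists_param_box (((tendsto_zero_amplitude a₀ b₀).eventually
    (hL.cycle.and (hL.close.and (((hL.smooth ha2).eventually (by simp)).and
      ((hL.smooth_pos ha2).eventually (by simp))))).eventually_nhds).and (hcd ha2).eventually_nhds)
  -- Half of `ε₂ ≤ 1` also ensures `|s₀| < 1/2`.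
  refine ⟨min ε₁ (ε₂ / 2), by positivity, M, hL.bound_pos, fun s₀ τ₀ hs1 hs2 hτ1 hτ2 hc0 => ?_⟩
  have hs : |s₀| < min ε₁ (ε₂ / 2) := by rwa [abs_of_neg hs2, neg_lt]
  rw [lt_min_iff] at hs hτ2
  set p₀ : Params := (a₀, b₀, s₀, τ₀) with hp₀
  have hp₀τ : 0 < p₀.τ := hτ1
  obtain ⟨hnear, hcoef⟩ := hbox p₀ (by simpa [hp₀, Params.a] using hε₂)
    (by simpa [hp₀, Params.b] using hε₂) (hs.2.trans (half_lt_self hε₂))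
    (by rw [abs_of_pos hp₀τ]; exact hτ2.2.trans (half_lt_self hε₂))
  obtain ⟨-, hm0, hf2, -⟩ := hnear.self_of_nhds
  have hcyc : ∀ᶠ q in 𝓝 (p₀, (0 : ℝ)), ∀ (x : ℝ) (θ φ : ℝ → ℝ), q.2 = x ^ 2 → x ≠ 0 → 0 < q.1.τ →
      IsForwardOrbit G q.1 x θ φ → ∃ P, IsCycle q.1 x θ φ (q.1.τ * U q) P ∧ P ≤ M * q.1.τ ∧
        θ q.1.τ = x * m q ∧ energyChange q.1 θ φ (q.1.τ * U q) = q.1.τ * f q * (x * m q) ^ 2 :=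
    hnear.mono fun q h x θ φ => h.1 G x θ φ hGa hGe
  have hm : ∀ᶠ q in 𝓝 (p₀, (0 : ℝ)), |m q - 1| ≤ 1 / 20 ∧ ContinuousAt m q :=
    hnear.mono fun q h => ⟨h.2.1, h.2.2.2.continuousAt⟩
  obtain ⟨hc1, hd1⟩ := hcoef.self_of_nhds hp₀τ
  have hf0 : f (p₀, 0) = 0 := by
    rw [hc0] at hc1
    exact (mul_eq_zero.1 hc1.symm).resolve_left hp₀τ.ne'
  obtain ⟨hg, hfa, hfτ⟩ := hsigns s₀ τ₀ hs.1 hτ1 hτ2.1 hf0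
  have hmpos : 0 < m (p₀, 0) := by linarith [(abs_le.1 hm0).1]
  set g₀ := fderiv ℝ f (p₀, 0) (0, 1) with hg₀
  set d₀ := quartAmp G p₀ with hd₀
  -- The quartic coefficient is a positive multiple of the amplitude derivative of the rate, so sign
  -- conditions on either may be exchanged.
  have hdκ : ∃ k > 0, d₀ = k * g₀ := ⟨p₀.τ / m (p₀, 0) ^ 2, by positivity, by rw [hd1]; ring⟩
  obtain ⟨k, hk, hdk⟩ := hdκ
  have hg0 : g₀ ≠ 0 := left_ne_zero_of_mul hg.ne'
  have hpos : 0 < d₀ ↔ 0 < g₀ := by rw [hdk]; exact mul_pos_iff_of_pos_left hk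
  have hneg : d₀ < 0 ↔ g₀ < 0 := by rw [hdk]; exact smul_neg_iff_of_pos_left hk
  have hτev : ∀ᶠ p : Params in 𝓝 p₀, 0 < p.τ :=
    ((Params.contDiff_τ (n := 0)).continuous.tendsto p₀).eventually_const_lt hp₀τ
  have hc : ∀ᶠ p in 𝓝 p₀, quadAmp p = p.τ * f (p, 0) := by
    filter_upwards [hτev, hcoef] with p h1 h2 using (h2 h1).1
  have hcsign : ∀ᶠ p in 𝓝 p₀, quadAmp p * d₀ < 0 ↔ f (p, 0) * g₀ < 0 := by
    filter_upwards [hτev, hc] with p h1 h2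
    rw [h2, hdk, show p.τ * f (p, 0) * (k * g₀) = (p.τ * k) * (f (p, 0) * g₀) by ring]
    exact smul_neg_iff_of_pos_left (mul_pos h1 hk)
  have hLd := hasFDerivAt_of_eq_delay_mul hc (hf2.differentiableAt (by norm_num)) hf0
  have hLv : ∀ v : Params, (p₀.τ • (fderiv ℝ f (p₀, 0)).comp
      (ContinuousLinearMap.inl ℝ Params ℝ)) v = p₀.τ * fderiv ℝ f (p₀, 0) (v, 0) := fun v => by simp
  refine ⟨fun h => hneg.2 ?_, fun h => hpos.2 ?_, _, hLd, ?_, ?_, ?_⟩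
  · exact neg_of_mul_pos_left hg (hlcos h).le
  · exact pos_of_mul_pos_left hg (hlone h).le
  · rw [hLv]; exact mul_ne_zero hp₀τ.ne' hfa
  · rw [hLv]; exact mul_ne_zero hp₀τ.ne' hfτ
  obtain ⟨ρ, hρ, η, hη, X, hX0, hiff, hprop⟩ := exists_bifurcation (M := M) (U := U) (m := m) hGa hp₀τ
    (show |s₀| < 1 / 2 by linarith [hs.2]) hcyc hm (hf2.of_le one_le_two) hf0 hg0
  obtain ⟨η', hη', hb⟩ := Metric.eventually_nhds_iff_ball.1 hcsign
  refine ⟨ρ, hρ, min η η', lt_min hη hη', X, fun p hp x hx hxρ => ?_, fun p hp hcp => ?_,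
    fun γ v hγ0 hγ hv => ?_⟩
  · rw [lt_min_iff] at hp
    rw [hb p hp.2]
    exact hiff p hp.1 x hx hxρ
  · rw [lt_min_iff] at hp
    obtain ⟨h1, h2, -, -, h3⟩ := hprop p hp.1 ((hb p hp.2).1 hcp)
    refine ⟨h1, h2, fun x θ φ P hx ho => ?_⟩
    obtain ⟨h4, h5, h6, h7⟩ := h3 x θ φ P hx ho
    exact ⟨ho.neg hGa, h4, h5, fun h => h6 (hpos.1 h), fun h => h7 (hneg.1 h)⟩
  · refine exists_tendsto_amplitude hp₀τ (hf2.of_le one_le_two) hf0 (d₀ := d₀)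
      (by rw [hdk, mul_assoc]; exact mul_pos hk (mul_self_pos.2 hg0)) hLd hc hX0 ?_ hγ0 hγ hv
    filter_upwards [Metric.ball_mem_nhds p₀ hη, hcsign] with p hp h1 h2
    obtain ⟨h3, -, h4, h5, -⟩ := hprop p hp (h1.1 h2)
    exact ⟨h3, h4, h5⟩

end Pendulum

end

theorem mainTheorem1 :
    ∃ (c : Params → ℝ) (d : (ℝ → ℝ) → Params → ℝ),
      -- every small orbit zigzags, and the expansion of its energy change
      (∀ G ∈ Pendulum.actuations, ∀ a₀ b₀ : ℝ, 1 < a₀ → ∃ ε > 0, ∃ C > 0, ∀ p : Params,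
        |p.a - a₀| < ε → |p.b - b₀| < ε → -ε < p.s → p.s ≤ 0 → 0 < p.τ → p.τ < ε →
          (a₀ < 2 → |c p - Pendulum.quadCoeff p| ≤ C * (|p.s| + p.τ) ^ 4) ∧
          ∀ x : ℝ, x ≠ 0 → |x| < ε →
            (∃ θ φ : ℝ → ℝ, Pendulum.IsForwardOrbit G p x θ φ) ∧
            ∀ θ φ : ℝ → ℝ, Pendulum.IsForwardOrbit G p x θ φ →
              ∃ T P : ℝ, Pendulum.IsZigzag p θ φ T P ∧ P ≤ C * p.τ ∧
                (2 * p.τ ≤ T →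
                  |Pendulum.energyChange p θ φ T - Pendulum.quadCoeff p * θ p.τ ^ 2|
                    ≤ C * ((|p.s| + p.τ) ^ 4 * θ p.τ ^ 2 + θ p.τ ^ 4)) ∧
                (a₀ < 2 → 2 * p.τ ≤ T ∧
                  |Pendulum.energyChange p θ φ T - c p * θ p.τ ^ 2 - d G p * θ p.τ ^ 4|
                    ≤ C * θ p.τ ^ 6)) ∧
      -- where the coefficients of `θ₁²` and `θ₁⁴` vanish
      Pendulum.HasZeroCurve c (Set.Ioo 1 2) Pendulum.bifurcationDelay ∧
      Pendulum.HasZeroCurve (d Real.cos) (Set.Ioo 1 (5 / 3)) Pendulum.criticalDelayCos ∧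
      Pendulum.HasZeroCurve (d fun _ => 1) (Set.Ioo 1 2) Pendulum.criticalDelayOne ∧
      -- the bifurcation at the points where `c` vanishes
      (∀ G ∈ Pendulum.actuations, ∀ a₀ b₀ : ℝ, 1 < a₀ → a₀ < 2 → ∃ ε > 0, ∃ C > 0,
        ∀ s₀ τ₀ : ℝ, -ε < s₀ → s₀ < 0 → 0 < τ₀ → τ₀ < ε → c (a₀, b₀, s₀, τ₀) = 0 →
          (G = Real.cos → d G (a₀, b₀, s₀, τ₀) < 0) ∧
          (G = (fun _ => 1) → 0 < d G (a₀, b₀, s₀, τ₀)) ∧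
          ∃ L : Params →L[ℝ] ℝ, HasFDerivAt c L (a₀, b₀, s₀, τ₀) ∧
            L (1, 0, 0, 0) ≠ 0 ∧ L (0, 0, 0, 1) ≠ 0 ∧
            ∃ ρ > 0, ∃ η > 0, ∃ X : Params → ℝ,
              -- existence on one side only, uniqueness up to symmetry
              (∀ p : Params, dist p (a₀, b₀, s₀, τ₀) < η → ∀ x : ℝ, x ≠ 0 → |x| < ρ →
                ((∃ (θ φ : ℝ → ℝ) (P : ℝ), Pendulum.IsZigzagPeriodicOrbit G p x θ φ P) ↔
                  c p * d G (a₀, b₀, s₀, τ₀) < 0 ∧ (x = X p ∨ x = -X p))) ∧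
              -- properties of the pair of orbits
              (∀ p : Params, dist p (a₀, b₀, s₀, τ₀) < η → c p * d G (a₀, b₀, s₀, τ₀) < 0 →
                0 < X p ∧ X p < ρ ∧
                ∀ (x : ℝ) (θ φ : ℝ → ℝ) (P : ℝ), (x = X p ∨ x = -X p) →
                  Pendulum.IsZigzagPeriodicOrbit G p x θ φ P →
                    Pendulum.IsZigzagPeriodicOrbit G p (-x) (-θ) (-φ) P ∧
                    P ≤ C * p.τ ∧
                    (∀ t : ℝ, 0 < θ t * x ∧ |x| / 2 ≤ |θ t| ∧ |θ t| ≤ 2 * |x| ∧ |φ t| ≤ |x|) ∧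
                    (0 < d G (a₀, b₀, s₀, τ₀) → Pendulum.IsAsymptoticallyStable G p θ φ) ∧
                    (d G (a₀, b₀, s₀, τ₀) < 0 → ¬ Pendulum.IsStable G p θ φ)) ∧
              -- square-root growth of the amplitude along nondegenerate parameter changes
              (∀ (γ : ℝ → Params) (v : Params), γ 0 = (a₀, b₀, s₀, τ₀) → HasDerivAt γ v 0 →
                L v ≠ 0 → ∃ κ > 0,
                  Filter.Tendsto (fun μ => X (γ μ) / Real.sqrt |μ|)
                    (nhdsWithin 0 {μ : ℝ | μ * L v * d G (a₀, b₀, s₀, τ₀) < 0}) (nhds κ))) :=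
  ⟨Pendulum.quadAmp, Pendulum.quartAmp,
    fun _ hG _ b₀ ha => Pendulum.zigzag_expansion hG b₀ ha,
    Pendulum.hasZeroCurve_quadAmp, Pendulum.hasZeroCurve_quartAmp_cos,
    Pendulum.hasZeroCurve_quartAmp_one,
    fun _ hG _ b₀ ha ha2 => Pendulum.bifurcation hG b₀ ha ha2⟩
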